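/- Graphs are finite and simple, with $n\ge 2$ vertices and $m\ge n$ edges. The pseudoarboricity $p$ of $G$ is the least $k$ such that $E(G)$ can be partitioned into $k$ pseudoforests (graphs with at most one cycle per connected component). Consider the following orientation algorithm of Asahiro et al. for a graph $G=(V,E)$ with edge weights $w:E\to\mathbb{Z}_{\ge 0}$ (in the unweighted case $w\equiv 1$). All degrees and sizes refer to the current graph $(V,E)$, $\deg_w(v)$ is the total weight of the edges at $v$, and $w(E)$ is the total weight of $E$. 1. Put $l\leftarrow w(E)/|V|$. 2. Repeat: (i) while there is $v\in V$ with $\deg_w(v)\le\lceil 2l\rceil-1$, orient all edges at $v$ towards $v$ and delete these edges and $v$; (ii) if $V=\emptyset$, return the orientation; (iii) put $l\leftarrow w(E)/|V|$; until $\deg_w(v)=\lceil 2l\rceil$ for all $v\in V$. 3. While there is a cycle, orient it cyclically and delete its edges. 4. While there is a vertex $v$ with at most one incident edge, orient this edge (if it exists) towards $v$ and delete it and $v$. Then return the orientation. In the Euler tour variant, steps 3 and 4 are replaced by: add a new vertex $v^*$ and join it to all vertices that have an odd number of incident edges; orient the edges as they are traversed by an Euler tour in every connected component; remove $v^*$ and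 its edges; return the orientation. **Theorem.** Both the algorithm and its Euler tour variant can be implemented in linear time on unweighted graphs and in $O(m+n\log n)$ time on edge-weighted graphs. Precisely, for each of the two procedures: (a) There is a random access machine program that, given any unweighted graph $G$ as a list of its edges, halts after $O(m)$ steps and outputs an orientation of $G$ that is a possible result of the procedure (for some resolution of its free choices). Every indegree of this orientation is at most $(2-1/p)\,p=2p-1$. (b) There is a random access machine program that, given any graph as a list of its edges together with nonnegative integer edge weights, halts after $O(m+n\log n)$ steps and outputs an orientation of $G$ that is a possible result of the procedure with these weights. Here each arithmetic operation ($+,-,\times,\div$), comparison, and memory access on machine words takes one step, and words hold integers bounded by a fixed power of $n+m$ in (a) and of $n+m+W$ in (b), where $W$ is any upper bound on the weights. -/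

import Mathlib

/-! ## Orientations and pseudoarboricity -/

section Graphs

variable {V : Type*}

/-- `D` is an orientation of `G`: every edge of `G` is present in exactly one of its two
directions, and nothing else is present. -/
def IsOrientation (G : SimpleGraph V) (D : Finset (V × V)) : Prop :=
  (∀ a ∈ D, G.Adj a.1 a.2) ∧
    ∀ u v, G.Adj u v → Xor ((u, v) ∈ D) ((v, u) ∈ D)

/-- The indegree of `v` in the set of arcs `D`, an arc `(u, v)` being directed from `u` to `v`. -/
def indeg [DecidableEq V] (D : Finset (V × V)) (v : V) : ℕ :=
  (D.filter fun a => a.2 = v).card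

/-- At most one cycle per connected component (a cycle being determined by its edge set). -/
def IsPseudoforest (F : SimpleGraph V) : Prop :=
  ∀ (u v : V) (c : F.Walk u u) (d : F.Walk v v), c.IsCycle → d.IsCycle → F.Reachable u v →
    ∀ e, e ∈ c.edges ↔ e ∈ d.edges

/-- `P` is a partition of (the edges of) `G` into `k` pseudoforests. -/
def IsPseudoforestPartition (G : SimpleGraph V) (k : ℕ) (P : Fin k → SimpleGraph V) : Prop :=
  (⨆ i, P i) = G ∧ (∀ i j, i ≠ j → Disjoint (P i) (P j)) ∧ ∀ i, IsPseudoforest (P i)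

/-- The smallest `k` such that a pseudoforest `k`-partition exists. -/
noncomputable def pseudoarboricity (G : SimpleGraph V) : ℕ :=
  sInf {k | ∃ P : Fin k → SimpleGraph V, IsPseudoforestPartition G k P}

end Graphs

/-! ## The orientation algorithm, as a nondeterministic procedure

All choices that the pseudocode leaves open (which vertex, which cycle, which tour) are left open.
Edge weights are natural numbers; the unweighted algorithm is the one with all weights equal
to one. -/

namespace Asahiro

variable {V : Type*} [Fintype V] [DecidableEq V]

/-- The variables of the algorithm: the remaining vertices, the remaining edges, and the arcs
that have been oriented so far. -/
structure Config (V : Type*) where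
  verts : Finset V
  edges : Finset (Sym2 V)
  arcs : Finset (V × V)

/-- The weighted degree of `v` in the remaining graph. -/
def wdeg (w : Sym2 V → ℕ) (c : Config V) (v : V) : ℕ :=
  ∑ e ∈ c.edges.filter (fun e => v ∈ e), w e

/-- The number of remaining edges at `v`. -/
def deg (c : Config V) (v : V) : ℕ :=
  (c.edges.filter (fun e => v ∈ e)).card

/-- The weighted density of the remaining graph. -/
def density (w : Sym2 V → ℕ) (c : Config V) : ℚ :=
  (∑ e ∈ c.edges, (w e : ℚ)) / (c.verts.card : ℚ)

/-- Orient all remaining edges at `v` towards `v`, and delete them and `v`. -/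
def absorb (c : Config V) (v : V) : Config V where
  verts := c.verts.erase v
  edges := c.edges.filter (fun e => v ∉ e)
  arcs := c.arcs ∪ (Finset.univ.filter fun u => s(u, v) ∈ c.edges).image (fun u => (u, v))

/-- One iteration of the inner while loop for the current value `l`. -/
def PeelStep (w : Sym2 V → ℕ) (l : ℚ) (c c' : Config V) : Prop :=
  ∃ v ∈ c.verts, (wdeg w c v : ℤ) ≤ ⌈2 * l⌉ - 1 ∧ c' = absorb c v

/-- A complete execution of the inner while loop. -/
def PeelLoop (w : Sym2 V → ℕ) (l : ℚ) (c c' : Config V) : Prop :=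
  Relation.ReflTransGen (PeelStep w l) c c' ∧ ¬ ∃ d, PeelStep w l c' d

/-- The until-condition: all remaining weighted degrees are equal to `⌈2l⌉`, for the density `l` of
the current graph. -/
def IsUniform (w : Sym2 V → ℕ) (c : Config V) : Prop :=
  ∀ v ∈ c.verts, (wdeg w c v : ℤ) = ⌈2 * density w c⌉

/-- `RepeatLoop w l c c'`: the repeat-until loop, entered in `c` with the value `l`, is left in `c'`
(either through the return statement, with no vertex left, or because the until-condition holds). -/
inductive RepeatLoop (w : Sym2 V → ℕ) : ℚ → Config V → Config V → Prop
  | ret {l : ℚ} {c c' : Config V} : PeelLoop w l c c' → c'.verts = ∅ → RepeatLoop w l c c'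
  | until {l : ℚ} {c c' : Config V} : PeelLoop w l c c' → c'.verts ≠ ∅ → IsUniform w c' →
      RepeatLoop w l c c'
  | again {l : ℚ} {c c' c'' : Config V} : PeelLoop w l c c' → c'.verts ≠ ∅ → ¬ IsUniform w c' →
      RepeatLoop w (density w c') c' c'' → RepeatLoop w l c c''

/-- One iteration of the cycle loop: orient along a cycle and delete its edges. -/
def CycleStep (c c' : Config V) : Prop :=
  ∃ (v : V) (z : (SimpleGraph.fromEdgeSet (c.edges : Set (Sym2 V))).Walk v v), z.IsCycle ∧
    c' = { verts := c.verts
           edges := c.edges \ z.edges.toFinset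
           arcs := c.arcs ∪ (z.darts.map fun d => d.toProd).toFinset }

/-- A complete execution of the cycle loop. -/
def CycleLoop (c c' : Config V) : Prop :=
  Relation.ReflTransGen CycleStep c c' ∧ ¬ ∃ d, CycleStep c' d

/-- One iteration of the forest loop: a vertex with at most one edge absorbs this edge. -/
def ForestStep (c c' : Config V) : Prop :=
  ∃ v ∈ c.verts, deg c v ≤ 1 ∧ c' = absorb c v

/-- A complete execution of the forest loop. -/
def ForestLoop (c c' : Config V) : Prop :=
  Relation.ReflTransGen ForestStep c c' ∧ ¬ ∃ d, ForestStep c' d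

/-- The remaining graph with a new vertex `none`, joined to all vertices of odd degree. -/
def evenGraph (c : Config V) : SimpleGraph (Option V) :=
  SimpleGraph.fromEdgeSet
    ({e | ∃ f ∈ c.edges, e = f.map some} ∪
      {e | ∃ u ∈ c.verts, Odd (deg c u) ∧ e = s(some u, none)})

/-- `D` arises by orienting the remaining edges as they are traversed by an Euler tour `T C` in every
connected component `C` of `evenGraph c`. (A closed trail stays in its component, so `T C` uses
every edge of `C` exactly once.) -/
def EulerFinish (c : Config V) (D : Finset (V × V)) : Prop :=
  ∃ (base : (evenGraph c).ConnectedComponent → Option V)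
    (T : ∀ C, (evenGraph c).Walk (base C) (base C)),
    (∀ C, (evenGraph c).connectedComponentMk (base C) = C) ∧
    (∀ C, (T C).IsTrail) ∧
    (∀ e ∈ (evenGraph c).edgeSet, ∃ C, e ∈ (T C).edges) ∧
    ∀ a : V × V, a ∈ D ↔
      a ∈ c.arcs ∨ ∃ C, ∃ d ∈ (T C).darts, d.toProd = (some a.1, some a.2)

/-- How the graph that remains after the repeat-until loop is treated: by the cycle loop followed by
the forest loop, or by Euler tours in place of these two loops. -/
inductive Mode
  | cycles
  | euler

/-- `Finish μ c D`: from `c`, the part of the algorithm after the repeat-until loop may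
return `D`. -/
def Finish : Mode → Config V → Finset (V × V) → Prop
  | .cycles, c, D => ∃ c₁ c₂, CycleLoop c c₁ ∧ ForestLoop c₁ c₂ ∧ D = c₂.arcs
  | .euler, c, D => EulerFinish c D

/-- The algorithm, run on `G` with edge weights `w`, may return the set of arcs `D`. -/
def MayReturn (μ : Mode) (G : SimpleGraph V) [DecidableRel G.Adj] (w : Sym2 V → ℕ)
    (D : Finset (V × V)) : Prop :=
  let c₀ : Config V := { verts := Finset.univ, edges := G.edgeFinset, arcs := ∅ }
  ∃ c, RepeatLoop w (density w c₀) c₀ c ∧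
    ((c.verts = ∅ ∧ D = c.arcs) ∨ (c.verts ≠ ∅ ∧ Finish μ c D))

end Asahiro

/-! ## A random access machine

Programs use finitely many registers and finitely many random access arrays (all named by numerals
in the program text), whose cells hold natural numbers below a bound `B`. An instruction that would
produce a number `≥ B` gets stuck. Every instruction and every evaluation of a test takes one
step. -/

namespace RAM

/-- The contents `reg r` of the registers and `arr A i` of the array cells. -/
structure Store where
  reg : ℕ → ℕ
  arr : ℕ → ℕ → ℕ

/-- Arithmetic instructions. -/
inductive Op
  | add
  | sub
  | mul
  | div

/-- Subtraction is truncated at zero, division rounds down (and division by zero gives zero). -/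
def Op.eval : Op → ℕ → ℕ → ℕ
  | .add, a, b => a + b
  | .sub, a, b => a - b
  | .mul, a, b => a * b
  | .div, a, b => a / b

/-- Comparisons of the contents of two registers. -/
inductive Test
  | lt (r s : ℕ)
  | eq (r s : ℕ)

def Test.holds : Test → Store → Prop
  | .lt r s, σ => σ.reg r < σ.reg s
  | .eq r s, σ => σ.reg r = σ.reg s

/-- Programs. -/
inductive Prog
  | skip
  /-- `r := k` -/
  | const (r k : ℕ)
  /-- `r := a ∘ b` for registers `r`, `a`, `b` -/
  | arith (o : Op) (r a b : ℕ)
  /-- `r := A[i]` for registers `r`, `i` -/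
  | load (r A i : ℕ)
  /-- `A[i] := r` for registers `r`, `i` -/
  | store (A i r : ℕ)
  | seq (P Q : Prog)
  | ite (b : Test) (P Q : Prog)
  | while (b : Test) (P : Prog)

def Store.setReg (σ : Store) (r x : ℕ) : Store :=
  { σ with reg := Function.update σ.reg r x }

def Store.setArr (σ : Store) (A i x : ℕ) : Store :=
  { σ with arr := Function.update σ.arr A (Function.update (σ.arr A) i x) }

/-- `Exec B P σ t τ`: with all computed numbers below `B`, the program `P`, started in `σ`, halts
after exactly `t` steps in `τ`. -/
inductive Exec (B : ℕ) : Prog → Store → ℕ → Store → Prop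
  | skip {σ : Store} : Exec B .skip σ 1 σ
  | const {σ : Store} {r k : ℕ} : k < B → Exec B (.const r k) σ 1 (σ.setReg r k)
  | arith {σ : Store} {o : Op} {r a b : ℕ} : o.eval (σ.reg a) (σ.reg b) < B →
      Exec B (.arith o r a b) σ 1 (σ.setReg r (o.eval (σ.reg a) (σ.reg b)))
  | load {σ : Store} {r A i : ℕ} : Exec B (.load r A i) σ 1 (σ.setReg r (σ.arr A (σ.reg i)))
  | store {σ : Store} {A i r : ℕ} : Exec B (.store A i r) σ 1 (σ.setArr A (σ.reg i) (σ.reg r))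
  | seq {P Q : Prog} {σ τ υ : Store} {s t : ℕ} : Exec B P σ s τ → Exec B Q τ t υ →
      Exec B (.seq P Q) σ (s + t) υ
  | iteTrue {b : Test} {P Q : Prog} {σ τ : Store} {t : ℕ} : b.holds σ → Exec B P σ t τ →
      Exec B (.ite b P Q) σ (t + 1) τ
  | iteFalse {b : Test} {P Q : Prog} {σ τ : Store} {t : ℕ} : ¬ b.holds σ → Exec B Q σ t τ →
      Exec B (.ite b P Q) σ (t + 1) τ
  | whileFalse {b : Test} {P : Prog} {σ : Store} : ¬ b.holds σ → Exec B (.while b P) σ 1 σ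
  | whileTrue {b : Test} {P : Prog} {σ τ υ : Store} {s t : ℕ} : b.holds σ → Exec B P σ s τ →
      Exec B (.while b P) τ t υ → Exec B (.while b P) σ (s + t + 1) υ

end RAM

/-! ## Input and output -/

/-- `es` lists every edge of `G` exactly once, in any order, with its ends in any order. -/
def IsEdgeListing {n m : ℕ} (G : SimpleGraph (Fin n)) (es : Fin m → Fin n × Fin n) : Prop :=
  Function.Injective (fun i => s((es i).1, (es i).2)) ∧
    Set.range (fun i => s((es i).1, (es i).2)) = G.edgeSet

/-- The finite sequence `f` as the contents of an array, with zeros behind it. -/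
def arrayOf {m : ℕ} (f : Fin m → ℕ) (i : ℕ) : ℕ :=
  if h : i < m then f ⟨i, h⟩ else 0

/-- Input: registers 0 and 1 hold `n` and `m`, arrays 0 and 1 hold the two ends of the edges. All
other registers and cells hold 0. -/
def graphInput {n m : ℕ} (es : Fin m → Fin n × Fin n) : RAM.Store where
  reg := fun | 0 => n | 1 => m | _ => 0
  arr := fun
    | 0 => arrayOf fun i => ((es i).1 : ℕ)
    | 1 => arrayOf fun i => ((es i).2 : ℕ)
    | _ => fun _ => 0

/-- Input with edge weights: in addition, array 2 holds the weights of the listed edges. -/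
def weightedInput {n m : ℕ} (es : Fin m → Fin n × Fin n) (w : Sym2 (Fin n) → ℕ) : RAM.Store where
  reg := (graphInput es).reg
  arr := Function.update (graphInput es).arr 2 (arrayOf fun i => w s((es i).1, (es i).2))

/-- Output: entry `i` of array 3 tells whether the `i`-th edge is directed as it was listed (entry 0)
or in the other direction (any other entry). -/
def outputArcs {n m : ℕ} (es : Fin m → Fin n × Fin n) (σ : RAM.Store) : Finset (Fin n × Fin n) :=
  Finset.univ.image fun i : Fin m => if σ.arr 3 i = 0 then es i else (es i).swap

/-! Three facts about the procedure itself carry the theorem.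

Peeling. When all remaining weighted degrees reach the threshold `⌈2l⌉` for the current density `l`,
they all equal it, because their average is `2l` (`isUniform_of_le`). So one extracted minimum
decides everything: below the threshold its vertex is absorbed; otherwise the threshold is
recomputed, and if the minimum still reaches it, the until-condition holds. The repeat loop thus
needs one extract-min per vertex and one decrease-key per edge. Buckets with lazy deletion give
linear time for unit weights, where every decrease is by one. A Fibonacci heap gives `O(m + n log
n)` for arbitrary weights.

Finishing. A vertex of degree at most one lies on no cycle, so cycle steps commute to the front of
forest steps (`cycles_before_forests`), and any interleaving of them that empties the graph is a
legal execution. A loop-erased walk is such an interleaving: it extends a path, erases a cycle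
whenever it returns to the path, and retires the last vertex once its edges are used up. Each step
orients at most about half of the edges at a vertex towards it (`indeg_le_of_finishSteps`). For the
Euler variant the same walk runs on the graph with `v*` added. There all degrees are even, so the
half bound forces a balanced orientation, and a balanced orientation is traversed by an Euler tour
in each component (`Euler.exists_euler_tour`). No tour has to be computed.

Indegrees. A pseudoforest has at most as many edges as vertices, so every subgraph has density at
most `p` and every threshold is at most `2p`. A peeled vertex receives at most `2p - 1` arcs. A
vertex left in the uniform graph has degree at most `2p` and receives at most `p ≤ 2p - 1`.

The programs are written in a small structured language that compiles to the machine with constant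
overhead (`exists_compiled`). They are verified by triples with time credits, so that the potentials
of amortized analysis become parts of loop invariants. -/

set_option linter.unusedSectionVars false
set_option linter.unusedSimpArgs false

/-! ## A structured language with expressions, compiled to the random access machine -/

namespace HL

open RAM

/-- Expressions; comparisons evaluate to one or zero. -/
inductive Expr
  | const (k : ℕ)
  | var (r : ℕ)
  | get (A : ℕ) (i : Expr)
  | bin (o : Op) (a b : Expr)
  | lt (a b : Expr)
  | eq (a b : Expr)

@[simp]
def Expr.eval (s : Store) : Expr → ℕ
  | .const k => k
  | .var r => s.reg r
  | .get A i => s.arr A (i.eval s)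
  | .bin o a b => o.eval (a.eval s) (b.eval s)
  | .lt a b => if a.eval s < b.eval s then 1 else 0
  | .eq a b => if a.eval s = b.eval s then 1 else 0

infixl:65 " ∔ " => Expr.bin Op.add
infixl:65 " ∸ " => Expr.bin Op.sub
infixl:70 " ⨰ " => Expr.bin Op.mul
infixl:70 " ⨸ " => Expr.bin Op.div

/-- Expressions whose value is at most one or the content of some cell. -/
@[simp]
def Expr.tame : Expr → Bool
  | .const k => k ≤ 1
  | .var _ => true
  | .get _ _ => true
  | .bin .sub a _ => a.tame
  | .bin .div a _ => a.tame
  | .bin _ _ _ => false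
  | .lt _ _ => true
  | .eq _ _ => true

/-- Expressions whose value exceeds the content of all cells by at most one. -/
@[simp]
def Expr.safe : Expr → Bool
  | .bin .add a (.const 1) => a.tame
  | e => e.tame

/-- All variables of the expression are below `k`. -/
def Expr.Below (k : ℕ) : Expr → Prop
  | .const _ => True
  | .var r => r < k
  | .get _ i => i.Below k
  | .bin _ a b => a.Below k ∧ b.Below k
  | .lt a b => a.Below k ∧ b.Below k
  | .eq a b => a.Below k ∧ b.Below k

/-- Commands; `call` marks a block that is treated as a unit by `wp`. -/
inductive Cmd
  | skip
  | set (r : ℕ) (e : Expr)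
  | put (A : ℕ) (i e : Expr)
  | seq (c d : Cmd)
  | ite (e : Expr) (c d : Cmd)
  | while (e : Expr) (c : Cmd)
  | call (c : Cmd)

infixr:20 " ⨾ " => Cmd.seq

def Cmd.Below (k : ℕ) : Cmd → Prop
  | .skip => True
  | .set r e => r < k ∧ e.Below k
  | .put _ i e => i.Below k ∧ e.Below k
  | .seq c d => c.Below k ∧ d.Below k
  | .ite e c d => e.Below k ∧ c.Below k ∧ d.Below k
  | .while e c => e.Below k ∧ c.Below k
  | .call c => c.Below k

theorem Expr.Below.mono {k k' : ℕ} (h : k ≤ k') : ∀ {e : Expr}, e.Below k → e.Below k'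
  | .const _, _ => trivial
  | .var _, h' => lt_of_lt_of_le h' h
  | .get _ i, h' => Expr.Below.mono (e := i) h h'
  | .bin _ a b, h' => ⟨Expr.Below.mono (e := a) h h'.1, Expr.Below.mono (e := b) h h'.2⟩
  | .lt a b, h' => ⟨Expr.Below.mono (e := a) h h'.1, Expr.Below.mono (e := b) h h'.2⟩
  | .eq a b, h' => ⟨Expr.Below.mono (e := a) h h'.1, Expr.Below.mono (e := b) h h'.2⟩

theorem Cmd.Below.mono {k k' : ℕ} (h : k ≤ k') : ∀ {c : Cmd}, c.Below k → c.Below k'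
  | .skip, _ => trivial
  | .set _ _, h' => ⟨lt_of_lt_of_le h'.1 h, h'.2.mono h⟩
  | .put _ _ _, h' => ⟨h'.1.mono h, h'.2.mono h⟩
  | .seq c d, h' => ⟨Cmd.Below.mono (c := c) h h'.1, Cmd.Below.mono (c := d) h h'.2⟩
  | .ite _ c d, h' =>
    ⟨h'.1.mono h, Cmd.Below.mono (c := c) h h'.2.1, Cmd.Below.mono (c := d) h h'.2.2⟩
  | .while _ c, h' => ⟨h'.1.mono h, Cmd.Below.mono (c := c) h h'.2⟩
  | .call c, h' => Cmd.Below.mono (c := c) h h'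

theorem Expr.exists_below : ∀ e : Expr, ∃ k, e.Below k
  | .const _ => ⟨0, trivial⟩
  | .var r => ⟨r + 1, Nat.lt_succ_self r⟩
  | .get _ i => exists_below i
  | .bin _ a b | .lt a b | .eq a b =>
    let ⟨k, hk⟩ := exists_below a
    let ⟨l, hl⟩ := exists_below b
    ⟨max k l, hk.mono (le_max_left _ _), hl.mono (le_max_right _ _)⟩

theorem Cmd.exists_below : ∀ c : Cmd, ∃ k, c.Below k
  | .skip => ⟨0, trivial⟩
  | .set r e =>
    let ⟨k, hk⟩ := e.exists_below
    ⟨max k (r + 1), lt_of_lt_of_le (Nat.lt_succ_self r) (le_max_right _ _),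
      hk.mono (le_max_left _ _)⟩
  | .put _ i e =>
    let ⟨k, hk⟩ := i.exists_below
    let ⟨l, hl⟩ := e.exists_below
    ⟨max k l, hk.mono (le_max_left _ _), hl.mono (le_max_right _ _)⟩
  | .seq c d =>
    let ⟨k, hk⟩ := exists_below c
    let ⟨l, hl⟩ := exists_below d
    ⟨max k l, hk.mono (le_max_left _ _), hl.mono (le_max_right _ _)⟩
  | .ite e c d =>
    let ⟨j, hj⟩ := e.exists_below
    let ⟨k, hk⟩ := exists_below c
    let ⟨l, hl⟩ := exists_below d
    ⟨max j (max k l), hj.mono (le_max_left _ _),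
      hk.mono ((le_max_left _ _).trans (le_max_right _ _)),
      hl.mono ((le_max_right _ _).trans (le_max_right _ _))⟩
  | .while e c =>
    let ⟨k, hk⟩ := e.exists_below
    let ⟨l, hl⟩ := exists_below c
    ⟨max k l, hk.mono (le_max_left _ _), hl.mono (le_max_right _ _)⟩
  | .call c => exists_below c

/-- `Big M c s t s'`: the command `c`, started in `s`, ends in `s'` at cost `t`; the values of
assigned expressions that are not safe are at most `M`. -/
inductive Big (M : ℕ) : Cmd → Store → ℕ → Store → Prop
  | skip {s : Store} : Big M .skip s 1 s
  | set {s : Store} {r : ℕ} {e : Expr} : (e.safe = true ∨ e.eval s ≤ M) →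
      Big M (.set r e) s 1 (s.setReg r (e.eval s))
  | put {s : Store} {A : ℕ} {i e : Expr} : (e.safe = true ∨ e.eval s ≤ M) →
      Big M (.put A i e) s 1 (s.setArr A (i.eval s) (e.eval s))
  | seq {c d : Cmd} {s s' s'' : Store} {t t' : ℕ} : Big M c s t s' → Big M d s' t' s'' →
      Big M (.seq c d) s (t + t') s''
  | iteTrue {e : Expr} {c d : Cmd} {s s' : Store} {t : ℕ} : e.eval s ≠ 0 → Big M c s t s' →
      Big M (.ite e c d) s (t + 1) s'
  | iteFalse {e : Expr} {c d : Cmd} {s s' : Store} {t : ℕ} : e.eval s = 0 → Big M d s t s' →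
      Big M (.ite e c d) s (t + 1) s'
  | whileFalse {e : Expr} {c : Cmd} {s : Store} : e.eval s = 0 → Big M (.while e c) s 1 s
  | whileTrue {e : Expr} {c : Cmd} {s s' s'' : Store} {t t' : ℕ} : e.eval s ≠ 0 →
      Big M c s t s' → Big M (.while e c) s' t' s'' → Big M (.while e c) s (t + t' + 1) s''
  | call {c : Cmd} {s s' : Store} {t : ℕ} : Big M c s t s' → Big M (.call c) s t s'

/-- Code that evaluates an expression into register `k`, using only registers from `k` on. -/
def compExpr : ℕ → Expr → Prog
  | k, .const c => .const k c
  | k, .var r => .seq (.const (k + 1) 0) (.arith .add k r (k + 1))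
  | k, .get A i => .seq (compExpr k i) (.load k A k)
  | k, .bin o a b => .seq (compExpr k a) (.seq (compExpr (k + 1) b) (.arith o k k (k + 1)))
  | k, .lt a b => .seq (compExpr k a) (.seq (compExpr (k + 1) b)
      (.ite (.lt k (k + 1)) (.const k 1) (.const k 0)))
  | k, .eq a b => .seq (compExpr k a) (.seq (compExpr (k + 1) b)
      (.ite (.eq k (k + 1)) (.const k 1) (.const k 0)))

def compTest (k : ℕ) (e : Expr) : Prog :=
  .seq (compExpr k e) (.const (k + 1) 0)

/-- Registers below `k` belong to the source program, those from `k` on are scratch. Machine tests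
only compare registers, so a loop evaluates its condition once before the machine loop and again at
the end of each round. -/
def comp (k : ℕ) : Cmd → Prog
  | .skip => .skip
  | .set r e => .seq (compExpr k e) (.seq (.const (k + 1) 0) (.arith .add r k (k + 1)))
  | .put A i e => .seq (compExpr k i) (.seq (compExpr (k + 1) e) (.store A k (k + 1)))
  | .seq c d => .seq (comp k c) (comp k d)
  | .ite e c d => .seq (compTest k e) (.ite (.lt (k + 1) k) (comp k c) (comp k d))
  | .while e c => .seq (compTest k e)
      (.while (.lt (k + 1) k) (.seq (comp k c) (compTest k e)))
  | .call c => comp k c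

/-- All cells hold numbers up to `X`. -/
def Fits (X : ℕ) (s : Store) : Prop :=
  (∀ r, s.reg r ≤ X) ∧ ∀ A i, s.arr A i ≤ X

/-- The stores have the same arrays and agree on the registers below `k`. -/
def Agree (k : ℕ) (s σ : Store) : Prop :=
  (∀ r < k, σ.reg r = s.reg r) ∧ σ.arr = s.arr

/-! ### Correctness and overhead of compilation -/

theorem pow_self_mono {X a b : ℕ} (h : a ≤ b) (ha : 1 ≤ a) : (X + a) ^ a ≤ (X + b) ^ b :=
  (Nat.pow_le_pow_left (by omega) a).trans (Nat.pow_le_pow_right (by omega) h)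

theorem pow_self_pos {X a : ℕ} (ha : 1 ≤ a) : 1 ≤ (X + a) ^ a :=
  Nat.one_le_pow _ _ (by omega)

@[simp] theorem setReg_reg (s : Store) (r x r' : ℕ) :
    (s.setReg r x).reg r' = if r' = r then x else s.reg r' := by
  simp [Store.setReg, Function.update_apply]

@[simp] theorem setReg_arr (s : Store) (r x : ℕ) : (s.setReg r x).arr = s.arr := rfl

@[simp] theorem setArr_reg (s : Store) (A i x : ℕ) : (s.setArr A i x).reg = s.reg := rfl

@[simp] theorem setArr_arr (s : Store) (A i x A' : ℕ) :
    (s.setArr A i x).arr A' = if A' = A then Function.update (s.arr A) i x else s.arr A' := by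
  simp only [Store.setArr, Function.update_apply]

/-- What compiled code for `e` achieves for the constant `κ`. -/
def ExprSpec (e : Expr) (κ : ℕ) : Prop :=
  1 ≤ κ ∧ ∀ (X : ℕ) (s : Store), Fits X s → e.eval s ≤ (X + κ) ^ κ ∧
    ∀ (B k₀ k : ℕ) (σ : Store), (X + κ) ^ κ < B → e.Below k₀ → k₀ ≤ k → Agree k₀ s σ →
      ∃ t σ', Exec B (compExpr k e) σ t σ' ∧ t ≤ κ ∧ σ'.reg k = e.eval s ∧
        (∀ r < k, σ'.reg r = σ.reg r) ∧ σ'.arr = σ.arr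

theorem Op.eval_le (o : Op) {X κ l a b : ℕ} (ha : a ≤ (X + κ) ^ κ) (hb : b ≤ (X + l) ^ l)
    (hκ : 1 ≤ κ) (hl : 1 ≤ l) : o.eval a b ≤ (X + (κ + l + 8)) ^ (κ + l + 8) := by
  set Y := X + (κ + l + 8) with hY
  have h1 : a ≤ Y ^ κ := ha.trans (Nat.pow_le_pow_left (by omega) _)
  have h2 : b ≤ Y ^ l := hb.trans (Nat.pow_le_pow_left (by omega) _)
  have h3 : Y ^ κ ≤ Y ^ (κ + l) := Nat.pow_le_pow_right (by omega) (by omega)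
  have h4 : Y ^ l ≤ Y ^ (κ + l) := Nat.pow_le_pow_right (by omega) (by omega)
  have h5 : Y ^ (κ + l) * 2 ≤ Y ^ (κ + l + 1) := by
    rw [pow_succ]; exact Nat.mul_le_mul_left _ (by omega)
  have h6 : Y ^ (κ + l + 1) ≤ Y ^ (κ + l + 8) := Nat.pow_le_pow_right (by omega) (by omega)
  have h7 : a * b ≤ Y ^ (κ + l) := by rw [pow_add]; exact Nat.mul_le_mul h1 h2
  have h8 : a / b ≤ a := Nat.div_le_self _ _
  cases o <;> simp only [Op.eval] <;> omega

theorem two_operands {a b : Expr} {κ l : ℕ} (ha : ExprSpec a κ) (hb : ExprSpec b l)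
    {X B k₀ k : ℕ} {s σ : Store} (hX : Fits X s)
    (hB : (X + (κ + l + 8)) ^ (κ + l + 8) < B) (hak : a.Below k₀) (hbk : b.Below k₀)
    (hk : k₀ ≤ k) (hσ : Agree k₀ s σ) :
    ∃ t₁ t₂ σ₁ σ₂, Exec B (compExpr k a) σ t₁ σ₁ ∧ Exec B (compExpr (k + 1) b) σ₁ t₂ σ₂ ∧
      t₁ + t₂ ≤ κ + l ∧ σ₂.reg k = a.eval s ∧ σ₂.reg (k + 1) = b.eval s ∧
      (∀ r < k, σ₂.reg r = σ.reg r) ∧ σ₂.arr = σ.arr := by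
  obtain ⟨t₁, σ₁, e₁, b₁, v₁, f₁, g₁⟩ := (ha.2 X s hX).2 B k₀ k σ
    ((pow_self_mono (by omega) ha.1).trans_lt hB) hak hk hσ
  have hσ₁ : Agree k₀ s σ₁ :=
    ⟨fun r hr => (f₁ r (by omega)).trans (hσ.1 r hr), g₁.trans hσ.2⟩
  obtain ⟨t₂, σ₂, e₂, b₂, v₂, f₂, g₂⟩ := (hb.2 X s hX).2 B k₀ (k + 1) σ₁
    ((pow_self_mono (by omega) hb.1).trans_lt hB) hbk (by omega) hσ₁
  exact ⟨t₁, t₂, σ₁, σ₂, e₁, e₂, by omega, (f₂ k (by omega)).trans v₁, v₂,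
    fun r hr => (f₂ r (by omega)).trans (f₁ r hr), g₂.trans g₁⟩

/-- A fixed expression performs a fixed number of operations, each of which at worst multiplies two
numbers. Hence one constant `κ`, depending on the expression only, bounds the time and, as exponent,
all intermediate values. -/
theorem exists_exprSpec : ∀ e : Expr, ∃ κ, ExprSpec e κ
  | .const c => by
    refine ⟨c + 2, by omega, fun X s _ => ⟨?_, fun B k₀ k σ hB _ _ _ => ?_⟩⟩
    · exact (show c ≤ X + (c + 2) by omega).trans (Nat.le_self_pow (by omega) _)
    · refine ⟨1, _, .const ?_, by omega, ?_, ?_, rfl⟩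
      · exact lt_of_le_of_lt ((show c ≤ X + (c + 2) by omega).trans
          (Nat.le_self_pow (by omega) _)) hB
      · simp
      · intro r hr
        simp [hr.ne]
  | .var r => by
    refine ⟨3, by omega, fun X s hX => ⟨?_, fun B k₀ k σ hB hr hk hσ => ?_⟩⟩
    · exact ((hX.1 r).trans (by omega)).trans (Nat.le_self_pow (by omega) (X + 3))
    · have h1 : X + 3 ≤ (X + 3) ^ 3 := Nat.le_self_pow (by omega) _
      have h2 := hX.1 r
      have h3 : σ.reg r = s.reg r := hσ.1 r hr
      have h4 : r < k₀ := hr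
      refine ⟨_, _, .seq (.const (by omega)) (.arith ?_), by omega, ?_, ?_, rfl⟩
      · simp [Op.eval, show r ≠ k + 1 by omega]
        omega
      · simp [Op.eval, show r ≠ k + 1 by omega, h3]
      · intro r' hr'
        simp [hr'.ne, show r' ≠ k + 1 by omega]
  | .get A i => by
    obtain ⟨κ, hκ, h⟩ := exists_exprSpec i
    refine ⟨κ + 1, by omega, fun X s hX => ⟨?_, fun B k₀ k σ hB hr hk hσ => ?_⟩⟩
    · exact ((hX.2 A _).trans (by omega)).trans (Nat.le_self_pow (by omega) (X + (κ + 1)))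
    · obtain ⟨t, σ', e, b, v, f, g⟩ := (h X s hX).2 B k₀ k σ
        ((pow_self_mono (by omega) hκ).trans_lt hB) hr hk hσ
      refine ⟨_, _, .seq e .load, by omega, ?_, ?_, ?_⟩
      · simp [v, g, hσ.2]
      · intro r' hr'
        simp [hr'.ne, f r' hr']
      · simpa using g
  | .bin o a b => by
    obtain ⟨κ, ha⟩ := exists_exprSpec a
    obtain ⟨l, hb⟩ := exists_exprSpec b
    refine ⟨κ + l + 8, by omega, fun X s hX => ⟨?_, fun B k₀ k σ hB hr hk hσ => ?_⟩⟩
    · exact Op.eval_le o (ha.2 X s hX).1 (hb.2 X s hX).1 ha.1 hb.1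
    · obtain ⟨t₁, t₂, σ₁, σ₂, e₁, e₂, ht, va, vb, f, g⟩ :=
        two_operands ha hb hX hB hr.1 hr.2 hk hσ
      have := Op.eval_le o (ha.2 X s hX).1 (hb.2 X s hX).1 ha.1 hb.1
      refine ⟨_, _, .seq e₁ (.seq e₂ (.arith ?_)), by omega, ?_, ?_, ?_⟩
      · rw [va, vb]; omega
      · simp [va, vb]
      · intro r' hr'
        simp [hr'.ne, f r' hr']
      · simpa using g
  | .lt a b => by
    obtain ⟨κ, ha⟩ := exists_exprSpec a
    obtain ⟨l, hb⟩ := exists_exprSpec b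
    refine ⟨κ + l + 8, by omega, fun X s hX => ⟨?_, fun B k₀ k σ hB hr hk hσ => ?_⟩⟩
    · refine le_trans ?_ (pow_self_pos (by omega))
      simp only [Expr.eval]
      split <;> omega
    · obtain ⟨t₁, t₂, σ₁, σ₂, e₁, e₂, ht, va, vb, f, g⟩ :=
        two_operands ha hb hX hB hr.1 hr.2 hk hσ
      have h1 : 1 ≤ (X + (κ + l + 8)) ^ (κ + l + 8) := pow_self_pos (by omega)
      by_cases hlt : a.eval s < b.eval s
      · refine ⟨_, _, .seq e₁ (.seq e₂ (.iteTrue ?_ (.const (by omega)))), by omega, ?_, ?_, ?_⟩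
        · simpa [Test.holds, va, vb] using hlt
        · simp [hlt]
        · intro r' hr'
          simp [hr'.ne, f r' hr']
        · simpa using g
      · refine ⟨_, _, .seq e₁ (.seq e₂ (.iteFalse ?_ (.const (by omega)))), by omega, ?_, ?_, ?_⟩
        · simpa [Test.holds, va, vb] using hlt
        · simp [hlt]
        · intro r' hr'
          simp [hr'.ne, f r' hr']
        · simpa using g
  | .eq a b => by
    obtain ⟨κ, ha⟩ := exists_exprSpec a
    obtain ⟨l, hb⟩ := exists_exprSpec b
    refine ⟨κ + l + 8, by omega, fun X s hX => ⟨?_, fun B k₀ k σ hB hr hk hσ => ?_⟩⟩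
    · refine le_trans ?_ (pow_self_pos (by omega))
      simp only [Expr.eval]
      split <;> omega
    · obtain ⟨t₁, t₂, σ₁, σ₂, e₁, e₂, ht, va, vb, f, g⟩ :=
        two_operands ha hb hX hB hr.1 hr.2 hk hσ
      have h1 : 1 ≤ (X + (κ + l + 8)) ^ (κ + l + 8) := pow_self_pos (by omega)
      by_cases hlt : a.eval s = b.eval s
      · refine ⟨_, _, .seq e₁ (.seq e₂ (.iteTrue ?_ (.const (by omega)))), by omega, ?_, ?_, ?_⟩
        · simpa [Test.holds, va, vb] using hlt
        · simp [hlt]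
        · intro r' hr'
          simp [hr'.ne, f r' hr']
        · simpa using g
      · refine ⟨_, _, .seq e₁ (.seq e₂ (.iteFalse ?_ (.const (by omega)))), by omega, ?_, ?_, ?_⟩
        · simpa [Test.holds, va, vb] using hlt
        · simp [hlt]
        · intro r' hr'
          simp [hr'.ne, f r' hr']
        · simpa using g

theorem Expr.eval_le_of_tame {X : ℕ} {s : Store} (hX : Fits X s) (h1 : 1 ≤ X) :
    ∀ {e : Expr}, e.tame = true → e.eval s ≤ X
  | .const k, h => by simp at h; simp; omega
  | .var r, _ => hX.1 r
  | .get A i, _ => hX.2 A _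
  | .bin .sub a b, h => (Nat.sub_le _ _).trans (Expr.eval_le_of_tame (e := a) hX h1 h)
  | .bin .div a b, h => (Nat.div_le_self _ _).trans (Expr.eval_le_of_tame (e := a) hX h1 h)
  | .bin .add _ _, h => by simp at h
  | .bin .mul _ _, h => by simp at h
  | .lt a b, _ => by simp only [Expr.eval]; split <;> omega
  | .eq a b, _ => by simp only [Expr.eval]; split <;> omega

theorem Expr.eval_le_of_safe {X : ℕ} {s : Store} (hX : Fits X s) (h1 : 1 ≤ X) {e : Expr}
    (h : e.safe = true) : e.eval s ≤ X + 1 := by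
  unfold Expr.safe at h
  split at h
  · next a => exact Nat.succ_le_succ (eval_le_of_tame hX h1 h)
  · exact (eval_le_of_tame hX h1 h).trans (by omega)

theorem Fits.mono {X Y : ℕ} {s : Store} (h : Fits X s) (hXY : X ≤ Y) : Fits Y s :=
  ⟨fun r => (h.1 r).trans hXY, fun A i => (h.2 A i).trans hXY⟩

theorem Fits.setReg {X x : ℕ} {s : Store} (h : Fits X s) (hx : x ≤ X) (r : ℕ) :
    Fits X (s.setReg r x) := by
  refine ⟨fun r' => ?_, fun A i => h.2 A i⟩
  simp only [setReg_reg]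
  split
  · exact hx
  · exact h.1 r'

theorem Fits.setArr {X x : ℕ} {s : Store} (h : Fits X s) (hx : x ≤ X) (A i : ℕ) :
    Fits X (s.setArr A i x) := by
  refine ⟨fun r' => h.1 r', fun A' i' => ?_⟩
  simp only [setArr_arr]
  split
  · rw [Function.update_apply]
    split
    · exact hx
    · exact h.2 _ _
  · exact h.2 _ _

/-- What compiled code for `c` achieves for the constant `κ`. -/
def CmdSpec (k : ℕ) (c : Cmd) (κ : ℕ) : Prop :=
  1 ≤ κ ∧ ∀ (M B X t : ℕ) (s s' σ : Store), Big M c s t s' → M ≤ X → 1 ≤ X → Fits X s →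
    (X + t + κ) ^ κ < B → Agree k s σ →
    Fits (X + t) s' ∧ ∃ t' σ', Exec B (comp k c) σ t' σ' ∧ t' ≤ κ * t ∧ Agree k s' σ'

theorem compTest_spec {e : Expr} {κ k X B : ℕ} {s σ : Store} (he : ExprSpec e κ) (hX : Fits X s)
    (hB : (X + κ) ^ κ < B) (hk : e.Below k) (hσ : Agree k s σ) :
    ∃ t σ', Exec B (compTest k e) σ t σ' ∧ t ≤ κ + 1 ∧ Agree k s σ' ∧
      ((Test.lt (k + 1) k).holds σ' ↔ e.eval s ≠ 0) := by
  obtain ⟨t, σ', ex, b, v, f, g⟩ := (he.2 X s hX).2 B k k σ hB hk le_rfl hσ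
  refine ⟨_, _, .seq ex (.const (by omega)), by omega, ⟨fun r hr => ?_, g.trans hσ.2⟩, ?_⟩
  · simp [show r ≠ k + 1 by omega, f r hr, hσ.1 r hr]
  · simp [Test.holds, v, Nat.pos_iff_ne_zero]

/-- Safe assignments raise the largest cell by at most one and the others stay below `M ≤ X`, so
after `t` steps all cells are at most `X + t`. Without this distinction, repeated multiplication
could outgrow every fixed power. Larger numbers occur only inside one expression, where
`exists_exprSpec` bounds them. -/
theorem exists_cmdSpec (k : ℕ) : ∀ c : Cmd, c.Below k → ∃ κ, CmdSpec k c κ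
  | .skip, _ => by
    refine ⟨1, le_rfl, fun M B X t s s' σ h hM h1 hX hB hσ => ?_⟩
    cases h
    exact ⟨hX.mono (by omega), 1, σ, .skip, by omega, hσ⟩
  | .set r e, hc => by
    obtain ⟨κ, he⟩ := exists_exprSpec e
    refine ⟨κ + 8, by omega, fun M B X t s s' σ h hM h1 hX hB hσ => ?_⟩
    cases h with
    | set hs =>
      have hv : e.eval s ≤ X + 1 := by
        rcases hs with hs | hs
        · exact Expr.eval_le_of_safe hX h1 hs
        · omega
      have hκ : (X + κ) ^ κ < B := lt_of_le_of_lt ((Nat.pow_le_pow_left (by omega) _).trans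
        (pow_self_mono (X := X + 1) (by omega) he.1)) hB
      obtain ⟨t, σ', ex, b, v, f, g⟩ := (he.2 X s hX).2 B k k σ hκ hc.2 le_rfl hσ
      have hr : r < k := hc.1
      have hB' : X + 1 + (κ + 8) ≤ (X + 1 + (κ + 8)) ^ (κ + 8) := Nat.le_self_pow (by omega) _
      refine ⟨(hX.mono (by omega)).setReg hv r, _, _,
        .seq ex (.seq (.const (by omega)) (.arith ?_)), by omega, fun r' hr' => ?_, g.trans hσ.2⟩
      · simp [Op.eval, v]; omega
      · simp [Op.eval, v, show r' ≠ k + 1 by omega, f r' hr', hσ.1 r' hr']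
  | .put A i e, hc => by
    obtain ⟨κ, hi⟩ := exists_exprSpec i
    obtain ⟨l, he⟩ := exists_exprSpec e
    refine ⟨κ + l + 8, by omega, fun M B X t s s' σ h hM h1 hX hB hσ => ?_⟩
    cases h with
    | put hs =>
      have hv : e.eval s ≤ X + 1 := by
        rcases hs with hs | hs
        · exact Expr.eval_le_of_safe hX h1 hs
        · omega
      obtain ⟨t₁, t₂, σ₁, σ₂, e₁, e₂, ht, va, vb, f, g⟩ := two_operands hi he
        (hX.mono (show X ≤ X + 1 by omega)) hB hc.1 hc.2 le_rfl hσ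
      refine ⟨(hX.mono (by omega)).setArr hv A _, _, _, .seq e₁ (.seq e₂ .store), by omega,
        fun r' hr' => ?_, ?_⟩
      · simp [f r' hr', hσ.1 r' hr']
      · rw [va, vb]
        simp [Store.setArr, g, hσ.2]
  | .seq c d, hc => by
    obtain ⟨κ, hκ, h₁⟩ := exists_cmdSpec k c hc.1
    obtain ⟨l, hl, h₂⟩ := exists_cmdSpec k d hc.2
    refine ⟨κ + l, by omega, fun M B X t s s' σ h hM h1 hX hB hσ => ?_⟩
    cases h with
    | @seq _ _ _ s₁ _ t₁ t₂ hb₁ hb₂ =>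
      obtain ⟨F₁, t₁', σ₁, e₁, c₁, a₁⟩ := h₁ M B X t₁ s s₁ σ hb₁ hM h1 hX
        (((Nat.pow_le_pow_left (by omega) _).trans
          (pow_self_mono (X := X + (t₁ + t₂)) (by omega) hκ)).trans_lt hB) hσ
      obtain ⟨F₂, t₂', σ₂, e₂, c₂, a₂⟩ := h₂ M B (X + t₁) t₂ s₁ s' σ₁ hb₂ (by omega) (by omega) F₁
        (((Nat.pow_le_pow_left (by omega) _).trans
          (pow_self_mono (X := X + (t₁ + t₂)) (by omega) hl)).trans_lt hB) a₁
      refine ⟨F₂.mono (by omega), _, _, .seq e₁ e₂, ?_, a₂⟩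
      nlinarith
  | .ite e c d, hc => by
    obtain ⟨j, he⟩ := exists_exprSpec e
    obtain ⟨κ, hκ, h₁⟩ := exists_cmdSpec k c hc.2.1
    obtain ⟨l, hl, h₂⟩ := exists_cmdSpec k d hc.2.2
    refine ⟨κ + l + j + 2, by omega, fun M B X t s s' σ h hM h1 hX hB hσ => ?_⟩
    obtain ⟨t₀, σ₀, e₀, c₀, a₀, tst⟩ := compTest_spec he hX
      (((Nat.pow_le_pow_left (by omega) _).trans
          (pow_self_mono (X := X + t) (by omega) he.1)).trans_lt hB) hc.1 hσ
    cases h with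
    | @iteTrue _ _ _ _ _ t₁ hn hb =>
      obtain ⟨F₁, t₁', σ₁, e₁, c₁, a₁⟩ := h₁ M B X t₁ s s' σ₀ hb hM h1 hX
        (((Nat.pow_le_pow_left (by omega) _).trans
          (pow_self_mono (X := X + (t₁ + 1)) (by omega) hκ)).trans_lt hB) a₀
      refine ⟨F₁.mono (by omega), _, _, .seq e₀ (.iteTrue (tst.2 hn) e₁), ?_, a₁⟩
      nlinarith
    | @iteFalse _ _ _ _ _ t₁ hn hb =>
      obtain ⟨F₁, t₁', σ₁, e₁, c₁, a₁⟩ := h₂ M B X t₁ s s' σ₀ hb hM h1 hX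
        (((Nat.pow_le_pow_left (by omega) _).trans
          (pow_self_mono (X := X + (t₁ + 1)) (by omega) hl)).trans_lt hB) a₀
      refine ⟨F₁.mono (by omega), _, _, .seq e₀ (.iteFalse (fun h => tst.1 h hn) e₁), ?_, a₁⟩
      nlinarith
  | .while e c, hc => by
    obtain ⟨j, he⟩ := exists_exprSpec e
    obtain ⟨κ, hκ, h₁⟩ := exists_cmdSpec k c hc.2
    refine ⟨κ + j + 3, by omega, fun M B X t s s' σ h hM h1 hX hB hσ => ?_⟩
    -- The induction over the rounds starts just after an evaluation of the test; the summand `j +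
    -- 1` reserves the time for that evaluation.
    suffices H : ∀ σ₀, Agree k s σ₀ → ((Test.lt (k + 1) k).holds σ₀ ↔ e.eval s ≠ 0) →
        Fits (X + t) s' ∧ ∃ t' σ', Exec B (.while (.lt (k + 1) k) (.seq (comp k c) (compTest k e)))
          σ₀ t' σ' ∧ t' + j + 1 ≤ (κ + j + 3) * t ∧ Agree k s' σ' by
      obtain ⟨t₀, σ₀, e₀, c₀, a₀, tst⟩ := compTest_spec he hX
        (((Nat.pow_le_pow_left (by omega) _).trans
          (pow_self_mono (X := X + t) (by omega) he.1)).trans_lt hB) hc.1 hσ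
      obtain ⟨F, t', σ', e', ht', a'⟩ := H σ₀ a₀ tst
      exact ⟨F, _, _, .seq e₀ e', by omega, a'⟩
    clear hσ
    generalize hw : Cmd.while e c = W at h
    induction h generalizing X with
    | whileFalse hz =>
      cases hw
      intro σ₀ a₀ tst
      exact ⟨hX.mono (by omega), 1, σ₀, .whileFalse (fun h => tst.1 h hz), by omega, a₀⟩
    | @whileTrue e c s s₁ s₂ t₁ t₂ hn hb₁ hb₂ _ ih =>
      cases hw
      intro σ₀ a₀ tst
      obtain ⟨F₁, t₁', σ₁, e₁, c₁, a₁⟩ := h₁ M B X t₁ s s₁ σ₀ hb₁ hM h1 hX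
        (((Nat.pow_le_pow_left (by omega) _).trans
          (pow_self_mono (X := X + (t₁ + t₂ + 1)) (by omega) hκ)).trans_lt hB) a₀
      obtain ⟨t₂', σ₂, e₂, c₂, a₂, tst₂⟩ := compTest_spec he F₁
        (((Nat.pow_le_pow_left (by omega) _).trans
          (pow_self_mono (X := X + (t₁ + t₂ + 1)) (by omega) he.1)).trans_lt hB) hc.1 a₁
      obtain ⟨F₃, t₃', σ₃, e₃, c₃, a₃⟩ := ih (X + t₁) (by omega) (by omega) F₁
        ((Nat.pow_le_pow_left (by omega) _).trans_lt hB) rfl σ₂ a₂ tst₂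
      refine ⟨F₃.mono (by omega), _, _, .whileTrue (tst.2 hn) (.seq e₁ e₂) e₃, ?_, a₃⟩
      nlinarith
    | _ => cases hw
  | .call c, hc => by
    obtain ⟨κ, hκ, h₁⟩ := exists_cmdSpec k c hc
    refine ⟨κ, hκ, fun M B X t s s' σ h hM h1 hX hB hσ => ?_⟩
    cases h with
    | call h => exact h₁ M B X t s s' σ h hM h1 hX hB hσ

/-- Every command can be compiled with a constant overhead. -/
theorem exists_compiled (c : Cmd) : ∃ (P : Prog) (κ : ℕ), ∀ (M B X t : ℕ) (s s' : Store),
    Big M c s t s' → M ≤ X → 1 ≤ X → Fits X s → (X + t + κ) ^ κ < B →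
    ∃ t' σ', Exec B P s t' σ' ∧ t' ≤ κ * t ∧ σ'.arr = s'.arr := by
  obtain ⟨k, hk⟩ := c.exists_below
  obtain ⟨κ, _, h⟩ := exists_cmdSpec k c hk
  refine ⟨comp k c, κ, fun M B X t s s' hb hM h1 hX hB => ?_⟩
  obtain ⟨_, t', σ', e, ht, a⟩ := h M B X t s s' s hb hM h1 hX hB ⟨fun _ _ => rfl, rfl⟩
  exact ⟨t', σ', e, ht, a.2⟩

/-! ### Triples with time credits -/

/-- With `k` credits, the command `c` runs from `s` to a store `s'` such that `Q k' s'` for the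
number `k'` of credits left. -/
def Tri (M : ℕ) (c : Cmd) (s : Store) (k : ℕ) (Q : ℕ → Store → Prop) : Prop :=
  ∃ t s' k', Big M c s t s' ∧ t + k' ≤ k ∧ Q k' s'

/-- Sufficient condition for a triple, computed through straight-line code. -/
def wp (M : ℕ) : Cmd → (ℕ → Store → Prop) → ℕ → Store → Prop
  | .skip, Q => fun k s => 1 ≤ k ∧ Q (k - 1) s
  | .set r e, Q => fun k s => 1 ≤ k ∧ (e.safe = true ∨ e.eval s ≤ M) ∧
      Q (k - 1) (s.setReg r (e.eval s))
  | .put A i e, Q => fun k s => 1 ≤ k ∧ (e.safe = true ∨ e.eval s ≤ M) ∧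
      Q (k - 1) (s.setArr A (i.eval s) (e.eval s))
  | .seq c d, Q => wp M c (wp M d Q)
  | .ite e c d, Q => fun k s => 1 ≤ k ∧ (e.eval s ≠ 0 → wp M c Q (k - 1) s) ∧
      (e.eval s = 0 → wp M d Q (k - 1) s)
  | .while e c, Q => fun k s => Tri M (.while e c) s k Q
  | .call c, Q => fun k s => Tri M c s k Q

theorem Tri.of_wp {M : ℕ} : ∀ {c : Cmd} {Q : ℕ → Store → Prop} {k : ℕ} {s : Store},
    wp M c Q k s → Tri M c s k Q
  | .skip, _, k, s, h => ⟨1, s, k - 1, .skip, by have := h.1; omega, h.2⟩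
  | .set _ _, _, k, s, h => ⟨1, _, k - 1, .set h.2.1, by have := h.1; omega, h.2.2⟩
  | .put _ _ _, _, k, s, h => ⟨1, _, k - 1, .put h.2.1, by have := h.1; omega, h.2.2⟩
  | .seq c d, _, k, s, h => by
    obtain ⟨t, s', k', hb, ht, h'⟩ := Tri.of_wp (c := c) h
    obtain ⟨u, s'', k'', hb', hu, h''⟩ := Tri.of_wp (c := d) h'
    exact ⟨_, _, _, .seq hb hb', by omega, h''⟩
  | .ite e c d, _, k, s, h => by
    have h1 := h.1
    by_cases he : e.eval s = 0
    · obtain ⟨t, s', k', hb, ht, h'⟩ := Tri.of_wp (c := d) (h.2.2 he)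
      exact ⟨_, _, _, .iteFalse he hb, by omega, h'⟩
    · obtain ⟨t, s', k', hb, ht, h'⟩ := Tri.of_wp (c := c) (h.2.1 he)
      exact ⟨_, _, _, .iteTrue he hb, by omega, h'⟩
  | .while _ _, _, _, _, h => h
  | .call c, _, _, _, h => by
    obtain ⟨t, s', k', hb, ht, h'⟩ := h
    exact ⟨_, _, _, .call hb, ht, h'⟩

theorem Tri.mono {M : ℕ} {c : Cmd} {s : Store} {k : ℕ} {Q R : ℕ → Store → Prop}
    (h : Tri M c s k Q) (hQR : ∀ k' s', Q k' s' → R k' s') : Tri M c s k R := by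
  obtain ⟨t, s', k', hb, ht, h'⟩ := h
  exact ⟨t, s', k', hb, ht, hQR _ _ h'⟩

/-- An opaque postcondition `R` keeps simplification from unfolding the real one while `wp` is
computed. -/
theorem Tri.of_wp_forall {M : ℕ} {c : Cmd} {Q : ℕ → Store → Prop} {k : ℕ} {s : Store}
    (h : ∀ R : ℕ → Store → Prop, (∀ k' s', Q k' s' → R k' s') → wp M c R k s) : Tri M c s k Q :=
  .of_wp (h Q fun _ _ h => h)

/-- The invariant may speak of the credits left, so it can hold a potential. Every round spends at
least one credit, and induction on the credits gives termination along with the time bound. -/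
theorem Tri.while {M : ℕ} {e : Expr} {c : Cmd} {Q : ℕ → Store → Prop} (I : ℕ → Store → Prop)
    (step : ∀ k s, I k s → e.eval s ≠ 0 → 1 ≤ k ∧ Tri M c s (k - 1) I)
    (exit : ∀ k s, I k s → e.eval s = 0 → 1 ≤ k ∧ Q (k - 1) s) {k : ℕ} {s : Store} (h : I k s) :
    Tri M (.while e c) s k Q := by
  induction k using Nat.strong_induction_on generalizing s with
  | _ k ih =>
    by_cases he : e.eval s = 0
    · obtain ⟨h1, h2⟩ := exit k s h he
      exact ⟨1, s, k - 1, .whileFalse he, by omega, h2⟩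
    · obtain ⟨h1, t, s', k', hb, ht, h'⟩ := step k s h he
      obtain ⟨u, s'', k'', hb', hu, h''⟩ := ih k' (by omega) h'
      exact ⟨_, _, _, .whileTrue he hb hb', by omega, h''⟩

theorem eval_lt_eq_zero {s : Store} {a b : Expr} :
    (Expr.lt a b).eval s = 0 ↔ ¬ a.eval s < b.eval s := by
  simp

theorem eval_eq_eq_zero {s : Store} {a b : Expr} :
    (Expr.eq a b).eval s = 0 ↔ ¬ a.eval s = b.eval s := by
  simp

/-- The registers a command may change. -/
@[simp]
def Cmd.regs : Cmd → List ℕ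
  | .skip => []
  | .set r _ => [r]
  | .put _ _ _ => []
  | .seq c d => c.regs ++ d.regs
  | .ite _ c d => c.regs ++ d.regs
  | .while _ c => c.regs
  | .call c => c.regs

/-- The arrays a command may change. -/
@[simp]
def Cmd.arrs : Cmd → List ℕ
  | .skip => []
  | .set _ _ => []
  | .put A _ _ => [A]
  | .seq c d => c.arrs ++ d.arrs
  | .ite _ c d => c.arrs ++ d.arrs
  | .while _ c => c.arrs
  | .call c => c.arrs

/-- A syntactic frame rule: specifications need only describe what changes, and the rest is read off
the lists of assigned registers and arrays. -/
theorem Big.frame {M : ℕ} {c : Cmd} {s s' : Store} {t : ℕ} (h : Big M c s t s') :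
    (∀ r, r ∉ c.regs → s'.reg r = s.reg r) ∧ ∀ A, A ∉ c.arrs → s'.arr A = s.arr A := by
  induction h <;> simp_all

/-- `s'` differs from `s` only in what `c` may change. -/
def Framed (c : Cmd) (s s' : Store) : Prop :=
  (∀ r, r ∉ c.regs → s'.reg r = s.reg r) ∧ ∀ A, A ∉ c.arrs → s'.arr A = s.arr A

theorem Tri.framed {M : ℕ} {c : Cmd} {s : Store} {k : ℕ} {Q R : ℕ → Store → Prop}
    (h : Tri M c s k Q) (hQR : ∀ k' s', Q k' s' → Framed c s s' → R k' s') : Tri M c s k R := by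
  obtain ⟨t, s', k', hb, ht, h'⟩ := h
  exact ⟨t, s', k', hb, ht, hQR _ _ h' hb.frame⟩

end HL

/-! ## Pseudoforests have at most as many edges as vertices -/

namespace IsPseudoforest

variable {V : Type*} {F : SimpleGraph V}

theorem induce (hF : IsPseudoforest F) (S : Set V) : IsPseudoforest (F.induce S) := by
  intro u v c d hc hd huv e
  let f : F.induce S →g F := (SimpleGraph.Embedding.induce S).toHom
  have hf : Function.Injective f := Subtype.val_injective
  have key := hF _ _ (c.map f) (d.map f) (hc.map hf) (hd.map hf) (huv.map f) (e.map f)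
  simpa [SimpleGraph.Walk.edges_map, (Sym2.map.injective hf).eq_iff] using key

/-- Two edges outside a spanning forest that lie in the same component are equal. -/
theorem eq_of_not_mem_forest (hF : IsPseudoforest F) {T : SimpleGraph V} (hT : T ≤ F)
    (hr : T.Reachable = F.Reachable) {a b a' b' : V} (h : F.Adj a b) (h' : F.Adj a' b')
    (hn : ¬ T.Adj a b) (hn' : ¬ T.Adj a' b') (haa : F.Reachable a a') : s(a, b) = s(a', b') := by
  classical
  -- The fundamental cycle of an edge outside the spanning forest: that edge is its only edge
  -- outside `T`, so two such cycles with the same edges have the same outside edge.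
  have cyc : ∀ {x y : V} (hxy : F.Adj x y), ¬ T.Adj x y → ∃ c : F.Walk x x, c.IsCycle ∧
      ∀ e, e ∈ c.edges ↔ e = s(x, y) ∨ e ∈ c.edges ∧ e ∈ T.edgeSet := by
    intro x y hxy hTxy
    have : T.Reachable y x := by rw [hr]; exact hxy.symm.reachable
    obtain ⟨p, hp⟩ := this.exists_isPath
    have hed : ∀ e ∈ (p.mapLe hT).edges, e ∈ T.edgeSet := by
      intro e he
      rw [SimpleGraph.Walk.edges_mapLe_eq_edges] at he
      exact p.edges_subset_edgeSet he
    refine ⟨.cons hxy (p.mapLe hT), ?_, ?_⟩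
    · rw [SimpleGraph.Walk.cons_isCycle_iff]
      exact ⟨hp.mapLe hT, fun h => hTxy (hed _ h)⟩
    · intro e
      simp only [SimpleGraph.Walk.edges_cons, List.mem_cons]
      have := hed e
      tauto
  obtain ⟨c, hc, he⟩ := cyc h hn
  obtain ⟨d, hd, he'⟩ := cyc h' hn'
  have h1 : s(a, b) ∈ d.edges := (hF _ _ c d hc hd haa _).1 ((he _).2 (Or.inl rfl))
  rcases (he' _).1 h1 with h2 | h2
  · exact h2
  · exact absurd h2.2 hn

/-- In a rooted spanning forest the edges correspond to the non-root vertices. Each component has at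
most one further edge, by `eq_of_not_mem_forest`, and its root can be charged for it. -/
theorem card_edgeFinset_le [Fintype V] [Fintype F.edgeSet] (hF : IsPseudoforest F) :
    F.edgeFinset.card ≤ Fintype.card V := by
  classical
  obtain ⟨T, hTF, hT, hr⟩ := F.exists_isAcyclic_reachable_eq_le
  let root : V → V := fun v => (T.connectedComponentMk v).out
  have hroot : ∀ v, T.Reachable v (root v) := fun v =>
    (SimpleGraph.ConnectedComponent.eq.1 (T.connectedComponentMk v).out_eq).symm
  have hroot_eq : ∀ {u v}, T.Reachable u v → root u = root v := fun {u v} h => by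
    simp only [root, SimpleGraph.ConnectedComponent.eq.2 h]
  choose p hp using fun v => (hroot v).exists_isPath
  -- A non-root is sent to the first edge of its path to the root, a root to the extra edge of its
  -- component. The loop `s(x, x)` is a dummy value for components that are trees. Only surjectivity
  -- onto the edges matters.
  let g : V → Sym2 V := fun x => if x = root x then
      (if h : ∃ e ∈ F.edgeSet, e ∉ T.edgeSet ∧ ∃ a ∈ e, T.Reachable a x then h.choose else s(x, x))
    else s(x, (p x).snd)
  have hsub : F.edgeFinset ⊆ Finset.univ.image g := by
    intro e he
    rw [SimpleGraph.mem_edgeFinset] at he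
    rw [Finset.mem_image]
    induction e with
    | _ a b =>
    have hab : F.Adj a b := he
    by_cases hTab : T.Adj a b
    · have key : ∀ {u v : V}, T.Adj u v → u ∈ (p v).support → g v = s(v, u) := by
        intro u v huv hu
        have h1 : u = (p v).snd := hT.eq_snd_of_adj_start (hp v) huv.symm hu
        have h2 : v ≠ root v := by
          intro h
          have hnil : ∀ (r : V) (q : T.Walk v r), v = r → q.IsPath → q.support = [v] := by
            rintro r q rfl hq
            rw [(SimpleGraph.Walk.isPath_iff_nil.1 hq).eq_nil]
            rfl
          rw [hnil _ _ h (hp v), List.mem_singleton] at hu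
          exact huv.ne hu
        simp only [g, if_neg h2, ← h1]
      by_cases hb : b ∈ (p a).support
      · exact ⟨a, Finset.mem_univ _, key hTab.symm hb⟩
      · refine ⟨b, Finset.mem_univ _, ?_⟩
        rw [Sym2.eq_swap]
        refine key hTab ?_
        have hre : root a = root b := hroot_eq hTab.reachable
        -- If `b` is not on the path from `a` to the root, then prolonging this path by `b` gives a
        -- path from `b`, which is the chosen one since paths in a forest are unique. So `a` lies on
        -- the path of `b`.
        have hpath : (SimpleGraph.Walk.cons hTab.symm (p a)).IsPath := (hp a).cons hb
        have := (hT.subsingleton_path _ _).elim ⟨_, hpath⟩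
          ⟨(p b).copy rfl hre.symm, by simpa using hp b⟩
        have h2 := congrArg (fun q : T.Path b (root a) => (q : T.Walk b (root a)).support) this
        simp only [SimpleGraph.Walk.support_copy, SimpleGraph.Walk.support_cons] at h2
        rw [← h2]
        simp
    · refine ⟨root a, Finset.mem_univ _, ?_⟩
      have h1 : root a = root (root a) := hroot_eq (hroot a)
      have hex : ∃ e ∈ F.edgeSet, e ∉ T.edgeSet ∧ ∃ x ∈ e, T.Reachable x (root a) :=
        ⟨s(a, b), hab, hTab, a, by simp, hroot a⟩
      have h2 : g (root a) = hex.choose := by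
        simp only [g]
        rw [if_pos h1, dif_pos hex]
      obtain ⟨h3, h4, x, hx, hxr⟩ := hex.choose_spec
      rw [h2]
      obtain ⟨y, hy⟩ := hx
      rw [hy] at h3 h4 ⊢
      refine hF.eq_of_not_mem_forest hTF hr h3 hab h4 hTab ?_
      rw [← hr]
      exact hxr.trans (hroot a).symm
  calc F.edgeFinset.card ≤ (Finset.univ.image g).card := Finset.card_le_card hsub
    _ ≤ Fintype.card V := Finset.card_image_le

end IsPseudoforest

/-! ### Pseudoarboricity bounds the density of subgraphs -/

section Pseudoarboricity

variable {V : Type*} {G : SimpleGraph V}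

/-- Single edges are pseudoforests, having no cycle at all. This makes the set in the definition of
`pseudoarboricity` nonempty, so that its infimum is attained and is not a default value. -/
theorem exists_isPseudoforestPartition [Finite V] (G : SimpleGraph V) :
    ∃ k, ∃ P : Fin k → SimpleGraph V, IsPseudoforestPartition G k P := by
  classical
  have : Fintype V := Fintype.ofFinite V
  let e := (Finset.equivFin G.edgeFinset).symm
  refine ⟨G.edgeFinset.card, fun i => SimpleGraph.fromEdgeSet {(e i : Sym2 V)}, ?_, ?_, ?_⟩
  · ext u v
    simp only [SimpleGraph.iSup_adj, SimpleGraph.fromEdgeSet_adj, Set.mem_singleton_iff]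
    constructor
    · rintro ⟨i, hi, _⟩
      have := (e i).2
      rw [← hi] at this
      simpa using this
    · intro h
      refine ⟨e.symm ⟨s(u, v), by simpa using h⟩, by simp, h.ne⟩
  · intro i j hij
    rw [SimpleGraph.disjoint_left]
    intro u v hu hv
    simp only [SimpleGraph.fromEdgeSet_adj, Set.mem_singleton_iff] at hu hv
    exact hij (e.injective (Subtype.ext (hu.1.symm.trans hv.1)))
  · intro i u v c d hc
    exfalso
    have h3 := hc.three_le_length
    have h1 : c.edges.length ≤ 1 := by
      have hsub : c.edges ⊆ [(e i : Sym2 V)] := by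
        intro x hx
        have := c.edges_subset_edgeSet hx
        simp only [SimpleGraph.edgeSet_fromEdgeSet] at this
        simpa using this.1
      exact (hc.isCircuit.isTrail.edges_nodup.subperm hsub).length_le
    rw [SimpleGraph.Walk.length_edges] at h1
    omega

theorem pseudoarboricity_spec [Finite V] (G : SimpleGraph V) :
    ∃ P : Fin (pseudoarboricity G) → SimpleGraph V,
      IsPseudoforestPartition G (pseudoarboricity G) P :=
  Nat.sInf_mem (s := {k | ∃ P : Fin k → SimpleGraph V, IsPseudoforestPartition G k P})
    (exists_isPseudoforestPartition G)

/-- A set `S` of vertices spans at most `p |S|` edges. -/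
theorem card_le_pseudoarboricity_mul [Fintype V] [DecidableEq V] {S : Finset V}
    {E : Finset (Sym2 V)} (hE : ∀ e ∈ E, e ∈ G.edgeSet) (hS : ∀ e ∈ E, ∀ v ∈ e, v ∈ S) :
    E.card ≤ pseudoarboricity G * S.card := by
  classical
  obtain ⟨P, hP, -, hpf⟩ := pseudoarboricity_spec G
  -- Each class is restricted to `S`, where it is a pseudoforest on `S.card` vertices.
  have hsub : E ⊆ Finset.univ.biUnion fun i =>
      ((P i).induce (S : Set V)).edgeFinset.image (Sym2.map Subtype.val) := by
    intro e he
    rw [Finset.mem_biUnion]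
    have h1 := hE e he
    have h2 := hS e he
    induction e with
    | _ a b =>
    rw [← hP] at h1
    simp only [SimpleGraph.mem_edgeSet, SimpleGraph.iSup_adj] at h1
    obtain ⟨i, hi⟩ := h1
    refine ⟨i, Finset.mem_univ _, Finset.mem_image.2 ⟨s(⟨a, h2 a (by simp)⟩, ⟨b, h2 b (by simp)⟩),
      ?_, rfl⟩⟩
    simpa using hi
  calc E.card ≤ _ := Finset.card_le_card hsub
    _ ≤ ∑ i : Fin (pseudoarboricity G),
        (((P i).induce (S : Set V)).edgeFinset.image (Sym2.map Subtype.val)).card :=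
      Finset.card_biUnion_le
    _ ≤ ∑ _i : Fin (pseudoarboricity G), S.card := by
      refine Finset.sum_le_sum fun i _ => Finset.card_image_le.trans ?_
      have := ((hpf i).induce (S : Set V)).card_edgeFinset_le
      simpa using this
    _ = _ := by simp

theorem pseudoarboricity_pos [Finite V] {a b : V} (h : G.Adj a b) : 0 < pseudoarboricity G := by
  obtain ⟨P, hP, -, -⟩ := pseudoarboricity_spec G
  rw [← hP, SimpleGraph.iSup_adj] at h
  obtain ⟨i, -⟩ := h
  exact Fin.pos i

end Pseudoarboricity

/-! ## The nondeterministic algorithm -/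

namespace Asahiro

variable {V : Type*}

/-- The ends of the remaining edges are distinct remaining vertices. -/
structure Config.Good (c : Config V) : Prop where
  ends : ∀ e ∈ c.edges, ∀ v ∈ e, v ∈ c.verts
  loopless : ∀ e ∈ c.edges, ¬ e.IsDiag

/-! ### Degrees and the density threshold -/

section

variable [DecidableEq V]

theorem sum_wdeg {c : Config V} (hc : c.Good) (w : Sym2 V → ℕ) :
    ∑ v ∈ c.verts, wdeg w c v = 2 * ∑ e ∈ c.edges, w e := by
  simp only [wdeg, Finset.sum_filter]
  rw [Finset.sum_comm, Finset.mul_sum]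
  refine Finset.sum_congr rfl fun e he => ?_
  have h1 := hc.ends e he
  have h2 := hc.loopless e he
  induction e with
  | _ a b =>
  rw [← Finset.sum_filter]
  have : c.verts.filter (fun v => v ∈ s(a, b)) = {a, b} := by
    ext v
    simp only [Finset.mem_filter, Finset.mem_insert, Finset.mem_singleton, Sym2.mem_iff]
    constructor
    · exact fun h => h.2
    · rintro (rfl | rfl)
      · exact ⟨h1 _ (by simp), by simp⟩
      · exact ⟨h1 _ (by simp), by simp⟩
  rw [this, Finset.sum_pair (by simpa using h2)]
  ring

theorem deg_eq_wdeg (c : Config V) (v : V) : deg c v = wdeg (fun _ => 1) c v := by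
  simp [deg, wdeg]

end

/-- The rational threshold as a rounded-down division of natural numbers, which the machine can
perform. -/
theorem ceil_two_mul_density (w : Sym2 V → ℕ) (c : Config V) (h : 0 < c.verts.card) :
    ⌈2 * density w c⌉ =
      (((2 * ∑ e ∈ c.edges, w e) + c.verts.card - 1) / c.verts.card : ℕ) := by
  set N := c.verts.card
  set S := ∑ e ∈ c.edges, w e
  have hd : 2 * density w c = (2 * S : ℕ) / (N : ℚ) := by
    simp only [density, S]
    push_cast
    ring
  have hN : (0 : ℚ) < N := by exact_mod_cast h
  set q := (2 * S + N - 1) / N with hq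
  have h1 : q * N ≤ 2 * S + N - 1 := Nat.div_mul_le_self _ _
  have h2 : 2 * S + N - 1 < (q + 1) * N := by
    have := Nat.lt_div_mul_add (a := 2 * S + N - 1) h
    rw [← hq] at this
    linarith
  rw [hd, Int.ceil_eq_iff]
  constructor
  · rw [lt_div_iff₀ hN]
    have : q * N < 2 * S + N := by omega
    have : (q * N : ℚ) < (2 * S : ℕ) + N := by exact_mod_cast this
    push_cast at this ⊢
    linarith
  · rw [div_le_iff₀ hN]
    have : 2 * S ≤ q * N := by
      have : (q + 1) * N = q * N + N := by ring
      omega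
    exact_mod_cast this

/-- The average weighted degree is `2l ≤ ⌈2l⌉`. If no degree is below `⌈2l⌉`, the differences are
nonnegative with sum at most zero, so all vanish. Hence comparing the minimum degree with the
threshold decides the until-condition. -/
theorem isUniform_of_le [DecidableEq V] {w : Sym2 V → ℕ} {c : Config V} (hc : c.Good)
    (h : ∀ v ∈ c.verts, ⌈2 * density w c⌉ ≤ wdeg w c v) : IsUniform w c := by
  intro v hv
  have hpos : 0 < c.verts.card := Finset.card_pos.2 ⟨v, hv⟩
  have hsum : ∑ v ∈ c.verts, ((wdeg w c v : ℤ) - ⌈2 * density w c⌉) ≤ 0 := by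
    rw [Finset.sum_sub_distrib, Finset.sum_const, nsmul_eq_mul]
    have h1 := sum_wdeg hc w
    have h2 : 2 * density w c ≤ ⌈2 * density w c⌉ := Int.le_ceil _
    have h3 : (c.verts.card : ℚ) * (2 * density w c) = (2 * ∑ e ∈ c.edges, w e : ℕ) := by
      simp only [density]
      have : (c.verts.card : ℚ) ≠ 0 := by exact_mod_cast hpos.ne'
      push_cast
      field_simp
    have h4 : ((2 * ∑ e ∈ c.edges, w e : ℕ) : ℚ) ≤ c.verts.card * ⌈2 * density w c⌉ := by
      rw [← h3]
      exact mul_le_mul_of_nonneg_left h2 (by positivity)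
    have h5 : ((2 * ∑ e ∈ c.edges, w e : ℕ) : ℤ) ≤ c.verts.card * ⌈2 * density w c⌉ := by
      exact_mod_cast h4
    rw [← h1] at h5
    push_cast at h5
    linarith
  have hz := (Finset.sum_eq_zero_iff_of_nonneg (s := c.verts)
    (f := fun v => (wdeg w c v : ℤ) - ⌈2 * density w c⌉)
    (fun u hu => by have := h u hu; omega)).1
    (le_antisymm hsum (Finset.sum_nonneg fun u hu => by have := h u hu; omega)) v hv
  omega

section Loop

variable [Fintype V] [DecidableEq V] {w : Sym2 V → ℕ}

/-- A peeling step belongs to the first run of the inner loop, whichever way the repeat loop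
continues after that run. This lets a run be assembled one absorbed vertex at a time. -/
theorem RepeatLoop.head {l : ℚ} {c d c' : Config V} (h : PeelStep w l c d)
    (h' : RepeatLoop w l d c') : RepeatLoop w l c c' := by
  rcases h' with ⟨hp, hv⟩ | ⟨hp, hv, hu⟩ | ⟨hp, hv, hu, hr⟩
  · exact .ret ⟨hp.1.head h, hp.2⟩ hv
  · exact .until ⟨hp.1.head h, hp.2⟩ hv hu
  · exact .again ⟨hp.1.head h, hp.2⟩ hv hu hr

theorem not_peelStep {l : ℚ} {c : Config V} (h : ∀ v ∈ c.verts, ⌈2 * l⌉ ≤ wdeg w c v) :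
    ¬ ∃ d, PeelStep w l c d := by
  rintro ⟨d, v, hv, hw, -⟩
  have := h v hv
  omega

theorem Config.Good.absorb {c : Config V} (hc : c.Good) (v : V) : (absorb c v).Good := by
  constructor
  · intro e he u hu
    simp only [Asahiro.absorb, Finset.mem_filter, Finset.mem_erase] at he ⊢
    exact ⟨fun h => he.2 (h ▸ hu), hc.ends e he.1 u hu⟩
  · intro e he
    simp only [Asahiro.absorb, Finset.mem_filter] at he
    exact hc.loopless e he.1

end Loop

/-! ### Interleaving the cycle loop and the forest loop -/

section Finish

variable [DecidableEq V]

/-- `E` and `A` are the edges and the arcs of a cycle with edges in `F`. -/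
def IsCyc (F E : Finset (Sym2 V)) (A : Finset (V × V)) : Prop :=
  ∃ (v : V) (z : (SimpleGraph.fromEdgeSet (F : Set (Sym2 V))).Walk v v), z.IsCycle ∧
    E = z.edges.toFinset ∧ A = (z.darts.map fun d => d.toProd).toFinset

theorem cycleStep_iff {c c' : Config V} : CycleStep c c' ↔ ∃ E A, IsCyc c.edges E A ∧
    c' = ⟨c.verts, c.edges \ E, c.arcs ∪ A⟩ := by
  constructor
  · rintro ⟨v, z, hz, rfl⟩
    exact ⟨_, _, ⟨v, z, hz, rfl, rfl⟩, rfl⟩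
  · rintro ⟨_, _, ⟨v, z, hz, rfl, rfl⟩, rfl⟩
    exact ⟨v, z, hz, rfl⟩

theorem IsCyc.mono {F F' E : Finset (Sym2 V)} {A : Finset (V × V)} (h : IsCyc F E A)
    (hF : F ⊆ F') : IsCyc F' E A := by
  obtain ⟨v, z, hz, rfl, rfl⟩ := h
  have hle : SimpleGraph.fromEdgeSet (F : Set (Sym2 V)) ≤
      SimpleGraph.fromEdgeSet (F' : Set (Sym2 V)) :=
    SimpleGraph.fromEdgeSet_mono (by exact_mod_cast hF)
  refine ⟨v, z.mapLe hle, hz.mapLe hle, by rw [SimpleGraph.Walk.edges_mapLe_eq_edges], ?_⟩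
  congr 1
  rw [SimpleGraph.Walk.mapLe, SimpleGraph.Walk.darts_map, List.map_map]
  rfl

theorem IsCyc.subset {F E : Finset (Sym2 V)} {A : Finset (V × V)} (h : IsCyc F E A) : E ⊆ F := by
  obtain ⟨v, z, hz, rfl, rfl⟩ := h
  intro e he
  have := z.edges_subset_edgeSet (List.mem_toFinset.1 he)
  rw [SimpleGraph.edgeSet_fromEdgeSet] at this
  exact_mod_cast this.1

theorem IsCyc.nonempty {F E : Finset (Sym2 V)} {A : Finset (V × V)} (h : IsCyc F E A) :
    E.Nonempty := by
  obtain ⟨v, z, hz, rfl, rfl⟩ := h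
  exact ⟨_, List.mem_toFinset.2 (SimpleGraph.Walk.mk_start_snd_mem_edges hz.not_nil)⟩

/-- The arcs of a cycle enter each vertex at most once, and if so, then there are two edges at it. -/
theorem IsCyc.indeg_le {F E : Finset (Sym2 V)} {A : Finset (V × V)} (h : IsCyc F E A) (v : V) :
    (∀ e ∈ E, v ∉ e) ∧ indeg A v = 0 ∨
      2 ≤ (E.filter fun e => v ∈ e).card ∧ indeg A v ≤ 1 := by
  obtain ⟨u, z, hz, rfl, rfl⟩ := h
  by_cases hv : v ∈ z.support
  · right
    constructor
    · have hr := hz.rotate hv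
      have h1 := SimpleGraph.Walk.mk_start_snd_mem_edges hr.not_nil
      have h2 := SimpleGraph.Walk.mk_penultimate_end_mem_edges hr.not_nil
      have h3 := hr.snd_ne_penultimate
      rw [(z.rotate_edges v hv).mem_iff] at h1 h2
      have hsub : {s(v, (z.rotate v hv).snd), s((z.rotate v hv).penultimate, v)} ⊆
          z.edges.toFinset.filter (fun e => v ∈ e) := by
        intro e he
        simp only [Finset.mem_insert, Finset.mem_singleton] at he
        rcases he with rfl | rfl
        · simp [h1]
        · simp [h2]
      refine le_trans ?_ (Finset.card_le_card hsub)
      rw [Finset.card_pair]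
      rw [Sym2.eq_swap]
      intro h
      exact h3 (Sym2.congr_left.1 h)
    · unfold indeg
      rw [Finset.card_le_one]
      intro a ha b hb
      simp only [Finset.mem_filter, List.mem_toFinset, List.mem_map] at ha hb
      obtain ⟨⟨d, hd, rfl⟩, h1⟩ := ha
      obtain ⟨⟨d', hd', rfl⟩, h2⟩ := hb
      have hnd : (z.darts.map (·.snd)).Nodup := by
        rw [z.map_snd_darts]
        exact hz.support_nodup
      rw [List.inj_on_of_nodup_map hnd hd hd' (h1.trans h2.symm)]
  · left
    constructor
    · intro e he hve
      rw [List.mem_toFinset] at he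
      exact hv (z.mem_support_of_mem_edges he hve)
    · unfold indeg
      rw [Finset.card_eq_zero, Finset.filter_eq_empty_iff]
      intro a ha h
      simp only [List.mem_toFinset, List.mem_map] at ha
      obtain ⟨d, hd, rfl⟩ := ha
      exact hv (h ▸ z.dart_snd_mem_support_of_mem_darts hd)

theorem indeg_union_le (A A' : Finset (V × V)) (v : V) :
    indeg (A ∪ A') v ≤ indeg A v + indeg A' v := by
  unfold indeg
  rw [Finset.filter_union]
  exact Finset.card_union_le _ _

variable [Fintype V]

/-- A cycle uses two edges at each of its vertices, so it misses a vertex of degree at most one: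
forest steps never destroy cycles. -/
theorem cycle_of_forestStep {c d : Config V} (h : ForestStep c d) {E : Finset (Sym2 V)}
    {A : Finset (V × V)} (hE : IsCyc c.edges E A) : ∃ E' A', IsCyc d.edges E' A' := by
  obtain ⟨v, hv, hdeg, rfl⟩ := h
  rcases hE.indeg_le v with h1 | h1
  · obtain ⟨u, z, hz, rfl, rfl⟩ := hE
    have hq : ∀ e ∈ z.edges, e ∈ (SimpleGraph.fromEdgeSet ((absorb c v).edges : Set _)).edgeSet := by
      intro e he
      have h2 := z.edges_subset_edgeSet he
      rw [SimpleGraph.edgeSet_fromEdgeSet] at h2 ⊢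
      refine ⟨?_, h2.2⟩
      simp only [absorb, Finset.coe_filter, Set.mem_ofPred_eq]
      exact ⟨h2.1, h1.1 e (List.mem_toFinset.2 he)⟩
    exact ⟨_, _, u, z.transfer _ hq, hz.transfer hq, rfl, rfl⟩
  · exfalso
    have : (E.filter fun e => v ∈ e).card ≤ deg c v :=
      Finset.card_le_card (Finset.filter_subset_filter _ hE.subset)
    omega

/-- A cycle found after `v` was deleted avoids `v`. Removing it earlier does not touch the edges at
`v`, so the forest step stays available and both orders give the same result. -/
theorem cycleStep_before_forestStep {c d c' : Config V} (h : ForestStep c d) (h' : CycleStep d c') :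
    ∃ b, CycleStep c b ∧ ForestStep b c' := by
  obtain ⟨v, hv, hdeg, rfl⟩ := h
  obtain ⟨E, A, hE, rfl⟩ := cycleStep_iff.1 h'
  have hsub : (absorb c v).edges ⊆ c.edges := Finset.filter_subset _ _
  have hEv : ∀ e ∈ E, v ∉ e := fun e he => (Finset.mem_filter.1 (hE.subset he)).2
  refine ⟨⟨c.verts, c.edges \ E, c.arcs ∪ A⟩, cycleStep_iff.2 ⟨E, A, hE.mono hsub, rfl⟩, v, hv,
    (Finset.card_le_card (Finset.filter_subset_filter _ Finset.sdiff_subset)).trans hdeg, ?_⟩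
  simp only [absorb, Config.mk.injEq, true_and]
  constructor
  · ext e
    simp only [Finset.mem_sdiff, Finset.mem_filter]
    tauto
  · ext a
    simp only [Finset.mem_union, Finset.mem_image, Finset.mem_filter, Finset.mem_univ, true_and,
      Finset.mem_sdiff]
    have : ∀ u, s(u, v) ∉ E := fun u hu => hEv _ hu (by simp)
    simp only [this, not_false_eq_true, and_true]
    exact or_right_comm

/-- One step of the cycle loop or of the forest loop. -/
def FinishStep (c d : Config V) : Prop :=
  CycleStep c d ∨ ForestStep c d

/-- Bubble sort with the exchange of `cycleStep_before_forestStep`. It allows a program to find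
cycles and low-degree vertices in any order, although the procedure exhausts all cycles before it
starts on the forest. -/
theorem cycles_before_forests {c d : Config V} (h : Relation.ReflTransGen FinishStep c d) :
    ∃ b, Relation.ReflTransGen CycleStep c b ∧ Relation.ReflTransGen ForestStep b d := by
  have swap : ∀ {b d d' : Config V}, Relation.ReflTransGen ForestStep b d → CycleStep d d' →
      ∃ b', CycleStep b b' ∧ Relation.ReflTransGen ForestStep b' d' := by
    intro b d d' h1 h2
    induction h1 using Relation.ReflTransGen.head_induction_on with
    | refl => exact ⟨_, h2, .refl⟩
    | head hs _ ih =>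
      obtain ⟨b', h3, h4⟩ := ih
      obtain ⟨b'', h5, h6⟩ := cycleStep_before_forestStep hs h3
      exact ⟨b'', h5, h4.head h6⟩
  induction h with
  | refl => exact ⟨c, .refl, .refl⟩
  | tail _ hs ih =>
    obtain ⟨b, h1, h2⟩ := ih
    rcases hs with hs | hs
    · obtain ⟨b', h3, h4⟩ := swap h2 hs
      exact ⟨b', h1.tail h3, h4⟩
    · exact ⟨b, h1, h2.tail hs⟩

/-- After sorting, the cycle loop must really be finished when the forest loop starts. A cycle left
at that moment would survive all forest steps, but the final graph is empty. -/
theorem finish_cycles {c d : Config V} (h : Relation.ReflTransGen FinishStep c d)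
    (hv : d.verts = ∅) (he : d.edges = ∅) : Finish .cycles c d.arcs := by
  obtain ⟨b, h1, h2⟩ := cycles_before_forests h
  refine ⟨b, d, ⟨h1, ?_⟩, ⟨h2, ?_⟩, rfl⟩
  · rintro ⟨b', hb⟩
    obtain ⟨E, A, hE, -⟩ := cycleStep_iff.1 hb
    have : ∃ E A, IsCyc d.edges E A := by
      clear h1 hb
      induction h2 using Relation.ReflTransGen.head_induction_on generalizing E A with
      | refl => exact ⟨E, A, hE⟩
      | head hs _ ih =>
        obtain ⟨E', A', hE'⟩ := cycle_of_forestStep hs hE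
        exact ih _ _ hE'
    obtain ⟨E, A, hE⟩ := this
    rw [he] at hE
    obtain ⟨e, h⟩ := hE.nonempty
    simpa using hE.subset h
  · rintro ⟨d', v, hv', -⟩
    simp [hv] at hv'

theorem indeg_absorb_self (c : Config V) (v : V) :
    indeg (absorb c v).arcs v ≤ indeg c.arcs v + deg c v := by
  refine (indeg_union_le _ _ _).trans (Nat.add_le_add_left ?_ _)
  refine (Finset.card_filter_le _ _).trans (Finset.card_image_le.trans ?_)
  refine Finset.card_le_card_of_injOn (fun u => s(u, v)) ?_ ?_
  · intro u hu
    simp only [Finset.coe_filter, Finset.mem_univ, true_and, Set.mem_ofPred_eq] at hu ⊢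
    exact ⟨hu, by simp⟩
  · intro u _ u' _ h
    exact Sym2.congr_left.1 h

theorem indeg_absorb_of_ne (c : Config V) {u v : V} (h : u ≠ v) :
    indeg (absorb c v).arcs u = indeg c.arcs u := by
  unfold indeg absorb
  congr 1
  ext a
  simp only [Finset.mem_filter, Finset.mem_union, Finset.mem_image, Finset.mem_univ, true_and]
  constructor
  · rintro ⟨h1 | ⟨x, -, rfl⟩, h2⟩
    · exact ⟨h1, h2⟩
    · exact absurd h2.symm h
  · exact fun h => ⟨Or.inl h.1, h.2⟩

theorem deg_absorb_self (c : Config V) (v : V) : deg (absorb c v) v = 0 := by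
  unfold deg absorb
  rw [Finset.card_eq_zero, Finset.filter_eq_empty_iff]
  intro e he
  exact (Finset.mem_filter.1 he).2

theorem deg_absorb_le (c : Config V) (u v : V) : deg (absorb c v) u ≤ deg c u :=
  Finset.card_le_card (Finset.filter_subset_filter _ (Finset.filter_subset _ _))

/-- In the cycle loop and the forest loop, about half of the edges at a vertex are oriented
towards it. -/
theorem indeg_le_of_finishSteps {c d : Config V} (h : Relation.ReflTransGen FinishStep c d)
    (v : V) : indeg d.arcs v ≤ indeg c.arcs v + (deg c v + 1) / 2 := by
  induction h using Relation.ReflTransGen.head_induction_on with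
  | refl => omega
  | @head a b hs _ ih =>
    rcases hs with hs | ⟨u, -, hdeg, rfl⟩
    · obtain ⟨E, A, hE, rfl⟩ := cycleStep_iff.1 hs
      have h1 := indeg_union_le a.arcs A v
      have h2 : deg (⟨a.verts, a.edges \ E, a.arcs ∪ A⟩ : Config V) v +
          (E.filter fun e => v ∈ e).card = deg a v := by
        unfold deg
        rw [← Finset.card_union_of_disjoint]
        · congr 1
          ext e
          have : e ∈ E → e ∈ a.edges := fun h => hE.subset h
          simp only [Finset.mem_union, Finset.mem_filter, Finset.mem_sdiff]
          tauto
        · rw [Finset.disjoint_left]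
          intro e he he'
          simp only [Finset.mem_filter, Finset.mem_sdiff] at he he'
          exact he.1.2 he'.1
      simp only at ih
      -- A cycle through `v` uses up at least two edges at `v` and adds at most one arc into it; the
      -- rounding up is spent only once, on the edge that a forest step absorbs.
      rcases hE.indeg_le v with h3 | h3 <;> omega
    · by_cases huv : v = u
      · subst huv
        have h1 := indeg_absorb_self a v
        rw [deg_absorb_self] at ih
        omega
      · rw [indeg_absorb_of_ne a huv] at ih
        have := deg_absorb_le a v u
        omega

end Finish

/-! ### Indegrees -/

section Indeg

variable [Fintype V] [DecidableEq V] {G : SimpleGraph V}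

/-- Invariant of the repeat loop on unweighted graphs. -/
structure PeelInv (G : SimpleGraph V) (c : Config V) : Prop where
  good : c.Good
  edges : ∀ e ∈ c.edges, e ∈ G.edgeSet
  alive : ∀ v ∈ c.verts, indeg c.arcs v = 0
  dead : ∀ v ∉ c.verts, (indeg c.arcs v : ℤ) ≤ 2 * pseudoarboricity G - 1

/-- By `card_le_pseudoarboricity_mul` the density of a remaining graph is at most `p`; since `2p` is
an integer, rounding up does no harm. -/
theorem PeelInv.ceil_le {c : Config V} (hc : PeelInv G c) (hne : c.verts ≠ ∅) :
    ⌈2 * density (fun _ => 1) c⌉ ≤ 2 * pseudoarboricity G := by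
  have hpos : 0 < c.verts.card := Finset.card_pos.2 (Finset.nonempty_iff_ne_empty.2 hne)
  have h := card_le_pseudoarboricity_mul hc.edges hc.good.ends
  rw [Int.ceil_le]
  have : density (fun _ => 1) c ≤ pseudoarboricity G := by
    unfold density
    rw [div_le_iff₀ (by exact_mod_cast hpos)]
    simp only [Nat.cast_one, Finset.sum_const, nsmul_eq_mul, mul_one]
    exact_mod_cast h
  push_cast
  linarith

/-- Arcs only enter vertices that have been deleted. So the vertex `v` had indegree zero and now
gets its current degree, at most `⌈2l⌉ - 1 ≤ 2p - 1`, and it never gains an arc afterwards. -/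
theorem PeelInv.step {c d : Config V} {l : ℚ} (hc : PeelInv G c)
    (hl : ⌈2 * l⌉ ≤ 2 * pseudoarboricity G) (h : PeelStep (fun _ => 1) l c d) : PeelInv G d := by
  obtain ⟨v, hv, hd, rfl⟩ := h
  refine ⟨hc.good.absorb v, fun e he => hc.edges e (Finset.mem_filter.1 he).1, ?_, ?_⟩
  · intro u hu
    obtain ⟨h1, h2⟩ := Finset.mem_erase.1 hu
    rw [indeg_absorb_of_ne c h1, hc.alive u h2]
  · intro u hu
    by_cases huv : u = v
    · subst huv
      have h1 := indeg_absorb_self c u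
      rw [hc.alive u hv, deg_eq_wdeg] at h1
      omega
    · rw [indeg_absorb_of_ne c huv]
      exact hc.dead u fun h => hu (Finset.mem_erase.2 ⟨huv, h⟩)

/-- Every new value of `l` is the density of a remaining graph, so `PeelInv.ceil_le` renews the
bound on the threshold in each round. -/
theorem PeelInv.repeatLoop {c d : Config V} {l : ℚ} (hc : PeelInv G c)
    (hl : ⌈2 * l⌉ ≤ 2 * pseudoarboricity G) (h : RepeatLoop (fun _ => 1) l c d) :
    PeelInv G d ∧ (d.verts = ∅ ∨ IsUniform (fun _ => 1) d) := by
  have loop : ∀ {l : ℚ} {c d : Config V}, PeelInv G c → ⌈2 * l⌉ ≤ 2 * pseudoarboricity G →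
      PeelLoop (fun _ => 1) l c d → PeelInv G d := by
    intro l c d hc hl h
    induction h.1 using Relation.ReflTransGen.head_induction_on with
    | refl => exact hc
    | head hs h' ih => exact ih (hc.step hl hs) ⟨h', h.2⟩
  induction' h with l c d hp hv l c d hp hv hu l c d e hp hv _ _ ih
  · exact ⟨loop hc hl hp, Or.inl hv⟩
  · exact ⟨loop hc hl hp, Or.inr hu⟩
  · have := loop hc hl hp
    exact ih this (this.ceil_le hv)

end Indeg

end Asahiro

/-! ## Euler tours of balanced orientations -/

namespace Euler

variable {X : Type*} {G : SimpleGraph X}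

/-- The arcs along which a walk runs. -/
def arcs {u v : X} (p : G.Walk u v) : List (X × X) :=
  p.darts.map fun d => d.toProd

@[simp] theorem arcs_nil {u : X} : arcs (.nil : G.Walk u u) = [] := rfl

@[simp] theorem arcs_cons {u v w : X} (h : G.Adj u v) (p : G.Walk v w) :
    arcs (.cons h p) = (u, v) :: arcs p := rfl

@[simp] theorem arcs_append {u v w : X} (p : G.Walk u v) (q : G.Walk v w) :
    arcs (p.append q) = arcs p ++ arcs q := by
  simp [arcs]

@[simp] theorem arcs_concat {u v w : X} (p : G.Walk u v) (h : G.Adj v w) :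
    arcs (p.concat h) = arcs p ++ [(v, w)] := by
  simp [arcs]

theorem length_arcs {u v : X} (p : G.Walk u v) : (arcs p).length = p.length := by
  simp [arcs]

theorem edges_eq_arcs {u v : X} (p : G.Walk u v) :
    p.edges = (arcs p).map fun a => s(a.1, a.2) := by
  simp only [arcs, SimpleGraph.Walk.edges, List.map_map]
  rfl

theorem mem_support_of_mem_arcs {u v : X} {p : G.Walk u v} {a : X × X} (h : a ∈ arcs p) :
    a.1 ∈ p.support ∧ a.2 ∈ p.support := by
  obtain ⟨d, hd, rfl⟩ := List.mem_map.1 h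
  exact ⟨p.dart_fst_mem_support_of_mem_darts hd, p.dart_snd_mem_support_of_mem_darts hd⟩

variable [DecidableEq X]

/-- The number of arcs in `D` that leave `v`. -/
def outdeg (D : Finset (X × X)) (v : X) : ℕ :=
  (D.filter fun a => a.1 = v).card

/-- A walk leaves each vertex as often as it enters it, up to corrections at its two ends. -/
theorem out_add_eq_in_add {u v : X} (p : G.Walk u v) (x : X) :
    (arcs p).countP (fun a => a.1 = x) + (if v = x then 1 else 0) =
      (arcs p).countP (fun a => a.2 = x) + (if u = x then 1 else 0) := by
  induction p with
  | nil => simp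
  | @cons a b c h p ih =>
    simp only [arcs_cons, List.countP_cons, decide_eq_true_eq]
    omega

/-- A walk that uses arcs in `D`, each at most once. -/
structure IsTrailIn (D : Finset (X × X)) {u v : X} (p : G.Walk u v) : Prop where
  nodup : (arcs p).Nodup
  mem : ∀ a ∈ arcs p, a ∈ D

theorem IsTrailIn.countP_eq {D : Finset (X × X)} {u v : X} {p : G.Walk u v} (hp : IsTrailIn D p)
    (q : X × X → Prop) [DecidablePred q] :
    (arcs p).countP (fun a => q a) + ((D.filter fun a => a ∉ arcs p).filter q).card =
      (D.filter q).card := by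
  have h1 : (arcs p).countP (fun a => q a) = ((arcs p).toFinset.filter q).card := by
    rw [List.countP_eq_length_filter, ← List.toFinset_card_of_nodup (hp.nodup.filter _)]
    congr 1
    ext a
    simp
  rw [h1, ← Finset.card_union_of_disjoint]
  · congr 1
    ext a
    have := hp.mem a
    simp only [Finset.mem_union, Finset.mem_filter, List.mem_toFinset]
    tauto
  · rw [Finset.disjoint_left]
    intro a ha hb
    simp only [Finset.mem_filter, List.mem_toFinset] at ha hb
    exact hb.1.2 ha.1

theorem IsTrailIn.length_le {D : Finset (X × X)} {u v : X} {p : G.Walk u v}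
    (hp : IsTrailIn D p) : p.length ≤ D.card := by
  rw [← length_arcs, ← List.toFinset_card_of_nodup hp.nodup]
  exact Finset.card_le_card fun a ha => hp.mem a (List.mem_toFinset.1 ha)

theorem IsTrailIn.countP_le {D : Finset (X × X)} {u v : X} {p : G.Walk u v} (hp : IsTrailIn D p)
    (q : X × X → Prop) [DecidablePred q] :
    (arcs p).countP (fun a => q a) ≤ (D.filter q).card := by
  have := hp.countP_eq q
  omega

/-- In a balanced set of arcs, a trail can be continued unless it returns to its start. -/
theorem exists_closed_trail {D : Finset (X × X)} (hG : ∀ a ∈ D, G.Adj a.1 a.2)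
    (hbal : ∀ v, indeg D v = outdeg D v) {a : X × X} (ha : a ∈ D) :
    ∃ p : G.Walk a.1 a.1, IsTrailIn D p ∧ 0 < p.length := by
  -- A longest trail from `a.1` is taken. If it ended at another vertex `v`, it would have entered
  -- `v` once more than left it, and balance would supply an unused arc out of `v` to continue.
  let P : ℕ → Prop := fun N => ∃ (v : X) (p : G.Walk a.1 v), IsTrailIn D p ∧ p.length = N
  have hP : P 1 := ⟨a.2, .cons (hG a ha) .nil, ⟨by simp, by simpa using ha⟩, rfl⟩
  have hbd : ∀ N, P N → N ≤ D.card := by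
    rintro N ⟨v, p, hp, rfl⟩
    exact hp.length_le
  classical
  have hmax := Nat.findGreatest_spec (P := P) (hbd 1 hP) hP
  have hge : 1 ≤ Nat.findGreatest P D.card := Nat.le_findGreatest (hbd 1 hP) hP
  obtain ⟨v, p, hp, hlen⟩ := hmax
  by_cases hv : v = a.1
  · subst hv
    exact ⟨p, hp, by omega⟩
  exfalso
  have h1 := out_add_eq_in_add p v
  rw [if_pos rfl, if_neg (fun h => hv h.symm)] at h1
  have h2 := hp.countP_eq (fun b => b.1 = v)
  have h3 := hp.countP_le (fun b => b.2 = v)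
  have h4 := hbal v
  unfold indeg outdeg at h4
  have h5 : 0 < ((D.filter fun b => b ∉ arcs p).filter fun b => b.1 = v).card := by omega
  obtain ⟨b, hb⟩ := Finset.card_pos.1 h5
  simp only [Finset.mem_filter] at hb
  obtain ⟨⟨hbD, hbp⟩, rfl⟩ := hb
  have h6 : P (p.length + 1) := by
    refine ⟨b.2, p.concat (hG b hbD), ⟨?_, ?_⟩, by simp⟩
    · rw [arcs_concat, List.nodup_append]
      refine ⟨hp.nodup, by simp, ?_⟩
      rintro x hx y hy rfl
      simp only [List.mem_singleton] at hy
      rw [hy] at hx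
      exact hbp hx
    · intro x hx
      rw [arcs_concat, List.mem_append, List.mem_singleton] at hx
      rcases hx with hx | rfl
      · exact hp.mem x hx
      · exact hbD
  have := Nat.le_findGreatest (hbd _ h6) h6
  omega

theorem IsTrailIn.remove_balanced {D : Finset (X × X)} (hbal : ∀ v, indeg D v = outdeg D v) {b : X}
    {p : G.Walk b b} (hp : IsTrailIn D p) (v : X) :
    indeg (D.filter fun a => a ∉ arcs p) v = outdeg (D.filter fun a => a ∉ arcs p) v := by
  have h1 := out_add_eq_in_add p v
  have h2 := hp.countP_eq (fun a => a.1 = v)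
  have h3 := hp.countP_eq (fun a => a.2 = v)
  have h4 := hbal v
  unfold indeg outdeg at h4 ⊢
  omega

/-- Every component of a balanced orientation has an Euler tour. -/
theorem exists_euler_tour {D : Finset (X × X)} (hD : IsOrientation G D)
    (hbal : ∀ v, indeg D v = outdeg D v) (C : G.ConnectedComponent) :
    ∃ (b : X) (p : G.Walk b b), G.connectedComponentMk b = C ∧ p.IsTrail ∧ (∀ a ∈ arcs p, a ∈ D) ∧
      ∀ a ∈ D, G.connectedComponentMk a.1 = C → a ∈ arcs p := by
  classical
  -- A longest closed trail in the component, in the manner of Hierholzer; the trivial one shows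
  -- that some exists.
  let P : ℕ → Prop := fun N => ∃ (b : X) (p : G.Walk b b), G.connectedComponentMk b = C ∧
    IsTrailIn D p ∧ p.length = N
  have hP : P 0 := ⟨C.out, .nil, C.out_eq, ⟨by simp, by simp⟩, rfl⟩
  have hbd : ∀ N, P N → N ≤ D.card := by
    rintro N ⟨v, p, -, hp, rfl⟩
    exact hp.length_le
  have hmax := Nat.findGreatest_spec (P := P) (hbd 0 hP) hP
  obtain ⟨b, p, hb, hp, hlen⟩ := hmax
  set D' := D.filter fun a => a ∉ arcs p with hD'
  have hbal' : ∀ v, indeg D' v = outdeg D' v := hp.remove_balanced hbal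
  -- The unused arcs are balanced again. One that starts on the trail therefore lies on a closed
  -- trail of unused arcs, and splicing this in would give a longer trail.
  have hout : ∀ a ∈ D', a.1 ∉ p.support := by
    intro a ha hsup
    obtain ⟨q, hq, hq0⟩ := exists_closed_trail (G := G) (D := D')
      (fun a ha => hD.1 a (Finset.mem_filter.1 ha).1) hbal' ha
    have hrot : List.Perm (arcs (p.rotate a.1 hsup)) (arcs p) :=
      ((p.rotate_darts a.1 hsup).map _).perm
    have h6 : P (p.length + q.length) := by
      refine ⟨a.1, (p.rotate a.1 hsup).append q, ?_, ⟨?_, ?_⟩, by simp⟩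
      · rw [← hb]
        exact SimpleGraph.ConnectedComponent.eq.2 (p.takeUntil a.1 hsup).reachable.symm
      · rw [arcs_append, List.nodup_append]
        refine ⟨hrot.nodup_iff.2 hp.nodup, hq.nodup, ?_⟩
        rintro x hx y hy rfl
        exact (Finset.mem_filter.1 (hq.mem x hy)).2 (hrot.mem_iff.1 hx)
      · intro x hx
        rw [arcs_append, List.mem_append] at hx
        rcases hx with hx | hx
        · exact hp.mem x (hrot.mem_iff.1 hx)
        · exact (Finset.mem_filter.1 (hq.mem x hx)).1
    have := Nat.le_findGreatest (hbd _ h6) h6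
    omega
  have hin : ∀ a ∈ D', a.2 ∉ p.support := by
    intro a ha hsup
    have h1 : 0 < indeg D' a.2 := Finset.card_pos.2 ⟨a, Finset.mem_filter.2 ⟨ha, rfl⟩⟩
    rw [hbal'] at h1
    obtain ⟨x, hx⟩ := Finset.card_pos.1 h1
    obtain ⟨hx1, hx2⟩ := Finset.mem_filter.1 hx
    exact hout x hx1 (hx2 ▸ hsup)
  have hclosed : ∀ x ∈ p.support, ∀ y, G.Adj x y → y ∈ p.support := by
    intro x hx y hxy
    have key : ∀ z : X × X, z ∈ D → z.1 ∈ p.support ∨ z.2 ∈ p.support → z ∈ arcs p := by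
      intro z hz h
      by_contra hn
      have hz' : z ∈ D' := Finset.mem_filter.2 ⟨hz, hn⟩
      rcases h with h | h
      · exact hout z hz' h
      · exact hin z hz' h
    rcases (hD.2 x y hxy).or with h | h
    · exact (mem_support_of_mem_arcs (key _ h (Or.inl hx))).2
    · exact (mem_support_of_mem_arcs (key _ h (Or.inr hx))).1
  -- Distinct arcs lie on distinct edges because an orientation never contains both directions; and
  -- the support is closed under adjacency, so it is the whole component.
  refine ⟨b, p, hb, ⟨?_⟩, hp.mem, ?_⟩
  · rw [edges_eq_arcs]
    refine hp.nodup.map_on fun x hx y hy hxy => ?_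
    rcases x with ⟨x1, x2⟩
    rcases y with ⟨y1, y2⟩
    rw [Sym2.eq_iff] at hxy
    rcases hxy with ⟨h1, h2⟩ | ⟨h1, h2⟩
    · simp only at h1 h2
      rw [h1, h2]
    · simp only at h1 h2
      subst h1 h2
      have hx' := hp.mem _ hx
      have hy' := hp.mem _ hy
      rcases hD.2 _ _ (hD.1 _ hx') with h | h
      · exact absurd hy' h.2
      · exact absurd hx' h.2
  · intro a ha haC
    have hreach : G.Reachable b a.1 := SimpleGraph.ConnectedComponent.eq.1 (hb.trans haC.symm)
    have hmem : a.1 ∈ p.support := by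
      obtain ⟨q⟩ := hreach
      have : ∀ {x y : X}, G.Walk x y → x ∈ p.support → y ∈ p.support := by
        intro x y q
        induction q with
        | nil => exact id
        | cons h _ ih => exact fun hx => ih (hclosed _ hx _ h)
      exact this q p.start_mem_support
    by_contra hn
    exact hout a (Finset.mem_filter.2 ⟨ha, hn⟩) hmem

end Euler

/-! ## The Euler tour variant -/

namespace Asahiro

/-! ### Balanced orientations and the graph with all degrees even -/

section Orientation

variable {X : Type*} [Fintype X] [DecidableEq X] {G : SimpleGraph X}

theorem indeg_add_outdeg {D : Finset (X × X)} (hD : IsOrientation G D) {c : Config X}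
    (hc : ∀ e, e ∈ c.edges ↔ e ∈ G.edgeSet) (x : X) :
    indeg D x + Euler.outdeg D x = deg c x := by
  unfold indeg Euler.outdeg deg
  rw [← Finset.card_union_of_disjoint]
  · refine Finset.card_bij (fun a _ => s(a.1, a.2)) ?_ ?_ ?_
    · intro a ha
      simp only [Finset.mem_union, Finset.mem_filter] at ha
      rw [Finset.mem_filter, hc]
      rcases ha with ha | ha
      · exact ⟨hD.1 a ha.1, by rw [← ha.2]; exact Sym2.mem_mk_right _ _⟩
      · exact ⟨hD.1 a ha.1, by rw [← ha.2]; exact Sym2.mem_mk_left _ _⟩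
    · rintro ⟨a1, a2⟩ ha ⟨b1, b2⟩ hb hab
      simp only [Finset.mem_union, Finset.mem_filter] at ha hb
      have ha' : (a1, a2) ∈ D := by tauto
      have hb' : (b1, b2) ∈ D := by tauto
      rw [Sym2.eq_iff] at hab
      rcases hab with ⟨h1, h2⟩ | ⟨h1, h2⟩
      · simp only at h1 h2
        rw [h1, h2]
      · simp only at h1 h2
        subst h1 h2
        rcases hD.2 _ _ (hD.1 _ ha') with h | h
        · exact absurd hb' h.2
        · exact absurd ha' h.2
    · intro e he
      rw [Finset.mem_filter, hc] at he
      induction e with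
      | _ a b =>
      obtain ⟨h1, h2⟩ := he
      rw [Sym2.mem_iff] at h2
      rcases (hD.2 a b h1).or with h | h
      · refine ⟨(a, b), ?_, rfl⟩
        simp only [Finset.mem_union, Finset.mem_filter, h, true_and]
        tauto
      · refine ⟨(b, a), ?_, Sym2.eq_swap⟩
        simp only [Finset.mem_union, Finset.mem_filter, h, true_and]
        tauto
  · rw [Finset.disjoint_left]
    intro a ha hb
    simp only [Finset.mem_filter] at ha hb
    exact (hD.1 a ha.1).ne (hb.2.trans ha.2.symm)

/-- If at each vertex at most half of the edges are incoming, then exactly half of them are. -/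
theorem balanced_of_indeg_le {D : Finset (X × X)}
    (h : ∀ x, indeg D x ≤ Euler.outdeg D x) (x : X) : indeg D x = Euler.outdeg D x := by
  have h1 : ∑ x, indeg D x = ∑ x, Euler.outdeg D x := by
    unfold indeg Euler.outdeg
    rw [← Finset.card_eq_sum_card_fiberwise (f := fun a : X × X => a.2) (by simp),
      ← Finset.card_eq_sum_card_fiberwise (f := fun a : X × X => a.1) (by simp)]
  exact (Finset.sum_eq_sum_iff_of_le fun x _ => h x).1 h1 x (Finset.mem_univ x)

end Orientation

variable {V : Type*} [Fintype V] [DecidableEq V]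

/-- The configuration for the remaining graph with a new vertex joined to all odd vertices. -/
def evenConfig (c : Config V) : Config (Option V) where
  verts := Finset.insertNone c.verts
  edges := c.edges.image (Sym2.map some) ∪
    (c.verts.filter fun u => Odd (deg c u)).image fun u => s(some u, none)
  arcs := ∅

theorem mem_evenConfig_edges {c : Config V} (hc : c.Good) (e : Sym2 (Option V)) :
    e ∈ (evenConfig c).edges ↔ e ∈ (evenGraph c).edgeSet := by
  unfold evenConfig evenGraph
  rw [SimpleGraph.edgeSet_fromEdgeSet]
  simp only [Finset.mem_union, Finset.mem_image, Finset.mem_filter, Set.mem_sdiff, Set.mem_union]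
  constructor
  · rintro (⟨f, hf, rfl⟩ | ⟨u, hu, rfl⟩)
    · refine ⟨Or.inl ⟨f, hf, rfl⟩, ?_⟩
      intro h
      apply hc.loopless f hf
      induction f with
      | _ a b => simpa using h
    · exact ⟨Or.inr ⟨u, hu.1, hu.2, rfl⟩, by simp⟩
  · rintro ⟨⟨f, hf, rfl⟩ | ⟨u, hu, h, rfl⟩, -⟩
    · exact Or.inl ⟨f, hf, rfl⟩
    · exact Or.inr ⟨u, ⟨hu, h⟩, rfl⟩

theorem evenConfig_good {c : Config V} (hc : c.Good) : (evenConfig c).Good := by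
  constructor
  · intro e he x hx
    simp only [evenConfig, Finset.mem_union, Finset.mem_image, Finset.mem_filter] at he ⊢
    rcases he with ⟨f, hf, rfl⟩ | ⟨u, hu, rfl⟩
    · rw [Sym2.mem_map] at hx
      obtain ⟨y, hy, rfl⟩ := hx
      simpa using hc.ends f hf y hy
    · rw [Sym2.mem_iff] at hx
      rcases hx with rfl | rfl
      · simpa using hu.1
      · simp
  · intro e he
    rw [mem_evenConfig_edges hc] at he
    exact (evenGraph c).not_isDiag_of_mem_edgeSet he

theorem deg_evenConfig_some {c : Config V} (hc : c.Good) (v : V) :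
    deg (evenConfig c) (some v) = deg c v + deg c v % 2 := by
  have hsplit : (evenConfig c).edges.filter (fun e => some v ∈ e) =
      (c.edges.filter fun e => v ∈ e).image (Sym2.map some) ∪
        if Odd (deg c v) then {s(some v, none)} else ∅ := by
    ext e
    simp only [evenConfig, Finset.mem_filter, Finset.mem_union, Finset.mem_image]
    constructor
    · rintro ⟨⟨f, hf, rfl⟩ | ⟨u, hu, rfl⟩, hv⟩
      · rw [Sym2.mem_map] at hv
        obtain ⟨y, hy, h⟩ := hv
        cases h
        exact Or.inl ⟨f, ⟨hf, hy⟩, rfl⟩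
      · simp only [Sym2.mem_iff, Option.some.injEq, reduceCtorEq, or_false] at hv
        subst hv
        right
        simp [hu.2]
    · rintro (⟨f, ⟨hf, hv⟩, rfl⟩ | h)
      · exact ⟨Or.inl ⟨f, hf, rfl⟩, Sym2.mem_map.2 ⟨v, hv, rfl⟩⟩
      · split at h
        · next hodd =>
          rw [Finset.mem_singleton] at h
          subst h
          refine ⟨Or.inr ⟨v, ⟨?_, hodd⟩, rfl⟩, by simp⟩
          have h0 : 0 < deg c v := hodd.pos
          obtain ⟨f, hf⟩ := Finset.card_pos.1 h0
          obtain ⟨hf1, hf2⟩ := Finset.mem_filter.1 hf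
          exact hc.ends f hf1 v hf2
        · simp at h
  unfold deg at hsplit ⊢
  rw [hsplit, Finset.card_union_of_disjoint,
    Finset.card_image_of_injective _ (Sym2.map.injective (Option.some_injective _))]
  · congr 1
    split
    · next h => rw [Nat.odd_iff.1 h]; simp
    · next h => rw [Nat.even_iff.1 (Nat.not_odd_iff_even.1 h)]; simp
  · rw [Finset.disjoint_left]
    intro e he he'
    split at he'
    · rw [Finset.mem_singleton] at he'
      subst he'
      obtain ⟨f, -, hf⟩ := Finset.mem_image.1 he
      have : (none : Option V) ∈ Sym2.map some f := by rw [hf]; simp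
      rw [Sym2.mem_map] at this
      obtain ⟨y, -, hy⟩ := this
      cases hy
    · simp at he'

/-- At an old vertex the extra edge repairs the parity; at the new vertex evenness follows from the
handshake lemma. -/
theorem even_deg_evenConfig {c : Config V} (hc : c.Good) (x : Option V) :
    Even (deg (evenConfig c) x) := by
  have hsome : ∀ v, Even (deg (evenConfig c) (some v)) := by
    intro v
    rw [deg_evenConfig_some hc, Nat.even_iff]
    omega
  cases x with
  | some v => exact hsome v
  | none =>
    have h := sum_wdeg (evenConfig_good hc) (fun _ => 1)
    simp only [← deg_eq_wdeg] at h
    have h2 : (evenConfig c).verts = Finset.insertNone c.verts := rfl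
    rw [h2, Finset.sum_insertNone] at h
    have h3 : Even (∑ v ∈ c.verts, deg (evenConfig c) (some v)) :=
      Finset.even_sum _ fun v _ => hsome v
    have h4 : Even (deg (evenConfig c) none + ∑ v ∈ c.verts, deg (evenConfig c) (some v)) := by
      rw [h]
      exact even_two_mul _
    exact (Nat.even_add.1 h4).2 h3

/-- Orienting the even graph in a balanced way amounts to following Euler tours. -/
theorem eulerFinish {c : Config V} (hc : c.Good) {A : Finset (Option V × Option V)}
    (hA : IsOrientation (evenGraph c) A)
    (hdeg : ∀ x, indeg A x ≤ (deg (evenConfig c) x + 1) / 2) {D : Finset (V × V)}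
    (hD : ∀ a : V × V, a ∈ D ↔ a ∈ c.arcs ∨ (some a.1, some a.2) ∈ A) : EulerFinish c D := by
  -- For an even degree, half rounded up is exactly half, so no indegree exceeds the outdegree; both
  -- have the same sum.
  have hbal : ∀ x, indeg A x = Euler.outdeg A x := by
    refine balanced_of_indeg_le fun x => ?_
    have h1 := indeg_add_outdeg hA (mem_evenConfig_edges hc) x
    have h2 := Nat.even_iff.1 (even_deg_evenConfig hc x)
    have h3 := hdeg x
    omega
  choose base T h1 h2 h3 h4 using Euler.exists_euler_tour hA hbal
  refine ⟨base, T, h1, h2, ?_, ?_⟩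
  · intro e he
    induction e with
    | _ a b =>
    have hmem : ∀ z ∈ A, ∃ C, s(z.1, z.2) ∈ (T C).edges := fun z hz => by
      refine ⟨(evenGraph c).connectedComponentMk z.1, ?_⟩
      rw [Euler.edges_eq_arcs]
      exact List.mem_map_of_mem (h4 _ z hz rfl)
    rcases (hA.2 a b he).or with h | h
    · exact hmem _ h
    · rw [Sym2.eq_swap]
      exact hmem _ h
  · intro a
    rw [hD]
    refine or_congr_right ?_
    constructor
    · intro h
      have := h4 _ _ h rfl
      obtain ⟨d, hd, hd'⟩ := List.mem_map.1 this
      exact ⟨_, d, hd, hd'⟩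
    · rintro ⟨C, d, hd, hd'⟩
      have := h3 C d.toProd (List.mem_map_of_mem hd)
      rwa [hd'] at this

/-- The edge to the new vertex costs nothing in the bound: for `d = deg c v`, half of `d + d % 2`
rounded up equals half of `d` rounded up. -/
theorem indeg_le_of_even {c : Config V} (hc : c.Good) {A : Finset (Option V × Option V)}
    (hdeg : ∀ x, indeg A x ≤ (deg (evenConfig c) x + 1) / 2) {D : Finset (V × V)}
    (hD : ∀ a : V × V, a ∈ D ↔ a ∈ c.arcs ∨ (some a.1, some a.2) ∈ A) (v : V) :
    indeg D v ≤ indeg c.arcs v + (deg c v + 1) / 2 := by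
  have h1 : indeg D v ≤ indeg c.arcs v + indeg A (some v) := by
    have hsub : D.filter (fun a => a.2 = v) ⊆ c.arcs.filter (fun a => a.2 = v) ∪
        (Finset.univ.filter fun a : V × V => (some a.1, some a.2) ∈ A ∧ a.2 = v) := by
      intro a ha
      simp only [Finset.mem_filter, hD, Finset.mem_union, Finset.mem_univ, true_and] at ha ⊢
      tauto
    refine (Finset.card_le_card hsub).trans ((Finset.card_union_le _ _).trans ?_)
    refine Nat.add_le_add_left ?_ _
    refine Finset.card_le_card_of_injOn (fun a => (some a.1, some a.2)) ?_ ?_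
    · intro a ha
      simp only [Finset.coe_filter, Finset.mem_univ, true_and, Set.mem_ofPred_eq] at ha ⊢
      exact ⟨ha.1, by rw [ha.2]⟩
    · rintro ⟨a1, a2⟩ _ ⟨b1, b2⟩ _ h
      simpa using h
  have h2 := hdeg (some v)
  rw [deg_evenConfig_some hc] at h2
  omega

end Asahiro

/-! ## Lists in the rows of an array -/

open RAM HL

/-- Row `v` of the array `arr`, of width `st`, holds the list `L v` of length `cnt v`. -/
structure Rows (st : ℕ) (cnt arr : ℕ → ℕ) (L : ℕ → List ℕ) : Prop where
  len : ∀ v, cnt v = (L v).length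
  get : ∀ v k (h : k < (L v).length), arr (v * st + k) = (L v)[k]
  le : ∀ v, (L v).length ≤ st

theorem row_inj {st a b i j : ℕ} (hi : i < st) (hj : j < st) (h : a * st + i = b * st + j) :
    a = b ∧ i = j := by
  have h1 : (a * st + i) / st = a := by
    rw [Nat.add_comm, Nat.add_mul_div_right _ _ (by omega), Nat.div_eq_of_lt hi, Nat.zero_add]
  have h2 : (b * st + j) / st = b := by
    rw [Nat.add_comm, Nat.add_mul_div_right _ _ (by omega), Nat.div_eq_of_lt hj, Nat.zero_add]
  have : a = b := by rw [← h1, ← h2, h]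
  subst this
  omega

theorem Rows.push {st : ℕ} {cnt arr : ℕ → ℕ} {L : ℕ → List ℕ} (h : Rows st cnt arr L) (a x : ℕ)
    (ha : (L a).length < st) : Rows st (Function.update cnt a (cnt a + 1))
      (Function.update arr (a * st + cnt a) x) (Function.update L a (L a ++ [x])) := by
  constructor
  · intro v
    by_cases hv : v = a
    · subst hv
      simp [h.len]
    · simp [Function.update_of_ne hv, h.len]
  · intro v k hk
    by_cases hv : v = a
    · subst hv
      simp only [Function.update_self, List.length_append, List.length_cons, List.length_nil] at hk
      by_cases hk' : k = cnt v
      · subst hk'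
        simp [h.len]
      · have hlt : k < (L v).length := by rw [h.len] at hk'; omega
        have hne : v * st + k ≠ v * st + cnt v := by omega
        rw [Function.update_of_ne hne]
        simp only [Function.update_self]
        rw [List.getElem_append_left hlt]
        exact h.get v k hlt
    · simp only [Function.update_of_ne hv] at hk ⊢
      rw [Function.update_of_ne]
      · exact h.get v k hk
      · intro he
        have := h.le v
        exact hv (row_inj (by omega) (by rw [h.len]; exact ha) he).1
  · intro v
    by_cases hv : v = a
    · subst hv
      simp
      omega
    · simp [Function.update_of_ne hv, h.le]

theorem Rows.get_of_lt {st : ℕ} {cnt arr : ℕ → ℕ} {L : ℕ → List ℕ} (h : Rows st cnt arr L)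
    {v k : ℕ} (hk : k < cnt v) : ∃ h' : k < (L v).length, arr (v * st + k) = (L v)[k] := by
  have hk' : k < (L v).length := by rw [← h.len]; exact hk
  exact ⟨hk', h.get v k hk'⟩

/-! ## Building the adjacency lists -/

/-- The edges among the first `i` ones that are incident with `v`. -/
def incList (eu ev : ℕ → ℕ) (i v : ℕ) : List ℕ :=
  (List.range i).filter fun j => eu j = v ∨ ev j = v

theorem mem_incList {eu ev : ℕ → ℕ} {i v j : ℕ} :
    j ∈ incList eu ev i v ↔ j < i ∧ (eu j = v ∨ ev j = v) := by
  simp [incList]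

theorem length_incList_le (eu ev : ℕ → ℕ) (i v : ℕ) : (incList eu ev i v).length ≤ i :=
  (List.length_filter_le _ _).trans (by simp)

/-- The nested updates have the shape that two successive applications of `Rows.push` produce. -/
theorem incList_succ {eu ev : ℕ → ℕ} {i : ℕ} (h : eu i ≠ ev i) :
    incList eu ev (i + 1) = Function.update
      (Function.update (incList eu ev i) (eu i) (incList eu ev i (eu i) ++ [i])) (ev i)
      (Function.update (incList eu ev i) (eu i) (incList eu ev i (eu i) ++ [i]) (ev i) ++ [i]) := by
  funext v
  have h1 : incList eu ev (i + 1) v =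
      incList eu ev i v ++ if eu i = v ∨ ev i = v then [i] else [] := by
    simp only [incList, List.range_succ, List.filter_append, List.filter_cons, List.filter_nil]
    simp
  rw [h1]
  by_cases hv : v = ev i
  · subst hv
    simp [Function.update_of_ne h.symm]
  · rw [Function.update_of_ne hv]
    by_cases hu : v = eu i
    · subst hu
      simp
    · rw [Function.update_of_ne hu]
      simp [Ne.symm hu, Ne.symm hv]

theorem sum_length_incList {n m : ℕ} {eu ev : ℕ → ℕ} (hne : ∀ i < m, eu i ≠ ev i) :
    ∑ v ∈ Finset.range n, (incList eu ev m v).length ≤ 2 * m := by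
  induction m with
  | zero => simp [incList]
  | succ m ih =>
    have h1 : ∀ v, (incList eu ev (m + 1) v).length ≤
        (incList eu ev m v).length + ((if v = eu m then 1 else 0) + (if v = ev m then 1 else 0)) := by
      intro v
      simp only [incList, List.range_succ, List.filter_append, List.filter_cons, List.filter_nil,
        List.length_append]
      by_cases h1 : v = eu m
      · have := hne m (by omega)
        subst h1
        simp [this]
      · by_cases h2 : v = ev m
        · subst h2
          simp
        · simp [Ne.symm h1, Ne.symm h2]
    refine (Finset.sum_le_sum fun v _ => h1 v).trans ?_
    rw [Finset.sum_add_distrib, Finset.sum_add_distrib, Finset.sum_ite_eq', Finset.sum_ite_eq']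
    have := ih fun i hi => hne i (by omega)
    split <;> split <;> omega

/-- The total weight of the first `i` edges that satisfy `p`. -/
def wsum (w : ℕ → ℕ) (i : ℕ) (p : ℕ → Prop) [DecidablePred p] : ℕ :=
  ∑ j ∈ Finset.range i, if p j then w j else 0

theorem wsum_le (w : ℕ → ℕ) (i : ℕ) (p : ℕ → Prop) [DecidablePred p] {W : ℕ}
    (hw : ∀ j < i, w j ≤ W) : wsum w i p ≤ i * W := by
  refine (Finset.sum_le_sum (g := fun _ => W) fun j hj => ?_).trans (by simp)
  split
  · exact hw j (Finset.mem_range.1 hj)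
  · omega

/-- Adjacency lists in arrays 4 and 5, weighted degrees in array 6, total weight in register 6. -/
def buildCmd : Cmd :=
  .set 11 (.var 0 ∔ .var 1 ∔ .const 1) ⨾
  .set 2 (.const 0) ⨾
  .set 6 (.const 0) ⨾
  .while (.lt (.var 2) (.var 1))
    (.set 3 (.get 0 (.var 2)) ⨾
     .set 4 (.get 1 (.var 2)) ⨾
     .put 5 (.var 3 ⨰ .var 11 ∔ .get 4 (.var 3)) (.var 2) ⨾
     .put 4 (.var 3) (.get 4 (.var 3) ∔ .const 1) ⨾
     .put 5 (.var 4 ⨰ .var 11 ∔ .get 4 (.var 4)) (.var 2) ⨾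
     .put 4 (.var 4) (.get 4 (.var 4) ∔ .const 1) ⨾
     .put 6 (.var 3) (.get 6 (.var 3) ∔ .get 2 (.var 2)) ⨾
     .put 6 (.var 4) (.get 6 (.var 4) ∔ .get 2 (.var 2)) ⨾
     .set 6 (.var 6 ∔ .get 2 (.var 2)) ⨾
     .set 2 (.var 2 ∔ .const 1))

theorem buildCmd_spec {M n m W : ℕ} {eu ev w : ℕ → ℕ} (hne : ∀ i < m, eu i ≠ ev i)
    (hw : ∀ i < m, w i ≤ W) (hM : n + m + 1 ≤ M) (hM' : m * W ≤ M) {s : Store} {k K : ℕ}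
    (h0 : s.reg 0 = n) (h1 : s.reg 1 = m) (a0 : s.arr 0 = eu) (a1 : s.arr 1 = ev)
    (a2 : s.arr 2 = w) (a4 : s.arr 4 = fun _ => 0) (a6 : s.arr 6 = fun _ => 0)
    (hk : 11 * m + 4 + K ≤ k) :
    Tri M buildCmd s k fun k' s' => K ≤ k' ∧ s'.reg 11 = n + m + 1 ∧
      Rows (n + m + 1) (s'.arr 4) (s'.arr 5) (incList eu ev m) ∧
      (∀ v, s'.arr 6 v = wsum w m fun j => eu j = v ∨ ev j = v) ∧
      s'.reg 6 = wsum w m fun _ => True := by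
  apply Tri.of_wp
  simp only [buildCmd, wp]
  obtain ⟨k, rfl⟩ := Nat.exists_eq_add_of_le' (show 3 ≤ k by omega)
  simp [Op.eval, h0, h1]
  refine ⟨hM, ?_⟩
  refine Tri.while (fun k s => s.reg 1 = m ∧ s.arr 0 = eu ∧ s.arr 1 = ev ∧ s.arr 2 = w ∧
      s.reg 11 = n + m + 1 ∧ s.reg 2 ≤ m ∧ 11 * (m - s.reg 2) + 1 + K ≤ k ∧
      Rows (n + m + 1) (s.arr 4) (s.arr 5) (incList eu ev (s.reg 2)) ∧
      (∀ v, s.arr 6 v = wsum w (s.reg 2) fun j => eu j = v ∨ ev j = v) ∧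
      s.reg 6 = wsum w (s.reg 2) fun _ => True) ?_ ?_ ?_
  · clear! s k
    rintro k s ⟨h1, a0, a1, a2, h11, hi, hk, hr, hd, hs⟩ hc
    simp [h1] at hc
    obtain ⟨k, rfl⟩ := Nat.exists_eq_add_of_le' (show 12 ≤ k by omega)
    refine ⟨by omega, Tri.of_wp ?_⟩
    simp [wp, Op.eval, a0, a1, a2, h11, h1]
    generalize s.reg 2 = i at *
    have hsucc : ∀ (p : ℕ → Prop) [DecidablePred p],
        wsum w (i + 1) p = wsum w i p + if p i then w i else 0 := fun p _ => by
      simp [wsum, Finset.sum_range_succ]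
    -- Sums of weights are not safe values, so they need the explicit bound `M`: at most `i + 1 ≤ m`
    -- weights of size at most `W` are added.
    have hbd : ∀ (p : ℕ → Prop) [DecidablePred p], p i → wsum w i p + w i ≤ M := fun p _ hp => by
      have h := wsum_le w (i + 1) p (W := W) fun j hj => hw j (by omega)
      rw [hsucc, if_pos hp] at h
      exact h.trans ((Nat.mul_le_mul_right W (by omega)).trans hM')
    have hne' := hne i hc
    refine ⟨by rw [hd]; exact hbd _ (Or.inl rfl), ?_, ?_, by omega, by omega, ?_, ?_, ?_⟩
    · rw [Function.update_of_ne hne'.symm, hd]; exact hbd _ (Or.inr rfl)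
    · rw [hs]; exact hbd _ trivial
    · have hl := length_incList_le eu ev i
      have hr1 := hr.push (eu i) i (by have := hl (eu i); omega)
      have hr2 := hr1.push (ev i) i (by
        rw [Function.update_of_ne hne'.symm]
        have := hl (ev i)
        omega)
      rw [incList_succ hne']
      exact hr2
    · intro v
      rw [hsucc]
      by_cases hv : v = ev i
      · subst hv
        simp [hd, Function.update_of_ne hne'.symm]
      · rw [Function.update_of_ne hv]
        by_cases hu : v = eu i
        · subst hu
          simp [hd]
        · rw [Function.update_of_ne hu, hd]
          simp [Ne.symm hu, Ne.symm hv]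
    · rw [hsucc, hs]
      simp
  · clear! s k
    rintro k s ⟨h1, a0, a1, a2, h11, hi, hk, hr, hd, hs⟩ hc
    simp [h1] at hc
    have : s.reg 2 = m := by omega
    rw [this] at hr hs hd
    exact ⟨by omega, by omega, h11, hr, hd, hs⟩
  · simp [h1, a0, a1, a2, a6, a4, wsum]
    refine ⟨by omega, ⟨?_, ?_, ?_⟩⟩ <;> simp [incList]

/-! ## Peeling with a priority queue -/

/-- Specification of a priority queue for the keys in array 6. `Inv S Φ s` says that in `s` the queue
holds the elements of `S`, with potential `Φ`. The command `ext` extracts a minimum into register 10,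
at amortized cost `a₁`; `dec` is run after the key of the element in register 4 has been decreased,
at amortized cost `a₂`, provided that the amount of the decrease satisfies `ok`. -/
structure PQSpec (M a₁ a₂ : ℕ) (ok : ℕ → Prop) (ext dec : Cmd)
    (Inv : Finset ℕ → ℕ → Store → Prop) : Prop where
  congr : ∀ {S Φ s s'}, Inv S Φ s → s'.arr 6 = s.arr 6 →
    (∀ r, r ≤ 1 ∨ 20 ≤ r → s'.reg r = s.reg r) → (∀ A, 20 ≤ A → s'.arr A = s.arr A) → Inv S Φ s'
  ext_spec : ∀ {S Φ s k K}, Inv S Φ s → S.Nonempty → Φ + a₁ + K ≤ k →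
    Tri M ext s k fun k' s' => ∃ Φ', s'.reg 10 ∈ S ∧
      (∀ u ∈ S, s.arr 6 (s'.reg 10) ≤ s.arr 6 u) ∧ Inv (S.erase (s'.reg 10)) Φ' s' ∧ Φ' + K ≤ k'
  dec_spec : ∀ {S Φ s k K u x}, Inv S Φ s → s.reg 4 = u → u ∈ S → x ≤ s.arr 6 u →
    ok (s.arr 6 u - x) → Φ + a₂ + K ≤ k →
    Tri M dec (s.setArr 6 u x) k fun k' s' => ∃ Φ', Inv S Φ' s' ∧ Φ' + K ≤ k'
  ext_regs : ∀ r ∈ ext.regs, r = 10 ∨ 20 ≤ r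
  ext_arrs : ∀ A ∈ ext.arrs, 20 ≤ A
  dec_regs : ∀ r ∈ dec.regs, 20 ≤ r
  dec_arrs : ∀ A ∈ dec.arrs, 20 ≤ A

/-- The state of the peeling phase, with the set `S` of remaining vertices. -/
structure PeelSt (n m : ℕ) (eu ev w : ℕ → ℕ) (S : Finset ℕ) (s : Store) : Prop where
  n_eq : s.reg 0 = n
  m_eq : s.reg 1 = m
  st_eq : s.reg 11 = n + m + 1
  eu_eq : s.arr 0 = eu
  ev_eq : s.arr 1 = ev
  w_eq : s.arr 2 = w
  rows : Rows (n + m + 1) (s.arr 4) (s.arr 5) (incList eu ev m)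
  sub : ∀ v ∈ S, v < n
  dead : ∀ v < n, s.arr 7 v = 0 ↔ v ∈ S
  ends : ∀ i < m, s.arr 8 i = 0 → eu i ∈ S ∧ ev i ∈ S
  key : ∀ u ∈ S, s.arr 6 u = wsum w m fun j => (eu j = u ∨ ev j = u) ∧ s.arr 8 j = 0
  tot : s.reg 6 = wsum w m fun j => s.arr 8 j = 0
  num : s.reg 7 = S.card

theorem PeelSt.congr {n m : ℕ} {eu ev w : ℕ → ℕ} {S : Finset ℕ} {s s' : Store}
    (h : PeelSt n m eu ev w S s)
    (hr : ∀ r ∈ [0, 1, 6, 7, 11], s'.reg r = s.reg r)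
    (ha : ∀ A ∈ [0, 1, 2, 4, 5, 6, 7, 8], s'.arr A = s.arr A) : PeelSt n m eu ev w S s' := by
  simp at hr ha
  obtain ⟨h1, h2, h3, h4, h5, h6, h7, h8, h9, h10, h11, h12, h13⟩ := h
  constructor <;> simp_all

theorem wsum_erase {w : ℕ → ℕ} {m e : ℕ} (p q : ℕ → Prop) [DecidablePred p] [DecidablePred q]
    (he : e < m) (hp : p e) (hq : ∀ j, q j ↔ p j ∧ j ≠ e) : wsum w m q = wsum w m p - w e := by
  have h1 : wsum w m p = wsum w m q + w e := by
    have : w e = ∑ j ∈ Finset.range m, if j = e then w j else 0 := by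
      rw [Finset.sum_ite_eq']
      simp [he]
    rw [this]
    unfold wsum
    rw [← Finset.sum_add_distrib]
    refine Finset.sum_congr rfl fun j _ => ?_
    by_cases hj : j = e
    · subst hj
      simp [hp, hq]
    · simp [hq, hj]
  omega

theorem wsum_congr {w : ℕ → ℕ} {m : ℕ} (p q : ℕ → Prop) [DecidablePred p] [DecidablePred q]
    (h : ∀ j < m, p j ↔ q j) : wsum w m p = wsum w m q := by
  refine Finset.sum_congr rfl fun j hj => ?_
  simp [h j (Finset.mem_range.1 hj)]

theorem le_wsum {w : ℕ → ℕ} {m e : ℕ} (p : ℕ → Prop) [DecidablePred p] (he : e < m) (hp : p e) :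
    w e ≤ wsum w m p := by
  refine le_trans ?_ (Finset.single_le_sum (f := fun j => if p j then w j else 0)
    (fun j _ => Nat.zero_le _) (Finset.mem_range.2 he))
  simp [hp]

/-- Orient all remaining edges at the vertex in register 10 towards it. -/
def absorbCmd (dec : Cmd) : Cmd :=
  .put 7 (.var 10) (.const 1) ⨾
  .set 7 (.var 7 ∸ .const 1) ⨾
  .set 5 (.const 0) ⨾
  .while (.lt (.var 5) (.get 4 (.var 10)))
    (.set 12 (.get 5 (.var 10 ⨰ .var 11 ∔ .var 5)) ⨾
     .set 5 (.var 5 ∔ .const 1) ⨾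
     .ite (.eq (.get 8 (.var 12)) (.const 0))
      (.put 8 (.var 12) (.const 1) ⨾
       .put 3 (.var 12) (.eq (.get 0 (.var 12)) (.var 10)) ⨾
       .set 4 (.get 0 (.var 12) ∔ .get 1 (.var 12) ∸ .var 10) ⨾
       .set 6 (.var 6 ∸ .get 2 (.var 12)) ⨾
       .put 6 (.var 4) (.get 6 (.var 4) ∸ .get 2 (.var 12)) ⨾
       .call dec)
      .skip)

/-- The arrays 8 (edges removed) and 3 (orientation) after absorbing `v`. -/
structure Absorbed (eu ev : ℕ → ℕ) (m v : ℕ) (l : List ℕ) (s s' : Store) : Prop where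
  dead : s'.arr 7 = Function.update (s.arr 7) v 1
  removed : ∀ i, s'.arr 8 i = if i ∈ l ∧ s.arr 8 i = 0 then 1 else s.arr 8 i
  out : ∀ i, s'.arr 3 i =
    if i ∈ l ∧ s.arr 8 i = 0 then (if eu i = v then 1 else 0) else s.arr 3 i

/-- The queue already omits `v` while the edges at `v` are deleted one by one. Deleting an edge
changes the key of its other end only, which is one decrease-key, so each entry of the incidence
list costs `a₂ + 10`. -/
theorem absorbCmd_spec {M n m a₁ a₂ : ℕ} {eu ev w : ℕ → ℕ} {ok : ℕ → Prop} {ext dec : Cmd}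
    {Inv : Finset ℕ → ℕ → Store → Prop} (pq : PQSpec M a₁ a₂ ok ext dec Inv)
    (hne : ∀ i < m, eu i ≠ ev i) (hok : ∀ i < m, ok (w i)) (hM : n ≤ M)
    {S : Finset ℕ} {s : Store} {Φ k K v : ℕ} (hs : PeelSt n m eu ev w S s) (hv : s.reg 10 = v)
    (hvS : v ∈ S) (hI : Inv (S.erase v) Φ s)
    (hk : Φ + (incList eu ev m v).length * (a₂ + 10) + 4 + K ≤ k) :
    Tri M (absorbCmd dec) s k fun k' s' => ∃ Φ', Φ' + K ≤ k' ∧ Inv (S.erase v) Φ' s' ∧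
      PeelSt n m eu ev w (S.erase v) s' ∧ Absorbed eu ev m v (incList eu ev m v) s s' ∧
      s'.reg 8 = s.reg 8 ∧ s'.reg 9 = s.reg 9 := by
  set l := incList eu ev m v with hl
  have hvn := hs.sub v hvS
  apply Tri.of_wp
  simp only [absorbCmd, wp]
  obtain ⟨k, rfl⟩ := Nat.exists_eq_add_of_le' (show 3 ≤ k by omega)
  simp [Op.eval, hv]
  refine Tri.while (fun k s' => ∃ Φ', s'.reg 10 = v ∧ s'.reg 5 ≤ l.length ∧
      Φ' + (l.length - s'.reg 5) * (a₂ + 10) + 1 + K ≤ k ∧ Inv (S.erase v) Φ' s' ∧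
      s'.reg 0 = n ∧ s'.reg 1 = m ∧ s'.reg 11 = n + m + 1 ∧ s'.reg 7 = s.reg 7 - 1 ∧
      s'.reg 8 = s.reg 8 ∧ s'.reg 9 = s.reg 9 ∧ s'.arr 0 = eu ∧ s'.arr 1 = ev ∧ s'.arr 2 = w ∧
      s'.arr 4 = s.arr 4 ∧ s'.arr 5 = s.arr 5 ∧
      (∀ u ∈ S, u ≠ v →
        s'.arr 6 u = wsum w m fun j => (eu j = u ∨ ev j = u) ∧ s'.arr 8 j = 0) ∧
      (s'.reg 6 = wsum w m fun j => s'.arr 8 j = 0) ∧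
      Absorbed eu ev m v (l.take (s'.reg 5)) s s') ?_ ?_ ?_
  · clear hk k hI Φ
    rintro k s' ⟨Φ, h10, h5, hk, hI, h0, h1, h11, h7, h8, h9, a0, a1, a2, a4, a5, key, tot, ab⟩ hc
    simp [h10, a4] at hc
    obtain ⟨hlt, hget⟩ := hs.rows.get_of_lt hc
    have hlt' : s'.reg 5 < l.length := hlt
    have hsub : l.length - s'.reg 5 = (l.length - (s'.reg 5 + 1)) + 1 := by omega
    rw [hsub, Nat.add_mul, Nat.one_mul] at hk
    obtain ⟨k, rfl⟩ := Nat.exists_eq_add_of_le' (show 10 ≤ k by omega)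
    refine ⟨by omega, Tri.of_wp_forall fun R hR => ?_⟩
    set e := l[s'.reg 5] with he
    have hget' : s'.arr 5 (v * (n + m + 1) + s'.reg 5) = e := by rw [a5]; exact hget
    have hel : e ∈ l := List.getElem_mem _
    obtain ⟨hem, hev⟩ := mem_incList.1 (hl ▸ hel)
    have htake : l.take (s'.reg 5 + 1) = l.take (s'.reg 5) ++ [e] := by
      rw [List.take_succ_eq_append_getElem hlt']
    simp [wp, Op.eval, a0, a1, a2, h11, h10, hget']
    constructor
    · intro hdone
      -- An edge still present now was present at the start and is not among the entries already
      -- passed.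
      have hdone0 : s.arr 8 e = 0 ∧ e ∉ l.take (s'.reg 5) := by
        have := ab.removed e
        by_cases hc : e ∈ l.take (s'.reg 5) ∧ s.arr 8 e = 0
        · rw [if_pos hc] at this; omega
        · rw [if_neg hc] at this
          rw [hdone] at this
          exact ⟨this.symm, fun h => hc ⟨h, this.symm⟩⟩
      obtain ⟨e1, e2⟩ := hs.ends e hem hdone0.1
      have hne' := hne e hem
      -- The other end of `e` is the sum of its two ends minus `v`, which spares the program a case
      -- distinction.
      obtain ⟨u, hu, huS, huv, hinc⟩ : ∃ u, eu e + ev e - v = u ∧ u ∈ S ∧ u ≠ v ∧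
          ∀ x, x ≠ v → ((eu e = x ∨ ev e = x) ↔ x = u) := by
        rcases hev with h | h
        · refine ⟨ev e, by omega, e2, by omega, fun x hx => ?_⟩
          constructor
          · rintro (rfl | rfl)
            · exact absurd h hx
            · rfl
          · rintro rfl; simp
        · refine ⟨eu e, by omega, e1, by omega, fun x hx => ?_⟩
          constructor
          · rintro (rfl | rfl)
            · rfl
            · exact absurd h hx
          · rintro rfl; simp
      have hun := hs.sub u huS
      rw [hu]
      refine ⟨by omega, ?_⟩
      have hkey := key u huS huv
      have hwle : w e ≤ s'.arr 6 u := by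
        rw [hkey]
        exact le_wsum _ hem ⟨(hinc u huv).2 rfl, hdone⟩
      refine Tri.framed (pq.dec_spec (Φ := Φ) (K := (l.length - (s'.reg 5 + 1)) * (a₂ + 10) + 1 + K)
        (S := S.erase v)
        ?_ ?_ (Finset.mem_erase.2 ⟨huv, huS⟩) ?_ ?_ ?_) ?_
      · refine pq.congr hI ?_ ?_ ?_
        · simp
        · intro r hr
          simp only [setReg_reg, setArr_reg, setArr_arr, setReg_arr]
          (repeat' split) <;> omega
        · intro A hA
          simp only [setReg_reg, setArr_reg, setArr_arr, setReg_arr]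
          (repeat' split) <;> first | omega | rfl
      · simp
      · simp
      · simp
        rw [Nat.sub_sub_self hwle]
        exact hok e hem
      · omega
      · rintro k' s'' ⟨Φ', hI', hk'⟩ ⟨fr, fa⟩
        have hr : ∀ r < 20, s''.reg r = _ := fun r hr =>
          fr r fun h => by have := pq.dec_regs r h; omega
        have ha : ∀ r < 20, s''.arr r = _ := fun r hr =>
          fa r fun h => by have := pq.dec_arrs r h; omega
        refine hR _ _ ⟨Φ', ?_⟩
        rw [hr 10 (by omega), hr 5 (by omega), hr 0 (by omega), hr 1 (by omega), hr 11 (by omega),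
          hr 7 (by omega), hr 8 (by omega), hr 9 (by omega), hr 6 (by omega), ha 0 (by omega),
          ha 1 (by omega), ha 2 (by omega), ha 4 (by omega), ha 5 (by omega), ha 6 (by omega),
          ha 8 (by omega)]
        simp [h10, h0, h1, h11, h7, h8, h9, a0, a1, a2, a4, a5]
        have hupd : ∀ j, Function.update (s'.arr 8) e 1 j = 0 ↔ s'.arr 8 j = 0 ∧ j ≠ e := by
          intro j
          by_cases hj : j = e
          · subst hj; simp
          · simp [Function.update_of_ne hj, hj]
        refine ⟨hlt', by omega, hI', ?_, ?_, ?_, ?_, ?_⟩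
        · intro x hx hxv
          by_cases hxu : x = u
          · subst hxu
            simp only [Function.update_self]
            rw [hkey]
            refine (wsum_erase _ _ hem ⟨(hinc x hxv).2 rfl, hdone⟩ fun j => ?_).symm
            rw [hupd]
            tauto
          · rw [Function.update_of_ne hxu, key x hx hxv]
            refine wsum_congr _ _ fun j _ => ?_
            rw [hupd]
            constructor
            · rintro ⟨h1, h2⟩
              refine ⟨h1, h2, ?_⟩
              rintro rfl
              exact hxu ((hinc x hxv).1 h1)
            · tauto
        · rw [tot]
          exact (wsum_erase _ _ hem hdone fun j => hupd j).symm
        · rw [ha 7 (by omega)]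
          simp [ab.dead]
        · intro i
          rw [ha 8 (by omega), htake]
          simp only [setArr_arr, setReg_arr]
          by_cases hi : i = e
          · subst hi
            simp [hdone0.1]
          · simp [Function.update_of_ne hi, ab.removed, hi]
        · intro i
          rw [ha 3 (by omega), htake]
          simp only [setArr_arr, setReg_arr]
          by_cases hi : i = e
          · subst hi
            simp [hdone0.1]
          · simp [Function.update_of_ne hi, ab.out, hi]
    · intro hdone
      have hdone0 : ¬ (s.arr 8 e = 0 ∧ e ∉ l.take (s'.reg 5)) := by
        rintro ⟨h1, h2⟩
        have := ab.removed e
        rw [if_neg (fun h => h2 h.1), h1] at this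
        exact hdone this
      have hmem : ∀ i, (i ∈ l.take (s'.reg 5 + 1) ∧ s.arr 8 i = 0) ↔
          (i ∈ l.take (s'.reg 5) ∧ s.arr 8 i = 0) := by
        intro i
        rw [htake, List.mem_append, List.mem_singleton]
        constructor
        · rintro ⟨h | rfl, h2⟩
          · exact ⟨h, h2⟩
          · exact ⟨by tauto, h2⟩
        · tauto
      refine hR _ _ ⟨Φ, ?_⟩
      simp [h10, h0, h1, h11, h7, h8, h9, a0, a1, a2, a4, a5]
      refine ⟨hlt', by omega, ?_, fun u h1 h2 => key u h1 h2, tot, ?_⟩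
      · refine pq.congr hI rfl ?_ ?_
        · intro r hr
          simp only [setReg_reg, setArr_reg, setArr_arr, setReg_arr]
          (repeat' split) <;> omega
        · intro A hA
          simp
      · exact ⟨ab.dead, fun i => by simp only [hmem]; exact ab.removed i,
          fun i => by simp only [hmem]; exact ab.out i⟩
  · clear hk k hI Φ
    rintro k s' ⟨Φ, h10, h5, hk, hI, h0, h1, h11, h7, h8, h9, a0, a1, a2, a4, a5, key, tot, ab⟩ hc
    have hlen : s.arr 4 v = l.length := hs.rows.len v
    simp [h10, a4, hlen] at hc
    have h5' : s'.reg 5 = l.length := by omega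
    rw [h5', List.take_length] at ab
    refine ⟨by omega, Φ, by omega, hI, ⟨h0, h1, h11, a0, a1, a2, ?_, ?_, ?_, ?_, ?_, tot, ?_⟩, ab,
      h8, h9⟩
    · rw [a4, a5]; exact hs.rows
    · intro x hx
      exact hs.sub x (Finset.mem_of_mem_erase hx)
    · intro x hx
      rw [ab.dead, Finset.mem_erase]
      by_cases hxv : x = v
      · subst hxv; simp
      · simp [hxv, hs.dead x hx]
    · intro i hi hd
      have := ab.removed i
      by_cases hc : i ∈ l ∧ s.arr 8 i = 0
      · rw [if_pos hc] at this; omega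
      · rw [if_neg hc, hd] at this
        obtain ⟨h1, h2⟩ := hs.ends i hi this.symm
        have hil : i ∉ l := fun h => hc ⟨h, this.symm⟩
        rw [hl, mem_incList] at hil
        simp only [Finset.mem_erase]
        exact ⟨⟨fun h => hil ⟨hi, Or.inl h⟩, h1⟩, ⟨fun h => hil ⟨hi, Or.inr h⟩, h2⟩⟩
    · intro u hu
      exact key u (Finset.mem_of_mem_erase hu) (Finset.ne_of_mem_erase hu)
    · rw [h7, hs.num, Finset.card_erase_of_mem hvS]
  · refine ⟨Φ, by simp [hv], by simp, ?_, ?_, ?_⟩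
    · simp; omega
    · refine pq.congr hI ?_ ?_ ?_
      · simp
      · intro r hr
        simp only [setReg_reg, setArr_reg, setArr_arr, setReg_arr]
        (repeat' split) <;> omega
      · intro A hA
        simp only [setReg_reg, setArr_reg, setArr_arr, setReg_arr]
        (repeat' split) <;> first | omega | rfl
    · simp [hs.n_eq, hs.m_eq, hs.st_eq, hs.eu_eq, hs.ev_eq, hs.w_eq]
      refine ⟨?_, hs.tot, ?_⟩
      · intro u hu _
        exact hs.key u hu
      · constructor <;> simp

/-! ## The peeling loop -/

open Asahiro

/-! ### Stores as configurations of the algorithm -/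

section Abstraction

/-- The `i`-th edge, directed as the array `out` says. -/
def orient {V : Type*} {m : ℕ} (es : Fin m → V × V) (out : ℕ → ℕ) (i : Fin m) : V × V :=
  if out i = 0 then es i else (es i).swap

theorem arrayOf_fin {m : ℕ} (f : Fin m → ℕ) (i : Fin m) : arrayOf f i = f i := by
  simp [arrayOf]

variable {n m : ℕ} (es : Fin m → Fin n × Fin n)

/-- The first ends of the edges. -/
def tails : ℕ → ℕ := arrayOf fun i => ((es i).1 : ℕ)

/-- The second ends of the edges. -/
def heads : ℕ → ℕ := arrayOf fun i => ((es i).2 : ℕ)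

@[simp] theorem tails_fin (i : Fin m) : tails es i = (es i).1 := arrayOf_fin _ i

@[simp] theorem heads_fin (i : Fin m) : heads es i = (es i).2 := arrayOf_fin _ i

/-- The configuration that a store represents during the peeling phase. -/
def cfgOf (s : Store) : Config (Fin n) where
  verts := Finset.univ.filter fun v => s.arr 7 v = 0
  edges := (Finset.univ.filter fun i : Fin m => s.arr 8 i = 0).image fun i => s((es i).1, (es i).2)
  arcs := (Finset.univ.filter fun i : Fin m => s.arr 8 i ≠ 0).image (orient es (s.arr 3))

variable {es}

theorem mem_cfgOf_edges {s : Store} {e : Sym2 (Fin n)} :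
    e ∈ (cfgOf es s).edges ↔ ∃ i : Fin m, s.arr 8 i = 0 ∧ s((es i).1, (es i).2) = e := by
  simp [cfgOf]

/-- The output entry is set to one exactly when `v` is the first listed end, so in either case the
edge is directed towards `v`. -/
theorem cfgOf_absorb {s s' : Store} {v : Fin n} (hne : ∀ i, (es i).1 ≠ (es i).2)
    (h : Absorbed (tails es) (heads es) m v (incList (tails es) (heads es) m v) s s') :
    cfgOf es s' = absorb (cfgOf es s) v := by
  have hinc : ∀ i : Fin m, (i : ℕ) ∈ incList (tails es) (heads es) m v ↔
      v ∈ s((es i).1, (es i).2) := by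
    intro i
    rw [mem_incList]
    simp [Fin.ext_iff, eq_comm]
  have hrem : ∀ i : Fin m, s'.arr 8 i = 0 ↔ s.arr 8 i = 0 ∧ v ∉ s((es i).1, (es i).2) := by
    intro i
    rw [h.removed]
    simp only [hinc]
    split_ifs with hc
    · simp [hc.1]
    · tauto
  unfold absorb
  rw [cfgOf, Config.mk.injEq]
  refine ⟨?_, ?_, ?_⟩
  · ext u
    simp only [h.dead, Finset.mem_filter, Finset.mem_univ, true_and, Finset.mem_erase, cfgOf]
    by_cases huv : u = v
    · subst huv; simp
    · rw [Function.update_of_ne (fun h => huv (Fin.ext h))]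
      simp [huv]
  · ext e
    simp only [Finset.mem_image, Finset.mem_filter, Finset.mem_univ, true_and, cfgOf, hrem]
    constructor
    · rintro ⟨i, ⟨h1, h2⟩, rfl⟩
      exact ⟨⟨i, h1, rfl⟩, h2⟩
    · rintro ⟨⟨i, h1, rfl⟩, h2⟩
      exact ⟨i, ⟨h1, h2⟩, rfl⟩
  · ext a
    simp only [Finset.mem_union, Finset.mem_image, Finset.mem_filter, Finset.mem_univ, true_and,
      cfgOf, ne_eq, hrem]
    constructor
    · rintro ⟨i, hi, rfl⟩
      by_cases hd : s.arr 8 i = 0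
      · right
        have hv : v ∈ s((es i).1, (es i).2) := by tauto
        have hout : s'.arr 3 i = if tails es i = v then 1 else 0 := by
          rw [h.out, if_pos ⟨(hinc i).2 hv, hd⟩]
        rw [Sym2.mem_iff] at hv
        rw [tails_fin] at hout
        unfold orient
        rcases hv with hv | hv
        · refine ⟨(es i).2, ⟨i, hd, ?_⟩, ?_⟩
          · rw [hv]; exact Sym2.eq_swap
          · rw [if_pos (by rw [hv])] at hout
            simp [hout, Prod.swap, hv]
        · have h1 : ((es i).1 : ℕ) ≠ v := by
            rw [hv]
            exact fun h => hne i (Fin.ext h)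
          refine ⟨(es i).1, ⟨i, hd, by rw [hv]⟩, ?_⟩
          rw [if_neg h1] at hout
          simp [hout, hv]
      · left
        have hout : s'.arr 3 i = s.arr 3 i := by rw [h.out, if_neg (fun hc => hd hc.2)]
        exact ⟨i, hd, by unfold orient; rw [hout]⟩
    · rintro (⟨i, hi, rfl⟩ | ⟨u, ⟨i, hi, hu⟩, rfl⟩)
      · have hout : s'.arr 3 i = s.arr 3 i := by rw [h.out, if_neg (fun hc => hi hc.2)]
        exact ⟨i, fun hc => hi hc.1, by unfold orient; rw [hout]⟩
      · have hv : v ∈ s((es i).1, (es i).2) := by rw [hu]; simp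
        refine ⟨i, fun hc => hc.2 hv, ?_⟩
        have hout : s'.arr 3 i = if ((es i).1 : ℕ) = v then 1 else 0 := by
          rw [h.out, if_pos ⟨(hinc i).2 hv, hi⟩, tails_fin]
        unfold orient
        have h1 := hne i
        rw [Sym2.eq_iff] at hu
        rcases hu with ⟨hu1, hu2⟩ | ⟨hu1, hu2⟩
        · rw [if_neg (fun h => h1 (by rw [hu2]; exact Fin.ext h))] at hout
          rw [hout, if_pos rfl]
          exact Prod.ext hu1 hu2
        · rw [if_pos (by rw [hu1])] at hout
          simp [hout, Prod.swap, hu1, hu2]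

theorem cfgOf_congr {s s' : Store} (h3 : s'.arr 3 = s.arr 3) (h7 : s'.arr 7 = s.arr 7)
    (h8 : s'.arr 8 = s.arr 8) : cfgOf es s' = cfgOf es s := by
  unfold cfgOf
  rw [h3, h7, h8]

theorem wdeg_cfgOf {s : Store} {w : Sym2 (Fin n) → ℕ} {wN : ℕ → ℕ}
    (hinj : Function.Injective fun i => s((es i).1, (es i).2))
    (hw : ∀ i : Fin m, wN i = w s((es i).1, (es i).2)) (v : Fin n) :
    wdeg w (cfgOf es s) v =
      wsum wN m fun j => (tails es j = v ∨ heads es j = v) ∧ s.arr 8 j = 0 := by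
  unfold wdeg wsum cfgOf
  rw [Finset.sum_range, Finset.sum_filter, Finset.sum_image (fun i _ j _ h => hinj h),
    Finset.sum_filter]
  refine Finset.sum_congr rfl fun i _ => ?_
  simp only [tails_fin, heads_fin, hw, Sym2.mem_iff]
  have h1 : (((es i).1 : ℕ) = v ∨ ((es i).2 : ℕ) = v) ↔ (v = (es i).1 ∨ v = (es i).2) := by
    simp [Fin.ext_iff, eq_comm]
  simp only [h1]
  split_ifs <;> first | rfl | tauto

theorem sum_cfgOf {s : Store} {w : Sym2 (Fin n) → ℕ} {wN : ℕ → ℕ}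
    (hinj : Function.Injective fun i => s((es i).1, (es i).2))
    (hw : ∀ i : Fin m, wN i = w s((es i).1, (es i).2)) :
    ∑ e ∈ (cfgOf es s).edges, w e = wsum wN m fun j => s.arr 8 j = 0 := by
  unfold wsum cfgOf
  rw [Finset.sum_range, Finset.sum_image (fun i _ j _ h => hinj h), Finset.sum_filter]
  refine Finset.sum_congr rfl fun i _ => ?_
  rw [hw]

end Abstraction

/-! ### The peeling program follows the repeat-until loop -/

variable {n m : ℕ} {es : Fin m → Fin n × Fin n}

theorem PeelSt.mem_verts {wN : ℕ → ℕ} {S : Finset ℕ} {s : Store}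
    (h : PeelSt n m (tails es) (heads es) wN S s) (v : Fin n) :
    v ∈ (cfgOf es s).verts ↔ (v : ℕ) ∈ S := by
  simp [cfgOf, h.dead v v.2]

theorem PeelSt.card_verts {wN : ℕ → ℕ} {S : Finset ℕ} {s : Store}
    (h : PeelSt n m (tails es) (heads es) wN S s) : (cfgOf es s).verts.card = S.card := by
  refine Finset.card_bij (fun v _ => (v : ℕ)) (fun v hv => (h.mem_verts v).1 hv)
    (fun u _ v _ h => Fin.ext h) fun v hv => ?_
  exact ⟨⟨v, h.sub v hv⟩, (h.mem_verts _).2 hv, rfl⟩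

theorem PeelSt.good {wN : ℕ → ℕ} {S : Finset ℕ} {s : Store}
    (h : PeelSt n m (tails es) (heads es) wN S s) (hne : ∀ i, (es i).1 ≠ (es i).2) :
    (cfgOf es s).Good := by
  constructor
  · intro e he v hv
    obtain ⟨i, hi, rfl⟩ := mem_cfgOf_edges.1 he
    have h1 := h.ends i i.2 hi
    rw [tails_fin, heads_fin] at h1
    rw [h.mem_verts]
    rw [Sym2.mem_iff] at hv
    rcases hv with rfl | rfl
    · exact h1.1
    · exact h1.2
  · intro e he
    obtain ⟨i, hi, rfl⟩ := mem_cfgOf_edges.1 he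
    simpa using hne i

/-- The number `⌈2 w(E) / |V|⌉`, for the total weight in register 6 and the number of vertices in
register 7. -/
def thresholdExpr : Expr :=
  (.var 6 ∔ .var 6 ∔ .var 7 ∸ .const 1) ⨸ .var 7

/-- The repeat-until loop. -/
def peelCmd (ext dec : Cmd) : Cmd :=
  .set 7 (.var 0) ⨾
  .set 8 thresholdExpr ⨾
  .set 9 (.const 1) ⨾
  .while (.var 9)
    (.ite (.eq (.var 7) (.const 0)) (.set 9 (.const 0))
      (.call ext ⨾
       .ite (.lt (.get 6 (.var 10)) (.var 8)) .skip (.set 8 thresholdExpr) ⨾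
       .ite (.lt (.get 6 (.var 10)) (.var 8)) (.call (absorbCmd dec)) (.set 9 (.const 0))))

/-- Each extraction either absorbs a vertex or ends the loop. A minimum that reaches the old
threshold proves the inner loop complete. If it lies below the recomputed one, the graph is not
uniform and another round begins with this same vertex; otherwise all degrees reach the threshold
and `isUniform_of_le` applies. -/
theorem peelCmd_spec {M W a₁ a₂ : ℕ} {w : Sym2 (Fin n) → ℕ} {wN : ℕ → ℕ} {ok : ℕ → Prop}
    {ext dec : Cmd} {Inv : Finset ℕ → ℕ → Store → Prop} (pq : PQSpec M a₁ a₂ ok ext dec Inv)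
    (hinj : Function.Injective fun i => s((es i).1, (es i).2)) (hne : ∀ i, (es i).1 ≠ (es i).2)
    (hw : ∀ i : Fin m, wN i = w s((es i).1, (es i).2)) (hW : ∀ i < m, wN i ≤ W)
    (hok : ∀ i < m, ok (wN i)) (hM : 2 * (m * W) + n ≤ M) (hn : 0 < n)
    {s : Store} {Φ k K : ℕ}
    (hs : PeelSt n m (tails es) (heads es) wN (Finset.range n) (s.setReg 7 n))
    (hI : Inv (Finset.range n) Φ s)
    (hk : Φ + ∑ v ∈ Finset.range n,
      ((incList (tails es) (heads es) m v).length * (a₂ + 10) + (a₁ + 12)) + 8 + K ≤ k) :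
    Tri M (peelCmd ext dec) s k fun k' s' => K ≤ k' ∧
      (∃ S, PeelSt n m (tails es) (heads es) wN S s') ∧
      RepeatLoop w (density w (cfgOf es s)) (cfgOf es s) (cfgOf es s') := by
  set L := incList (tails es) (heads es) m with hL
  set c₀ := cfgOf es s with hc₀
  have hneN : ∀ i < m, tails es i ≠ heads es i := by
    intro i hi
    have := hne ⟨i, hi⟩
    have h1 := tails_fin es ⟨i, hi⟩
    have h2 := heads_fin es ⟨i, hi⟩
    simp only at h1 h2
    rw [h1, h2]
    exact fun h => this (Fin.ext h)
  have hceil : ∀ {S : Finset ℕ} {s : Store}, PeelSt n m (tails es) (heads es) wN S s →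
      0 < S.card → ((s.reg 6 + s.reg 6 + s.reg 7 - 1) / s.reg 7 ≤ M) ∧
      (((s.reg 6 + s.reg 6 + s.reg 7 - 1) / s.reg 7 : ℕ) : ℤ) =
        ⌈2 * density w (cfgOf es s)⌉ := by
    intro S s hs hS
    constructor
    · refine (Nat.div_le_self _ _).trans ?_
      have h1 : s.reg 6 ≤ m * W := by rw [hs.tot]; exact wsum_le _ _ _ hW
      have h2 : s.reg 7 ≤ n := by
        rw [hs.num]
        refine (Finset.card_le_card (t := Finset.range n) fun v hv => ?_).trans (by simp)
        exact Finset.mem_range.2 (hs.sub v hv)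
      omega
    · rw [ceil_two_mul_density _ _ (by rw [hs.card_verts]; exact hS), hs.card_verts,
        sum_cfgOf hinj hw, hs.num, hs.tot, two_mul]
  apply Tri.of_wp
  simp only [peelCmd, wp]
  obtain ⟨k, rfl⟩ := Nat.exists_eq_add_of_le' (show 3 ≤ k by omega)
  have h0 : s.reg 0 = n := by simpa using hs.n_eq
  have hc0 := hceil hs (by simpa using hn)
  simp only [setReg_reg, if_true, if_false, Nat.reduceEqDiff] at hc0
  simp [Op.eval, thresholdExpr, h0]
  refine ⟨hc0.1, ?_⟩
  -- A run of `RepeatLoop` is built from its end, so the invariant is stated with a continuation: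
  -- every completion from the present configuration completes a run from the start. Register 8
  -- holds only `⌈2l⌉`, hence `l` is quantified existentially.
  refine Tri.while (fun k s => ∃ S Φ, PeelSt n m (tails es) (heads es) wN S s ∧
    ((s.reg 9 ≠ 0 ∧ Inv S Φ s ∧
        Φ + ∑ v ∈ S, ((L v).length * (a₂ + 10) + (a₁ + 12)) + 5 + K ≤ k ∧
        ∃ l, (s.reg 8 : ℤ) = ⌈2 * l⌉ ∧
          ∀ c, RepeatLoop w l (cfgOf es s) c → RepeatLoop w (density w c₀) c₀ c) ∨
      (s.reg 9 = 0 ∧ 1 + K ≤ k ∧ RepeatLoop w (density w c₀) c₀ (cfgOf es s)))) ?_ ?_ ?_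
  · clear hk hI hc0 hs h0
    rintro k s ⟨S, Φ, hs, ⟨h9, hI, hk, l, hl, hrep⟩ | ⟨h9, -⟩⟩ hc
    swap
    · simp [h9] at hc
    obtain ⟨k, rfl⟩ := Nat.exists_eq_add_of_le' (show 3 ≤ k by omega)
    refine ⟨by omega, Tri.of_wp_forall fun R hR => ?_⟩
    simp only [wp, ne_eq, eval_lt_eq_zero, eval_eq_eq_zero, not_not]
    simp [Op.eval, thresholdExpr]
    constructor
    · intro h7
      refine hR _ _ ⟨S, Φ, hs.congr (by simp) (by simp), Or.inr ⟨by simp, by omega, ?_⟩⟩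
      rw [cfgOf_congr (s := s) (by simp) (by simp) (by simp)]
      have hemp : (cfgOf es s).verts = ∅ := by
        rw [← Finset.card_eq_zero, hs.card_verts, ← hs.num, h7]
      exact hrep _ (.ret ⟨.refl, not_peelStep (by simp [hemp])⟩ hemp)
    · intro h7
      have hcard : 0 < S.card := by rw [← hs.num]; omega
      have hSne : S.Nonempty := Finset.card_pos.1 hcard
      -- The cost of one extraction is due before it is known which vertex comes out, so the summand
      -- `a₁` is separated from the cost that depends on the vertex.
      have hsplit : ∀ T : Finset ℕ, ∑ v ∈ T, ((L v).length * (a₂ + 10) + (a₁ + 12)) =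
          ∑ v ∈ T, ((L v).length * (a₂ + 10) + 12) + a₁ * T.card := by
        intro T
        simp only [Finset.sum_add_distrib, Finset.sum_const, smul_eq_mul]
        ring
      rw [hsplit] at hk
      refine Tri.framed (pq.ext_spec
        (K := ∑ v ∈ S, ((L v).length * (a₂ + 10) + 12) + a₁ * (S.card - 1) + 3 + K) hI hSne ?_) ?_
      · have : a₁ * S.card = a₁ * (S.card - 1) + a₁ := by
          rw [← Nat.mul_succ]; congr 1; omega
        omega
      rintro k' s₁ ⟨Φ', hvS, hmin, hI', hk'⟩ ⟨fr, fa⟩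
      have hr : ∀ r < 20, r ≠ 10 → s₁.reg r = s.reg r := fun r hr hr' =>
        fr r fun h => by have := pq.ext_regs r h; omega
      have ha : ∀ A < 20, s₁.arr A = s.arr A := fun r hr =>
        fa r fun h => by have := pq.ext_arrs r h; omega
      have hs₁ : PeelSt n m (tails es) (heads es) wN S s₁ :=
        hs.congr (by simp [hr]) (by simp [ha])
      have hcfg : cfgOf es s₁ = cfgOf es s :=
        cfgOf_congr (ha 3 (by omega)) (ha 7 (by omega)) (ha 8 (by omega))
      rw [← hcfg] at hrep
      rw [← hr 8 (by omega) (by omega)] at hl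
      rw [← ha 6 (by omega)] at hmin
      set v := s₁.reg 10 with hv
      have hvn : v < n := hs.sub v hvS
      have hdeg : ∀ u (hu : u < n), u ∈ S → s₁.arr 6 u = wdeg w (cfgOf es s₁) ⟨u, hu⟩ := by
        intro u hu huS
        rw [wdeg_cfgOf hinj hw, hs₁.key u huS]
      -- absorbing `v` for a threshold that exceeds its degree
      have main : ∀ (l' : ℚ) (s₂ : Store) (k₂ : ℕ), cfgOf es s₂ = cfgOf es s₁ → s₂.reg 10 = v →
          Inv (S.erase v) Φ' s₂ → PeelSt n m (tails es) (heads es) wN S s₂ →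
          (s₂.reg 8 : ℤ) = ⌈2 * l'⌉ → s₁.arr 6 v < s₂.reg 8 → s₂.reg 9 ≠ 0 → k' ≤ k₂ + 3 →
          (∀ c, RepeatLoop w l' (cfgOf es s₁) c → RepeatLoop w (density w c₀) c₀ c) →
          Tri M (absorbCmd dec) s₂ k₂ R := by
        intro l' s₂ k₂ hcfg₂ hv₂ hI₂ hs₂ hl₂ hlt h9₂ hk₂ hrep₂
        have hsum := Finset.add_sum_erase S (fun v => (L v).length * (a₂ + 10) + 12) hvS
        refine (absorbCmd_spec pq hneN hok (by omega) hs₂ hv₂ hvS hI₂ (K := 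
          ∑ v ∈ S.erase v, ((L v).length * (a₂ + 10) + (a₁ + 12)) + 5 + K) ?_).mono ?_
        · rw [hsplit, Finset.card_erase_of_mem hvS, ← hL]
          omega
        · rintro k₃ s₃ ⟨Φ₃, hk₃, hI₃, hs₃, hab, h8, h9'⟩
          refine hR _ _ ⟨S.erase v, Φ₃, hs₃, Or.inl ⟨by rw [h9']; exact h9₂, hI₃, by omega, l',
            by rw [h8]; exact hl₂, fun c hc => hrep₂ c ?_⟩⟩
          refine RepeatLoop.head ⟨⟨v, hvn⟩, (hs₁.mem_verts _).2 hvS, ?_, rfl⟩ ?_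
          · rw [← hdeg v hvn hvS, ← hl₂]
            omega
          · rw [← hcfg₂, ← cfgOf_absorb (v := ⟨v, hvn⟩) hne hab]
            exact hc
      have h91 : s₁.reg 9 ≠ 0 := by rw [hr 9 (by omega) (by omega)]; exact h9
      obtain ⟨k', rfl⟩ := Nat.exists_eq_add_of_le' (show 3 ≤ k' by omega)
      simp [wp, Op.eval]
      constructor
      · intro hlt
        simp [hlt]
        exact main l s₁ k' rfl rfl hI' hs₁ hl hlt h91 (by omega) hrep
      · intro hge
        obtain ⟨hc1, hc2⟩ := hceil hs₁ hcard
        refine ⟨hc1, ?_⟩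
        set tau := (s₁.reg 6 + s₁.reg 6 + s₁.reg 7 - 1) / s₁.reg 7 with htau
        -- Since the extracted key is minimal, no vertex is below the old threshold: the inner loop
        -- stops here without a further step.
        have hpl : PeelLoop w l (cfgOf es s₁) (cfgOf es s₁) := by
          refine ⟨.refl, not_peelStep fun u hu => ?_⟩
          rw [← hdeg u u.2 ((hs₁.mem_verts u).1 hu), ← hl]
          have := hmin u ((hs₁.mem_verts u).1 hu)
          omega
        have hne' : (cfgOf es s₁).verts ≠ ∅ := by
          rw [← Finset.card_pos.trans Finset.nonempty_iff_ne_empty, hs₁.card_verts]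
          exact hcard
        have hs₂ : PeelSt n m (tails es) (heads es) wN S (s₁.setReg 8 tau) :=
          hs₁.congr (by simp) (by simp)
        constructor
        · intro hlt
          refine main (density w (cfgOf es s₁)) _ k' (cfgOf_congr rfl rfl rfl) (by simp [hv]) ?_
            hs₂ (by simpa using hc2) (by simpa using hlt) (by simpa using h91) (by omega) ?_
          · refine pq.congr hI' rfl ?_ (fun _ _ => rfl)
            intro r hr
            simp only [setReg_reg]
            (repeat' split) <;> omega
          · intro c hc
            -- The vertex `v` has degree below the new threshold, which refutes uniformity and makes
            -- `v` the first vertex of the next inner loop.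
            refine hrep c (.again hpl hne' ?_ hc)
            intro hu
            have := hu ⟨v, hvn⟩ ((hs₁.mem_verts _).2 hvS)
            rw [← hdeg v hvn hvS, ← hc2] at this
            omega
        · intro hge'
          have hsum := Finset.add_sum_erase S (fun v => (L v).length * (a₂ + 10) + 12) hvS
          refine ⟨by omega, hR _ _ ⟨S, Φ, hs₁.congr ?_ ?_, Or.inr ⟨?_, ?_, ?_⟩⟩⟩
          · simp
          · simp
          · simp
          · omega
          rw [show cfgOf es ((s₁.setReg 8 tau).setReg 9 0) = cfgOf es s₁ from
            cfgOf_congr rfl rfl rfl]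
          -- The extracted vertex has left the queue but not the graph, and the queue is not used
          -- any more.
          refine hrep _ (.until hpl hne' (isUniform_of_le (hs₁.good hne) fun u hu => ?_))
          rw [← hdeg u u.2 ((hs₁.mem_verts u).1 hu), ← hc2]
          have := hmin u ((hs₁.mem_verts u).1 hu)
          omega
  · rintro k s ⟨S, Φ, hs, ⟨h9, -⟩ | ⟨h9, hk, hrep⟩⟩ hc
    · simp at hc
      exact absurd hc h9
    · exact ⟨by omega, by omega, ⟨S, hs⟩, hrep⟩
  · refine ⟨Finset.range n, Φ, hs.congr ?_ ?_, Or.inl ⟨by simp, ?_, by omega, density w c₀, ?_, ?_⟩⟩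
    · simp
    · simp
    · refine pq.congr hI rfl ?_ (fun _ _ => rfl)
      intro r hr
      simp only [setReg_reg]
      (repeat' split) <;> omega
    · simp only [setReg_reg, if_true, if_false, Nat.reduceEqDiff]
      exact hc0.2
    · intro c hc
      exact hc

/-! ## Buckets as a priority queue for unit decreases -/

theorem Rows.pop {st : ℕ} {cnt arr : ℕ → ℕ} {L : ℕ → List ℕ} (h : Rows st cnt arr L) {a : ℕ}
    (ha : cnt a ≠ 0) : ∃ l x, L a = l ++ [x] ∧ arr (a * st + (cnt a - 1)) = x ∧
      Rows st (Function.update cnt a (cnt a - 1)) arr (Function.update L a l) := by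
  have hlen := h.len a
  have hne : L a ≠ [] := fun h' => ha (by rw [hlen, h']; rfl)
  have hl : (L a).dropLast.length = cnt a - 1 := by simp [hlen]
  refine ⟨(L a).dropLast, (L a).getLast hne, (List.dropLast_append_getLast hne).symm, ?_, ?_⟩
  · rw [List.getLast_eq_getElem hne, h.get a _ (by omega)]
    congr 1
    omega
  · constructor
    · intro v
      by_cases hv : v = a
      · subst hv; simp [hlen]
      · simp [Function.update_of_ne hv, h.len]
    · intro v k hk
      by_cases hv : v = a
      · subst hv
        simp only [Function.update_self] at hk ⊢
        rw [List.getElem_dropLast]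
        exact h.get _ _ _
      · simp only [Function.update_of_ne hv] at hk ⊢
        exact h.get v k hk
    · intro v
      have := h.le v
      by_cases hv : v = a
      · subst hv
        simp only [Function.update_self]
        omega
      · simpa [Function.update_of_ne hv] using this

/-- Move to the next bucket, or pop an entry of the current one, until an entry is up to date. -/
def bucketExt : Cmd :=
  .set 22 (.const 0) ⨾
  .while (.eq (.var 22) (.const 0))
    (.ite (.eq (.get 20 (.var 21)) (.const 0))
      (.set 21 (.var 21 ∔ .const 1))
      (.put 20 (.var 21) (.get 20 (.var 21) ∸ .const 1) ⨾
       .set 10 (.get 21 (.var 21 ⨰ .var 20 ∔ .get 20 (.var 21))) ⨾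
       .ite (.eq (.get 6 (.var 10)) (.var 21)) (.set 22 (.const 1)) .skip))

/-- Deletion is lazy: the entry in the old bucket stays and is recognized later because its bucket
differs from the current key. The pointer moves down if the new key lies below it. -/
def bucketDec : Cmd :=
  .put 21 (.get 6 (.var 4) ⨰ .var 20 ∔ .get 20 (.get 6 (.var 4))) (.var 4) ⨾
  .put 20 (.get 6 (.var 4)) (.get 20 (.get 6 (.var 4)) ∔ .const 1) ⨾
  .ite (.lt (.get 6 (.var 4)) (.var 21)) (.set 21 (.get 6 (.var 4))) .skip

def bucketInit : Cmd :=
  .set 20 (.var 0 ∔ .const 1) ⨾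
  .set 21 (.const 0) ⨾
  .set 22 (.const 0) ⨾
  .while (.lt (.var 22) (.var 0))
    (.put 21 (.get 6 (.var 22) ⨰ .var 20 ∔ .get 20 (.get 6 (.var 22))) (.var 22) ⨾
     .put 20 (.get 6 (.var 22)) (.get 20 (.get 6 (.var 22)) ∔ .const 1) ⨾
     .set 22 (.var 22 ∔ .const 1))

/-- The queue consists of the entries of `L`, for keys `d` at most `N`. -/
structure BucketRep (n N : ℕ) (d : ℕ → ℕ) (S : Finset ℕ) (cur : ℕ) (L : ℕ → List ℕ) : Prop where
  key_le : ∀ u ∈ S, d u ≤ N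
  cur_le : ∀ u ∈ S, cur ≤ d u
  mem : ∀ u ∈ S, u ∈ L (d u)
  key : ∀ b, ∀ v ∈ L b, v < n ∧ d v ≤ b ∧ (d v = b → v ∈ S)
  nodup : ∀ b, (L b).Nodup

/-- The number of entries in the buckets up to `N`. -/
def entries (N : ℕ) (L : ℕ → List ℕ) : ℕ := ∑ b ∈ Finset.range (N + 1), (L b).length

theorem entries_update {N b : ℕ} (hb : b ≤ N) (L : ℕ → List ℕ) (l : List ℕ) :
    entries N (Function.update L b l) + (L b).length = entries N L + l.length := by
  have hm : b ∈ Finset.range (N + 1) := Finset.mem_range.2 (by omega)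
  unfold entries
  rw [← Finset.add_sum_erase _ _ hm, ← Finset.add_sum_erase _ (fun b => (L b).length) hm]
  have : ∑ x ∈ (Finset.range (N + 1)).erase b, (Function.update L b l x).length =
      ∑ x ∈ (Finset.range (N + 1)).erase b, (L x).length := by
    refine Finset.sum_congr rfl fun x hx => ?_
    rw [Function.update_of_ne (Finset.ne_of_mem_erase hx)]
  rw [this]
  simp
  omega

theorem BucketRep.length_lt {n N : ℕ} {d : ℕ → ℕ} {S : Finset ℕ} {cur : ℕ} {L : ℕ → List ℕ}
    (h : BucketRep n N d S cur L) (b : ℕ) : (L b).length < n + 1 := by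
  have : (L b).length ≤ n := by
    rw [← List.toFinset_card_of_nodup (h.nodup b)]
    refine (Finset.card_le_card (t := Finset.range n) fun v hv => ?_).trans (by simp)
    exact Finset.mem_range.2 (h.key b v (List.mem_toFinset.1 hv)).1
  omega

/-- Adding an entry for a key that was not larger before. -/
theorem BucketRep.push {n N : ℕ} {d : ℕ → ℕ} {S : Finset ℕ} {cur : ℕ} {L : ℕ → List ℕ}
    (h : BucketRep n N d S cur L) {u x : ℕ} (hu : u < n) (hx : x ≤ N) (hxu : u ∈ S → x < d u)
    (hL : ∀ b ≤ x, u ∉ L b) {cur' : ℕ} (hc : cur' ≤ cur) (hc' : cur' ≤ x) :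
    BucketRep n N (Function.update d u x) (insert u S) cur'
      (Function.update L x (L x ++ [u])) := by
  have hmem : ∀ b v, v ∈ Function.update L x (L x ++ [u]) b ↔ v ∈ L b ∨ (b = x ∧ v = u) := by
    intro b v
    by_cases hb : b = x
    · subst hb; simp
    · simp [Function.update_of_ne hb, hb]
  constructor
  · intro v hv
    by_cases hvu : v = u
    · subst hvu; simpa using hx
    · rw [Function.update_of_ne hvu]
      exact h.key_le v ((Finset.mem_insert.1 hv).resolve_left hvu)
  · intro v hv
    by_cases hvu : v = u
    · subst hvu; simpa using hc'
    · rw [Function.update_of_ne hvu]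
      exact hc.trans (h.cur_le v ((Finset.mem_insert.1 hv).resolve_left hvu))
  · intro v hv
    rw [hmem]
    by_cases hvu : v = u
    · subst hvu; simp
    · rw [Function.update_of_ne hvu]
      exact Or.inl (h.mem v ((Finset.mem_insert.1 hv).resolve_left hvu))
  · intro b v hv
    rw [hmem] at hv
    by_cases hvu : v = u
    · subst hvu
      refine ⟨hu, ?_, fun _ => Finset.mem_insert_self _ _⟩
      simp only [Function.update_self]
      rcases hv with hv | hv
      · by_contra hlt
        exact hL b (by omega) hv
      · exact hv.1.ge
    · rw [Function.update_of_ne hvu]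
      obtain ⟨h1, h2, h3⟩ := h.key b v (hv.resolve_right fun h => hvu h.2)
      exact ⟨h1, h2, fun h => Finset.mem_insert_of_mem (h3 h)⟩
  · intro b
    by_cases hb : b = x
    · subst hb
      simp only [Function.update_self]
      rw [List.nodup_append]
      refine ⟨h.nodup _, by simp, ?_⟩
      intro a ha c hc hac
      rw [List.mem_singleton] at hc
      subst hc; subst hac
      exact hL b le_rfl ha
    · rw [Function.update_of_ne hb]
      exact h.nodup b

/-- An entry in bucket `cur` is up to date if and only if its key is `cur`, and then it is a
minimum. Otherwise it is stale and the set of elements does not change. -/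
theorem BucketRep.pop {n N : ℕ} {d : ℕ → ℕ} {S : Finset ℕ} {cur : ℕ} {L : ℕ → List ℕ}
    (h : BucketRep n N d S cur L) {l : List ℕ} {v : ℕ} (hL : L cur = l ++ [v]) :
    v ∉ l ∧ (d v = cur → v ∈ S) ∧
    BucketRep n N d (if d v = cur then S.erase v else S) cur (Function.update L cur l) := by
  have hnd := h.nodup cur
  rw [hL, List.nodup_append] at hnd
  have hvl : v ∉ l := fun hv => hnd.2.2 v hv v (by simp) rfl
  have hsub : ∀ b x, x ∈ Function.update L cur l b → x ∈ L b ∧ (b = cur → x ≠ v) := by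
    intro b x hx
    by_cases hb : b = cur
    · subst hb
      simp only [Function.update_self] at hx
      refine ⟨by rw [hL]; simp [hx], fun _ h => hvl (h ▸ hx)⟩
    · rw [Function.update_of_ne hb] at hx
      exact ⟨hx, fun h => absurd h hb⟩
  have hS : ∀ u, u ∈ (if d v = cur then S.erase v else S) ↔ u ∈ S ∧ (d v = cur → u ≠ v) := by
    intro u
    split_ifs with hd
    · simp [hd, and_comm]
    · simp [hd]
  refine ⟨hvl, (h.key cur v (by rw [hL]; simp)).2.2, ?_, ?_, ?_, ?_, ?_⟩
  · exact fun u hu => h.key_le u ((hS u).1 hu).1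
  · exact fun u hu => h.cur_le u ((hS u).1 hu).1
  · intro u hu
    obtain ⟨h1, h2⟩ := (hS u).1 hu
    have hm := h.mem u h1
    by_cases hb : d u = cur
    · rw [hb] at hm ⊢
      simp only [Function.update_self]
      rw [hL, List.mem_append, List.mem_singleton] at hm
      refine hm.resolve_right fun hv => ?_
      subst hv
      exact h2 hb rfl
    · rwa [Function.update_of_ne hb]
  · intro b x hx
    obtain ⟨h1, h2⟩ := hsub b x hx
    obtain ⟨h3, h4, h5⟩ := h.key b x h1
    refine ⟨h3, h4, fun h => (hS x).2 ⟨h5 h, fun hd hxv => ?_⟩⟩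
    subst hxv
    exact h2 (by omega) rfl
  · intro b
    by_cases hb : b = cur
    · subst hb
      simpa using hnd.1
    · rw [Function.update_of_ne hb]
      exact h.nodup b

/-- The invariant of the bucket queue. -/
def BucketInv (n N : ℕ) (S : Finset ℕ) (Φ : ℕ) (s : Store) : Prop :=
  ∃ L, s.reg 20 = n + 1 ∧ Rows (n + 1) (s.arr 20) (s.arr 21) L ∧
    BucketRep n N (s.arr 6) S (s.reg 21) L ∧ 6 * entries N L + 6 * (N - s.reg 21) ≤ Φ

/-- The potential counts 6 for each entry, stale ones included, and 6 for each bucket the pointer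
has still to climb. Each round of an extraction removes an entry or advances the pointer, so it pays
for itself. A decrease adds an entry and, being by one, lowers the pointer by at most one: 12 of
potential and 4 steps. -/
theorem bucket_spec (M n N : ℕ) :
    PQSpec M 4 16 (· = 1) bucketExt bucketDec (BucketInv n N) where
  congr := by
    rintro S Φ s s' ⟨L, h1, h2, h3, h4⟩ h6 hr ha
    refine ⟨L, ?_⟩
    rw [hr 20 (by omega), hr 21 (by omega), ha 20 (by omega), ha 21 (by omega), h6]
    exact ⟨h1, h2, h3, h4⟩
  ext_spec := by
    intro S Φ s k K hI hS hk
    refine Tri.of_wp_forall fun R hR => ?_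
    simp only [bucketExt, wp]
    obtain ⟨k, rfl⟩ := Nat.exists_eq_add_of_le' (show 1 ≤ k by omega)
    simp
    refine Tri.while (fun k s' => s'.arr 6 = s.arr 6 ∧ ∃ Φ',
      (s'.reg 22 = 0 ∧ BucketInv n N S Φ' s' ∧ Φ' + 1 + K ≤ k) ∨
      (s'.reg 22 ≠ 0 ∧ s'.reg 10 ∈ S ∧ (∀ u ∈ S, s.arr 6 (s'.reg 10) ≤ s.arr 6 u) ∧
        BucketInv n N (S.erase (s'.reg 10)) Φ' s' ∧ Φ' + 1 + K ≤ k)) ?_ ?_ ?_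
    · clear hI hk k Φ
      rintro k s' ⟨h6, Φ, ⟨h22, ⟨L, h20, hL, hrep, hΦ⟩, hk⟩ | ⟨h22, -⟩⟩ hc
      swap
      · simp [h22] at hc
      clear hc
      obtain ⟨u, hu⟩ := hS
      have hcur := (hrep.cur_le u hu).trans (hrep.key_le u hu)
      by_cases h0 : s'.arr 20 (s'.reg 21) = 0
      · have hemp : L (s'.reg 21) = [] := List.length_eq_zero_iff.1 (by rw [← hL.len, h0])
        -- Every element has an entry in the bucket of its key, so an empty current bucket holds no
        -- key and the pointer may advance without passing a minimum.
        have hne : ∀ u ∈ S, s'.reg 21 ≠ s'.arr 6 u := by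
          intro u hu h
          have := hrep.mem u hu
          rw [← h, hemp] at this
          simp at this
        have hlt := lt_of_le_of_ne (hrep.cur_le u hu) (hne u hu)
        have hle := hrep.key_le u hu
        obtain ⟨k, rfl⟩ := Nat.exists_eq_add_of_le' (show 4 ≤ k by omega)
        refine ⟨by omega, Tri.of_wp_forall fun R hR => ?_⟩
        simp only [wp, ne_eq, eval_lt_eq_zero, eval_eq_eq_zero, not_not]
        simp [Op.eval, h0]
        refine hR _ _ ⟨by simpa using h6, Φ - 6, Or.inl ⟨by simpa using h22,
          ⟨L, by simpa using h20, by simpa using hL, ?_, ?_⟩, by omega⟩⟩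
        · simp only [setReg_reg, setReg_arr, if_true]
          exact ⟨hrep.key_le, fun u hu => lt_of_le_of_ne (hrep.cur_le u hu) (hne u hu),
            hrep.mem, hrep.key, hrep.nodup⟩
        · simp
          omega
      · obtain ⟨l, v, hl, hv, hL'⟩ := hL.pop h0
        have hent := entries_update hcur L l
        rw [hl, List.length_append, List.length_singleton] at hent
        obtain ⟨-, hvS, hrep'⟩ := hrep.pop hl
        obtain ⟨k, rfl⟩ := Nat.exists_eq_add_of_le' (show 6 ≤ k by omega)
        refine ⟨by omega, Tri.of_wp_forall fun R hR => ?_⟩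
        simp only [wp, ne_eq, eval_lt_eq_zero, eval_eq_eq_zero, not_not]
        simp [Op.eval, h0, h20, hv]
        constructor
        · intro hd
          rw [if_pos hd] at hrep'
          refine hR _ _ ⟨by simpa using h6, Φ - 6, Or.inr ⟨by simp, ?_, ?_,
            ⟨Function.update L (s'.reg 21) l, ?_, ?_, ?_, ?_⟩, by omega⟩⟩
          · simpa using hvS hd
          · intro u hu
            simp only [setReg_reg, setArr_reg, if_true, if_false, Nat.reduceEqDiff,
              Nat.reduceEqDiff]
            rw [← h6, hd]
            exact hrep.cur_le u hu
          · simpa using h20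
          · simpa using hL'
          · simpa using hrep'
          · simp
            omega
        · intro hd
          rw [if_neg hd] at hrep'
          refine hR _ _ ⟨by simpa using h6, Φ - 6, Or.inl ⟨by simpa using h22,
            ⟨Function.update L (s'.reg 21) l, ?_, ?_, ?_, ?_⟩, by omega⟩⟩
          · simpa using h20
          · simpa using hL'
          · simpa using hrep'
          · simp
            omega
    · rintro k s' ⟨h6, Φ', ⟨h22, -⟩ | ⟨h22, h⟩⟩ hc
      · simp [h22] at hc
      · exact ⟨by omega, hR _ _ ⟨Φ', h.1, h.2.1, h.2.2.1, by omega⟩⟩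
    · refine ⟨rfl, Φ, Or.inl ⟨by simp, ?_, by omega⟩⟩
      obtain ⟨L, h1, h2, h3, h4⟩ := hI
      exact ⟨L, by simpa using h1, h2, by simpa using h3, by simpa using h4⟩
  dec_spec := by
    rintro S Φ s k K u x ⟨L, h20, hL, hrep, hΦ⟩ h4 hu hx hone hk
    refine Tri.of_wp_forall fun R hR => ?_
    have hdu : s.arr 6 u = x + 1 := by omega
    have hun : u < n := (hrep.key _ u (hrep.mem u hu)).1
    have hkey := hrep.key_le u hu
    have hcur := hrep.cur_le u hu
    have hpush := hL.push x u (hrep.length_lt x)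
    -- The element has no entry in a bucket up to `x`: the bucket of an entry is at least the key,
    -- which was `x + 1`. So pushing creates no duplicate.
    have hrep' : ∀ cur', cur' ≤ s.reg 21 → cur' ≤ x → BucketRep n N (Function.update (s.arr 6) u x)
        S cur' (Function.update L x (L x ++ [u])) := by
      intro cur' h1 h2
      have := hrep.push (u := u) (x := x) (cur' := cur') hun (by omega) (fun _ => by omega)
        (fun b hb hm => by have := (hrep.key b u hm).2.1; omega) h1 h2
      rwa [Finset.insert_eq_of_mem hu] at this
    have hent := entries_update (show x ≤ N by omega) L (L x ++ [u])
    rw [List.length_append, List.length_singleton] at hent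
    obtain ⟨k, rfl⟩ := Nat.exists_eq_add_of_le' (show 4 ≤ k by omega)
    simp only [bucketDec, wp, ne_eq, eval_lt_eq_zero, eval_eq_eq_zero, not_not]
    simp [Op.eval, h4, h20]
    constructor
    · intro hlt
      refine hR _ _ ⟨Φ + 12, ⟨_, by simpa using h20, by simpa using hpush, ?_, ?_⟩, by omega⟩
      · simpa using hrep' x hlt.le le_rfl
      · simp
        omega
    · intro hge
      refine hR _ _ ⟨Φ + 12, ⟨_, by simpa using h20, by simpa using hpush, ?_, ?_⟩, by omega⟩
      · simpa using hrep' (s.reg 21) le_rfl hge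
      · simp
        omega
  ext_regs := by simp [bucketExt]
  ext_arrs := by simp [bucketExt]
  dec_regs := by simp [bucketDec]
  dec_arrs := by simp [bucketDec]

theorem bucketInit_spec {M n N : ℕ} {s : Store} {k K : ℕ} (h0 : s.reg 0 = n)
    (h20 : s.arr 20 = fun _ => 0) (hN : ∀ v < n, s.arr 6 v ≤ N) (hk : 4 * n + 4 + K ≤ k) :
    Tri M bucketInit s k fun k' s' => K ≤ k' ∧
      BucketInv n N (Finset.range n) (6 * n + 6 * N) s' := by
  refine Tri.of_wp_forall fun R hR => ?_
  obtain ⟨k, rfl⟩ := Nat.exists_eq_add_of_le' (show 3 ≤ k by omega)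
  simp only [bucketInit, wp]
  simp [Op.eval, h0]
  refine Tri.while (fun k s' => s'.reg 0 = n ∧ s'.reg 20 = n + 1 ∧ s'.reg 21 = 0 ∧ s'.reg 22 ≤ n ∧
    s'.arr 6 = s.arr 6 ∧ 4 * (n - s'.reg 22) + 1 + K ≤ k ∧ ∃ L,
      Rows (n + 1) (s'.arr 20) (s'.arr 21) L ∧
      BucketRep n N (s.arr 6) (Finset.range (s'.reg 22)) 0 L ∧
      (∀ b, ∀ v ∈ L b, v < s'.reg 22) ∧ entries N L = s'.reg 22) ?_ ?_ ?_
  · clear hk h0 h20 k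
    rintro k s' ⟨h0, h20, h21, h22, h6, hk, L, hL, hrep, hlt, hent⟩ hc
    simp [h0] at hc
    obtain ⟨k, rfl⟩ := Nat.exists_eq_add_of_le' (show 4 ≤ k by omega)
    refine ⟨by omega, Tri.of_wp_forall fun R hR => ?_⟩
    set i := s'.reg 22 with hi
    have hpush := hL.push (s.arr 6 i) i (hrep.length_lt _)
    have hrep' := hrep.push (u := i) (x := s.arr 6 i) (cur' := 0) hc (hN i hc)
      (fun h => by simp at h) (fun b _ hm => by have := hlt b i hm; omega) le_rfl (by omega)
    rw [Function.update_eq_self] at hrep'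
    have hent' := entries_update (hN i hc) L (L (s.arr 6 i) ++ [i])
    rw [List.length_append, List.length_singleton] at hent'
    simp [wp, Op.eval, h6, h20, ← hi]
    refine hR _ _ ⟨by simpa using h0, by simpa using h20, by simpa using h21, ?_, ?_, ?_,
      Function.update L (s.arr 6 i) (L (s.arr 6 i) ++ [i]), ?_, ?_, ?_, ?_⟩
    · simp; omega
    · simpa using h6
    · simp; omega
    · simpa using hpush
    · simp only [setReg_reg, if_true]
      rw [Finset.range_add_one]
      exact hrep'
    · intro b v hv
      simp only [setReg_reg, if_true]
      by_cases hb : b = s.arr 6 i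
      · subst hb
        simp only [Function.update_self, List.mem_append, List.mem_singleton] at hv
        rcases hv with hv | hv
        · have := hlt _ v hv; omega
        · omega
      · rw [Function.update_of_ne hb] at hv
        have := hlt _ v hv
        omega
    · simp
      omega
  · rintro k s' ⟨h0, h20, h21, h22, h6, hk, L, hL, hrep, hlt, hent⟩ hc
    simp [h0] at hc
    have h22' : s'.reg 22 = n := by omega
    refine ⟨by omega, hR _ _ ⟨by omega, L, h20, hL, ?_, by omega⟩⟩
    rw [h6, h21, ← h22']
    rw [h22'] at hrep ⊢
    exact hrep
  · simp [h20, h0]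
    refine ⟨by omega, fun _ => [], ⟨by simp, by simp, by simp⟩, ⟨?_, ?_, ?_, ?_, ?_⟩, ?_, ?_⟩ <;>
      simp [entries]

/-! ## Forests of a Fibonacci heap -/

/-- A forest on `S`: `par v` is the parent of `v`, or `n` if `v` is a root; the children of `p` are
`ch (p * n + i)` for `i < rk p`, and `pos` gives their positions. The number `mk v` counts the
children that `v` has lost since it became a child, and `ht` bounds the heights. -/
structure Forest (n : ℕ) (S : Finset ℕ) (par rk mk pos ch ht : ℕ → ℕ) : Prop where
  lt : ∀ v ∈ S, v < n
  dead : ∀ v < n, v ∉ S → par v ≠ n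
  par_mem : ∀ v ∈ S, par v ≠ n → par v ∈ S
  child : ∀ v ∈ S, par v ≠ n → pos v < rk (par v) ∧ ch (par v * n + pos v) = v
  slot : ∀ p ∈ S, ∀ i < rk p,
    ch (p * n + i) ∈ S ∧ par (ch (p * n + i)) = p ∧ pos (ch (p * n + i)) = i
  ht_lt : ∀ v ∈ S, par v ≠ n → ht v < ht (par v)
  mk_root : ∀ v ∈ S, par v = n → mk v = 0
  few : ∀ p ∈ S, ∀ j, (S.filter fun c => par c = p ∧ rk c + mk c ≤ j).card ≤ j + 1

namespace Forest

variable {n : ℕ} {S : Finset ℕ} {par rk mk pos ch ht : ℕ → ℕ}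

/-- The fields `child` and `slot` make `pos` and `ch` inverse to each other, so the rank is the
number of children. -/
theorem card_children (h : Forest n S par rk mk pos ch ht) {p : ℕ} (hp : p ∈ S) :
    (S.filter fun c => par c = p).card = rk p := by
  have hpn := h.lt p hp
  apply le_antisymm
  · rw [← Finset.card_range (rk p)]
    refine Finset.card_le_card_of_injOn pos ?_ ?_
    · intro c hc
      simp only [Finset.coe_filter, Set.mem_ofPred_eq] at hc
      have := h.child c hc.1 (by omega)
      rw [hc.2] at this
      simpa using this.1
    · intro c hc c' hc' hcc
      simp only [Finset.coe_filter, Set.mem_ofPred_eq] at hc hc'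
      have h1 := (h.child c hc.1 (by omega)).2
      have h2 := (h.child c' hc'.1 (by omega)).2
      rw [← h1, ← h2, hc.2, hc'.2, hcc]
  · conv_lhs => rw [← Finset.card_range (rk p)]
    refine Finset.card_le_card_of_injOn (fun i => ch (p * n + i)) ?_ ?_
    · intro i hi
      simp only [Finset.coe_range, Set.mem_Iio] at hi
      have := h.slot p hp i hi
      simpa using ⟨this.1, this.2.1⟩
    · intro i hi j hj hij
      simp only [Finset.coe_range, Set.mem_Iio] at hi hj
      rw [← (h.slot p hp i hi).2.2, ← (h.slot p hp j hj).2.2]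
      exact congrArg pos hij

theorem card_le (h : Forest n S par rk mk pos ch ht) : S.card ≤ n := by
  refine (Finset.card_le_card (t := Finset.range n) fun v hv => ?_).trans (by simp)
  exact Finset.mem_range.2 (h.lt v hv)

theorem par_ne_self (h : Forest n S par rk mk pos ch ht) {p : ℕ} (hp : p ∈ S) : par p ≠ p := by
  intro he
  have h1 := h.lt p hp
  have := h.ht_lt p hp (by omega)
  rw [he] at this
  omega

theorem rk_lt (h : Forest n S par rk mk pos ch ht) {p : ℕ} (hp : p ∈ S) : rk p < n := by
  have h1 : (S.filter fun c => par c = p) ⊆ S.erase p := by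
    intro c hc
    rw [Finset.mem_filter] at hc
    refine Finset.mem_erase.2 ⟨?_, hc.1⟩
    rintro rfl
    exact h.par_ne_self hp hc.2
  have h2 := Finset.card_le_card h1
  rw [h.card_children hp, Finset.card_erase_of_mem hp] at h2
  have h3 := h.card_le
  have h4 := h.lt p hp
  have h5 := Finset.card_pos.2 ⟨p, hp⟩
  omega

/-- The delicate field is `few`. The new child has rank `rk x`, so it counts only for `j ≥ rk x`;
but then the number `rk x + 1` of all children of `x` is small enough. -/
theorem link (h : Forest n S par rk mk pos ch ht) {x y : ℕ} (hx : x ∈ S) (hy : y ∈ S)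
    (hxy : x ≠ y) (hpx : par x = n) (hpy : par y = n) (hr : rk x = rk y) :
    Forest n S (Function.update par y x) (Function.update rk x (rk x + 1)) mk
      (Function.update pos y (rk x)) (Function.update ch (x * n + rk x) y)
      (Function.update ht x (max (ht x) (ht y + 1))) := by
  have hxn := h.lt x hx
  have hyn := h.lt y hy
  have hrx := h.rk_lt hx
  have hrk : ∀ p, rk p ≤ Function.update rk x (rk x + 1) p := by
    intro p
    by_cases hp : p = x
    · subst hp; simp
    · simp [Function.update_of_ne hp]
  have hchild : ∀ v ∈ S, Function.update par y x v ≠ n →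
      Function.update pos y (rk x) v < Function.update rk x (rk x + 1)
        (Function.update par y x v) ∧
      Function.update ch (x * n + rk x) y
        (Function.update par y x v * n + Function.update pos y (rk x) v) = v := by
    intro v hv hne
    by_cases hvy : v = y
    · subst hvy; simp
    · simp only [Function.update_of_ne hvy] at hne ⊢
      obtain ⟨h1, h2⟩ := h.child v hv hne
      have h3 := h.rk_lt (h.par_mem v hv hne)
      refine ⟨h1.trans_le (hrk _), ?_⟩
      rw [Function.update_of_ne, h2]
      intro he
      obtain ⟨h4, h5⟩ := row_inj (by omega) hrx he
      rw [h4] at h1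
      omega
  have hcard : (S.filter fun c => Function.update par y x c = x).card ≤ rk x + 1 := by
    rw [← Finset.card_range (rk x + 1)]
    refine Finset.card_le_card_of_injOn (Function.update pos y (rk x)) ?_ ?_
    · intro c hc
      simp only [Finset.coe_filter, Set.mem_ofPred_eq] at hc
      have := hchild c hc.1 (by omega)
      rw [hc.2] at this
      simpa using this.1
    · intro c hc c' hc' hcc
      simp only [Finset.coe_filter, Set.mem_ofPred_eq] at hc hc'
      have h1 := (hchild c hc.1 (by omega)).2
      have h2 := (hchild c' hc'.1 (by omega)).2
      rw [← h1, ← h2, hc.2, hc'.2, hcc]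
  constructor
  · exact h.lt
  · intro v hv hvS
    rw [Function.update_of_ne (by rintro rfl; exact hvS hy)]
    exact h.dead v hv hvS
  · intro v hv hne
    by_cases hvy : v = y
    · subst hvy; simpa using hx
    · simp only [Function.update_of_ne hvy] at hne ⊢
      exact h.par_mem v hv hne
  · exact hchild
  · intro p hp i hi
    by_cases hpi : p = x ∧ i = rk x
    · obtain ⟨rfl, rfl⟩ := hpi
      simpa using hy
    · have hi' : i < rk p := by
        by_cases hpx : p = x
        · subst hpx
          simp only [Function.update_self] at hi
          have : i ≠ rk p := fun h => hpi ⟨rfl, h⟩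
          omega
        · rwa [Function.update_of_ne hpx] at hi
      obtain ⟨h1, h2, h3⟩ := h.slot p hp i hi'
      have hin := h.rk_lt hp
      have hpn := h.lt p hp
      rw [Function.update_of_ne (fun he => hpi (row_inj (by omega) hrx he))]
      have hcy : ch (p * n + i) ≠ y := by
        intro he
        rw [he] at h2
        omega
      rw [Function.update_of_ne hcy, Function.update_of_ne hcy]
      exact ⟨h1, h2, h3⟩
  · intro v hv hne
    by_cases hvy : v = y
    · subst hvy
      rw [Function.update_of_ne hxy.symm]
      simp
    · simp only [Function.update_of_ne hvy] at hne ⊢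
      have hvx : v ≠ x := by rintro rfl; exact hne hpx
      have := h.ht_lt v hv hne
      rw [Function.update_of_ne hvx]
      by_cases hp : par v = x
      · rw [hp] at this ⊢
        simp only [Function.update_self]
        omega
      · rwa [Function.update_of_ne hp]
  · intro v hv hne
    by_cases hvy : v = y
    · subst hvy; exact h.mk_root v hv hpy
    · rw [Function.update_of_ne hvy] at hne
      exact h.mk_root v hv hne
  · intro p hp j
    have hpn := h.lt p hp
    -- Here all children of `x` are counted; in the other case `y` is not counted and the old bound
    -- remains.
    by_cases hj : p = x ∧ rk x ≤ j
    · obtain ⟨rfl, hj⟩ := hj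
      refine (Finset.card_le_card fun c hc => ?_).trans (hcard.trans (by omega))
      simp only [Finset.mem_filter] at hc ⊢
      exact ⟨hc.1, hc.2.1⟩
    · refine (Finset.card_le_card fun c hc => ?_).trans (h.few p hp j)
      simp only [Finset.mem_filter] at hc ⊢
      obtain ⟨hc, hcp, hcj⟩ := hc
      have hrkc := hrk c
      have hcy : c ≠ y := by
        rintro rfl
        simp only [Function.update_self] at hcp
        exact hj ⟨hcp.symm, by omega⟩
      rw [Function.update_of_ne hcy] at hcp
      exact ⟨hc, hcp, by omega⟩

/-- When a non-root loses a child, its rank drops by one and its `mk` grows by one, so the sum in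
`few` is unchanged. A root needs no mark because it is nobody's child. The last child `z` moves to
the vacated slot, which keeps the slots contiguous at constant cost. -/
theorem cut (h : Forest n S par rk mk pos ch ht) {c p z : ℕ} (hc : c ∈ S) (hcp : par c = p)
    (hpn : p ≠ n) (hz : ch (p * n + (rk p - 1)) = z) :
    Forest n S (Function.update par c n) (Function.update rk p (rk p - 1))
      (Function.update (Function.update mk p (if par p = n then mk p else mk p + 1)) c 0)
      (Function.update pos z (pos c)) (Function.update ch (p * n + pos c) z) ht := by
  have hp : p ∈ S := hcp ▸ h.par_mem c hc (by omega)
  obtain ⟨hc1, hc2⟩ := h.child c hc (by omega)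
  rw [hcp] at hc1 hc2
  have hpc : p ≠ c := by
    rintro rfl
    exact h.par_ne_self hp hcp
  obtain ⟨hz1, hz2, hz3⟩ := h.slot p hp (rk p - 1) (by omega)
  rw [hz] at hz1 hz2 hz3
  have hrp := h.rk_lt hp
  have hp' := h.lt p hp
  constructor
  · exact h.lt
  · intro v hv hvS
    rw [Function.update_of_ne (by rintro rfl; exact hvS hc)]
    exact h.dead v hv hvS
  · intro v hv hne
    by_cases hvc : v = c
    · subst hvc; simp at hne
    · simp only [Function.update_of_ne hvc] at hne ⊢
      exact h.par_mem v hv hne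
  · intro v hv hne
    by_cases hvc : v = c
    · subst hvc; simp at hne
    simp only [Function.update_of_ne hvc] at hne ⊢
    obtain ⟨h1, h2⟩ := h.child v hv hne
    by_cases hvz : v = z
    · subst hvz
      rw [hz2]
      have : pos c ≠ rk p - 1 := by
        intro he
        rw [he, hz] at hc2
        exact hvc hc2
      simp
      omega
    · rw [Function.update_of_ne hvz]
      by_cases hq : par v = p
      · rw [hq] at h1 h2 ⊢
        have h3 : pos v ≠ rk p - 1 := by
          intro he
          rw [he, hz] at h2
          exact hvz h2.symm
        have h4 : pos v ≠ pos c := by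
          intro he
          rw [he, hc2] at h2
          exact hvc h2.symm
        rw [Function.update_self, Function.update_of_ne (fun he => h4 (by omega))]
        exact ⟨by omega, h2⟩
      · have h3 := h.rk_lt (h.par_mem v hv hne)
        rw [Function.update_of_ne hq, Function.update_of_ne]
        · exact ⟨h1, h2⟩
        · intro he
          exact hq (row_inj (by omega) (by omega) he).1
  · intro q hq i hi
    have hqn := h.lt q hq
    by_cases hqp : q = p
    · subst hqp
      simp only [Function.update_self] at hi
      obtain ⟨h1, h2, h3⟩ := h.slot q hq i (by omega)
      by_cases hic : i = pos c
      · subst hic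
        have hzc : z ≠ c := by
          rintro rfl
          omega
        simp [Function.update_of_ne hzc, hz1, hz2]
      · rw [Function.update_of_ne (by omega)]
        have hc' : ch (q * n + i) ≠ c := fun he => hic (by rw [← h3, he])
        have hz' : ch (q * n + i) ≠ z := fun he => by rw [he] at h3; omega
        rw [Function.update_of_ne hc', Function.update_of_ne hz']
        exact ⟨h1, h2, h3⟩
    · rw [Function.update_of_ne hqp] at hi
      obtain ⟨h1, h2, h3⟩ := h.slot q hq i hi
      have h4 := h.rk_lt hq
      rw [Function.update_of_ne (fun he => hqp (row_inj (by omega) (by omega) he).1)]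
      have hc' : ch (q * n + i) ≠ c := fun he => hqp (by rw [← h2, he, hcp])
      have hz' : ch (q * n + i) ≠ z := fun he => hqp (by rw [← h2, he, hz2])
      rw [Function.update_of_ne hc', Function.update_of_ne hz']
      exact ⟨h1, h2, h3⟩
  · intro v hv hne
    by_cases hvc : v = c
    · subst hvc; simp at hne
    · simp only [Function.update_of_ne hvc] at hne ⊢
      exact h.ht_lt v hv hne
  · intro v hv hne
    by_cases hvc : v = c
    · subst hvc; simp
    · rw [Function.update_of_ne hvc] at hne
      rw [Function.update_of_ne hvc]
      by_cases hvp : v = p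
      · subst hvp
        simp [hne, h.mk_root v hv hne]
      · rw [Function.update_of_ne hvp]
        exact h.mk_root v hv hne
  · intro q hq j
    have hqn := h.lt q hq
    refine (Finset.card_le_card fun w hw => ?_).trans (h.few q hq j)
    simp only [Finset.mem_filter] at hw ⊢
    obtain ⟨hw, hwq, hwj⟩ := hw
    have hwc : w ≠ c := by
      rintro rfl
      simp only [Function.update_self] at hwq
      omega
    rw [Function.update_of_ne hwc] at hwq hwj
    refine ⟨hw, hwq, ?_⟩
    by_cases hwp : w = p
    · subst hwp
      simp only [Function.update_self] at hwj
      -- As a child of `q`, the vertex `p` is no root, so the mark did grow and makes up for the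
      -- lost rank.
      rw [if_neg (by omega)] at hwj
      omega
    · rwa [Function.update_of_ne hwp, Function.update_of_ne hwp] at hwj

/-- The dead vertex gets the impossible parent `n + 1`, so that leftover list entries for it are not
mistaken for roots. -/
theorem erase (h : Forest n S par rk mk pos ch ht) {v : ℕ} (hv : v ∈ S) (hpv : par v = n)
    (hr : rk v = 0) :
    Forest n (S.erase v) (Function.update par v (n + 1)) rk mk pos ch ht := by
  have hpar : ∀ w ∈ S, par w ≠ n → par w ≠ v := by
    intro w hw hne he
    have := (h.child w hw hne).1
    rw [he] at this
    omega
  constructor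
  · exact fun w hw => h.lt w (Finset.mem_of_mem_erase hw)
  · intro w hw hwS
    by_cases hwv : w = v
    · subst hwv; simp
    · rw [Function.update_of_ne hwv]
      exact h.dead w hw fun h => hwS (Finset.mem_erase.2 ⟨hwv, h⟩)
  · intro w hw hne
    obtain ⟨h1, h2⟩ := Finset.mem_erase.1 hw
    rw [Function.update_of_ne h1] at hne ⊢
    exact Finset.mem_erase.2 ⟨hpar w h2 hne, h.par_mem w h2 hne⟩
  · intro w hw hne
    obtain ⟨h1, h2⟩ := Finset.mem_erase.1 hw
    rw [Function.update_of_ne h1] at hne ⊢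
    exact h.child w h2 hne
  · intro q hq i hi
    obtain ⟨h1, h2⟩ := Finset.mem_erase.1 hq
    obtain ⟨h3, h4, h5⟩ := h.slot q h2 i hi
    have hqn := h.lt q h2
    have hne : ch (q * n + i) ≠ v := by
      intro he
      rw [he] at h4
      omega
    rw [Function.update_of_ne hne]
    exact ⟨Finset.mem_erase.2 ⟨hne, h3⟩, h4, h5⟩
  · intro w hw hne
    obtain ⟨h1, h2⟩ := Finset.mem_erase.1 hw
    rw [Function.update_of_ne h1] at hne ⊢
    exact h.ht_lt w h2 hne
  · intro w hw hne
    obtain ⟨h1, h2⟩ := Finset.mem_erase.1 hw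
    rw [Function.update_of_ne h1] at hne
    exact h.mk_root w h2 hne
  · intro q hq j
    obtain ⟨h1, h2⟩ := Finset.mem_erase.1 hq
    refine (Finset.card_le_card fun w hw => ?_).trans (h.few q h2 j)
    simp only [Finset.mem_filter, Finset.mem_erase] at hw ⊢
    obtain ⟨⟨h3, h4⟩, h5, h6⟩ := hw
    rw [Function.update_of_ne h3] at h5
    exact ⟨h4, h5, h6⟩

/-- This replaces the usual argument about the order in which children were acquired. By `few`, at
most `i + 1` children have rank plus marks at most `i`. A vertex of rank at least `i + 3` thus has
two children above that, and as each has lost at most one child, their ranks are at least `i`.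
Children of different vertices are different. -/
theorem two_mul_card_le (h : Forest n S par rk mk pos ch ht) (hm : ∀ v ∈ S, mk v ≤ 1) (i : ℕ) :
    2 * (S.filter fun p => i + 3 ≤ rk p).card ≤ (S.filter fun p => i ≤ rk p).card := by
  set T := S.filter fun p => i + 3 ≤ rk p with hT
  have h1 : ∑ p ∈ T, (S.filter fun c => i ≤ rk c ∧ par c = p).card ≤
      (S.filter fun p => i ≤ rk p).card := by
    have := Finset.sum_card_fiberwise_eq_card_filter (S.filter fun p => i ≤ rk p) T par
    simp only [Finset.filter_filter] at this
    rw [this]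
    refine Finset.card_le_card fun c hc => ?_
    simp only [Finset.mem_filter] at hc ⊢
    exact ⟨hc.1, hc.2.1⟩
  have h2 : ∀ p ∈ T, 2 ≤ (S.filter fun c => i ≤ rk c ∧ par c = p).card := by
    intro p hp
    obtain ⟨hp, hpi⟩ := Finset.mem_filter.1 hp
    have h3 := h.few p hp i
    have h4 := h.card_children hp
    have h5 : (S.filter fun c => par c = p) ⊆ (S.filter fun c => i ≤ rk c ∧ par c = p) ∪
        (S.filter fun c => par c = p ∧ rk c + mk c ≤ i) := by
      intro c hc
      obtain ⟨hc, hcp⟩ := Finset.mem_filter.1 hc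
      have := hm c hc
      simp only [Finset.mem_union, Finset.mem_filter]
      by_cases hi : i ≤ rk c
      · exact Or.inl ⟨hc, hi, hcp⟩
      · exact Or.inr ⟨hc, hcp, by omega⟩
    have h6 := (Finset.card_le_card h5).trans (Finset.card_union_le _ _)
    omega
  calc 2 * T.card = ∑ p ∈ T, 2 := by simp [mul_comm]
    _ ≤ _ := Finset.sum_le_sum h2
    _ ≤ _ := h1

theorem rk_le (h : Forest n S par rk mk pos ch ht) (hm : ∀ v ∈ S, mk v ≤ 1) {p : ℕ} (hp : p ∈ S) :
    rk p ≤ 3 * Nat.log 2 n + 2 := by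
  -- Each three units of rank halve the number of vertices; at `k = log n + 1` none is left.
  have key : ∀ k, 2 ^ k * (S.filter fun p => 3 * k ≤ rk p).card ≤ n := by
    intro k
    induction k with
    | zero => simpa using h.card_le
    | succ k ih =>
      have := h.two_mul_card_le hm (3 * k)
      rw [pow_succ, mul_assoc]
      exact (Nat.mul_le_mul_left _ this).trans ih
  by_contra hlt
  have h1 := key (Nat.log 2 n + 1)
  have h2 : 0 < (S.filter fun p => 3 * (Nat.log 2 n + 1) ≤ rk p).card :=
    Finset.card_pos.2 ⟨p, Finset.mem_filter.2 ⟨hp, by omega⟩⟩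
  have h3 : n < 2 ^ (Nat.log 2 n + 1) := Nat.lt_pow_succ_log_self (by omega) n
  have h4 := Nat.le_mul_of_pos_right (2 ^ (Nat.log 2 n + 1)) h2
  omega

/-- Climbing to the parent raises `ht`, so it ends at a root, and heap order makes keys no larger on
the way. A minimum over the roots is therefore a minimum over all elements. -/
theorem exists_root (h : Forest n S par rk mk pos ch ht) {d : ℕ → ℕ}
    (hd : ∀ v ∈ S, par v ≠ n → d (par v) ≤ d v) {u : ℕ} (hu : u ∈ S) :
    ∃ r ∈ S, par r = n ∧ d r ≤ d u := by
  have hfin : ∃ N, ∀ v ∈ S, ht v ≤ N := ⟨S.sup ht, fun v hv => Finset.le_sup hv⟩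
  obtain ⟨N, hN⟩ := hfin
  induction hk : N - ht u using Nat.strong_induction_on generalizing u with
  | _ k ih =>
    by_cases hp : par u = n
    · exact ⟨u, hu, hp, le_rfl⟩
    · have h1 := h.ht_lt u hu hp
      have h2 := h.par_mem u hu hp
      have h3 := hN _ h2
      obtain ⟨r, hr, hrn, hrd⟩ := ih _ (by omega) h2 rfl
      exact ⟨r, hr, hrn, hrd.trans (hd u hu hp)⟩

end Forest

/-! ## A Fibonacci heap as a priority queue -/

/-- The number of roots. -/
def numRoots (n : ℕ) (S : Finset ℕ) (par : ℕ → ℕ) : ℕ := (S.filter fun v => par v = n).card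

theorem numRoots_update_of_root {n : ℕ} {S : Finset ℕ} {par : ℕ → ℕ} {v p : ℕ} (hv : v ∈ S)
    (h : par v = n) (hp : p ≠ n) : numRoots n S (Function.update par v p) + 1 = numRoots n S par := by
  have : (S.filter fun u => Function.update par v p u = n) =
      (S.filter fun u => par u = n).erase v := by
    ext u
    simp only [Finset.mem_filter, Finset.mem_erase]
    by_cases hu : u = v
    · subst hu; simp [hp]
    · simp [Function.update_of_ne hu, hu]
  have hm : v ∈ S.filter fun u => par u = n := Finset.mem_filter.2 ⟨hv, h⟩
  unfold numRoots
  rw [this, Finset.card_erase_add_one hm]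

theorem numRoots_update_of_child {n : ℕ} {S : Finset ℕ} {par : ℕ → ℕ} {v : ℕ} (hv : v ∈ S)
    (h : par v ≠ n) : numRoots n S (Function.update par v n) = numRoots n S par + 1 := by
  rw [← numRoots_update_of_root (par := Function.update par v n) (p := par v) hv (by simp) h]
  simp

theorem sum_update_add {S : Finset ℕ} {f : ℕ → ℕ} {v : ℕ} (hv : v ∈ S) (x : ℕ) :
    ∑ u ∈ S, Function.update f v x u + f v = ∑ u ∈ S, f u + x := by
  rw [← Finset.add_sum_erase S _ hv, ← Finset.add_sum_erase S f hv]
  have : ∑ u ∈ S.erase v, Function.update f v x u = ∑ u ∈ S.erase v, f u :=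
    Finset.sum_congr rfl fun u hu => Function.update_of_ne (Finset.ne_of_mem_erase hu) _ _
  rw [this]
  simp
  omega

/-- The heap is stored in arrays 20 to 24, with (unsorted) lists of possible roots in arrays 25
and 26. Heap order and the bound on the number of lost children may fail at `x`. -/
structure FibSt (n : ℕ) (S : Finset ℕ) (x : ℕ) (s : Store) : Prop where
  n_eq : s.reg 0 = n
  forest : ∃ ht, Forest n S (s.arr 20) (s.arr 21) (s.arr 22) (s.arr 23) (s.arr 24) ht
  heap : ∀ v ∈ S, v ≠ x → s.arr 20 v ≠ n → s.arr 6 (s.arr 20 v) ≤ s.arr 6 v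
  mk_le : ∀ v ∈ S, v ≠ x → s.arr 22 v ≤ 1
  list_lt : ∀ i, s.arr 25 i < n
  slot_lt : ∀ i, s.arr 26 i < n

theorem FibSt.congr {n : ℕ} {S : Finset ℕ} {x : ℕ} {s s' : Store} (h : FibSt n S x s)
    (h0 : s'.reg 0 = s.reg 0) (h6 : s'.arr 6 = s.arr 6)
    (ha : ∀ A ∈ [20, 21, 22, 23, 24, 25, 26], s'.arr A = s.arr A) : FibSt n S x s' := by
  simp at ha
  obtain ⟨h1, h2, h3, h4, h5, h6⟩ := h
  constructor <;> simp_all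

/-- Every root is in the list of possible roots. -/
def Covered (n : ℕ) (S : Finset ℕ) (s : Store) : Prop :=
  ∀ r ∈ S, s.arr 20 r = n → ∃ i < s.reg 20, s.arr 25 i = r

/-- The potential. -/
def fibPot (n : ℕ) (S : Finset ℕ) (s : Store) : ℕ :=
  16 * s.reg 20 + 16 * numRoots n S (s.arr 20) + 48 * ∑ v ∈ S, s.arr 22 v

/-- All elements are below `n`, so the exceptional vertex `n` means no exception. Between operations
heap order and the mark bound hold everywhere. -/
def FibInv (n : ℕ) (S : Finset ℕ) (Φ : ℕ) (s : Store) : Prop :=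
  FibSt n S n s ∧ Covered n S s ∧ fibPot n S s ≤ Φ

/-- Make the root in register 24 a child of the root in register 23. -/
def linkCmd : Cmd :=
  .put 20 (.var 24) (.var 23) ⨾
  .put 23 (.var 24) (.get 21 (.var 23)) ⨾
  .put 24 (.var 23 ⨰ .var 0 ∔ .get 21 (.var 23)) (.var 24) ⨾
  .put 21 (.var 23) (.get 21 (.var 23) ∔ .const 1)

theorem linkCmd_spec {M n : ℕ} {S : Finset ℕ} {s : Store} {k x y : ℕ} (h : FibSt n S n s)
    (h23 : s.reg 23 = x) (h24 : s.reg 24 = y) (hx : x ∈ S) (hy : y ∈ S) (hxy : x ≠ y)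
    (hpx : s.arr 20 x = n) (hpy : s.arr 20 y = n) (hr : s.arr 21 x = s.arr 21 y)
    (hd : s.arr 6 x ≤ s.arr 6 y) (hk : 4 ≤ k) :
    Tri M linkCmd s k fun k' s' => k = k' + 4 ∧ FibSt n S n s' ∧
      s'.arr 20 = Function.update (s.arr 20) y x ∧
      s'.arr 21 = Function.update (s.arr 21) x (s.arr 21 x + 1) := by
  refine Tri.of_wp_forall fun R hR => ?_
  obtain ⟨k, rfl⟩ := Nat.exists_eq_add_of_le' hk
  obtain ⟨ht, hf⟩ := h.forest
  have hf' := hf.link hx hy hxy hpx hpy hr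
  have hxn := hf.lt x hx
  simp [linkCmd, wp, Op.eval, h23, h24, h.n_eq]
  refine hR _ _ ⟨rfl, ⟨?_, ?_, ?_, ?_, ?_, ?_⟩, ?_, ?_⟩
  · simpa using h.n_eq
  · exact ⟨_, by simpa using hf'⟩
  · intro v hv hvn hne
    simp only [setArr_arr, Nat.reduceEqDiff, if_true, if_false] at hne ⊢
    by_cases hvy : v = y
    · subst hvy; simpa using hd
    · rw [Function.update_of_ne hvy] at hne ⊢
      exact h.heap v hv hvn hne
  · simpa using h.mk_le
  · simpa using h.list_lt
  · simpa using h.slot_lt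
  · simp
  · simp

/-- Link roots of equal rank until all ranks of roots are different. -/
def consolidateCmd : Cmd :=
  .set 21 (.const 0) ⨾
  .set 22 (.const 0) ⨾
  .while (.lt (.var 22) (.var 20))
    (.set 23 (.get 25 (.var 22)) ⨾
     .ite (.eq (.get 20 (.var 23)) (.var 0))
      (.set 24 (.get 26 (.get 21 (.var 23))) ⨾
       .ite (.lt (.const 2) (.eq (.get 20 (.var 24)) (.var 0) ∔
          .eq (.get 21 (.var 24)) (.get 21 (.var 23)) ∔ (.const 1 ∸ .eq (.var 24) (.var 23))))
        (.ite (.lt (.get 6 (.var 24)) (.get 6 (.var 23)))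
          (.set 25 (.var 23) ⨾ .set 23 (.var 24) ⨾ .set 24 (.var 25)) .skip ⨾
         .call linkCmd ⨾
         .put 25 (.var 22) (.var 23))
        (.put 26 (.get 21 (.var 23)) (.var 23) ⨾
         .ite (.lt (.var 21) (.get 21 (.var 23))) (.set 21 (.get 21 (.var 23))) .skip ⨾
         .set 22 (.var 22 ∔ .const 1)))
      (.set 22 (.var 22 ∔ .const 1)))

/-- Roots are found in array 26 at the position given by their rank. -/
def Slotted (n : ℕ) (S : Finset ℕ) (s : Store) : Prop :=
  ∀ r ∈ S, s.arr 20 r = n → s.arr 26 (s.arr 21 r) = r ∧ s.arr 21 r ≤ s.reg 21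

/-- The language has no conjunction; three indicator values must add up to more than 2. -/
theorem eval_three_eq_zero {s : Store} {a b c d e f : Expr} :
    (Expr.lt (.const 2) (.eq a b ∔ .eq c d ∔ (.const 1 ∸ .eq e f))).eval s = 0 ↔
      ¬ (a.eval s = b.eval s ∧ c.eval s = d.eval s ∧ e.eval s ≠ f.eval s) := by
  simp only [Expr.eval, Op.eval]
  by_cases h1 : a.eval s = b.eval s <;> by_cases h2 : c.eval s = d.eval s <;>
    by_cases h3 : e.eval s = f.eval s <;> simp [h1, h2, h3]

/-- Each round either moves on in the list or removes a root by linking, and 16 credits are kept for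
each. A slot of array 26 is trusted only if its content is a root of the rank in question, so slots
never have to be cleared; likewise list entries that are no longer roots are skipped. -/
theorem consolidateCmd_spec {M n : ℕ} {S : Finset ℕ} {s : Store} {k K : ℕ} (h : FibSt n S n s)
    (hc : Covered n S s) (hk : 16 * s.reg 20 + 16 * numRoots n S (s.arr 20) + 3 + K ≤ k) :
    Tri M consolidateCmd s k fun k' s' => K ≤ k' ∧ FibSt n S n s' ∧ Slotted n S s' ∧
      s'.reg 21 ≤ 3 * Nat.log 2 n + 2 := by
  refine Tri.of_wp_forall fun R hR => ?_
  simp only [consolidateCmd, wp]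
  obtain ⟨k, rfl⟩ := Nat.exists_eq_add_of_le' (show 2 ≤ k by omega)
  simp
  refine Tri.while (fun k s => FibSt n S n s ∧ s.reg 22 ≤ s.reg 20 ∧
    (∀ r ∈ S, s.arr 20 r = n → (∃ i, s.reg 22 ≤ i ∧ i < s.reg 20 ∧ s.arr 25 i = r) ∨
      (s.arr 26 (s.arr 21 r) = r ∧ s.arr 21 r ≤ s.reg 21)) ∧
    s.reg 21 ≤ 3 * Nat.log 2 n + 2 ∧
    16 * (s.reg 20 - s.reg 22) + 16 * numRoots n S (s.arr 20) + 1 + K ≤ k) ?_ ?_ ?_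
  · clear hR R hk hc h s k
    rintro k s ⟨h, h22, hcov, h21, hk⟩ hlt
    rw [ne_eq, eval_lt_eq_zero, not_not] at hlt
    simp only [Expr.eval] at hlt
    obtain ⟨ht, hf⟩ := h.forest
    obtain ⟨k, rfl⟩ := Nat.exists_eq_add_of_le' (show 16 ≤ k by omega)
    refine ⟨by omega, Tri.of_wp_forall fun R hR => ?_⟩
    simp only [wp, ne_eq, eval_three_eq_zero, not_not]
    simp only [ne_eq, eval_lt_eq_zero, eval_eq_eq_zero, not_not]
    simp [Op.eval, h.n_eq]
    set x := s.arr 25 (s.reg 22) with hx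
    have hxn : x < n := h.list_lt _
    constructor
    · intro hpx
      have hxS : x ∈ S := by
        by_contra hxS
        exact hf.dead x hxn hxS hpx
      set y := s.arr 26 (s.arr 21 x) with hy
      have hyn : y < n := h.slot_lt _
      constructor
      · intro hpy hry hyx
        have hyS : y ∈ S := by
          by_contra hyS
          exact hf.dead y hyn hyS hpy
        -- Both outcomes of the key comparison lead here, with `x'` the root of smaller key. It is
        -- written back to the current list position, which is not advanced, so it is examined again
        -- with its new rank.
        have main : ∀ (s₂ : Store) (k₂ x' y' : ℕ), (∀ r, r ∉ [23, 24, 25] → s₂.reg r = s.reg r) →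
            s₂.arr = s.arr → s₂.reg 23 = x' → s₂.reg 24 = y' → s.arr 6 x' ≤ s.arr 6 y' →
            ((x' = x ∧ y' = y) ∨ (x' = y ∧ y' = x)) → k + 5 ≤ k₂ →
            Tri M linkCmd s₂ k₂ fun k s => 1 ≤ k ∧ R (k - 1) (s.setArr 25 (s.reg 22) (s.reg 23)) := by
          intro s₂ k₂ x' y' hreg harr h23 h24 hd hcase hk₂
          have hfib : FibSt n S n s₂ :=
            h.congr (hreg 0 (by simp)) (by rw [harr]) (by simp [harr])
          have hx'S : x' ∈ S := by rcases hcase with ⟨rfl, rfl⟩ | ⟨rfl, rfl⟩ <;> assumption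
          have hy'S : y' ∈ S := by rcases hcase with ⟨rfl, rfl⟩ | ⟨rfl, rfl⟩ <;> assumption
          have hpx' : s.arr 20 x' = n := by rcases hcase with ⟨rfl, rfl⟩ | ⟨rfl, rfl⟩ <;> assumption
          have hpy' : s.arr 20 y' = n := by rcases hcase with ⟨rfl, rfl⟩ | ⟨rfl, rfl⟩ <;> assumption
          have hne : x' ≠ y' := by
            rcases hcase with ⟨rfl, rfl⟩ | ⟨rfl, rfl⟩
            · exact fun h => hyx h.symm
            · exact hyx
          have hrk : s.arr 21 x' = s.arr 21 y' := by
            rcases hcase with ⟨rfl, rfl⟩ | ⟨rfl, rfl⟩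
            · exact hry.symm
            · exact hry
          refine Tri.framed (linkCmd_spec hfib h23 h24 hx'S hy'S hne (by rw [harr]; exact hpx')
            (by rw [harr]; exact hpy') (by rw [harr]; exact hrk) (by rw [harr]; exact hd)
            (by omega)) ?_
          rintro k' s' ⟨hk', hfib', h20', h21'⟩ ⟨fr, fa⟩
          have r20 : s'.reg 20 = s.reg 20 := by
            rw [fr 20 (by simp [linkCmd]), hreg 20 (by simp)]
          have r21 : s'.reg 21 = s.reg 21 := by
            rw [fr 21 (by simp [linkCmd]), hreg 21 (by simp)]
          have r22 : s'.reg 22 = s.reg 22 := by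
            rw [fr 22 (by simp [linkCmd]), hreg 22 (by simp)]
          have r23 : s'.reg 23 = x' := by
            rw [fr 23 (by simp [linkCmd]), h23]
          have a25 : s'.arr 25 = s.arr 25 := by
            rw [fa 25 (by simp [linkCmd]), harr]
          have a26 : s'.arr 26 = s.arr 26 := by
            rw [fa 26 (by simp [linkCmd]), harr]
          rw [harr] at h20' h21'
          have hroots := numRoots_update_of_root (p := x') hy'S hpy' (hf.lt x' hx'S).ne
          refine ⟨by omega, hR _ _ ⟨⟨?_, ?_, ?_, ?_, ?_, ?_⟩, ?_, ?_, ?_, ?_⟩⟩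
          · simpa using hfib'.n_eq
          · simpa using hfib'.forest
          · simpa using hfib'.heap
          · simpa using hfib'.mk_le
          · intro i
            simp only [setArr_arr, if_true, r22, r23]
            by_cases hi : i = s.reg 22
            · subst hi; simpa using hf.lt x' hx'S
            · rw [Function.update_of_ne hi]
              exact hfib'.list_lt i
          · simpa using hfib'.slot_lt
          · simpa [r22, r20] using h22
          · intro r hr hrn
            simp only [setArr_arr, setArr_reg, Nat.reduceEqDiff, if_true, if_false, h20', h21', r22,
              r23, r20, r21, a25, a26] at hrn ⊢
            by_cases hry' : r = y'
            · subst hry'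
              rw [Function.update_self] at hrn
              have := hf.lt x' hx'S
              omega
            rw [Function.update_of_ne hry'] at hrn
            by_cases hrx' : r = x'
            · subst hrx'
              exact Or.inl ⟨s.reg 22, le_rfl, hlt, by simp⟩
            · rw [Function.update_of_ne hrx']
              rcases hcov r hr hrn with ⟨i, h1, h2, h3⟩ | h1
              · refine Or.inl ⟨i, h1, h2, ?_⟩
                rw [Function.update_of_ne, h3]
                rintro rfl
                rw [← hx] at h3
                rcases hcase with ⟨rfl, rfl⟩ | ⟨rfl, rfl⟩
                · exact hrx' h3.symm
                · exact hry' h3.symm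
              · exact Or.inr h1
          · simpa [r21] using h21
          · simp only [setArr_arr, setArr_reg, Nat.reduceEqDiff, if_true, if_false, h20', r22, r20]
            omega
        constructor
        · intro hd
          refine main _ _ y x ?_ ?_ ?_ ?_ hd.le (Or.inr ⟨rfl, rfl⟩) (by omega)
          · intro r hr
            simp at hr
            simp [hr]
          · simp
          · simp
          · simp
        · intro hd
          refine main _ _ x y ?_ ?_ ?_ ?_ hd (Or.inl ⟨rfl, rfl⟩) (by omega)
          · intro r hr
            simp at hr
            simp [hr]
          · simp
          · simp
          · simp
      · intro hno
        have hrk := hf.rk_le (fun v hv => h.mk_le v hv (hf.lt v hv).ne) hxS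
        -- Overwriting the slot loses no root: another root of the same rank found there would have
        -- been linked with `x`.
        have hcov' : ∀ K', s.reg 21 ≤ K' → s.arr 21 x ≤ K' → ∀ r ∈ S, s.arr 20 r = n →
            (∃ i, s.reg 22 + 1 ≤ i ∧ i < s.reg 20 ∧ s.arr 25 i = r) ∨
            (Function.update (s.arr 26) (s.arr 21 x) x (s.arr 21 r) = r ∧ s.arr 21 r ≤ K') := by
          intro K' hK hK' r hr hrn
          by_cases hrx : r = x
          · subst hrx
            exact Or.inr ⟨by simp, hK'⟩
          rcases hcov r hr hrn with ⟨i, h1, h2, h3⟩ | ⟨h1, h2⟩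
          · refine Or.inl ⟨i, ?_, h2, h3⟩
            have : i ≠ s.reg 22 := by
              rintro rfl
              exact hrx h3.symm
            omega
          · refine Or.inr ⟨?_, h2.trans hK⟩
            rw [Function.update_of_ne, h1]
            intro he
            rw [he, ← hy] at h1
            refine hrx ?_
            rw [← h1]
            exact hno (by rw [h1]; exact hrn) (by rw [h1]; exact he)
        have hslot : ∀ i, Function.update (s.arr 26) (s.arr 21 x) x i < n := by
          intro i
          by_cases hi : i = s.arr 21 x
          · subst hi; simpa using hxn
          · rw [Function.update_of_ne hi]
            exact h.slot_lt i
        constructor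
        · intro hK
          refine hR _ _ ⟨⟨?_, ?_, ?_, ?_, ?_, ?_⟩, ?_, ?_, ?_, ?_⟩
          · simpa using h.n_eq
          · simpa using h.forest
          · simpa using h.heap
          · simpa using h.mk_le
          · simpa using h.list_lt
          · simpa using hslot
          · simpa using hlt
          · simpa using hcov' _ hK.le le_rfl
          · simpa using hrk
          · simp
            omega
        · intro hK
          refine hR _ _ ⟨⟨?_, ?_, ?_, ?_, ?_, ?_⟩, ?_, ?_, ?_, ?_⟩
          · simpa using h.n_eq
          · simpa using h.forest
          · simpa using h.heap
          · simpa using h.mk_le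
          · simpa using h.list_lt
          · simpa using hslot
          · simpa using hlt
          · simpa using hcov' _ le_rfl hK
          · simpa using h21
          · simp
            omega
    · intro hpx
      refine hR _ _ ⟨h.congr ?_ ?_ ?_, ?_, ?_, ?_, ?_⟩
      · simp
      · simp
      · simp
      · simpa using hlt
      · intro r hr hrn
        simp only [setReg_arr, setReg_reg, Nat.reduceEqDiff, if_true, if_false] at hrn ⊢
        refine (hcov r hr hrn).imp_left ?_
        rintro ⟨i, h1, h2, h3⟩
        refine ⟨i, ?_, h2, h3⟩
        have : i ≠ s.reg 22 := by
          rintro rfl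
          rw [← h3] at hrn
          exact hpx hrn
        omega
      · simpa using h21
      · simp
        omega
  · rintro k s' ⟨h, h22, hcov, h21, hk⟩ hlt
    rw [eval_lt_eq_zero] at hlt
    simp only [Expr.eval] at hlt
    refine ⟨by omega, hR _ _ ⟨by omega, h, fun r hr hrn => ?_, h21⟩⟩
    rcases hcov r hr hrn with ⟨i, h1, h2, h3⟩ | h1
    · omega
    · exact h1
  · refine ⟨h.congr ?_ ?_ ?_, ?_, ?_, ?_, ?_⟩
    · simp
    · simp
    · simp
    · simp
    · intro r hr hrn
      obtain ⟨i, h1, h2⟩ := hc r hr hrn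
      exact Or.inl ⟨i, by simp, by simpa using h1, h2⟩
    · simp
    · simp
      omega

/-- Collect the roots from array 26, and find one of minimal key. -/
def collectCmd : Cmd :=
  .set 20 (.const 0) ⨾
  .set 22 (.const 0) ⨾
  .while (.lt (.var 22) (.var 21 ∔ .const 1))
    (.set 23 (.get 26 (.var 22)) ⨾
     .ite (.eq (.get 20 (.var 23)) (.var 0))
      (.ite (.eq (.get 21 (.var 23)) (.var 22))
        (.put 25 (.var 20) (.var 23) ⨾
         .ite (.eq (.var 20) (.const 0)) (.set 10 (.var 23))
          (.ite (.lt (.get 6 (.var 23)) (.get 6 (.var 10))) (.set 10 (.var 23)) .skip) ⨾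
         .set 20 (.var 20 ∔ .const 1)) .skip) .skip ⨾
     .set 22 (.var 22 ∔ .const 1))

/-- After consolidation the slots up to the maximal rank contain every root. Scanning them rebuilds
the list with at most one entry per rank, which frees the potential of the old, possibly long, list.
-/
theorem collectCmd_spec {M n : ℕ} {S : Finset ℕ} {s : Store} {k K : ℕ} (h : FibSt n S n s)
    (hsl : Slotted n S s) (hS : S.Nonempty) (hk : 10 * (s.reg 21 + 1) + 3 + K ≤ k) :
    Tri M collectCmd s k fun k' s' => K ≤ k' ∧ FibSt n S n s' ∧ Covered n S s' ∧
      s'.reg 20 ≤ s.reg 21 + 1 ∧ s'.reg 10 ∈ S ∧ s'.arr 20 (s'.reg 10) = n ∧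
      ∀ u ∈ S, s.arr 6 (s'.reg 10) ≤ s.arr 6 u := by
  refine Tri.of_wp_forall fun R hR => ?_
  simp only [collectCmd, wp]
  obtain ⟨k, rfl⟩ := Nat.exists_eq_add_of_le' (show 2 ≤ k by omega)
  simp
  refine Tri.while (fun k s' => FibSt n S n s' ∧ Slotted n S s' ∧ s'.arr 6 = s.arr 6 ∧
    s'.reg 21 = s.reg 21 ∧ s'.reg 22 ≤ s.reg 21 + 1 ∧ s'.reg 20 ≤ s'.reg 22 ∧
    (s'.reg 20 ≠ 0 → s'.reg 10 ∈ S ∧ s'.arr 20 (s'.reg 10) = n) ∧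
    (∀ r ∈ S, s'.arr 20 r = n → s'.arr 21 r < s'.reg 22 →
      (∃ i < s'.reg 20, s'.arr 25 i = r) ∧ s.arr 6 (s'.reg 10) ≤ s.arr 6 r) ∧
    10 * (s.reg 21 + 1 - s'.reg 22) + 1 + K ≤ k) ?_ ?_ ?_
  · clear hR R hk hsl h k
    rintro k s' ⟨h, hsl, h6, h21, h22, h20, hmin, hcov, hk⟩ hlt
    rw [ne_eq, eval_lt_eq_zero, not_not] at hlt
    simp only [Expr.eval, Op.eval, h21] at hlt
    obtain ⟨ht, hf⟩ := h.forest
    obtain ⟨k, rfl⟩ := Nat.exists_eq_add_of_le' (show 10 ≤ k by omega)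
    refine ⟨by omega, Tri.of_wp_forall fun R hR => ?_⟩
    simp only [wp, ne_eq, eval_lt_eq_zero, eval_eq_eq_zero, not_not]
    simp [Op.eval, h.n_eq]
    set x := s'.arr 26 (s'.reg 22) with hx
    have hxn : x < n := h.slot_lt _
    -- By `Slotted`, a slot that fails the check proves that there is no root of this rank.
    have skip : ¬ (s'.arr 20 x = n ∧ s'.arr 21 x = s'.reg 22) → ∀ k₂, k ≤ k₂ →
        R k₂ ((s'.setReg 23 x).setReg 22 (s'.reg 22 + 1)) := by
      intro hno k₂ hk₂
      refine hR _ _ ⟨h.congr (by simp) (by simp) (by simp), by simpa [Slotted] using hsl,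
        by simpa using h6, by simpa using h21, by simp; omega, by simp; omega, by simpa using hmin,
        ?_, by simp; omega⟩
      intro r hr hrn hrl
      simp only [setReg_arr, setReg_reg, Nat.reduceEqDiff, if_true, if_false] at hrn hrl ⊢
      refine hcov r hr hrn ?_
      have : s'.arr 21 r ≠ s'.reg 22 := by
        intro he
        have h1 := (hsl r hr hrn).1
        rw [he, ← hx] at h1
        exact hno ⟨by rw [h1]; exact hrn, by rw [h1]; exact he⟩
      omega
    have main : ∀ (v : ℕ) (s₂ : Store) (k₂ : ℕ), k ≤ k₂ → x ∈ S → s'.arr 20 x = n →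
        s'.arr 21 x = s'.reg 22 → s₂.reg 10 = v → (v = x ∨ (s'.reg 20 ≠ 0 ∧ v = s'.reg 10)) →
        (s'.reg 20 ≠ 0 → s'.arr 6 v ≤ s'.arr 6 (s'.reg 10)) → s'.arr 6 v ≤ s'.arr 6 x →
        (∀ r, r ∉ [10, 20, 22, 23] → s₂.reg r = s'.reg r) → s₂.reg 20 = s'.reg 20 + 1 →
        s₂.reg 22 = s'.reg 22 + 1 → (∀ A, A ≠ 25 → s₂.arr A = s'.arr A) →
        s₂.arr 25 = Function.update (s'.arr 25) (s'.reg 20) x → R k₂ s₂ := by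
      intro v s₂ k₂ hk₂ hxS hpx hrx hv hcase hle hle' hr r20 r22 ha a25
      have e21 := hr 21 (by simp)
      refine hR _ _ ⟨⟨?_, ?_, ?_, ?_, ?_, ?_⟩, ?_, ?_, ?_, ?_, ?_, ?_, ?_, ?_⟩
      · rw [hr 0 (by simp)]; exact h.n_eq
      · rw [ha 20 (by simp), ha 21 (by simp), ha 22 (by simp), ha 23 (by simp), ha 24 (by simp)]
        exact h.forest
      · rw [ha 20 (by simp), ha 6 (by simp)]; exact h.heap
      · rw [ha 22 (by simp)]; exact h.mk_le
      · intro i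
        rw [a25]
        by_cases hi : i = s'.reg 20
        · subst hi; simpa using hxn
        · rw [Function.update_of_ne hi]; exact h.list_lt i
      · rw [ha 26 (by simp)]; exact h.slot_lt
      · intro r hr' hrn
        rw [ha 20 (by simp)] at hrn
        rw [ha 26 (by simp), ha 21 (by simp), e21]
        exact hsl r hr' hrn
      · rw [ha 6 (by simp)]; exact h6
      · rw [e21]; exact h21
      · omega
      · omega
      · intro _
        rw [hv, ha 20 (by simp)]
        rcases hcase with rfl | ⟨h1, rfl⟩
        · exact ⟨hxS, hpx⟩
        · exact hmin h1
      · intro r hr' hrn hrl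
        rw [ha 20 (by simp)] at hrn
        rw [ha 21 (by simp), r22] at hrl
        rw [hv, a25, r20, ← h6]
        by_cases hrx' : r = x
        · subst hrx'
          exact ⟨⟨s'.reg 20, by omega, by simp⟩, hle'⟩
        · have : s'.arr 21 r ≠ s'.reg 22 := by
            intro he
            have h1 := (hsl r hr' hrn).1
            rw [he, ← hx] at h1
            exact hrx' h1.symm
          obtain ⟨⟨i, h1, h2⟩, h3⟩ := hcov r hr' hrn (by omega)
          refine ⟨⟨i, by omega, ?_⟩, ?_⟩
          · rw [Function.update_of_ne (by omega), h2]
          · rw [h6] at hle ⊢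
            exact (hle (by omega)).trans h3
      · omega
    constructor
    · intro hpx
      have hxS : x ∈ S := by
        by_contra hxS
        exact hf.dead x hxn hxS hpx
      constructor
      · intro hrx
        constructor
        · intro h0
          refine main x _ _ ?_ hxS hpx hrx ?_ (Or.inl rfl) (fun h => absurd h0 h) le_rfl ?_ ?_ ?_ ?_ ?_
          · omega
          · simp
          · intro r hr
            simp at hr
            simp [hr]
          · simp
          · simp
          · intro A hA
            simp [hA]
          · simp
        · intro h0
          constructor
          · intro hd
            refine main x _ _ ?_ hxS hpx hrx ?_ (Or.inl rfl) (fun _ => hd.le) le_rfl ?_ ?_ ?_ ?_ ?_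
            · omega
            · simp
            · intro r hr
              simp at hr
              simp [hr]
            · simp
            · simp
            · intro A hA
              simp [hA]
            · simp
          · intro hd
            refine main (s'.reg 10) _ _ ?_ hxS hpx hrx ?_ (Or.inr ⟨h0, rfl⟩) (fun _ => le_rfl) hd
              ?_ ?_ ?_ ?_ ?_
            · omega
            · simp
            · intro r hr
              simp at hr
              simp [hr]
            · simp
            · simp
            · intro A hA
              simp [hA]
            · simp
      · intro hrx
        exact skip (fun h => hrx h.2) _ (by omega)
    · intro hpx
      exact skip (fun h => hpx h.1) _ (by omega)
  · rintro k s' ⟨h, hsl, h6, h21, h22, h20, hmin, hcov, hk⟩ hlt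
    rw [eval_lt_eq_zero] at hlt
    simp only [Expr.eval, Op.eval, h21] at hlt
    have hcov' : ∀ r ∈ S, s'.arr 20 r = n → (∃ i < s'.reg 20, s'.arr 25 i = r) ∧
        s.arr 6 (s'.reg 10) ≤ s.arr 6 r := by
      intro r hr hrn
      have := (hsl r hr hrn).2
      exact hcov r hr hrn (by omega)
    obtain ⟨ht, hf⟩ := h.forest
    have hex := fun u (hu : u ∈ S) => hf.exists_root (d := s'.arr 6)
      (fun v hv => h.heap v hv (hf.lt v hv).ne) hu
    obtain ⟨u, hu⟩ := hS
    obtain ⟨r, hr, hrn, -⟩ := hex u hu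
    obtain ⟨⟨i, hi, -⟩, -⟩ := hcov' r hr hrn
    obtain ⟨h1, h2⟩ := hmin (by omega)
    refine ⟨by omega, hR _ _ ⟨by omega, h, fun r hr hrn => (hcov' r hr hrn).1, by omega, h1, h2,
      fun u hu => ?_⟩⟩
    obtain ⟨r, hr, hrn, hrd⟩ := hex u hu
    rw [h6] at hrd
    exact (hcov' r hr hrn).2.trans hrd
  · refine ⟨h.congr (by simp) (by simp) (by simp), by simpa [Slotted] using hsl, by simp, by simp,
      by simp, by simp, by simp, by simp, ?_⟩
    simp
    omega

/-- Remove the root in register 10; its children become roots. -/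
def removeCmd : Cmd :=
  .while (.lt (.const 0) (.get 21 (.var 10)))
    (.put 21 (.var 10) (.get 21 (.var 10) ∸ .const 1) ⨾
     .set 23 (.get 24 (.var 10 ⨰ .var 0 ∔ .get 21 (.var 10))) ⨾
     .put 20 (.var 23) (.var 0) ⨾
     .put 22 (.var 23) (.const 0) ⨾
     .put 25 (.var 20) (.var 23) ⨾
     .set 20 (.var 20 ∔ .const 1)) ⨾
  .put 20 (.var 10) (.var 0 ∔ .const 1)

theorem Covered.push {n : ℕ} {S : Finset ℕ} {s s' : Store} {c : ℕ} (h : Covered n S s)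
    (h20 : s'.reg 20 = s.reg 20 + 1) (a20 : s'.arr 20 = Function.update (s.arr 20) c n)
    (a25 : s'.arr 25 = Function.update (s.arr 25) (s.reg 20) c) : Covered n S s' := by
  intro r hr hrn
  rw [h20, a25]
  by_cases hrc : r = c
  · subst hrc
    exact ⟨s.reg 20, by omega, by simp⟩
  · rw [a20, Function.update_of_ne hrc] at hrn
    obtain ⟨i, hi, hir⟩ := h r hr hrn
    exact ⟨i, by omega, by rw [Function.update_of_ne (by omega), hir]⟩

/-- Releasing a child costs 8 steps and adds a list entry and a root, 16 of potential each: 40 in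
all. Its marks are cleared, which can only help. -/
theorem removeCmd_spec {M n : ℕ} {S : Finset ℕ} {s : Store} {k K v : ℕ} (h : FibSt n S n s)
    (hc : Covered n S s) (hv : s.reg 10 = v) (hvS : v ∈ S) (hvn : s.arr 20 v = n)
    (hk : fibPot n S s + s.arr 21 v * 40 + 2 + K ≤ k) :
    Tri M removeCmd s k fun k' s' => ∃ Φ', Φ' + K ≤ k' ∧ FibInv n (S.erase v) Φ' s' ∧
      s'.reg 10 = v := by
  refine Tri.of_wp_forall fun R hR => ?_
  simp only [removeCmd, wp]
  refine Tri.while (fun k s => FibSt n S n s ∧ Covered n S s ∧ s.reg 10 = v ∧ s.arr 20 v = n ∧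
    fibPot n S s + s.arr 21 v * 40 + 2 + K ≤ k) ?_ ?_ ⟨h, hc, hv, hvn, hk⟩
  · clear hR R hk hvn hv hc h s k
    rintro k s ⟨h, hc, hv, hvn, hk⟩ hlt
    rw [ne_eq, eval_lt_eq_zero, not_not] at hlt
    simp only [Expr.eval, hv] at hlt
    obtain ⟨ht, hf⟩ := h.forest
    have hvn' := hf.lt v hvS
    obtain ⟨r, hr⟩ := Nat.exists_eq_add_of_le' (show 1 ≤ s.arr 21 v by omega)
    obtain ⟨k, rfl⟩ := Nat.exists_eq_add_of_le' (show 8 ≤ k by omega)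
    refine ⟨by omega, Tri.of_wp_forall fun R hR => ?_⟩
    obtain ⟨h1, h2, h3⟩ := hf.slot v hvS r (by omega)
    set c := s.arr 24 (v * n + r) with hcdef
    have hcv : c ≠ v := by
      intro he
      rw [he] at h2
      exact hf.par_ne_self hvS h2
    -- The last child is taken, so `z = c` and the updates of `pos` and `ch` are void: the program
    -- only lowers the rank. As `v` is a root, it gets no mark.
    have hcut := hf.cut (c := c) (p := v) (z := c) h1 h2 hvn'.ne (by rw [hr]; exact hcdef.symm)
    rw [if_pos hvn, Function.update_eq_self, Function.update_eq_self, h3, hcdef,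
      Function.update_eq_self, ← hcdef, hr] at hcut
    have hroots := numRoots_update_of_child (S := S) (par := s.arr 20) h1 (by rw [h2]; exact hvn'.ne)
    have hsum := sum_update_add (f := s.arr 22) h1 0
    simp [wp, Op.eval, hv, h.n_eq, hr]
    rw [← hcdef]
    refine hR _ _ ⟨⟨?_, ?_, ?_, ?_, ?_, ?_⟩, ?_, ?_, ?_, ?_⟩
    · simpa using h.n_eq
    · exact ⟨ht, by simpa using hcut⟩
    · intro x hx hxn hpx
      simp only [setArr_arr, setReg_arr, setArr_reg, setReg_reg, Nat.reduceEqDiff, if_true,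
        if_false] at hpx ⊢
      by_cases hxc : x = c
      · subst hxc; simp at hpx
      · rw [Function.update_of_ne hxc] at hpx ⊢
        exact h.heap x hx hxn hpx
    · intro x hx hxn
      simp only [setArr_arr, setReg_arr, setArr_reg, setReg_reg, Nat.reduceEqDiff, if_true,
        if_false]
      by_cases hxc : x = c
      · subst hxc; simp
      · rw [Function.update_of_ne hxc]
        exact h.mk_le x hx hxn
    · intro i
      simp only [setArr_arr, setReg_arr, setArr_reg, setReg_reg, Nat.reduceEqDiff, if_true,
        if_false]
      by_cases hi : i = s.reg 20
      · subst hi; simpa using hf.lt c h1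
      · rw [Function.update_of_ne hi]
        exact h.list_lt i
    · simpa using h.slot_lt
    · exact hc.push (c := c) (by simp) (by simp) (by simp)
    · simpa using hv
    · simpa [Function.update_of_ne hcv.symm] using hvn
    · unfold fibPot at hk ⊢
      simp
      omega
  · clear hk hvn hv hc h k
    rintro k s' ⟨h, hc, hv, hvn, hk⟩ hlt
    rw [eval_lt_eq_zero] at hlt
    simp only [Expr.eval, hv] at hlt
    obtain ⟨ht, hf⟩ := h.forest
    have her := hf.erase hvS hvn (by omega)
    have hroots := numRoots_update_of_root (p := n + 1) hvS hvn (by omega)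
    have hroots' : numRoots n (S.erase v) (Function.update (s'.arr 20) v (n + 1)) ≤
        numRoots n S (Function.update (s'.arr 20) v (n + 1)) :=
      Finset.card_le_card (Finset.filter_subset_filter _ (Finset.erase_subset _ _))
    have hsum : ∑ x ∈ S.erase v, s'.arr 22 x ≤ ∑ x ∈ S, s'.arr 22 x :=
      Finset.sum_le_sum_of_subset (Finset.erase_subset _ _)
    obtain ⟨k, rfl⟩ := Nat.exists_eq_add_of_le' (show 2 ≤ k by omega)
    refine ⟨by omega, ?_⟩
    simp [Op.eval, hv, h.n_eq]
    refine hR _ _ ⟨fibPot n S s', by omega, ⟨⟨?_, ?_, ?_, ?_, ?_, ?_⟩, ?_, ?_⟩, ?_⟩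
    · simpa using h.n_eq
    · exact ⟨ht, by simpa using her⟩
    · intro x hx hxn hpx
      have hxv := Finset.ne_of_mem_erase hx
      simp only [setArr_arr, Nat.reduceEqDiff, if_true, if_false] at hpx ⊢
      rw [Function.update_of_ne hxv] at hpx ⊢
      exact h.heap x (Finset.mem_of_mem_erase hx) hxn hpx
    · intro x hx hxn
      simpa using h.mk_le x (Finset.mem_of_mem_erase hx) hxn
    · simpa using h.list_lt
    · simpa using h.slot_lt
    · intro x hx hxn
      have hxv := Finset.ne_of_mem_erase hx
      simp only [setArr_arr, setArr_reg, Nat.reduceEqDiff, if_true, if_false] at hxn ⊢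
      rw [Function.update_of_ne hxv] at hxn
      exact hc x (Finset.mem_of_mem_erase hx) hxn
    · unfold fibPot
      simp
      omega
    · simpa using hv

/-- Make the element in register 4 a root, and cut ancestors that have lost two children. -/
def fibDec : Cmd :=
  .set 23 (.var 4) ⨾
  .while (.eq (.eq (.get 20 (.var 23)) (.var 0)) (.const 0))
    (.set 24 (.get 20 (.var 23)) ⨾
     .put 21 (.var 24) (.get 21 (.var 24) ∸ .const 1) ⨾
     .set 25 (.get 24 (.var 24 ⨰ .var 0 ∔ .get 21 (.var 24))) ⨾
     .put 24 (.var 24 ⨰ .var 0 ∔ .get 23 (.var 23)) (.var 25) ⨾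
     .put 23 (.var 25) (.get 23 (.var 23)) ⨾
     .put 20 (.var 23) (.var 0) ⨾
     .put 22 (.var 23) (.const 0) ⨾
     .put 25 (.var 20) (.var 23) ⨾
     .set 20 (.var 20 ∔ .const 1) ⨾
     .ite (.eq (.get 20 (.var 24)) (.var 0)) .skip
      (.put 22 (.var 24) (.get 22 (.var 24) ∔ .const 1) ⨾
       .ite (.eq (.get 22 (.var 24)) (.const 2)) (.set 23 (.var 24)) .skip))

def fibExt : Cmd :=
  .call consolidateCmd ⨾ .call collectCmd ⨾ .call removeCmd

def fibInit : Cmd :=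
  .set 20 (.const 0) ⨾
  .while (.lt (.var 20) (.var 0))
    (.put 20 (.var 20) (.var 0) ⨾
     .put 25 (.var 20) (.var 20) ⨾
     .set 20 (.var 20 ∔ .const 1))

theorem numRoots_le {n : ℕ} {S : Finset ℕ} {s : Store} (h : Covered n S s) :
    numRoots n S (s.arr 20) ≤ s.reg 20 := by
  refine (Finset.card_le_card (t := (Finset.range (s.reg 20)).image (s.arr 25)) fun r hr => ?_).trans
    (Finset.card_image_le.trans (by simp))
  obtain ⟨hr, hrn⟩ := Finset.mem_filter.1 hr
  obtain ⟨i, hi, hir⟩ := h r hr hrn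
  exact Finset.mem_image.2 ⟨i, Finset.mem_range.2 hi, hir⟩

/-- All ranks are at most `3 log n + 2`, so per unit of `log n + 1` collecting costs 30, the new
list and its roots hold at most 96 of potential, and releasing the children of the minimum costs at
most 120. The old list and the old roots pay for the consolidation. -/
theorem fibExt_spec {M n : ℕ} {S : Finset ℕ} {Φ : ℕ} {s : Store} {k K : ℕ} (hI : FibInv n S Φ s)
    (hS : S.Nonempty) (hk : Φ + 254 * (Nat.log 2 n + 1) + K ≤ k) :
    Tri M fibExt s k fun k' s' => ∃ Φ', s'.reg 10 ∈ S ∧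
      (∀ u ∈ S, s.arr 6 (s'.reg 10) ≤ s.arr 6 u) ∧ FibInv n (S.erase (s'.reg 10)) Φ' s' ∧
      Φ' + K ≤ k' := by
  refine Tri.of_wp_forall fun R hR => ?_
  simp only [fibExt, wp]
  obtain ⟨h, hc, hΦ⟩ := hI
  unfold fibPot at hΦ
  refine Tri.framed (consolidateCmd_spec h hc (K := 48 * ∑ v ∈ S, s.arr 22 v +
    254 * (Nat.log 2 n + 1) - 3 + K) (by omega)) ?_
  rintro k₁ s₁ ⟨hk₁, h₁, hsl, hrk⟩ ⟨-, fa₁⟩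
  have e6 : s₁.arr 6 = s.arr 6 := fa₁ 6 (by simp [consolidateCmd, linkCmd])
  have e22 : s₁.arr 22 = s.arr 22 := fa₁ 22 (by simp [consolidateCmd, linkCmd])
  refine Tri.framed (collectCmd_spec h₁ hsl hS (K := 48 * ∑ v ∈ S, s.arr 22 v +
    224 * (Nat.log 2 n + 1) - 6 + K) (by omega)) ?_
  rintro k₂ s₂ ⟨hk₂, h₂, hc₂, hr₂, hvS, hvn, hmin⟩ ⟨-, fa₂⟩
  have e22' : s₂.arr 22 = s.arr 22 := by rw [← e22]; exact fa₂ 22 (by simp [collectCmd])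
  have hroots := numRoots_le hc₂
  obtain ⟨ht, hf⟩ := h₂.forest
  have hrk₂ := hf.rk_le (fun v hv => h₂.mk_le v hv (hf.lt v hv).ne) hvS
  refine (removeCmd_spec h₂ hc₂ rfl hvS hvn (K := K) ?_).mono ?_
  · unfold fibPot
    rw [e22']
    omega
  · rintro k₃ s₃ ⟨Φ', hk', hI', h10⟩
    refine hR _ _ ⟨Φ', ?_, ?_, ?_, hk'⟩
    · rw [h10]; exact hvS
    · rw [h10, ← e6]; exact hmin
    · rw [h10]; exact hI'

/-- One cut takes at most 16 steps and creates a list entry and a root, 48 credits altogether. A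
cascading cut at a vertex with two lost children frees 96 of potential: 48 for this cut and 48 for
the mark it puts on the parent. -/
theorem fibDec_spec {M n : ℕ} {S : Finset ℕ} {Φ : ℕ} {s : Store} {k K u x : ℕ}
    (hI : FibInv n S Φ s) (h4 : s.reg 4 = u) (hu : u ∈ S) (hx : x ≤ s.arr 6 u)
    (hk : Φ + 100 + K ≤ k) :
    Tri M fibDec (s.setArr 6 u x) k fun k' s' => ∃ Φ', FibInv n S Φ' s' ∧ Φ' + K ≤ k' := by
  refine Tri.of_wp_forall fun R hR => ?_
  obtain ⟨h, hc, hΦ⟩ := hI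
  obtain ⟨k, rfl⟩ := Nat.exists_eq_add_of_le' (show 1 ≤ k by omega)
  simp only [fibDec, wp]
  simp [h4]
  -- The summand `48 * (2 - mk)` lends the first cut the marks it lacks, at most 96 credits. Heap
  -- order and the mark bound may fail only at the vertex in register 23.
  refine Tri.while (fun k s => FibSt n S (s.reg 23) s ∧ Covered n S s ∧ s.reg 23 ∈ S ∧
    s.arr 22 (s.reg 23) ≤ 2 ∧
    fibPot n S s + (if s.arr 20 (s.reg 23) = n then 0 else 48 * (2 - s.arr 22 (s.reg 23))) + 1 + K
      ≤ k) ?_ ?_ ?_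
  · clear hR R hk hΦ hx hu h4 hc h s k u x
    rintro k s ⟨h, hc, hcS, hmk, hk⟩ hlt
    rw [ne_eq, eval_eq_eq_zero, not_not] at hlt
    simp only [Expr.eval.eq_1] at hlt
    rw [eval_eq_eq_zero] at hlt
    simp only [Expr.eval, h.n_eq] at hlt
    rw [if_neg hlt] at hk
    set c := s.reg 23 with hcdef
    set p := s.arr 20 c with hp
    obtain ⟨ht, hf⟩ := h.forest
    have hpS := hf.par_mem c hcS hlt
    have hpn := hf.lt p hpS
    have hpc : p ≠ c := hf.par_ne_self hcS
    obtain ⟨hpos, -⟩ := hf.child c hcS hlt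
    have hcut := hf.cut hcS rfl hlt rfl
    rw [← hp] at hcut
    have hroots := numRoots_update_of_child (S := S) (par := s.arr 20) hcS hlt
    have hsum := sum_update_add (f := s.arr 22) hcS 0
    have hmp := h.mk_le p hpS hpc
    have main : ∀ (x' mkp : ℕ) (s₂ : Store) (k₂ : ℕ), k ≤ k₂ + 14 → s₂.reg 0 = s.reg 0 →
        s₂.reg 20 = s.reg 20 + 1 → s₂.reg 23 = x' → s₂.arr 6 = s.arr 6 →
        s₂.arr 20 = Function.update (s.arr 20) c n →
        s₂.arr 21 = Function.update (s.arr 21) p (s.arr 21 p - 1) →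
        s₂.arr 22 = Function.update (Function.update (s.arr 22) c 0) p mkp →
        s₂.arr 23 = Function.update (s.arr 23) (s.arr 24 (p * n + (s.arr 21 p - 1))) (s.arr 23 c) →
        s₂.arr 24 = Function.update (s.arr 24) (p * n + s.arr 23 c)
          (s.arr 24 (p * n + (s.arr 21 p - 1))) →
        s₂.arr 25 = Function.update (s.arr 25) (s.reg 20) c → s₂.arr 26 = s.arr 26 →
        mkp = (if s.arr 20 p = n then s.arr 22 p else s.arr 22 p + 1) →
        ((x' = c ∧ mkp ≤ 1) ∨ (x' = p ∧ mkp = 2)) →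
        FibSt n S (s₂.reg 23) s₂ ∧ Covered n S s₂ ∧ s₂.reg 23 ∈ S ∧ s₂.arr 22 (s₂.reg 23) ≤ 2 ∧
          fibPot n S s₂ + (if s₂.arr 20 (s₂.reg 23) = n then 0 else
            48 * (2 - s₂.arr 22 (s₂.reg 23))) + 1 + K ≤ k₂ := by
      intro x' mkp s₂ k₂ hk₂ r0 r20 r23 a6 a20 a21 a22 a23 a24 a25 a26 hmkp hx'
      have hmkp' : mkp ≤ s.arr 22 p + 1 := by
        rw [hmkp]
        split_ifs <;> omega
      have hsum' := sum_update_add (f := Function.update (s.arr 22) c 0) hpS mkp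
      rw [← hp, Function.update_of_ne hpc] at hsum'
      have hx'2 : s₂.arr 22 x' ≤ 2 ∧ (s₂.arr 20 x' = n ∨ s₂.arr 22 x' = 2) := by
        rw [a22, a20]
        rcases hx' with ⟨rfl, -⟩ | ⟨rfl, h2⟩
        · simp [Function.update_of_ne hpc.symm]
        · simp [h2]
      refine ⟨⟨?_, ⟨ht, ?_⟩, ?_, ?_, ?_, ?_⟩, hc.push r20 a20 a25, ?_, ?_, ?_⟩
      · rw [r0]; exact h.n_eq
      · rw [a20, a21, a22, a23, a24, hmkp, Function.update_comm hpc.symm]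
        exact hcut
      · intro v hv _ hpv
        rw [a20] at hpv ⊢
        by_cases hvc : v = c
        · subst hvc; simp at hpv
        · rw [Function.update_of_ne hvc] at hpv ⊢
          rw [a6]
          exact h.heap v hv hvc hpv
      · intro v hv hvx
        rw [r23] at hvx
        rw [a22]
        by_cases hvp : v = p
        · subst hvp
          rw [Function.update_self]
          rcases hx' with ⟨-, h1⟩ | ⟨h1, -⟩
          · exact h1
          · exact absurd h1.symm hvx
        · rw [Function.update_of_ne hvp]
          by_cases hvc : v = c
          · subst hvc; simp
          · rw [Function.update_of_ne hvc]
            exact h.mk_le v hv hvc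
      · intro i
        rw [a25]
        by_cases hi : i = s.reg 20
        · subst hi; simpa using hf.lt c hcS
        · rw [Function.update_of_ne hi]
          exact h.list_lt i
      · rw [a26]; exact h.slot_lt
      · rw [r23]
        rcases hx' with ⟨rfl, -⟩ | ⟨rfl, -⟩ <;> assumption
      · rw [r23]; exact hx'2.1
      -- After a cut the vertex in register 23 is either a root or has its two marks, so nothing
      -- more has to be lent.
      · have hz : (if s₂.arr 20 (s₂.reg 23) = n then 0 else 48 * (2 - s₂.arr 22 (s₂.reg 23))) = 0 := by
          rw [r23]
          rcases hx'2.2 with h1 | h1 <;> simp [h1]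
        rw [hz]
        unfold fibPot at hk ⊢
        rw [r20, a20, a22, hroots]
        omega
    have hk16 : 16 ≤ k := by unfold fibPot at hk; omega
    obtain ⟨k, rfl⟩ := Nat.exists_eq_add_of_le' hk16
    refine ⟨by omega, Tri.of_wp_forall fun R hR => ?_⟩
    simp only [wp, ne_eq, eval_lt_eq_zero, eval_eq_eq_zero, not_not]
    simp [Op.eval, h.n_eq, ← hcdef, ← hp, Function.update_of_ne hpc]
    constructor
    · intro hpr
      refine hR _ _ (main c (s.arr 22 p) _ _ ?_ ?_ ?_ ?_ ?_ ?_ ?_ ?_ ?_ ?_ ?_ ?_ ?_ ?_)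
      · omega
      all_goals try simp [← hcdef]
      · exact Function.update_of_ne hpc _ _
      · exact hpr
      · exact Or.inl hmp
    · intro hpr
      constructor
      · intro hm
        refine hR _ _ (main p (s.arr 22 p + 1) _ _ ?_ ?_ ?_ ?_ ?_ ?_ ?_ ?_ ?_ ?_ ?_ ?_ ?_ ?_)
        · omega
        all_goals try simp [← hcdef]
        · simp [hpr]
        · omega
      · intro hm
        refine hR _ _ (main c (s.arr 22 p + 1) _ _ ?_ ?_ ?_ ?_ ?_ ?_ ?_ ?_ ?_ ?_ ?_ ?_ ?_ ?_)
        · omega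
        all_goals try simp [← hcdef]
        · simp [hpr]
        · omega
  · rintro k s' ⟨h, hc, hcS, hmk, hk⟩ hlt
    rw [eval_eq_eq_zero] at hlt
    simp only [Expr.eval.eq_1] at hlt
    rw [eval_eq_eq_zero, not_not] at hlt
    simp only [Expr.eval, h.n_eq] at hlt
    refine ⟨by omega, hR _ _ ⟨fibPot n S s', ⟨⟨h.n_eq, h.forest, ?_, ?_, h.list_lt, h.slot_lt⟩,
      hc, le_rfl⟩, by omega⟩⟩
    · intro v hv _ hpv
      refine h.heap v hv ?_ hpv
      rintro rfl
      exact hpv hlt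
    · intro v hv _
      by_cases hvx : v = s'.reg 23
      · obtain ⟨ht, hf⟩ := h.forest
        subst hvx
        rw [hf.mk_root _ hcS hlt]
        omega
      · exact h.mk_le v hv hvx
  · obtain ⟨ht, hf⟩ := h.forest
    have hun := hf.lt u hu
    refine ⟨⟨?_, ?_, ?_, ?_, ?_, ?_⟩, ?_, ?_, ?_, ?_⟩
    · simpa using h.n_eq
    · simpa using h.forest
    -- A smaller key at `u` can violate heap order only towards the parent of `u`, which is the
    -- permitted exception.
    · intro v hv hvu hpv
      simp only [setReg_arr, setArr_arr, setReg_reg, Nat.reduceEqDiff, if_true, if_false] at hvu hpv ⊢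
      rw [Function.update_of_ne hvu]
      have := h.heap v hv (hf.lt v hv).ne hpv
      by_cases hpu : s.arr 20 v = u
      · rw [hpu] at this ⊢
        simp only [Function.update_self]
        omega
      · rwa [Function.update_of_ne hpu]
    · intro v hv hvu
      simpa using h.mk_le v hv (hf.lt v hv).ne
    · simpa using h.list_lt
    · simpa using h.slot_lt
    · simpa [Covered] using hc
    · simpa using hu
    · have := h.mk_le u hu hun.ne
      simp
      omega
    · unfold fibPot at hΦ ⊢
      simp
      split_ifs <;> omega

theorem fib_spec (M n : ℕ) :
    PQSpec M (254 * (Nat.log 2 n + 1)) 100 (fun _ => True) fibExt fibDec (FibInv n) where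
  congr := by
    rintro S Φ s s' ⟨h1, h2, h3⟩ h6 hr ha
    refine ⟨h1.congr (hr 0 (by omega)) h6 (by simp [ha]), ?_, ?_⟩
    · intro r hrS hrn
      rw [ha 20 (by omega)] at hrn
      rw [hr 20 (by omega), ha 25 (by omega)]
      exact h2 r hrS hrn
    · unfold fibPot at h3 ⊢
      rwa [hr 20 (by omega), ha 20 (by omega), ha 22 (by omega)]
  ext_spec := fun hI hS hk => fibExt_spec hI hS hk
  dec_spec := fun hI h4 hu hx _ hk => fibDec_spec hI h4 hu hx hk
  ext_regs := by simp [fibExt, consolidateCmd, linkCmd, collectCmd, removeCmd]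
  ext_arrs := by simp [fibExt, consolidateCmd, linkCmd, collectCmd, removeCmd]
  dec_regs := by simp [fibDec]
  dec_arrs := by simp [fibDec]

/-- All vertices start as roots of rank zero on the list, which accounts for the potential `32 n`.
The untouched slots contain 0, a legal vertex number since `0 < n`. -/
theorem fibInit_spec {M n : ℕ} {s : Store} {k K : ℕ} (h0 : s.reg 0 = n) (hn : 0 < n)
    (h20 : ∀ A, 20 ≤ A → s.arr A = fun _ => 0) (hk : 4 * n + 2 + K ≤ k) :
    Tri M fibInit s k fun k' s' => K ≤ k' ∧ FibInv n (Finset.range n) (32 * n) s' := by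
  refine Tri.of_wp_forall fun R hR => ?_
  obtain ⟨k, rfl⟩ := Nat.exists_eq_add_of_le' (show 1 ≤ k by omega)
  simp only [fibInit, wp]
  simp [Op.eval, h0]
  refine Tri.while (fun k s' => s'.reg 0 = n ∧ s'.reg 20 ≤ n ∧
    4 * (n - s'.reg 20) + 1 + K ≤ k ∧ (∀ v < s'.reg 20, s'.arr 20 v = n ∧ s'.arr 25 v = v) ∧
    (∀ i, s'.arr 25 i < n) ∧ s'.arr 21 = (fun _ => 0) ∧ s'.arr 22 = (fun _ => 0) ∧
    s'.arr 26 = fun _ => 0) ?_ ?_ ?_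
  · clear hk h0 h20 k s hR R
    rintro k s ⟨h0, h20, hk, hv, hlt, a21, a22, a26⟩ hc
    simp [h0] at hc
    obtain ⟨k, rfl⟩ := Nat.exists_eq_add_of_le' (show 4 ≤ k by omega)
    refine ⟨by omega, Tri.of_wp_forall fun R hR => ?_⟩
    simp [wp, Op.eval, h0]
    refine hR _ _ ⟨by simpa using h0, ?_, ?_, ?_, ?_, ?_, ?_, ?_⟩
    · simpa using hc
    · simp; omega
    · intro v hv'
      simp at hv' ⊢
      by_cases hvi : v = s.reg 20
      · subst hvi; simp
      · rw [Function.update_of_ne hvi, Function.update_of_ne hvi]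
        exact hv v (by omega)
    · intro i
      simp
      by_cases hi : i = s.reg 20
      · subst hi; simpa using hc
      · rw [Function.update_of_ne hi]
        exact hlt i
    · simpa using a21
    · simpa using a22
    · simpa using a26
  · rintro k s' ⟨h0, h20, hk, hv, hlt, a21, a22, a26⟩ hc
    simp [h0] at hc
    have h20' : s'.reg 20 = n := by omega
    rw [h20'] at hv
    have hroot : ∀ v ∈ Finset.range n, s'.arr 20 v = n := fun v hv' =>
      (hv v (Finset.mem_range.1 hv')).1
    refine ⟨by omega, hR _ _ ⟨by omega, ⟨h0, ⟨fun _ => 0, ?_⟩, ?_, ?_, hlt, ?_⟩, ?_, ?_⟩⟩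
    · constructor
      · simp
      · intro v h1 h2; simp at h2; omega
      · intro v h1 h2; exact absurd (hroot v h1) h2
      · intro v h1 h2; exact absurd (hroot v h1) h2
      · simp [a21]
      · intro v h1 h2; exact absurd (hroot v h1) h2
      · simp [a22]
      · intro p hp j
        have : (Finset.range n).filter
            (fun c => s'.arr 20 c = p ∧ s'.arr 21 c + s'.arr 22 c ≤ j) = ∅ := by
          refine Finset.filter_eq_empty_iff.2 fun c hc h => ?_
          have := hroot c hc
          simp at hp
          omega
        simp [this]
    · intro v h1 _ h2; exact absurd (hroot v h1) h2
    · simp [a22]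
    · simp [a26, hn]
    · intro r hr _
      simp at hr
      exact ⟨r, by omega, (hv r hr).2⟩
    · have h1 : numRoots n (Finset.range n) (s'.arr 20) ≤ n :=
        (Finset.card_filter_le _ _).trans (by simp)
      unfold fibPot
      simp [a22, h20']
      omega
  · simp [h0, h20]
    exact ⟨by omega, hn⟩

/-! ## Loop-erased walks -/

section Paths

variable {V I : Type*}

/-- The list `p` of vertices, last vertex first, is a path along the arcs `f i` for `i` in `q`. -/
inductive PathTo (f : I → V × V) : List V → List I → Prop
  | nil : PathTo f [] []
  | single (v : V) : PathTo f [v] []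
  | cons {u v : V} {vs : List V} {q : List I} {e : I} : PathTo f (v :: vs) q → f e = (v, u) →
      PathTo f (u :: v :: vs) (e :: q)

theorem PathTo.congr {f g : I → V × V} {p : List V} {q : List I} (h : PathTo f p q)
    (hfg : ∀ i ∈ q, f i = g i) : PathTo g p q := by
  induction h with
  | nil => exact .nil
  | single v => exact .single v
  | cons h he ih =>
    exact .cons (ih fun i hi => hfg i (List.mem_cons_of_mem _ hi))
      ((hfg _ (List.mem_cons_self ..)).symm.trans he)

theorem PathTo.mem {f : I → V × V} {p : List V} {q : List I} (h : PathTo f p q) :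
    ∀ i ∈ q, (f i).1 ∈ p ∧ (f i).2 ∈ p := by
  induction h with
  | nil => simp
  | single v => simp
  | cons h he ih =>
    intro i hi
    rcases List.mem_cons.1 hi with rfl | hi
    · simp [he]
    · exact ⟨List.mem_cons_of_mem _ (ih i hi).1, List.mem_cons_of_mem _ (ih i hi).2⟩

theorem PathTo.tail {f : I → V × V} {v : V} {vs : List V} {q : List I} (h : PathTo f (v :: vs) q) :
    PathTo f vs q.tail := by
  cases h with
  | single => exact .nil
  | cons h he => exact h

/-- Only the last edge of a path is incident with its last vertex. -/
theorem PathTo.eq_head {f : I → V × V} {v : V} {vs : List V} {q : List I}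
    (h : PathTo f (v :: vs) q) (hn : (v :: vs).Nodup) {i : I} (hi : i ∈ q)
    (hv : v = (f i).1 ∨ v = (f i).2) : q = i :: q.tail ∧ (f i).2 = v := by
  cases h with
  | single => simp at hi
  | cons h he =>
    rcases List.mem_cons.1 hi with rfl | hi
    · exact ⟨rfl, by rw [he]⟩
    · have := h.mem i hi
      rw [List.nodup_cons] at hn
      rcases hv with hv | hv
      · exact absurd (hv ▸ this.1) hn.1
      · exact absurd (hv ▸ this.2) hn.1

theorem PathTo.tail_not_mem {f : I → V × V} {v : V} {vs : List V} {q : List I}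
    (h : PathTo f (v :: vs) q) (hn : (v :: vs).Nodup) {i : I} (hi : i ∈ q.tail) :
    v ≠ (f i).1 ∧ v ≠ (f i).2 := by
  have := h.tail.mem i hi
  rw [List.nodup_cons] at hn
  exact ⟨fun h => hn.1 (h ▸ this.1), fun h => hn.1 (h ▸ this.2)⟩

/-- The part of a path from one of its vertices to the end. -/
theorem PathTo.split {f : I → V × V} (G : SimpleGraph V) {l : List V} {u : V} {vs : List V}
    {q : List I} (h : PathTo f (l ++ u :: vs) q) (hn : (l ++ u :: vs).Nodup)
    (hG : ∀ i ∈ q, G.Adj (f i).1 (f i).2) :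
    ∃ ql q' v, ∃ W : G.Walk u v, q = ql ++ q' ∧ PathTo f (u :: vs) q' ∧
      (∃ w, l ++ u :: vs = v :: w) ∧ (∀ i ∈ ql, (f i).2 ∈ l) ∧ W.IsPath ∧
      (∀ x ∈ W.support, x ∈ l ++ [u]) ∧
      (∀ e, e ∈ W.edges ↔ ∃ i ∈ ql, s((f i).1, (f i).2) = e) ∧
      ∀ a, a ∈ W.darts.map (fun d => d.toProd) ↔ ∃ i ∈ ql, f i = a := by
  induction l generalizing q with
  | nil =>
    exact ⟨[], q, u, .nil, rfl, h, ⟨vs, rfl⟩, by simp, by simp, by simp, by simp, by simp⟩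
  | cons x l ih =>
    obtain ⟨y, w, hy⟩ : ∃ y w, l ++ u :: vs = y :: w := by
      cases l with
      | nil => exact ⟨u, vs, rfl⟩
      | cons y l => exact ⟨y, l ++ u :: vs, rfl⟩
    rw [List.cons_append, hy] at h hn
    cases h with
    | @cons _ _ _ q e h he =>
    rw [← hy] at h
    have hn' := hn
    rw [List.nodup_cons, ← hy] at hn'
    obtain ⟨ql, q', v, W, hq, hp, ⟨w', hw'⟩, hl, hW, hsup, hed, hda⟩ := ih h hn'.2
      fun i hi => hG i (List.mem_cons_of_mem _ hi)
    rw [hy] at hw'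
    obtain ⟨rfl, rfl⟩ := List.cons.inj hw'
    have hadj : G.Adj y x := by
      have := hG e (List.mem_cons_self ..)
      rwa [he] at this
    refine ⟨e :: ql, q', x, W.concat hadj, by rw [hq]; rfl, hp, ⟨_, rfl⟩, ?_, ?_, ?_, ?_, ?_⟩
    · intro i hi
      rcases List.mem_cons.1 hi with rfl | hi
      · simp [he]
      · exact List.mem_cons_of_mem _ (hl i hi)
    · refine hW.concat ?_ hadj
      intro hx
      have := hsup x hx
      refine hn'.1 ?_
      rw [List.mem_append, List.mem_singleton] at this
      rw [List.mem_append, List.mem_cons]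
      tauto
    · intro z hz
      rw [SimpleGraph.Walk.support_concat, List.mem_append,
        List.mem_singleton] at hz
      rcases hz with hz | rfl
      · exact List.mem_cons_of_mem _ (hsup z hz)
      · simp
    · intro z
      rw [SimpleGraph.Walk.edges_concat, List.concat_eq_append, List.mem_append, hed,
        List.mem_singleton]
      simp [he, or_comm, eq_comm]
    · intro z
      rw [SimpleGraph.Walk.darts_concat, List.concat_eq_append, List.map_append, List.mem_append,
        hda]
      simp [he, or_comm, eq_comm]

/-- The bottom part of the array `st` holds the list `p`, its last entry first. -/
def StackRep (enc : V → ℕ) (st : ℕ → ℕ) : List V → Prop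
  | [] => True
  | v :: vs => st vs.length = enc v ∧ StackRep enc st vs

theorem StackRep.update {enc : V → ℕ} {st : ℕ → ℕ} {p : List V} (h : StackRep enc st p) {j x : ℕ}
    (hj : p.length ≤ j) : StackRep enc (Function.update st j x) p := by
  induction p with
  | nil => trivial
  | cons v vs ih =>
    simp only [List.length_cons] at hj
    refine ⟨?_, ih h.2 (by omega)⟩
    rw [Function.update_of_ne (by omega)]
    exact h.1

theorem StackRep.of_append {enc : V → ℕ} {st : ℕ → ℕ} {l p : List V} (h : StackRep enc st (l ++ p)) :
    StackRep enc st p := by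
  induction l with
  | nil => exact h
  | cons v l ih => exact ih h.2

end Paths

/-! ### States of a loop-erased walk -/

section Walks

variable {V : Type*} [Fintype V] [DecidableEq V] {m : ℕ}

/-- The graph in which the walks take place: the vertices are encoded as the numbers below `N`, and
`L` gives the lists of incident edges. Edges `i` with `d₀ i ≠ 0` are ignored. -/
structure WalkGraph (enc : V → ℕ) (N : ℕ) (es : Fin m → V × V) (L : ℕ → List ℕ) (d₀ : ℕ → ℕ) :
    Prop where
  inj : Function.Injective enc
  lt : ∀ v, enc v < N
  surj : ∀ x < N, ∃ v, enc v = x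
  simple : Function.Injective fun i => s((es i).1, (es i).2)
  loopless : ∀ i, (es i).1 ≠ (es i).2
  inc : ∀ v, ∀ j ∈ L (enc v), ∃ i : Fin m, (i : ℕ) = j ∧ ((es i).1 = v ∨ (es i).2 = v)
  mem : ∀ i : Fin m, d₀ i = 0 → (i : ℕ) ∈ L (enc (es i).1) ∧ (i : ℕ) ∈ L (enc (es i).2)

/-- The state during the walks: `p` is the current path, with edges `q`. -/
structure WalkSt (enc : V → ℕ) (N st : ℕ) (es : Fin m → V × V) (L : ℕ → List ℕ) (d₀ o₀ : ℕ → ℕ)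
    (p : List V) (q : List (Fin m)) (s : Store) : Prop where
  N_eq : s.reg 14 = N
  st_eq : s.reg 11 = st
  tails : ∀ i : Fin m, s.arr 0 i = enc (es i).1
  heads : ∀ i : Fin m, s.arr 1 i = enc (es i).2
  rows : Rows st (s.arr 4) (s.arr 5) L
  stack : StackRep enc (s.arr 10) p
  nodup : p.Nodup
  path : PathTo (orient es (s.arr 3)) p q
  onp : ∀ v, s.arr 12 (enc v) ≠ 0 ↔ v ∈ p
  alive : ∀ v ∈ p, s.arr 7 (enc v) = 0
  ends : ∀ i : Fin m, (s.arr 8 i = 0 ∨ i ∈ q) →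
    s.arr 7 (enc (es i).1) = 0 ∧ s.arr 7 (enc (es i).2) = 0
  seen : ∀ v, ∀ j ∈ (L (enc v)).take (s.arr 13 (enc v)), s.arr 8 j ≠ 0
  ptr_le : ∀ v, s.arr 13 (enc v) ≤ (L (enc v)).length
  mono : ∀ i : Fin m, d₀ i ≠ 0 → s.arr 8 i ≠ 0
  used : ∀ i ∈ q, s.arr 8 i ≠ 0 ∧ d₀ i = 0
  out : ∀ i : Fin m, d₀ i ≠ 0 → s.arr 3 i = o₀ i

/-- The configuration that a state represents. -/
def walkCfg (enc : V → ℕ) (es : Fin m → V × V) (A₀ : Finset (V × V)) (d₀ : ℕ → ℕ)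
    (q : List (Fin m)) (s : Store) : Config V where
  verts := Finset.univ.filter fun v => s.arr 7 (enc v) = 0
  edges := (Finset.univ.filter fun i : Fin m => s.arr 8 i = 0 ∨ i ∈ q).image
    fun i => s((es i).1, (es i).2)
  arcs := A₀ ∪ (Finset.univ.filter fun i : Fin m => d₀ i = 0 ∧ s.arr 8 i ≠ 0 ∧ i ∉ q).image
    (orient es (s.arr 3))

variable {enc : V → ℕ} {N st : ℕ} {es : Fin m → V × V} {L : ℕ → List ℕ} {d₀ o₀ : ℕ → ℕ}
  {p : List V} {q : List (Fin m)} {s s' : Store}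

theorem orient_edge (es : Fin m → V × V) (out : ℕ → ℕ) (i : Fin m) :
    s((orient es out i).1, (orient es out i).2) = s((es i).1, (es i).2) := by
  unfold orient
  split_ifs
  · rfl
  · exact Sym2.eq_swap

theorem mem_orient (es : Fin m → V × V) (out : ℕ → ℕ) (i : Fin m) (v : V) :
    (v = (orient es out i).1 ∨ v = (orient es out i).2) ↔ (v = (es i).1 ∨ v = (es i).2) := by
  rw [← Sym2.mem_iff, orient_edge, Sym2.mem_iff]

/-- Closing a cycle. -/
theorem WalkSt.cycle (hw : WalkGraph enc N es L d₀) (h : WalkSt enc N st es L d₀ o₀ p q s)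
    {v u : V} {l vs w : List V} (hp : p = l ++ u :: vs) (hv : p = v :: w) {e : Fin m}
    (he : s.arr 8 e = 0) (hde : (es e = (v, u) ∧ s'.arr 3 e = 0) ∨ (es e = (u, v) ∧ s'.arr 3 e ≠ 0))
    (h7 : s'.arr 7 = s.arr 7) (h8 : s'.arr 8 = Function.update (s.arr 8) e 1)
    (h3 : ∀ i, i ≠ (e : ℕ) → s'.arr 3 i = s.arr 3 i) (A₀ : Finset (V × V)) :
    ∃ q', PathTo (orient es (s.arr 3)) (u :: vs) q' ∧ (∀ i ∈ q', i ∈ q) ∧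
      CycleStep (walkCfg enc es A₀ d₀ q s) (walkCfg enc es A₀ d₀ q' s') := by
  set c := walkCfg enc es A₀ d₀ q s with hc
  set G := SimpleGraph.fromEdgeSet (c.edges : Set (Sym2 V)) with hG
  have hadj : ∀ i : Fin m, (s.arr 8 i = 0 ∨ i ∈ q) →
      G.Adj (orient es (s.arr 3) i).1 (orient es (s.arr 3) i).2 := by
    intro i hi
    rw [hG, SimpleGraph.fromEdgeSet_adj]
    refine ⟨?_, ?_⟩
    · rw [orient_edge]
      simp only [hc, walkCfg, Finset.coe_image, Finset.coe_filter, Set.mem_image]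
      exact ⟨i, by simpa using hi, rfl⟩
    · have := hw.loopless i
      unfold orient
      split_ifs
      · exact this
      · exact this.symm
  have hn := h.nodup
  have hpath := h.path
  rw [hp] at hn hpath
  -- The path edges split at `u`: those in `ql` lead from `u` to `v` and form the cycle with `e`,
  -- those in `q'` remain on the path.
  obtain ⟨ql, q', v', W, hq, hp', ⟨w', hw'⟩, hl, hW, hsup, hed, hda⟩ :=
    hpath.split G hn fun i hi => hadj i (Or.inr hi)
  rw [← hp, hv] at hw'
  obtain ⟨rfl, rfl⟩ := List.cons.inj hw'
  have hue : orient es (s'.arr 3) e = (v, u) := by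
    unfold orient
    rcases hde with ⟨h1, h2⟩ | ⟨h1, h2⟩
    · rw [if_pos h2, h1]
    · rw [if_neg h2, h1]; rfl
  have hedge : s((es e).1, (es e).2) = s(v, u) := by
    rw [← orient_edge es (s'.arr 3), hue]
  have heq : e ∉ q := fun hi => (h.used e hi).1 he
  have hvu : G.Adj v u := by
    have h1 := hadj e (Or.inl he)
    rw [← SimpleGraph.mem_edgeSet, orient_edge, hedge] at h1
    exact h1
  have hd0 : d₀ e = 0 := by
    by_contra hne
    exact h.mono e hne he
  have hor : ∀ i, i ≠ e → orient es (s'.arr 3) i = orient es (s.arr 3) i := by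
    intro i hi
    unfold orient
    rw [h3 i fun h => hi (Fin.ext h)]
  have hdisj : ∀ i ∈ ql, i ∉ q' := by
    intro i hi hi'
    have h1 := hl i hi
    have h2 := (hp'.mem i hi').2
    exact (List.nodup_append.1 hn).2.2 _ h1 _ h2 rfl
  have hqm : ∀ i, i ∈ q ↔ i ∈ ql ∨ i ∈ q' := fun i => by rw [hq, List.mem_append]
  refine ⟨q', hp', fun i hi => (hqm i).2 (Or.inr hi), v, .cons hvu W, ?_, ?_⟩
  · rw [SimpleGraph.Walk.cons_isCycle_iff]
    refine ⟨hW, fun hm => ?_⟩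
    obtain ⟨i, hi, hie⟩ := (hed _).1 hm
    rw [orient_edge, ← hedge] at hie
    have := hw.simple hie
    subst this
    exact heq ((hqm i).2 (Or.inl hi))
  · have hset : ∀ i : Fin m, s'.arr 8 i = 0 ↔ s.arr 8 i = 0 ∧ i ≠ e := by
      intro i
      rw [h8]
      by_cases hi : i = e
      · subst hi; simp
      · rw [Function.update_of_ne fun h => hi (Fin.ext h)]
        simp [hi]
    rw [walkCfg, Config.mk.injEq]
    refine ⟨?_, ?_, ?_⟩
    · rw [h7]; rfl
    · ext f
      simp only [hc, walkCfg, Finset.mem_image, Finset.mem_filter, Finset.mem_univ, true_and,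
        Finset.mem_sdiff, List.mem_toFinset, SimpleGraph.Walk.edges_cons, List.mem_cons, hed,
        orient_edge, hset, not_or, not_exists, not_and]
      constructor
      · rintro ⟨i, hi, rfl⟩
        refine ⟨⟨i, ?_, rfl⟩, ?_, ?_⟩
        · rw [hqm]; tauto
        · rw [← hedge]
          intro h1
          have := hw.simple h1
          subst this
          rcases hi with hi | hi
          · exact hi.2 rfl
          · exact heq ((hqm i).2 (Or.inr hi))
        · intro j hj h1
          have := hw.simple h1
          subst this
          rcases hi with hi | hi
          · exact (h.used j ((hqm j).2 (Or.inl hj))).1 hi.1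
          · exact hdisj j hj hi
      · rintro ⟨⟨i, hi, rfl⟩, h1, h2⟩
        refine ⟨i, ?_, rfl⟩
        rw [hqm] at hi
        have h3 : i ∉ ql := fun h => h2 i h rfl
        have h4 : i ≠ e := by
          rintro rfl
          exact h1 hedge
        tauto
    · ext a
      simp only [hc, walkCfg, Finset.mem_union, Finset.mem_image, Finset.mem_filter,
        Finset.mem_univ, true_and, List.mem_toFinset, SimpleGraph.Walk.darts_cons, List.map_cons,
        List.mem_cons, hda, ne_eq, hset]
      constructor
      · rintro (ha | ⟨i, ⟨h1, h2, h3⟩, rfl⟩)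
        · exact Or.inl (Or.inl ha)
        · by_cases hie : i = e
          · subst hie
            exact Or.inr (Or.inl hue)
          · rw [hor i hie]
            by_cases hiq : i ∈ ql
            · exact Or.inr (Or.inr ((hda _).2 ⟨i, hiq, rfl⟩))
            · refine Or.inl (Or.inr ⟨i, ⟨h1, ?_, ?_⟩, rfl⟩)
              · tauto
              · rw [hqm]; tauto
      · rintro ((ha | ⟨i, ⟨h1, h2, h3⟩, rfl⟩) | (rfl | hm))
        · exact Or.inl ha
        · have hie : i ≠ e := by
            rintro rfl
            exact h2 he
          refine Or.inr ⟨i, ⟨h1, by tauto, ?_⟩, hor i hie⟩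
          rw [hqm] at h3
          tauto
        · refine Or.inr ⟨e, ⟨hd0, by simp, ?_⟩, hue⟩
          intro h1
          exact heq ((hqm e).2 (Or.inr h1))
        · obtain ⟨i, hi, rfl⟩ := (hda _).1 hm
          have hiq := (hqm i).2 (Or.inl hi)
          have hie : i ≠ e := by
            rintro rfl
            exact heq hiq
          refine Or.inr ⟨i, ⟨(h.used i hiq).2, ?_, hdisj i hi⟩, hor i hie⟩
          intro h1
          exact (h.used i hiq).1 h1.1

/-- Removing the last vertex of the path when all its edges have been used. -/
theorem WalkSt.finish (hw : WalkGraph enc N es L d₀) {v : V} {vs : List V}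
    (h : WalkSt enc N st es L d₀ o₀ (v :: vs) q s)
    (hptr : s.arr 13 (enc v) = (L (enc v)).length)
    (h7 : s'.arr 7 = Function.update (s.arr 7) (enc v) 1) (h8 : s'.arr 8 = s.arr 8)
    (h3 : s'.arr 3 = s.arr 3) (A₀ : Finset (V × V)) :
    (∀ i : Fin m, (s.arr 8 i = 0 ∨ i ∈ q.tail) → v ≠ (es i).1 ∧ v ≠ (es i).2) ∧
      ForestStep (walkCfg enc es A₀ d₀ q s) (walkCfg enc es A₀ d₀ q.tail s') := by
  set f := orient es (s.arr 3) with hf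
  -- The pointer has passed the whole incidence list, so no fresh edge is left at `v`.
  have hvd : ∀ i : Fin m, (v = (es i).1 ∨ v = (es i).2) → s.arr 8 i ≠ 0 := by
    intro i hi h0
    have hd : d₀ i = 0 := by
      by_contra hne
      exact h.mono i hne h0
    have hm := hw.mem i hd
    have hs := h.seen v i
    rw [hptr, List.take_length] at hs
    rcases hi with rfl | rfl
    · exact hs hm.1 h0
    · exact hs hm.2 h0
  have htail : ∀ i ∈ q.tail, v ≠ (es i).1 ∧ v ≠ (es i).2 := by
    intro i hi
    have := h.path.tail_not_mem h.nodup hi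
    rwa [← not_or, mem_orient, not_or] at this
  have hhead : ∀ i ∈ q, (v = (es i).1 ∨ v = (es i).2) → q = i :: q.tail ∧ (f i).2 = v := by
    intro i hi hiv
    exact h.path.eq_head h.nodup hi ((mem_orient es (s.arr 3) i v).2 hiv)
  have hqt : ∀ i ∈ q.tail, i ∈ q := fun i hi => List.mem_of_mem_tail hi
  refine ⟨?_, v, ?_, ?_, ?_⟩
  · rintro i (hi | hi)
    · rw [← not_or]
      exact fun h => hvd i h hi
    · exact htail i hi
  · simpa [walkCfg] using h.alive v (by simp)
  · unfold deg
    rw [Finset.card_le_one]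
    -- What remains at `v` can only be a path edge, and only the last one touches the last vertex.
    -- It is directed towards `v`, exactly as the forest step demands.
    have key : ∀ e ∈ (walkCfg enc es A₀ d₀ q s).edges.filter (fun e => v ∈ e),
        ∃ i, q = i :: q.tail ∧ s((es i).1, (es i).2) = e := by
      intro e he
      simp only [walkCfg, Finset.mem_filter, Finset.mem_image, Finset.mem_univ, true_and] at he
      obtain ⟨⟨i, hi, rfl⟩, hv⟩ := he
      rw [Sym2.mem_iff] at hv
      exact ⟨i, (hhead i (hi.resolve_left (hvd i hv)) hv).1, rfl⟩
    intro a ha b hb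
    obtain ⟨i, hi, rfl⟩ := key a ha
    obtain ⟨j, hj, rfl⟩ := key b hb
    rw [hi] at hj
    rw [(List.cons.inj hj).1]
  · rw [absorb, walkCfg, Config.mk.injEq]
    refine ⟨?_, ?_, ?_⟩
    · ext u
      simp only [walkCfg, h7, Finset.mem_filter, Finset.mem_univ, true_and, Finset.mem_erase]
      by_cases huv : u = v
      · subst huv; simp
      · rw [Function.update_of_ne (fun h => huv (hw.inj h))]
        simp [huv]
    · ext e
      simp only [walkCfg, h8, Finset.mem_filter, Finset.mem_image, Finset.mem_univ, true_and]
      constructor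
      · rintro ⟨i, hi, rfl⟩
        refine ⟨⟨i, hi.imp_right (hqt i), rfl⟩, ?_⟩
        rw [Sym2.mem_iff]
        rintro hv
        rcases hi with hi | hi
        · exact hvd i hv hi
        · have := htail i hi
          tauto
      · rintro ⟨⟨i, hi, rfl⟩, hv⟩
        rw [Sym2.mem_iff] at hv
        refine ⟨i, hi.imp_right fun hi => ?_, rfl⟩
        cases hq : q with
        | nil => rw [hq] at hi; simp at hi
        | cons j q₁ =>
          rw [hq] at hi
          rcases List.mem_cons.1 hi with rfl | hi
          · exfalso
            refine hv ((mem_orient es (s.arr 3) i v).1 (Or.inr ?_))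
            have hpath := h.path
            rw [hq] at hpath
            cases hpath with
            | cons _ he => rw [he]
          · exact hi
    · ext a
      simp only [walkCfg, h3, h8, Finset.mem_union, Finset.mem_image, Finset.mem_filter,
        Finset.mem_univ, true_and]
      constructor
      · rintro (ha | ⟨i, ⟨h1, h2, h3⟩, rfl⟩)
        · exact Or.inl (Or.inl ha)
        · by_cases hi : i ∈ q
          · have hpath := h.path
            cases hq : q with
            | nil => rw [hq] at hi; simp at hi
            | cons j q₁ =>
              rw [hq] at hi h3 hpath
              rcases List.mem_cons.1 hi with rfl | hi
              · cases hpath with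
                | @cons _ y _ _ _ _ he =>
                  refine Or.inr ⟨y, ⟨i, Or.inr (by simp), ?_⟩, he.symm⟩
                  rw [← orient_edge es (s.arr 3), he]
              · exact absurd hi h3
          · exact Or.inl (Or.inr ⟨i, ⟨h1, h2, hi⟩, rfl⟩)
      · rintro ((ha | ⟨i, ⟨h1, h2, h3⟩, rfl⟩) | ⟨u, ⟨i, hi, hu⟩, rfl⟩)
        · exact Or.inl ha
        · exact Or.inr ⟨i, ⟨h1, h2, fun h => h3 (hqt i h)⟩, rfl⟩
        · have hv : v = (es i).1 ∨ v = (es i).2 := by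
            rw [← Sym2.mem_iff, hu]
            simp
          have hiq := hi.resolve_left (hvd i hv)
          obtain ⟨h1, h2⟩ := hhead i hiq hv
          refine Or.inr ⟨i, ⟨(h.used i hiq).2, (h.used i hiq).1, ?_⟩, ?_⟩
          · intro ht
            have := htail i ht
            tauto
          · have h3 := orient_edge es (s.arr 3) i
            rw [hu, Sym2.eq_iff] at h3
            have hl := hw.loopless i
            rcases h3 with ⟨h3, h4⟩ | ⟨h3, h4⟩
            · exact Prod.ext h3 h4
            · exfalso
              rw [← hf] at h4
              rw [h2] at h4
              rw [Sym2.eq_iff] at hu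
              subst h4
              rcases hu with ⟨h5, h6⟩ | ⟨h5, h6⟩
              · exact hl (h5.trans h6.symm)
              · exact hl (h5.trans h6.symm)

end Walks

/-! ## The walking program -/

section Walks

variable {V : Type*} [Fintype V] [DecidableEq V] {m : ℕ}
  {enc : V → ℕ} {N st : ℕ} {es : Fin m → V × V} {L : ℕ → List ℕ} {d₀ o₀ : ℕ → ℕ}
  {p : List V} {q : List (Fin m)} {s s' : Store} {A₀ : Finset (V × V)} {c₀ : Config V}

/-- The parts of the store that do not change during the walks. -/
def WalkFrame (s s' : Store) : Prop :=
  s'.reg 14 = s.reg 14 ∧ s'.reg 11 = s.reg 11 ∧ s'.arr 0 = s.arr 0 ∧ s'.arr 1 = s.arr 1 ∧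
    s'.arr 4 = s.arr 4 ∧ s'.arr 5 = s.arr 5

/-- The state `s` is reached from `c₀` while the current path is `p`. -/
def Walking (enc : V → ℕ) (N st : ℕ) (es : Fin m → V × V) (L : ℕ → List ℕ) (d₀ o₀ : ℕ → ℕ)
    (A₀ : Finset (V × V)) (c₀ : Config V) (p : List V) (s : Store) : Prop :=
  ∃ q, WalkSt enc N st es L d₀ o₀ p q s ∧
    Relation.ReflTransGen FinishStep c₀ (walkCfg enc es A₀ d₀ q s)

theorem seen_advance (hinj : Function.Injective enc) (h : WalkSt enc N st es L d₀ o₀ p q s) {v : V}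
    (hlt : s.arr 13 (enc v) < (L (enc v)).length)
    (h13 : s'.arr 13 = Function.update (s.arr 13) (enc v) (s.arr 13 (enc v) + 1))
    (hmono : ∀ j, s.arr 8 j ≠ 0 → s'.arr 8 j ≠ 0)
    (he : s'.arr 8 ((L (enc v))[s.arr 13 (enc v)]) ≠ 0) :
    (∀ v, ∀ j ∈ (L (enc v)).take (s'.arr 13 (enc v)), s'.arr 8 j ≠ 0) ∧
      ∀ v, s'.arr 13 (enc v) ≤ (L (enc v)).length := by
  constructor
  · intro x j hj
    rw [h13] at hj
    by_cases hx : x = v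
    · subst hx
      rw [Function.update_self, List.take_succ_eq_append_getElem hlt, List.mem_append,
        List.mem_singleton] at hj
      rcases hj with hj | rfl
      · exact hmono j (h.seen x j hj)
      · exact he
    · rw [Function.update_of_ne fun h => hx (hinj h)] at hj
      exact hmono j (h.seen x j hj)
  · intro x
    rw [h13]
    by_cases hx : x = v
    · subst hx
      rw [Function.update_self]
      omega
    · rw [Function.update_of_ne fun h => hx (hinj h)]
      exact h.ptr_le x

/-- Passing over a used edge. -/
theorem Walking.pass (hw : WalkGraph enc N es L d₀)
    (h : Walking enc N st es L d₀ o₀ A₀ c₀ p s) {v : V} (hf : WalkFrame s s')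
    (hlt : s.arr 13 (enc v) < (L (enc v)).length)
    (he : s.arr 8 ((L (enc v))[s.arr 13 (enc v)]) ≠ 0)
    (h13 : s'.arr 13 = Function.update (s.arr 13) (enc v) (s.arr 13 (enc v) + 1))
    (h3 : s'.arr 3 = s.arr 3) (h7 : s'.arr 7 = s.arr 7) (h8 : s'.arr 8 = s.arr 8)
    (h10 : s'.arr 10 = s.arr 10) (h12 : s'.arr 12 = s.arr 12) :
    Walking enc N st es L d₀ o₀ A₀ c₀ p s' := by
  obtain ⟨q, h, hr⟩ := h
  obtain ⟨hs1, hs2⟩ := seen_advance hw.inj h hlt h13 (fun j => by rw [h8]; exact id)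
    (by rw [h8]; exact he)
  obtain ⟨f1, f2, f3, f4, f5, f6⟩ := hf
  refine ⟨q, ⟨?_, ?_, ?_, ?_, ?_, ?_, h.nodup, ?_, ?_, ?_, ?_, hs1, hs2, ?_, ?_, ?_⟩, ?_⟩
  · rw [f1]; exact h.N_eq
  · rw [f2]; exact h.st_eq
  · rw [f3]; exact h.tails
  · rw [f4]; exact h.heads
  · rw [f5, f6]; exact h.rows
  · rw [h10]; exact h.stack
  · rw [h3]; exact h.path
  · rw [h12]; exact h.onp
  · rw [h7]; exact h.alive
  · rw [h7, h8]; exact h.ends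
  · rw [h8]; exact h.mono
  · rw [h8]; exact h.used
  · rw [h3]; exact h.out
  · have : walkCfg enc es A₀ d₀ q s' = walkCfg enc es A₀ d₀ q s := by
      simp only [walkCfg, h3, h7, h8]
    rw [this]
    exact hr

/-- Extending the path. -/
theorem Walking.push (hw : WalkGraph enc N es L d₀) {v u : V} {vs : List V}
    (h : Walking enc N st es L d₀ o₀ A₀ c₀ (v :: vs) s) (hf : WalkFrame s s')
    (hlt : s.arr 13 (enc v) < (L (enc v)).length) {e : Fin m}
    (heL : (L (enc v))[s.arr 13 (enc v)] = e) (he : s.arr 8 e = 0)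
    (hde : (es e = (v, u) ∧ s'.arr 3 e = 0) ∨ (es e = (u, v) ∧ s'.arr 3 e ≠ 0))
    (hu : s.arr 12 (enc u) = 0)
    (h13 : s'.arr 13 = Function.update (s.arr 13) (enc v) (s.arr 13 (enc v) + 1))
    (h3 : ∀ i, i ≠ (e : ℕ) → s'.arr 3 i = s.arr 3 i) (h7 : s'.arr 7 = s.arr 7)
    (h8 : s'.arr 8 = Function.update (s.arr 8) e 1)
    (h10 : s'.arr 10 = Function.update (s.arr 10) (vs.length + 1) (enc u))
    (h12 : s'.arr 12 = Function.update (s.arr 12) (enc u) 1) :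
    Walking enc N st es L d₀ o₀ A₀ c₀ (u :: v :: vs) s' := by
  obtain ⟨q, h, hr⟩ := h
  have hmono : ∀ j, s.arr 8 j ≠ 0 → s'.arr 8 j ≠ 0 := by
    intro j hj
    rw [h8, Function.update_apply]
    split
    · simp
    · exact hj
  have hset : ∀ i : Fin m, s'.arr 8 i = 0 ↔ s.arr 8 i = 0 ∧ i ≠ e := by
    intro i
    rw [h8]
    by_cases hi : i = e
    · subst hi; simp
    · rw [Function.update_of_ne fun h => hi (Fin.ext h)]
      simp [hi]
  obtain ⟨hs1, hs2⟩ := seen_advance hw.inj h hlt h13 hmono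
    (by rw [heL, h8]; simp)
  have hup : u ∉ v :: vs := fun hm => (h.onp u).2 hm hu
  have heq : e ∉ q := fun hi => (h.used e hi).1 he
  have hd0 : d₀ e = 0 := by
    by_contra hne
    exact h.mono e hne he
  have hue : orient es (s'.arr 3) e = (v, u) := by
    unfold orient
    rcases hde with ⟨h1, h2⟩ | ⟨h1, h2⟩
    · rw [if_pos h2, h1]
    · rw [if_neg h2, h1]; rfl
  have hor : ∀ i, i ≠ e → orient es (s'.arr 3) i = orient es (s.arr 3) i := by
    intro i hi
    unfold orient
    rw [h3 i fun h => hi (Fin.ext h)]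
  have hends := h.ends e (Or.inl he)
  have hualive : s.arr 7 (enc u) = 0 := by
    rcases hde with ⟨h1, h2⟩ | ⟨h1, h2⟩
    · rw [h1] at hends; exact hends.2
    · rw [h1] at hends; exact hends.1
  have hm : ∀ i : Fin m, (s'.arr 8 i = 0 ∨ i ∈ e :: q) ↔ (s.arr 8 i = 0 ∨ i ∈ q) := by
    intro i
    rw [hset, List.mem_cons]
    by_cases hi : i = e
    · subst hi; simp [he]
    · simp [hi]
  obtain ⟨f1, f2, f3, f4, f5, f6⟩ := hf
  refine ⟨e :: q, ⟨?_, ?_, ?_, ?_, ?_, ?_, ?_, ?_, ?_, ?_, ?_, hs1, hs2, ?_, ?_, ?_⟩, ?_⟩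
  · rw [f1]; exact h.N_eq
  · rw [f2]; exact h.st_eq
  · rw [f3]; exact h.tails
  · rw [f4]; exact h.heads
  · rw [f5, f6]; exact h.rows
  · rw [h10]
    exact ⟨by simp, h.stack.update (by simp)⟩
  · exact List.nodup_cons.2 ⟨hup, h.nodup⟩
  · refine .cons (h.path.congr fun i hi => (hor i ?_).symm) hue
    rintro rfl
    exact heq hi
  · intro x
    rw [h12, List.mem_cons]
    by_cases hx : x = u
    · subst hx; simp
    · rw [Function.update_of_ne fun h => hx (hw.inj h), h.onp]
      simp [hx]
  · rw [h7]
    intro x hx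
    rcases List.mem_cons.1 hx with rfl | hx
    · exact hualive
    · exact h.alive x hx
  · intro i hi
    rw [h7]
    exact h.ends i ((hm i).1 hi)
  · exact fun i hi => hmono _ (h.mono i hi)
  · intro i hi
    rcases List.mem_cons.1 hi with rfl | hi
    · exact ⟨by rw [h8]; simp, hd0⟩
    · exact ⟨hmono _ (h.used i hi).1, (h.used i hi).2⟩
  · intro i hi
    rw [h3]
    · exact h.out i hi
    · intro hie
      rw [hie] at hi
      exact hi hd0
  -- Edges on the path still count as remaining and their direction as undecided, so extending the
  -- path is no step of the procedure.
  · have : walkCfg enc es A₀ d₀ (e :: q) s' = walkCfg enc es A₀ d₀ q s := by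
      rw [walkCfg, walkCfg, Config.mk.injEq]
      refine ⟨by rw [h7], ?_, ?_⟩
      · congr 1
        ext i
        simp only [Finset.mem_filter, Finset.mem_univ, true_and]
        exact hm i
      · congr 1
        ext a
        simp only [Finset.mem_image, Finset.mem_filter, Finset.mem_univ, true_and]
        have hne : ∀ i : Fin m, d₀ i = 0 ∧ s.arr 8 i ≠ 0 ∧ i ∉ q → i ≠ e := by
          rintro i hi rfl
          exact hi.2.1 he
        constructor
        · rintro ⟨i, ⟨h1, h2, h4⟩, rfl⟩
          have h5 : i ≠ e := fun h => h4 (h ▸ List.mem_cons_self ..)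
          refine ⟨i, ⟨h1, fun h6 => h2 ((hset i).2 ⟨h6, h5⟩),
            fun h => h4 (List.mem_cons_of_mem _ h)⟩, (hor i h5).symm⟩
        · rintro ⟨i, hi, rfl⟩
          refine ⟨i, ⟨hi.1, hmono _ hi.2.1, ?_⟩, hor i (hne i hi)⟩
          rw [List.mem_cons]
          exact not_or.2 ⟨hne i hi, hi.2.2⟩
    rw [this]
    exact hr

/-- Closing a cycle and returning to its first vertex on the path. -/
theorem Walking.close (hw : WalkGraph enc N es L d₀) {v u : V} {l vs w : List V}
    (h : Walking enc N st es L d₀ o₀ A₀ c₀ p s) (hp : p = l ++ u :: vs) (hv : p = v :: w)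
    (hf : WalkFrame s s')
    (hlt : s.arr 13 (enc v) < (L (enc v)).length) {e : Fin m}
    (heL : (L (enc v))[s.arr 13 (enc v)] = e) (he : s.arr 8 e = 0)
    (hde : (es e = (v, u) ∧ s'.arr 3 e = 0) ∨ (es e = (u, v) ∧ s'.arr 3 e ≠ 0))
    (h13 : s'.arr 13 = Function.update (s.arr 13) (enc v) (s.arr 13 (enc v) + 1))
    (h3 : ∀ i, i ≠ (e : ℕ) → s'.arr 3 i = s.arr 3 i) (h7 : s'.arr 7 = s.arr 7)
    (h8 : s'.arr 8 = Function.update (s.arr 8) e 1) (h10 : s'.arr 10 = s.arr 10)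
    (h12 : ∀ x, s'.arr 12 (enc x) ≠ 0 ↔ x ∈ u :: vs) :
    Walking enc N st es L d₀ o₀ A₀ c₀ (u :: vs) s' := by
  obtain ⟨q, h, hr⟩ := h
  obtain ⟨q', hq', hsub, hcyc⟩ := h.cycle hw hp hv he hde h7 h8 h3 A₀
  have hmono : ∀ j, s.arr 8 j ≠ 0 → s'.arr 8 j ≠ 0 := by
    intro j hj
    rw [h8, Function.update_apply]
    split
    · simp
    · exact hj
  obtain ⟨hs1, hs2⟩ := seen_advance hw.inj h hlt h13 hmono
    (by rw [heL, h8]; simp)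
  have hd0 : d₀ e = 0 := by
    by_contra hne
    exact h.mono e hne he
  obtain ⟨f1, f2, f3, f4, f5, f6⟩ := hf
  refine ⟨q', ⟨?_, ?_, ?_, ?_, ?_, ?_, ?_, ?_, h12, ?_, ?_, hs1, hs2, ?_, ?_, ?_⟩,
    hr.tail (Or.inl hcyc)⟩
  · rw [f1]; exact h.N_eq
  · rw [f2]; exact h.st_eq
  · rw [f3]; exact h.tails
  · rw [f4]; exact h.heads
  · rw [f5, f6]; exact h.rows
  · rw [h10]
    have := h.stack
    rw [hp] at this
    exact this.of_append
  · have := h.nodup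
    rw [hp] at this
    exact (List.nodup_append.1 this).2.1
  · refine hq'.congr fun i hi => ?_
    unfold orient
    rw [h3 i]
    intro h1
    have h2 := (h.used i (hsub i hi)).1
    rw [h1] at h2
    exact h2 he
  · intro x hx
    rw [h7]
    refine h.alive x ?_
    rw [hp]
    exact List.mem_append_right _ hx
  · intro i hi
    rw [h7]
    refine h.ends i ?_
    rcases hi with hi | hi
    · left
      by_contra hne
      exact hmono _ hne hi
    · exact Or.inr (hsub i hi)
  · exact fun i hi => hmono _ (h.mono i hi)
  · intro i hi
    have := h.used i (hsub i hi)
    exact ⟨hmono _ this.1, this.2⟩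
  · intro i hi
    rw [h3]
    · exact h.out i hi
    · intro hie
      rw [hie] at hi
      exact hi hd0

/-- Removing the last vertex of the path. -/
theorem Walking.retire (hw : WalkGraph enc N es L d₀) {v : V} {vs : List V}
    (h : Walking enc N st es L d₀ o₀ A₀ c₀ (v :: vs) s) (hf : WalkFrame s s')
    (hptr : s.arr 13 (enc v) = (L (enc v)).length)
    (h3 : s'.arr 3 = s.arr 3) (h7 : s'.arr 7 = Function.update (s.arr 7) (enc v) 1)
    (h8 : s'.arr 8 = s.arr 8) (h10 : s'.arr 10 = s.arr 10)
    (h12 : s'.arr 12 = Function.update (s.arr 12) (enc v) 0) (h13 : s'.arr 13 = s.arr 13) :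
    Walking enc N st es L d₀ o₀ A₀ c₀ vs s' := by
  obtain ⟨q, h, hr⟩ := h
  obtain ⟨hfree, hstep⟩ := h.finish hw hptr h7 h8 h3 A₀
  have hvn : v ∉ vs := (List.nodup_cons.1 h.nodup).1
  obtain ⟨f1, f2, f3, f4, f5, f6⟩ := hf
  refine ⟨q.tail, ⟨?_, ?_, ?_, ?_, ?_, ?_, ?_, ?_, ?_, ?_, ?_, ?_, ?_, ?_, ?_, ?_⟩,
    hr.tail (Or.inr hstep)⟩
  · rw [f1]; exact h.N_eq
  · rw [f2]; exact h.st_eq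
  · rw [f3]; exact h.tails
  · rw [f4]; exact h.heads
  · rw [f5, f6]; exact h.rows
  · rw [h10]; exact h.stack.2
  · exact (List.nodup_cons.1 h.nodup).2
  · rw [h3]; exact h.path.tail
  · intro x
    rw [h12]
    by_cases hx : x = v
    · subst hx; simp [hvn]
    · rw [Function.update_of_ne fun h => hx (hw.inj h), h.onp]
      simp [hx]
  · intro x hx
    rw [h7, Function.update_of_ne]
    · exact h.alive x (List.mem_cons_of_mem _ hx)
    · intro h1
      rw [hw.inj h1] at hx
      exact hvn hx
  · intro i hi
    rw [h8] at hi
    obtain ⟨n1, n2⟩ := hfree i hi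
    rw [h7, Function.update_of_ne fun h => n1 (hw.inj h).symm,
      Function.update_of_ne fun h => n2 (hw.inj h).symm]
    exact h.ends i (hi.imp_right List.mem_of_mem_tail)
  · rw [h8, h13]; exact h.seen
  · rw [h13]; exact h.ptr_le
  · rw [h8]; exact h.mono
  · intro i hi
    rw [h8]
    exact h.used i (List.mem_of_mem_tail hi)
  · rw [h3]; exact h.out

/-- Starting a path at a vertex. -/
theorem Walking.start (hw : WalkGraph enc N es L d₀) {v : V}
    (h : Walking enc N st es L d₀ o₀ A₀ c₀ [] s) (hf : WalkFrame s s') (hv : s.arr 7 (enc v) = 0)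
    (h3 : s'.arr 3 = s.arr 3) (h7 : s'.arr 7 = s.arr 7)
    (h8 : s'.arr 8 = s.arr 8) (h10 : s'.arr 10 0 = enc v)
    (h12 : s'.arr 12 = Function.update (s.arr 12) (enc v) 1) (h13 : s'.arr 13 = s.arr 13) :
    Walking enc N st es L d₀ o₀ A₀ c₀ [v] s' := by
  obtain ⟨q, h, hr⟩ := h
  obtain rfl : q = [] := by
    have := h.path
    cases this
    rfl
  obtain ⟨f1, f2, f3, f4, f5, f6⟩ := hf
  refine ⟨[], ⟨?_, ?_, ?_, ?_, ?_, ?_, ?_, ?_, ?_, ?_, ?_, ?_, ?_, ?_, ?_, ?_⟩, ?_⟩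
  · rw [f1]; exact h.N_eq
  · rw [f2]; exact h.st_eq
  · rw [f3]; exact h.tails
  · rw [f4]; exact h.heads
  · rw [f5, f6]; exact h.rows
  · exact ⟨h10, trivial⟩
  · simp
  · exact .single v
  · intro x
    have := h.onp x
    rw [h12]
    by_cases hx : x = v
    · subst hx; simp
    · rw [Function.update_of_ne fun h => hx (hw.inj h), h.onp]
      simp [hx]
  · simpa [h7] using hv
  · rw [h7, h8]; exact h.ends
  · rw [h8, h13]; exact h.seen
  · rw [h13]; exact h.ptr_le
  · rw [h8]; exact h.mono
  · simp
  · rw [h3]; exact h.out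
  · have : walkCfg enc es A₀ d₀ [] s' = walkCfg enc es A₀ d₀ [] s := by
      simp only [walkCfg, h3, h7, h8]
    rw [this]
    exact hr

theorem Walking.congr (h : Walking enc N st es L d₀ o₀ A₀ c₀ p s)
    (hr : ∀ r ∈ [11, 14], s'.reg r = s.reg r) (ha : s'.arr = s.arr) :
    Walking enc N st es L d₀ o₀ A₀ c₀ p s' := by
  simp at hr
  obtain ⟨q, h, hq⟩ := h
  refine ⟨q, ?_, ?_⟩
  · obtain ⟨h1, h2, h3, h4, h5, h6, h7, h8, h9, h10, h11, h12, h13, h14, h15, h16⟩ := h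
    constructor <;> first | assumption | (simp only [ha, hr]; assumption)
  · have : walkCfg enc es A₀ d₀ q s' = walkCfg enc es A₀ d₀ q s := by
      simp only [walkCfg, ha]
    rw [this]
    exact hq

end Walks

/-- Shorten the path until the vertex in register 4 is its last one. -/
def popCmd : Cmd :=
  .while (.eq (.eq (.get 10 (.var 15)) (.var 4)) (.const 0))
    (.put 12 (.get 10 (.var 15)) (.const 0) ⨾
     .set 15 (.var 15 ∸ .const 1))

/-- Continue the walk by one edge, or remove the last vertex of the path. -/
def walkStepCmd : Cmd :=
  .set 3 (.get 10 (.var 15)) ⨾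
  .ite (.lt (.get 13 (.var 3)) (.get 4 (.var 3)))
    (.set 12 (.get 5 (.var 3 ⨰ .var 11 ∔ .get 13 (.var 3))) ⨾
     .put 13 (.var 3) (.get 13 (.var 3) ∔ .const 1) ⨾
     .ite (.eq (.get 8 (.var 12)) (.const 0))
      (.put 8 (.var 12) (.const 1) ⨾
       .set 4 (.get 0 (.var 12) ∔ .get 1 (.var 12) ∸ .var 3) ⨾
       .put 3 (.var 12) (.eq (.eq (.get 0 (.var 12)) (.var 3)) (.const 0)) ⨾
       .ite (.eq (.get 12 (.var 4)) (.const 0))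
        (.set 15 (.var 15 ∔ .const 1) ⨾
         .put 10 (.var 15) (.var 4) ⨾
         .put 12 (.var 4) (.const 1))
        (.call popCmd))
      .skip)
    (.put 12 (.var 3) (.const 0) ⨾
     .put 7 (.var 3) (.const 1) ⨾
     .ite (.eq (.var 15) (.const 0))
      (.set 9 (.const 0))
      (.set 15 (.var 15 ∸ .const 1)))

/-- Walk until no vertex is left. -/
def walkCmd : Cmd :=
  .set 2 (.const 0) ⨾
  .while (.lt (.var 2) (.var 14))
    (.ite (.eq (.get 7 (.var 2)) (.const 0))
      (.set 15 (.const 0) ⨾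
       .put 10 (.const 0) (.var 2) ⨾
       .put 12 (.var 2) (.const 1) ⨾
       .set 9 (.const 1) ⨾
       .while (.var 9) (.call walkStepCmd))
      .skip ⨾
     .set 2 (.var 2 ∔ .const 1))

/-! ### Correctness and cost of the walking program -/

section Walks

variable {V : Type*} [Fintype V] [DecidableEq V] {m : ℕ}
  {enc : V → ℕ} {N st : ℕ} {es : Fin m → V × V} {L : ℕ → List ℕ} {d₀ o₀ : ℕ → ℕ}
  {p : List V} {q : List (Fin m)} {s s' : Store} {A₀ : Finset (V × V)} {c₀ : Config V}

theorem popCmd_spec {M k K : ℕ} (hinj : Function.Injective enc) {l vs : List V} {u : V}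
    (h4 : s.reg 4 = enc u) (h15 : s.reg 15 = l.length + vs.length)
    (hst : StackRep enc (s.arr 10) (l ++ u :: vs)) (hn : (l ++ u :: vs).Nodup)
    (h12 : ∀ x, s.arr 12 (enc x) ≠ 0 ↔ x ∈ l ++ u :: vs) (hk : 3 * l.length + 1 + K ≤ k) :
    Tri M popCmd s k fun k' s' => K ≤ k' ∧ s'.reg 15 = vs.length ∧
      ∀ x, s'.arr 12 (enc x) ≠ 0 ↔ x ∈ u :: vs := by
  refine Tri.while (fun k' s' => ∃ l : List V, s'.reg 4 = enc u ∧
    s'.reg 15 = l.length + vs.length ∧ StackRep enc (s'.arr 10) (l ++ u :: vs) ∧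
    (l ++ u :: vs).Nodup ∧ (∀ x, s'.arr 12 (enc x) ≠ 0 ↔ x ∈ l ++ u :: vs) ∧
    3 * l.length + 1 + K ≤ k') ?_ ?_ ⟨l, h4, h15, hst, hn, h12, hk⟩
  · rintro k s ⟨l, h4, h15, hst, hn, h12, hk⟩ hc
    rw [ne_eq, eval_eq_eq_zero, not_not] at hc
    replace hc := eval_eq_eq_zero.1 (show _ = 0 from hc)
    simp only [Expr.eval, h4, h15] at hc
    cases l with
    | nil => exact absurd hst.1 (by simpa using hc)
    | cons y l =>
      simp only [List.length_cons] at h15 hk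
      have hy : s.arr 10 (l.length + 1 + vs.length) = enc y := by
        have := hst.1
        rw [← this]
        congr 1
        simp
        omega
      obtain ⟨k, rfl⟩ := Nat.exists_eq_add_of_le' (show 3 ≤ k by omega)
      refine ⟨by omega, Tri.of_wp_forall fun R hR => ?_⟩
      simp [wp, Op.eval, h15, hy]
      refine hR _ _ ⟨l, ?_, ?_, ?_, ?_, ?_, ?_⟩
      · simpa using h4
      · simp
      · simpa using hst.2
      · exact (List.nodup_cons.1 hn).2
      · intro x
        have hyn := (List.nodup_cons.1 hn).1
        have hx12 := h12 x
        simp only [setReg_arr, setArr_arr, if_pos]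
        by_cases hx : x = y
        · subst hx
          simpa using hyn
        · rw [Function.update_of_ne fun h => hx (hinj h), hx12]
          simp [hx]
      · omega
  · rintro k s ⟨l, h4, h15, hst, hn, h12, hk⟩ hc
    rw [eval_eq_eq_zero] at hc
    replace hc := not_not.1 fun h => hc (eval_eq_eq_zero.2 h)
    simp only [Expr.eval, h4, h15] at hc
    cases l with
    | nil => exact ⟨by omega, by omega, by simpa using h15, by simpa using h12⟩
    | cons y l =>
      have hy : s.arr 10 ((y :: l).length + vs.length) = enc y := by
        have := hst.1
        rw [← this]
        congr 1
        simp
        omega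
      rw [hy] at hc
      rw [hinj hc] at hn
      simp at hn

/-- The credits that pay for the rest of the walk. -/
def walkPot (enc : V → ℕ) (L : ℕ → List ℕ) (p : List V) (s : Store) : ℕ :=
  16 * ∑ v, ((L (enc v)).length - s.arr 13 (enc v)) +
    7 * (Finset.univ.filter fun v => s.arr 7 (enc v) = 0).card + 3 * p.length

theorem walkPot_setReg (p : List V) (s : Store) (r x : ℕ) :
    walkPot enc L p (s.setReg r x) = walkPot enc L p s := rfl

theorem sum_advance (hinj : Function.Injective enc) {v : V}
    (hlt : s.arr 13 (enc v) < (L (enc v)).length)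
    (h13 : s'.arr 13 = Function.update (s.arr 13) (enc v) (s.arr 13 (enc v) + 1)) :
    ∑ v, ((L (enc v)).length - s'.arr 13 (enc v)) + 1 =
      ∑ v, ((L (enc v)).length - s.arr 13 (enc v)) := by
  rw [← Finset.add_sum_erase _ _ (Finset.mem_univ v),
    ← Finset.add_sum_erase _ (fun v => (L (enc v)).length - s.arr 13 (enc v)) (Finset.mem_univ v)]
  have : ∑ x ∈ Finset.univ.erase v, ((L (enc x)).length - s'.arr 13 (enc x)) =
      ∑ x ∈ Finset.univ.erase v, ((L (enc x)).length - s.arr 13 (enc x)) := by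
    refine Finset.sum_congr rfl fun x hx => ?_
    rw [h13, Function.update_of_ne fun h => Finset.ne_of_mem_erase hx (hinj h)]
  rw [this, h13, Function.update_self]
  omega

/-- In `walkPot` each unread list entry carries 16 credits, which pay for reading it and for the 3
deposited with a newly pushed vertex. Erasing a cycle spends the deposits of the vertices popped.
Retiring a vertex spends its deposit and the 7 credits of a living vertex. -/
theorem walkStepCmd_spec {M k K : ℕ} (hw : WalkGraph enc N es L d₀) (hM : N ≤ M) {v : V}
    {vs : List V} (h : Walking enc N st es L d₀ o₀ A₀ c₀ (v :: vs) s)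
    (h9 : s.reg 9 = 1) (h15 : s.reg 15 = vs.length) (hk : walkPot enc L (v :: vs) s + K ≤ k) :
    1 ≤ k ∧ Tri M walkStepCmd s (k - 1) fun k' s' => ∃ p',
      Walking enc N st es L d₀ o₀ A₀ c₀ p' s' ∧ walkPot enc L p' s' + K ≤ k' ∧
      ((p' = [] ∧ s'.reg 9 = 0 ∧ s'.arr 7 (s.arr 10 0) ≠ 0) ∨
        ∃ v' vs', p' = v' :: vs' ∧ s'.reg 9 = 1 ∧ s'.reg 15 = vs'.length ∧
          s'.arr 10 0 = s.arr 10 0) ∧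
      s'.reg 2 = s.reg 2 ∧ ∀ x, s.arr 7 x ≠ 0 → s'.arr 7 x ≠ 0 := by
  obtain ⟨q, hq⟩ := id h
  have hq := hq.1
  have hst : s.arr 10 vs.length = enc v := hq.stack.1
  have halive : s.arr 7 (enc v) = 0 := hq.alive v (by simp)
  have hcard : 1 ≤ (Finset.univ.filter fun v => s.arr 7 (enc v) = 0).card :=
    Finset.card_pos.2 ⟨v, by simpa using halive⟩
  have hlen := hq.rows.len (enc v)
  by_cases hlt : s.arr 13 (enc v) < (L (enc v)).length
  · set e' := (L (enc v))[s.arr 13 (enc v)] with he'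
    have hget : s.arr 5 (enc v * st + s.arr 13 (enc v)) = e' := hq.rows.get _ _ hlt
    obtain ⟨e, hee, hev⟩ := hw.inc v e' (List.getElem_mem _)
    rw [← hee] at hget
    have h1 : 1 ≤ ∑ v, ((L (enc v)).length - s.arr 13 (enc v)) := by
      refine le_trans ?_ (Finset.single_le_sum
        (f := fun v => (L (enc v)).length - s.arr 13 (enc v)) (fun _ _ => Nat.zero_le _)
        (Finset.mem_univ v))
      omega
    have hk' := hk
    simp only [walkPot, List.length_cons] at hk'
    obtain ⟨k, rfl⟩ := Nat.exists_eq_add_of_le' (show 16 ≤ k by omega)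
    refine ⟨by omega, Tri.of_wp_forall fun R hR => ?_⟩
    simp only [walkStepCmd, wp, ne_eq, eval_lt_eq_zero, eval_eq_eq_zero, not_not]
    simp [Op.eval, h15, hst, hlen, hq.st_eq, hget, hlt, hq.tails, hq.heads]
    constructor
    · intro hdone
      obtain ⟨u, hu, hde⟩ : ∃ u, enc (es e).1 + enc (es e).2 - enc v = enc u ∧
          ((es e = (v, u) ∧ enc (es e).1 = enc v) ∨ (es e = (u, v) ∧ ¬ enc (es e).1 = enc v)) := by
        have hl := hw.loopless e
        rcases hev with h1 | h1
        · exact ⟨(es e).2, by rw [h1]; omega, Or.inl ⟨by rw [← h1], by rw [h1]⟩⟩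
        · refine ⟨(es e).1, by rw [h1]; omega, Or.inr ⟨by rw [← h1], fun h => hl ?_⟩⟩
          rw [hw.inj h, h1]
      rw [hu]
      have hun := hw.lt u
      refine ⟨by omega, ?_, ?_⟩
      · intro honp
        refine hR _ _ ⟨u :: v :: vs, ?_, ?_, ?_, ?_, ?_⟩
        · refine Walking.push hw h ⟨?_, ?_, ?_, ?_, ?_, ?_⟩ hlt (e := e) (by rw [← he', hee]) hdone
            ?_ honp ?_ ?_ ?_ ?_ ?_ ?_
          all_goals simp
          · rcases hde with ⟨h1, h2⟩ | ⟨h1, h2⟩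
            · exact Or.inl ⟨h1, h2⟩
            · exact Or.inr ⟨h1, h2⟩
          · intro i hi
            simp [Function.update_of_ne hi]
        · have := sum_advance (s := s) (s' := s.setArr 13 (enc v) (s.arr 13 (enc v) + 1)) hw.inj hlt
            (by simp)
          simp [walkPot] at this ⊢
          omega
        · right
          refine ⟨u, v :: vs, rfl, ?_, ?_, ?_⟩ <;> simp [h9, h15]
        · simp
        · simp
      · intro honp
        have hup : u ∈ v :: vs := (hq.onp u).1 honp
        obtain ⟨l, vs', hl⟩ := List.append_of_mem hup
        have hll := congrArg List.length hl
        simp at hll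
        refine Tri.framed (popCmd_spec (l := l) (vs := vs') (u := u)
          (K := k + 16 - 11 - 3 * l.length) hw.inj ?_ ?_ ?_ ?_ ?_ ?_) ?_
        · simp [hu]
        · simp [h15]; omega
        · simpa [← hl] using hq.stack
        · rw [← hl]; exact hq.nodup
        · simpa [← hl] using hq.onp
        · omega
        · rintro k' s' ⟨hk1, h15', h12'⟩ ⟨fr, fa⟩
          simp only [popCmd, Cmd.regs, Cmd.arrs, List.append_nil, List.nil_append,
            List.mem_cons, List.not_mem_nil, or_false, List.mem_append] at fr fa
          have h0 : s'.arr 10 = s.arr 10 := by rw [fa 10 (by decide)]; simp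
          have h7 : s'.arr 7 = s.arr 7 := by rw [fa 7 (by decide)]; simp
          have h13 : s'.arr 13 = Function.update (s.arr 13) (enc v) (s.arr 13 (enc v) + 1) := by
            rw [fa 13 (by decide)]; simp
          refine hR _ _ ⟨u :: vs', ?_, ?_, ?_, ?_, ?_⟩
          · refine Walking.close hw h hl rfl ⟨?_, ?_, ?_, ?_, ?_, ?_⟩ hlt (e := e)
              (by rw [← he', hee]) hdone ?_ h13 ?_ h7 ?_ h0 h12'
            · rw [fr 14 (by decide)]; simp
            · rw [fr 11 (by decide)]; simp
            · rw [fa 0 (by decide)]; simp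
            · rw [fa 1 (by decide)]; simp
            · rw [fa 4 (by decide)]; simp
            · rw [fa 5 (by decide)]; simp
            · rw [fa 3 (by decide)]
              simp
              rcases hde with ⟨h1, h2⟩ | ⟨h1, h2⟩
              · exact Or.inl ⟨h1, h2⟩
              · exact Or.inr ⟨h1, h2⟩
            · rw [fa 3 (by decide)]
              intro i hi
              simp [Function.update_of_ne hi]
            · rw [fa 8 (by decide)]; simp
          · have := sum_advance (s := s) (s' := s') hw.inj hlt h13
            simp only [walkPot, List.length_cons, h7]
            omega
          · right
            refine ⟨u, vs', rfl, ?_, h15', by rw [h0]⟩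
            rw [fr 9 (by decide)]
            simp [h9]
          · rw [fr 2 (by decide)]; simp
          · rw [h7]; exact fun _ => id
    · intro hdone
      refine hR _ _ ⟨v :: vs, ?_, ?_, ?_, ?_, ?_⟩
      · refine Walking.pass hw h ⟨?_, ?_, ?_, ?_, ?_, ?_⟩ hlt (by rw [← he', ← hee]; exact hdone)
          ?_ ?_ ?_ ?_ ?_ ?_
        all_goals simp
      · have := sum_advance (s := s) (s' := s.setArr 13 (enc v) (s.arr 13 (enc v) + 1)) hw.inj hlt
          (by simp)
        simp [walkPot] at this ⊢
        omega
      · right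
        refine ⟨v, vs, rfl, ?_, ?_, ?_⟩ <;> simp [h9, h15]
      · simp
      · simp
  · have hptr : s.arr 13 (enc v) = (L (enc v)).length := by
      have := hq.ptr_le v
      omega
    have hk' := hk
    simp only [walkPot, List.length_cons] at hk'
    obtain ⟨k, rfl⟩ := Nat.exists_eq_add_of_le' (show 10 ≤ k by omega)
    refine ⟨by omega, Tri.of_wp_forall fun R hR => ?_⟩
    have hcard' : (Finset.univ.filter fun x =>
        Function.update (s.arr 7) (enc v) 1 (enc x) = 0).card + 1 =
        (Finset.univ.filter fun x => s.arr 7 (enc x) = 0).card := by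
      rw [← Finset.card_erase_add_one (s := Finset.univ.filter fun x => s.arr 7 (enc x) = 0)
        (a := v) (by simpa using halive)]
      congr 2
      ext x
      by_cases hx : x = v
      · subst hx; simp
      · simp [Function.update_of_ne fun h => hx (hw.inj h), hx]
    have hdead : ∀ x, s.arr 7 x ≠ 0 → Function.update (s.arr 7) (enc v) 1 x ≠ 0 := by
      intro x hx
      rw [Function.update_apply]
      split
      · simp
      · exact hx
    have main : ∀ k₂ s₂, s₂.arr = ((s.setArr 12 (enc v) 0).setArr 7 (enc v) 1).arr →
        s₂.reg 14 = s.reg 14 → s₂.reg 11 = s.reg 11 → s₂.reg 2 = s.reg 2 → k + 3 ≤ k₂ →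
        ((vs = [] ∧ s₂.reg 9 = 0 ∧ s₂.arr 7 (s.arr 10 0) ≠ 0) ∨
        ∃ v' vs', vs = v' :: vs' ∧ s₂.reg 9 = 1 ∧ s₂.reg 15 = vs'.length ∧
          s₂.arr 10 0 = s.arr 10 0) → R k₂ s₂ := by
      intro k₂ s₂ ha h14 h11 h2 hk₂ hc
      refine hR _ _ ⟨vs, ?_, ?_, hc, h2, ?_⟩
      · refine Walking.retire hw h ⟨?_, ?_, ?_, ?_, ?_, ?_⟩ hptr ?_ ?_ ?_ ?_ ?_ ?_
        all_goals simp [ha, h14, h11]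
      · simp only [walkPot, ha]
        simp
        omega
      · simpa [ha] using hdead
    simp only [walkStepCmd, wp, ne_eq, eval_lt_eq_zero, eval_eq_eq_zero, not_not]
    simp [Op.eval, h15, hst, hlen, hptr]
    constructor
    · intro hvs
      refine main _ _ rfl ?_ ?_ ?_ ?_ (Or.inl ⟨hvs, ?_, ?_⟩)
      · simp
      · simp
      · simp
      · omega
      · simp
      · rw [hvs] at hst
        simp at hst
        simp [hst]
    · intro hvs
      refine main _ _ rfl ?_ ?_ ?_ ?_ (Or.inr ?_)
      · simp
      · simp
      · simp
      · omega
      · cases vs with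
        | nil => exact absurd rfl hvs
        | cons y vs =>
          refine ⟨y, vs, rfl, ?_, ?_, ?_⟩ <;> simp [h9, h15]

/-- A walk started at a living vertex goes on until its path is empty, when the start vertex itself
has been retired. So a single pass over the vertices retires all of them. The edges with `d₀ i ≠ 0`
were oriented earlier, and their arcs are the given `A₀`. -/
theorem walkCmd_spec {M k K : ℕ} (hw : WalkGraph enc N es L d₀) (hM : N ≤ M)
    (h : WalkSt enc N st es L d₀ o₀ [] [] s)
    (hk : 16 * ∑ v, (L (enc v)).length + 18 * N + 2 + K ≤ k) :
    Tri M walkCmd s k fun k' s' => K ≤ k' ∧ ∃ d,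
      Relation.ReflTransGen FinishStep (walkCfg enc es A₀ d₀ [] s) d ∧ d.verts = ∅ ∧ d.edges = ∅ ∧
      d.arcs = A₀ ∪ (Finset.univ.filter fun i : Fin m => d₀ i = 0).image (orient es (s'.arr 3)) ∧
      ∀ i : Fin m, d₀ i ≠ 0 → s'.arr 3 i = o₀ i := by
  have hcard : Fintype.card V ≤ N := by
    rw [← Finset.card_range N, ← Finset.card_univ, ← Finset.card_image_of_injective _ hw.inj]
    refine Finset.card_le_card fun x hx => ?_
    obtain ⟨v, _, rfl⟩ := Finset.mem_image.1 hx
    exact Finset.mem_range.2 (hw.lt v)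
  have hpot : walkPot enc L [] s ≤ 16 * ∑ v, (L (enc v)).length + 7 * N := by
    unfold walkPot
    have h1 : ∑ v, ((L (enc v)).length - s.arr 13 (enc v)) ≤ ∑ v, (L (enc v)).length :=
      Finset.sum_le_sum fun v _ => Nat.sub_le _ _
    have h2 := Finset.card_filter_le (Finset.univ : Finset V) fun v => s.arr 7 (enc v) = 0
    rw [Finset.card_univ] at h2
    simp only [List.length_nil]
    omega
  apply Tri.of_wp
  obtain ⟨k, rfl⟩ := Nat.exists_eq_add_of_le' (show 1 ≤ k by omega)
  simp only [walkCmd, wp]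
  simp
  set c₀ := walkCfg enc es A₀ d₀ [] s with hc₀
  refine Tri.while (fun k' s' => Walking enc N st es L d₀ o₀ A₀ c₀ [] s' ∧ s'.reg 2 ≤ N ∧
    (∀ x < s'.reg 2, s'.arr 7 x ≠ 0) ∧ walkPot enc L [] s' + 11 * (N - s'.reg 2) + 1 + K ≤ k')
    ?_ ?_ ?_
  · clear hk k hpot
    rintro k s' ⟨hW, h2, hdead, hk⟩ hlt
    have h14 : s'.reg 14 = N := by
      obtain ⟨q, hq, _⟩ := hW
      exact hq.N_eq
    rw [ne_eq, eval_lt_eq_zero, not_not] at hlt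
    simp only [Expr.eval, h14] at hlt
    obtain ⟨k, rfl⟩ := Nat.exists_eq_add_of_le' (show 11 ≤ k by omega)
    refine ⟨by omega, Tri.of_wp_forall fun R hR => ?_⟩
    have main : ∀ k₂ s₂, Walking enc N st es L d₀ o₀ A₀ c₀ [] s₂ → s₂.reg 2 = s'.reg 2 + 1 →
        (∀ x < s'.reg 2 + 1, s₂.arr 7 x ≠ 0) →
        walkPot enc L [] s₂ + 11 * (N - (s'.reg 2 + 1)) + 1 + K ≤ k₂ → R k₂ s₂ := by
      intro k₂ s₂ h1 h2 h3 h4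
      exact hR _ _ ⟨h1, by omega, by rwa [h2], by rwa [h2]⟩
    simp only [wp, ne_eq, eval_lt_eq_zero, eval_eq_eq_zero, not_not]
    simp
    constructor
    · intro hal
      obtain ⟨v, hv⟩ := hw.surj _ hlt
      refine Tri.while (fun k₂ s₂ => ∃ p, Walking enc N st es L d₀ o₀ A₀ c₀ p s₂ ∧
        walkPot enc L p s₂ + 11 * (N - (s'.reg 2 + 1)) + 3 + K ≤ k₂ ∧
        ((p = [] ∧ s₂.reg 9 = 0 ∧ s₂.arr 7 (s'.reg 2) ≠ 0) ∨
          ∃ v' vs', p = v' :: vs' ∧ s₂.reg 9 = 1 ∧ s₂.reg 15 = vs'.length ∧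
            s₂.arr 10 0 = s'.reg 2) ∧
        s₂.reg 2 = s'.reg 2 ∧ ∀ x < s'.reg 2, s₂.arr 7 x ≠ 0) ?_ ?_ ?_
      · rintro k₂ s₂ ⟨p, h1, h3, h4, h5, h6⟩ hne
        rcases h4 with h4 | ⟨v', vs', rfl, h7, h8, h9⟩
        · exact absurd h4.2.1 hne
        · obtain ⟨h10, h11⟩ := walkStepCmd_spec (k := k₂)
            (K := 11 * (N - (s'.reg 2 + 1)) + 3 + K) hw hM h1 h7 h8 (by omega)
          refine ⟨h10, Tri.of_wp (c := .call walkStepCmd) (h11.mono ?_)⟩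
          rintro k₃ s₃ ⟨p', g1, g2, g3, g4, g5⟩
          rw [h9] at g3
          exact ⟨p', g1, by omega, g3, by rw [g4, h5], fun x hx => g5 x (h6 x hx)⟩
      · rintro k₂ s₂ ⟨p, h1, h3, h4, h5, h6⟩ hne
        rcases h4 with ⟨rfl, h7, h8⟩ | ⟨v', vs', rfl, h7, h8, h9⟩
        · refine ⟨by omega, by omega, main _ _ (h1.congr (by simp) rfl) ?_ ?_ ?_⟩
          · simp [Op.eval, h5]
          · intro x hx
            by_cases hx' : x = s'.reg 2
            · subst hx'; exact h8
            · exact h6 x (by omega)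
          · rw [walkPot_setReg]
            omega
        · exact absurd hne (by simp [h7])
      · refine ⟨[v], ?_, ?_, Or.inr ⟨v, [], rfl, ?_, ?_, ?_⟩, ?_, ?_⟩
        · refine Walking.start hw hW ⟨?_, ?_, ?_, ?_, ?_, ?_⟩ (v := v) (by rw [hv]; exact hal)
            ?_ ?_ ?_ ?_ ?_ ?_
          all_goals simp [hv]
        · simp [walkPot] at hk ⊢
          omega
        · simp
        · simp
        · simp
        · simp
        · simpa using hdead
    · intro hal
      refine main _ _ (hW.congr ?_ rfl) ?_ ?_ ?_
      · simp
      · simp [Op.eval]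
      · intro x hx
        by_cases hx' : x = s'.reg 2
        · subst hx'; simpa using hal
        · simpa using hdead x (by omega)
      · rw [walkPot_setReg]
        omega
  · clear hk k hpot
    rintro k s' ⟨hW, h2, hdead, hk⟩ hlt
    obtain ⟨q, hq, hr⟩ := hW
    rw [eval_lt_eq_zero] at hlt
    simp only [Expr.eval, hq.N_eq] at hlt
    obtain rfl : q = [] := by
      have := hq.path
      cases this
      rfl
    -- Every vertex has been retired, and remaining edges have living ends; hence no edge remains.
    have hd : ∀ v, s'.arr 7 (enc v) ≠ 0 := fun v => hdead _ (by have := hw.lt v; omega)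
    have hdone : ∀ i : Fin m, s'.arr 8 i ≠ 0 := fun i h => hd _ (hq.ends i (Or.inl h)).1
    refine ⟨by omega, by omega, _, hr, ?_, ?_, ?_, hq.out⟩
    · simp [walkCfg, hd]
    · simp [walkCfg, hdone]
    · simp [walkCfg, hdone]
  · refine ⟨⟨[], ?_, ?_⟩, by simp, by simp, ?_⟩
    · obtain ⟨h1, h2, h3, h4, h5, h6, h7, h8, h9, h10, h11, h12, h13, h14, h15, h16⟩ := h
      constructor <;> assumption
    · exact .refl
    · rw [walkPot_setReg]
      simp
      omega

end Walks

/-! ## Finishing by cycles and forests -/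

section General

variable {V : Type*} [Fintype V] [DecidableEq V] {m : ℕ}

/-- One bit for each edge of an irredundant listing chooses exactly one of its directions, so any
content of the output array describes an orientation. -/
theorem isOrientation_image {G : SimpleGraph V} {es : Fin m → V × V} {P : Finset (Fin m)}
    (hinj : Function.Injective fun i => s((es i).1, (es i).2))
    (hG : ∀ e, e ∈ G.edgeSet ↔ ∃ i ∈ P, s((es i).1, (es i).2) = e) (out : ℕ → ℕ) :
    IsOrientation G (P.image (orient es out)) := by
  have hmem : ∀ a, a ∈ P.image (orient es out) ↔ ∃ i ∈ P, orient es out i = a := by simp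
  constructor
  · intro a ha
    obtain ⟨i, hi, rfl⟩ := (hmem a).1 ha
    rw [← SimpleGraph.mem_edgeSet, hG]
    exact ⟨i, hi, (orient_edge es out i).symm⟩
  · intro u v huv
    obtain ⟨i, hi, he⟩ := (hG _).1 (G.mem_edgeSet.2 huv)
    have huniq : ∀ a, a ∈ P.image (orient es out) → s(a.1, a.2) = s(u, v) →
        a = orient es out i := by
      intro a ha hae
      obtain ⟨j, hj, rfl⟩ := (hmem a).1 ha
      rw [orient_edge, ← he] at hae
      rw [hinj hae]
    have hi' : orient es out i ∈ P.image (orient es out) := (hmem _).2 ⟨i, hi, rfl⟩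
    have hne := huv.ne
    have hcase : orient es out i = (u, v) ∨ orient es out i = (v, u) := by
      have := orient_edge es out i
      rw [he, Sym2.eq_iff] at this
      rcases this with ⟨h1, h2⟩ | ⟨h1, h2⟩
      · exact Or.inl (Prod.ext h1 h2)
      · exact Or.inr (Prod.ext h1 h2)
    rcases hcase with hc | hc
    · refine Or.inl ⟨hc ▸ hi', fun h => ?_⟩
      have := huniq _ h Sym2.eq_swap
      rw [hc, Prod.mk.injEq] at this
      exact hne this.2
    · refine Or.inr ⟨hc ▸ hi', fun h => ?_⟩
      have := huniq _ h rfl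
      rw [hc, Prod.mk.injEq] at this
      exact hne this.1

theorem sum_enc_le {enc : V → ℕ} {N : ℕ} (hinj : Function.Injective enc) (hlt : ∀ v, enc v < N)
    (f : ℕ → ℕ) : ∑ v, f (enc v) ≤ ∑ x ∈ Finset.range N, f x := by
  rw [← Finset.sum_image (f := f) (fun a _ b _ h => hinj h)]
  refine Finset.sum_le_sum_of_subset fun x hx => ?_
  obtain ⟨v, _, rfl⟩ := Finset.mem_image.1 hx
  exact Finset.mem_range.2 (hlt v)

theorem walkGraph_incList {enc : V → ℕ} {N : ℕ} {es : Fin m → V × V} {eu ev : ℕ → ℕ}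
    (hinj : Function.Injective enc) (hlt : ∀ v, enc v < N) (hsurj : ∀ x < N, ∃ v, enc v = x)
    (hsimple : Function.Injective fun i => s((es i).1, (es i).2))
    (hne : ∀ i, (es i).1 ≠ (es i).2) (hu : ∀ i : Fin m, eu i = enc (es i).1)
    (hv : ∀ i : Fin m, ev i = enc (es i).2) (d₀ : ℕ → ℕ) :
    WalkGraph enc N es (incList eu ev m) d₀ := by
  refine ⟨hinj, hlt, hsurj, hsimple, hne, ?_, ?_⟩
  · intro v j hj
    obtain ⟨hjm, hj⟩ := mem_incList.1 hj
    have h1 := hu ⟨j, hjm⟩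
    have h2 := hv ⟨j, hjm⟩
    refine ⟨⟨j, hjm⟩, rfl, hj.imp (fun h => hinj ?_) fun h => hinj ?_⟩
    · rw [← h1]; exact h
    · rw [← h2]; exact h
  · intro i _
    exact ⟨mem_incList.2 ⟨i.2, Or.inl (hu i)⟩, mem_incList.2 ⟨i.2, Or.inr (hv i)⟩⟩

end General

variable {n m : ℕ} {es : Fin m → Fin n × Fin n}

theorem outputArcs_eq (s : Store) :
    outputArcs es s = Finset.univ.image (orient es (s.arr 3)) := rfl

theorem cycles_spec {M k K : ℕ} {wN : ℕ → ℕ} {S : Finset ℕ} {s : Store}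
    (hinj : Function.Injective fun i => s((es i).1, (es i).2)) (hne : ∀ i, (es i).1 ≠ (es i).2)
    (hs : PeelSt n m (tails es) (heads es) wN S s) (h12 : s.arr 12 = fun _ => 0)
    (h13 : s.arr 13 = fun _ => 0) (hM : n ≤ M) (hk : 32 * m + 18 * n + 3 + K ≤ k) :
    Tri M (.set 14 (.var 0) ⨾ .call walkCmd) s k fun k' s' => K ≤ k' ∧
      (∀ i : Fin m, s.arr 8 i ≠ 0 → s'.arr 3 i = s.arr 3 i) ∧
      Finish .cycles (cfgOf es s) (outputArcs es s') ∧
      ∀ v, indeg (outputArcs es s') v ≤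
        indeg (cfgOf es s).arcs v + (deg (cfgOf es s) v + 1) / 2 := by
  have hgood := hs.good hne
  have htne : ∀ i < m, tails es i ≠ heads es i := by
    intro i hi
    have := hne ⟨i, hi⟩
    rw [Ne, Fin.ext_iff, ← tails_fin, ← heads_fin] at this
    exact this
  have hw : WalkGraph (fun v : Fin n => (v : ℕ)) n es (incList (tails es) (heads es) m) (s.arr 8) :=
    walkGraph_incList Fin.val_injective (fun v => v.2) (fun x hx => ⟨⟨x, hx⟩, rfl⟩) hinj hne
      (tails_fin es) (heads_fin es) _
  apply Tri.of_wp
  obtain ⟨k, rfl⟩ := Nat.exists_eq_add_of_le' (show 1 ≤ k by omega)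
  simp only [wp]
  simp [hs.n_eq]
  have hst : WalkSt (fun v : Fin n => (v : ℕ)) n (n + m + 1) es (incList (tails es) (heads es) m)
      (s.arr 8) (s.arr 3) [] [] (s.setReg 14 n) := by
    refine ⟨by simp, by simp [hs.st_eq], ?_, ?_, hs.rows, trivial, by simp, .nil, ?_, by simp, ?_,
      ?_, ?_, fun i => id, by simp, fun _ _ => rfl⟩
    · intro i
      rw [setReg_arr, hs.eu_eq, tails_fin]
    · intro i
      rw [setReg_arr, hs.ev_eq, heads_fin]
    · simp [h12]
    · rintro i (hi | hi)
      · have h1 := hs.ends i i.2 hi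
        rw [tails_fin, heads_fin] at h1
        exact ⟨(hs.dead _ (es i).1.2).2 h1.1, (hs.dead _ (es i).2.2).2 h1.2⟩
      · simp at hi
    · simp [h13]
    · simp [h13]
  have hsum := (sum_enc_le (enc := fun v : Fin n => (v : ℕ)) Fin.val_injective (fun v => v.2)
    fun v => (incList (tails es) (heads es) m v).length).trans (sum_length_incList htne)
  refine (walkCmd_spec (A₀ := (cfgOf es s).arcs) (K := K) hw hM hst (by omega)).mono ?_
  rintro k' s' ⟨hk', d, hr, hv, he, ha, ho⟩
  have hcfg : walkCfg (fun v : Fin n => (v : ℕ)) es (cfgOf es s).arcs (s.arr 8) []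
      (s.setReg 14 n) = cfgOf es s := by
    rw [walkCfg, cfgOf, Config.mk.injEq]
    refine ⟨rfl, ?_, ?_⟩
    · simp
    · ext a
      simp
  have hor : ∀ i : Fin m, s.arr 8 i ≠ 0 → orient es (s'.arr 3) i = orient es (s.arr 3) i := by
    intro i hi
    unfold orient
    rw [ho i hi]
  have hout : outputArcs es s' = d.arcs := by
    rw [ha, outputArcs_eq]
    ext a
    simp only [cfgOf, Finset.mem_image, Finset.mem_union, Finset.mem_filter, Finset.mem_univ,
      true_and]
    constructor
    · rintro ⟨i, rfl⟩
      by_cases hi : s.arr 8 i = 0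
      · exact Or.inr ⟨i, hi, rfl⟩
      · exact Or.inl ⟨i, hi, (hor i hi).symm⟩
    · rintro (⟨i, hi, rfl⟩ | ⟨i, hi, rfl⟩)
      · exact ⟨i, hor i hi⟩
      · exact ⟨i, rfl⟩
  rw [hcfg] at hr
  rw [hout]
  exact ⟨hk', ho, finish_cycles hr hv he, indeg_le_of_finishSteps hr⟩

/-! ## Finishing by Euler tours -/

/-- The parities of the numbers of remaining edges at the vertices, in array 9. -/
def parityCmd : Cmd :=
  .set 2 (.const 0) ⨾
  .while (.lt (.var 2) (.var 1))
    (.ite (.eq (.get 8 (.var 2)) (.const 0))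
      (.set 3 (.get 0 (.var 2)) ⨾
       .set 4 (.get 1 (.var 2)) ⨾
       .put 9 (.var 3) (.const 1 ∸ .get 9 (.var 3)) ⨾
       .put 9 (.var 4) (.const 1 ∸ .get 9 (.var 4)))
      .skip ⨾
     .set 2 (.var 2 ∔ .const 1))

theorem parityCmd_spec {M m k K : ℕ} {s : Store} (h1 : s.reg 1 = m)
    (hne : ∀ i < m, s.arr 0 i ≠ s.arr 1 i) (h9 : s.arr 9 = fun _ => 0) (hk : 7 * m + 2 + K ≤ k) :
    Tri M parityCmd s k fun k' s' => K ≤ k' ∧ ∀ v, s'.arr 9 v =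
      (wsum (fun _ => 1) m fun j => (s.arr 0 j = v ∨ s.arr 1 j = v) ∧ s.arr 8 j = 0) % 2 := by
  apply Tri.of_wp
  obtain ⟨k, rfl⟩ := Nat.exists_eq_add_of_le' (show 1 ≤ k by omega)
  simp only [parityCmd, wp]
  simp
  refine Tri.while (fun k' s' => s'.reg 1 = m ∧ s'.reg 2 ≤ m ∧ s'.arr 0 = s.arr 0 ∧
    s'.arr 1 = s.arr 1 ∧ s'.arr 8 = s.arr 8 ∧ 7 * (m - s'.reg 2) + 1 + K ≤ k' ∧
    ∀ v, s'.arr 9 v = (wsum (fun _ => 1) (s'.reg 2)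
      fun j => (s.arr 0 j = v ∨ s.arr 1 j = v) ∧ s.arr 8 j = 0) % 2) ?_ ?_ ?_
  · clear hk k
    rintro k s' ⟨g1, g2, a0, a1, a8, hk, hpar⟩ hlt
    rw [ne_eq, eval_lt_eq_zero, not_not] at hlt
    simp only [Expr.eval, g1] at hlt
    obtain ⟨k, rfl⟩ := Nat.exists_eq_add_of_le' (show 7 ≤ k by omega)
    refine ⟨by omega, Tri.of_wp_forall fun R hR => ?_⟩
    have hi := hne _ hlt
    simp only [wp, ne_eq, eval_lt_eq_zero, eval_eq_eq_zero, not_not]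
    simp [Op.eval, a0, a1, a8, hi]
    have hsucc : ∀ v, (wsum (fun _ => 1) (s'.reg 2 + 1)
        fun j => (s.arr 0 j = v ∨ s.arr 1 j = v) ∧ s.arr 8 j = 0) = (wsum (fun _ => 1) (s'.reg 2)
        fun j => (s.arr 0 j = v ∨ s.arr 1 j = v) ∧ s.arr 8 j = 0) +
        if (s.arr 0 (s'.reg 2) = v ∨ s.arr 1 (s'.reg 2) = v) ∧ s.arr 8 (s'.reg 2) = 0
        then 1 else 0 := fun v => by
      unfold wsum
      rw [Finset.sum_range_succ]
    constructor
    · intro hd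
      refine hR _ _ ⟨?_, ?_, ?_, ?_, ?_, ?_, ?_⟩
      · simpa using g1
      · simp; omega
      · simpa using a0
      · simpa using a1
      · simpa using a8
      · simp; omega
      · intro v
        have hv := hpar v
        simp only [setReg_reg, setReg_arr, setArr_arr, if_pos, hsucc]
        by_cases hv0 : v = s.arr 0 (s'.reg 2)
        · subst hv0
          simp [hi, hd, hv]
          omega
        · by_cases hv1 : v = s.arr 1 (s'.reg 2)
          · subst hv1
            simp [hi.symm, hd, hv]
            omega
          · simp [hv0, hv1, Ne.symm hv0, Ne.symm hv1, hv]
    · intro hd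
      refine hR _ _ ⟨?_, ?_, ?_, ?_, ?_, ?_, ?_⟩
      · simpa using g1
      · simp; omega
      · simpa using a0
      · simpa using a1
      · simpa using a8
      · simp; omega
      · intro v
        simp [hsucc, hd, hpar v]
  · clear hk k
    rintro k s' ⟨g1, g2, a0, a1, a8, hk, hpar⟩ hlt
    rw [eval_lt_eq_zero] at hlt
    simp only [Expr.eval, g1] at hlt
    have hm : s'.reg 2 = m := by omega
    rw [hm] at hpar
    exact ⟨by omega, by omega, hpar⟩
  · refine ⟨by simpa using h1, by simp, by simp, by simp, by simp, by simp; omega, ?_⟩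
    simp [h9, wsum]

/-- Join all vertices with an odd number of edges to the new vertex `n`. -/
def joinCmd : Cmd :=
  .set 16 (.var 1) ⨾
  .set 2 (.const 0) ⨾
  .while (.lt (.var 2) (.var 0))
    (.ite (.eq (.get 9 (.var 2)) (.const 1))
      (.put 0 (.var 16) (.var 2) ⨾
       .put 1 (.var 16) (.var 0) ⨾
       .put 8 (.var 16) (.const 0) ⨾
       .put 5 (.var 2 ⨰ .var 11 ∔ .get 4 (.var 2)) (.var 16) ⨾
       .put 4 (.var 2) (.get 4 (.var 2) ∔ .const 1) ⨾
       .put 5 (.var 0 ⨰ .var 11 ∔ .get 4 (.var 0)) (.var 16) ⨾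
       .put 4 (.var 0) (.get 4 (.var 0) ∔ .const 1) ⨾
       .set 16 (.var 16 ∔ .const 1))
      .skip ⨾
     .set 2 (.var 2 ∔ .const 1))

/-- The arrays of edges after some edges to `n` have been added, from the vertices in `O`. -/
structure OddJoined (n m : ℕ) (O : List ℕ) (s s' : Store) : Prop where
  eu_eq : ∀ i < m, s'.arr 0 i = s.arr 0 i
  ev_eq : ∀ i < m, s'.arr 1 i = s.arr 1 i
  done : ∀ i < m, s'.arr 8 i = s.arr 8 i
  new_tails : ∀ j (h : j < O.length), s'.arr 0 (m + j) = O[j]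
  new_heads : ∀ j < O.length, s'.arr 1 (m + j) = n
  new_done : ∀ j < O.length, s'.arr 8 (m + j) = 0
  rows : Rows (n + m + 1) (s'.arr 4) (s'.arr 5) (incList (s'.arr 0) (s'.arr 1) (m + O.length))

theorem incList_congr {eu ev eu' ev' : ℕ → ℕ} {i : ℕ} (hu : ∀ j < i, eu' j = eu j)
    (hv : ∀ j < i, ev' j = ev j) : incList eu' ev' i = incList eu ev i := by
  funext v
  unfold incList
  refine List.filter_congr fun j hj => ?_
  rw [List.mem_range] at hj
  rw [hu j hj, hv j hj]

/-- The row width `n + m + 1` leaves room for the at most `n` edges added here, even in the row of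
the new vertex. -/
theorem joinCmd_spec {M n m k K : ℕ} {s : Store} (h0 : s.reg 0 = n) (h1 : s.reg 1 = m)
    (h11 : s.reg 11 = n + m + 1)
    (hrows : Rows (n + m + 1) (s.arr 4) (s.arr 5) (incList (s.arr 0) (s.arr 1) m))
    (hk : 11 * n + 3 + K ≤ k) :
    Tri M joinCmd s k fun k' s' => K ≤ k' ∧
      OddJoined n m ((List.range n).filter fun v => s.arr 9 v = 1) s s' := by
  apply Tri.of_wp
  obtain ⟨k, rfl⟩ := Nat.exists_eq_add_of_le' (show 2 ≤ k by omega)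
  simp only [joinCmd, wp]
  simp [h1]
  set O : ℕ → List ℕ := fun r => (List.range r).filter fun v => s.arr 9 v = 1 with hO
  have hOlen : ∀ r, (O r).length ≤ r := fun r => (List.length_filter_le _ _).trans (by simp)
  have hOlt : ∀ r, ∀ x ∈ O r, x < r := fun r x hx => by
    simp only [hO, List.mem_filter, List.mem_range] at hx
    exact hx.1
  refine Tri.while (fun k' s' => s'.reg 0 = n ∧ s'.reg 11 = n + m + 1 ∧ s'.reg 2 ≤ n ∧
    s'.reg 16 = m + (O (s'.reg 2)).length ∧ s'.arr 9 = s.arr 9 ∧ 11 * (n - s'.reg 2) + 1 + K ≤ k' ∧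
    OddJoined n m (O (s'.reg 2)) s s') ?_ ?_ ?_
  · clear hk k
    rintro k s' ⟨g0, g11, g2, g16, a9, hk, hJ⟩ hlt
    rw [ne_eq, eval_lt_eq_zero, not_not] at hlt
    simp only [Expr.eval, g0] at hlt
    obtain ⟨k, rfl⟩ := Nat.exists_eq_add_of_le' (show 11 ≤ k by omega)
    refine ⟨by omega, Tri.of_wp_forall fun R hR => ?_⟩
    set v := s'.reg 2 with hv
    have hOs : O (v + 1) = O v ++ if s.arr 9 v = 1 then [v] else [] := by
      simp only [hO, List.range_succ, List.filter_append, List.filter_cons, List.filter_nil]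
      simp
    set j := (O v).length with hj
    have hjv : j ≤ v := hOlen v
    have hnv : ¬ n = v := by omega
    simp only [wp, ne_eq, eval_lt_eq_zero, eval_eq_eq_zero, not_not]
    simp [Op.eval, a9, g0, g11, g16, ← hv, Ne.symm hnv, hnv]
    constructor
    · intro hodd
      rw [if_pos hodd] at hOs
      have hl : (O (v + 1)).length = j + 1 := by rw [hOs]; simp [hj]
      have hlv : (incList (s'.arr 0) (s'.arr 1) (m + j) v).length < n + m + 1 :=
        lt_of_le_of_lt (length_incList_le _ _ _ _) (by omega)
      have hln : (incList (s'.arr 0) (s'.arr 1) (m + j) n).length < n + m + 1 :=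
        lt_of_le_of_lt (length_incList_le _ _ _ _) (by omega)
      refine hR _ _ ⟨?_, ?_, ?_, ?_, ?_, ?_, ?_, ?_, ?_, ?_, ?_, ?_, ?_⟩
      · simpa using g0
      · simpa using g11
      · simp; omega
      · simp [hl]; omega
      · simpa using a9
      · simp; omega
      · intro i hi
        have hne : i ≠ m + j := by omega
        simp [Function.update_of_ne hne, hJ.eu_eq i hi]
      · intro i hi
        have hne : i ≠ m + j := by omega
        simp [Function.update_of_ne hne, hJ.ev_eq i hi]
      · intro i hi
        have hne : i ≠ m + j := by omega
        simp [Function.update_of_ne hne, hJ.done i hi]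
      · simp only [setReg_reg, setArr_reg, if_pos]
        simp only [hOs]
        intro x hx
        simp only [List.length_append, List.length_cons, List.length_nil, ← hj] at hx
        by_cases hxj : x = j
        · subst hxj
          simp [hj]
        · have hne : m + x ≠ m + j := by omega
          rw [List.getElem_append_left (by omega)]
          simp [Function.update_of_ne hne, hJ.new_tails x (by omega)]
      · simp only [setReg_reg, setArr_reg, if_pos]
        simp only [hOs]
        intro x hx
        simp only [List.length_append, List.length_cons, List.length_nil, ← hj] at hx
        by_cases hxj : x = j
        · subst hxj
          simp
        · have hne : m + x ≠ m + j := by omega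
          simp [Function.update_of_ne hne, hJ.new_heads x (by omega)]
      · simp only [setReg_reg, setArr_reg, if_pos]
        simp only [hOs]
        intro x hx
        simp only [List.length_append, List.length_cons, List.length_nil, ← hj] at hx
        by_cases hxj : x = j
        · subst hxj
          simp
        · have hne : m + x ≠ m + j := by omega
          simp [Function.update_of_ne hne, hJ.new_done x (by omega)]
      · have hR1 := (hJ.rows.push v (m + j) hlv).push n (m + j)
          (by rw [Function.update_of_ne hnv]; exact hln)
        have hc := incList_congr (i := m + j) (eu := s'.arr 0) (ev := s'.arr 1)
          (eu' := Function.update (s'.arr 0) (m + j) v)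
          (ev' := Function.update (s'.arr 1) (m + j) n)
          (fun i hi => by rw [Function.update_of_ne (by omega)])
          (fun i hi => by rw [Function.update_of_ne (by omega)])
        have hs := incList_succ (eu := Function.update (s'.arr 0) (m + j) v)
          (ev := Function.update (s'.arr 1) (m + j) n) (i := m + j) (by simpa using Ne.symm hnv)
        rw [hc] at hs
        simp only [Function.update_self] at hs
        simp only [setReg_reg, setArr_reg, setReg_arr, setArr_arr, if_pos]
        simp [hl, ← add_assoc]
        rw [hs]
        simpa [hnv] using hR1
    · intro hodd
      rw [if_neg hodd, List.append_nil] at hOs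
      refine hR _ _ ⟨?_, ?_, ?_, ?_, ?_, ?_, ?_⟩
      · simpa using g0
      · simpa using g11
      · simp; omega
      · simp [hOs, g16]
        omega
      · simpa using a9
      · simp; omega
      · obtain ⟨b1, b2, b3, b4, b5, b6, b7⟩ := hJ
        simp only [setReg_reg, if_pos, hOs]
        exact ⟨b1, b2, b3, b4, b5, b6, b7⟩
  · clear hk k
    rintro k s' ⟨g0, g11, g2, g16, a9, hk, hJ⟩ hlt
    rw [eval_lt_eq_zero] at hlt
    simp only [Expr.eval, g0] at hlt
    have hm : s'.reg 2 = n := by omega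
    rw [hm] at hJ
    exact ⟨by omega, by omega, hJ⟩
  · refine ⟨by simpa using h0, by simpa using h11, by simp, by simp [hO], by simp, by simp; omega, ?_⟩
    constructor <;> simp [hO]
    simpa using hrows

/-- The code of a vertex of the extended graph. -/
def encOption {n : ℕ} (x : Option (Fin n)) : ℕ := x.elim n fun v => v

/-- The vertex with a given code. -/
def decOption (n x : ℕ) : Option (Fin n) := if h : x < n then some ⟨x, h⟩ else none

theorem decOption_val {n : ℕ} (v : Fin n) : decOption n v = some v := by simp [decOption]

theorem decOption_self (n : ℕ) : decOption n n = none := by simp [decOption]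

theorem encOption_decOption {n x : ℕ} (h : x ≤ n) : encOption (decOption n x) = x := by
  unfold encOption decOption
  split
  · rfl
  · simp; omega

theorem decOption_encOption {n : ℕ} (x : Option (Fin n)) : decOption n (encOption x) = x := by
  cases x with
  | none => exact decOption_self n
  | some v => exact decOption_val v

theorem encOption_injective {n : ℕ} : Function.Injective (encOption (n := n)) :=
  Function.LeftInverse.injective decOption_encOption

theorem encOption_lt {n : ℕ} (x : Option (Fin n)) : encOption x < n + 1 := by
  cases x with
  | none => simp [encOption]
  | some v => have := v.2; simp [encOption]

section Extended

variable {n m : ℕ} {es : Fin m → Fin n × Fin n} {O : List ℕ} {s t : Store}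

/-- The edges of the extended graph. -/
def extEdges (n m' : ℕ) (t : Store) (i : Fin m') : Option (Fin n) × Option (Fin n) :=
  (decOption n (t.arr 0 i), decOption n (t.arr 1 i))

theorem OddJoined.extEdges_old (h : OddJoined n m O s t) (h0 : s.arr 0 = tails es)
    (h1 : s.arr 1 = heads es) (a : Fin m) (i : Fin (m + O.length)) (hi : (i : ℕ) = a) :
    extEdges n _ t i = (some (es a).1, some (es a).2) := by
  unfold extEdges
  rw [hi, h.eu_eq a a.2, h.ev_eq a a.2, h0, h1, tails_fin, heads_fin, decOption_val, decOption_val]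

theorem OddJoined.extEdges_new (h : OddJoined n m O s t) {j : ℕ} (hj : j < O.length)
    (hn : O[j] < n) (i : Fin (m + O.length)) (hi : (i : ℕ) = m + j) :
    extEdges n _ t i = (some ⟨O[j], hn⟩, none) := by
  unfold extEdges
  rw [hi, h.new_tails j hj, h.new_heads j hj, decOption_self]
  exact Prod.ext (decOption_val ⟨O[j], hn⟩) rfl

theorem fin_add_cases {m l : ℕ} (i : Fin (m + l)) :
    (∃ a : Fin m, (i : ℕ) = a) ∨ ∃ j < l, (i : ℕ) = m + j := by
  have := i.2
  by_cases h : (i : ℕ) < m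
  · exact Or.inl ⟨⟨i, h⟩, rfl⟩
  · exact Or.inr ⟨i - m, by omega, by omega⟩

theorem OddJoined.extEdges_injective (h : OddJoined n m O s t) (h0 : s.arr 0 = tails es)
    (h1 : s.arr 1 = heads es) (hinj : Function.Injective fun i => s((es i).1, (es i).2))
    (hO : ∀ x ∈ O, x < n) (hnd : O.Nodup) :
    Function.Injective fun i => s((extEdges n (m + O.length) t i).1, (extEdges n _ t i).2) := by
  intro i i' hii
  simp only at hii
  rcases fin_add_cases i with ⟨a, ha⟩ | ⟨j, hj, hij⟩ <;>
    rcases fin_add_cases i' with ⟨a', ha'⟩ | ⟨j', hj', hij'⟩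
  · rw [h.extEdges_old h0 h1 a i ha, h.extEdges_old h0 h1 a' i' ha'] at hii
    have : (s((es a).1, (es a).2)).map some = (s((es a').1, (es a').2)).map some := hii
    have := hinj (Sym2.map.injective (Option.some_injective _) this)
    subst this
    exact Fin.ext (ha.trans ha'.symm)
  · rw [h.extEdges_old h0 h1 a i ha, h.extEdges_new hj' (hO _ (List.getElem_mem _)) i' hij'] at hii
    simp [Sym2.eq_iff] at hii
  · rw [h.extEdges_old h0 h1 a' i' ha', h.extEdges_new hj (hO _ (List.getElem_mem _)) i hij] at hii
    simp [Sym2.eq_iff] at hii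
  · rw [h.extEdges_new hj (hO _ (List.getElem_mem _)) i hij,
      h.extEdges_new hj' (hO _ (List.getElem_mem _)) i' hij'] at hii
    simp only [Sym2.eq_iff, Option.some.injEq, Fin.mk.injEq, reduceCtorEq, and_true, and_self,
      or_false] at hii
    have := (List.Nodup.getElem_inj_iff hnd).1 hii
    exact Fin.ext (by omega)

theorem OddJoined.extEdges_loopless (h : OddJoined n m O s t) (h0 : s.arr 0 = tails es)
    (h1 : s.arr 1 = heads es) (hne : ∀ i, (es i).1 ≠ (es i).2)
    (hO : ∀ x ∈ O, x < n) (i : Fin (m + O.length)) :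
    (extEdges n _ t i).1 ≠ (extEdges n _ t i).2 := by
  rcases fin_add_cases i with ⟨a, ha⟩ | ⟨j, hj, hij⟩
  · rw [h.extEdges_old h0 h1 a i ha]
    simpa using hne a
  · rw [h.extEdges_new hj (hO _ (List.getElem_mem _)) i hij]
    simp

theorem OddJoined.extEdges_enc (h : OddJoined n m O s t) (h0 : s.arr 0 = tails es)
    (h1 : s.arr 1 = heads es) (hO : ∀ x ∈ O, x < n) (i : Fin (m + O.length)) :
    t.arr 0 i = encOption (extEdges n _ t i).1 ∧ t.arr 1 i = encOption (extEdges n _ t i).2 := by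
  unfold extEdges
  rcases fin_add_cases i with ⟨a, ha⟩ | ⟨j, hj, hij⟩
  · rw [ha, h.eu_eq a a.2, h.ev_eq a a.2, h0, h1, tails_fin, heads_fin]
    exact ⟨(encOption_decOption (es a).1.2.le).symm, (encOption_decOption (es a).2.2.le).symm⟩
  · rw [hij, h.new_tails j hj, h.new_heads j hj]
    have := hO _ (List.getElem_mem hj)
    exact ⟨(encOption_decOption this.le).symm, (encOption_decOption le_rfl).symm⟩

/-- The extended graph represents `evenConfig`. -/
theorem OddJoined.walkCfg_eq (h : OddJoined n m O s t) (h0 : s.arr 0 = tails es)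
    (h1 : s.arr 1 = heads es)
    (hO : ∀ v : Fin n, (v : ℕ) ∈ O ↔ v ∈ (cfgOf es s).verts ∧ Odd (deg (cfgOf es s) v))
    (hOn : ∀ x ∈ O, x < n) {t' : Store} (h7 : ∀ x < n, t'.arr 7 x = s.arr 7 x)
    (h7n : t'.arr 7 n = 0) (h8 : t'.arr 8 = t.arr 8) :
    walkCfg encOption (extEdges n (m + O.length) t) ∅ (t.arr 8) [] t' =
      evenConfig (cfgOf es s) := by
  rw [walkCfg, evenConfig, Config.mk.injEq]
  refine ⟨?_, ?_, ?_⟩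
  · ext x
    simp only [Finset.mem_filter, Finset.mem_univ, true_and]
    cases x with
    | none => simpa [encOption] using h7n
    | some v => simp [encOption, h7 v v.2, cfgOf]
  · ext e
    simp only [Finset.mem_image, Finset.mem_filter, Finset.mem_univ, true_and, Finset.mem_union,
      List.not_mem_nil, or_false, h8]
    constructor
    · rintro ⟨i, hi, rfl⟩
      rcases fin_add_cases i with ⟨a, ha⟩ | ⟨j, hj, hij⟩
      · left
        rw [h.extEdges_old h0 h1 a i ha]
        refine ⟨s((es a).1, (es a).2), mem_cfgOf_edges.2 ⟨a, ?_, rfl⟩, rfl⟩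
        rw [← h.done a a.2, ← ha, hi]
      · right
        have hn := hOn _ (List.getElem_mem hj)
        rw [h.extEdges_new hj hn i hij]
        exact ⟨⟨O[j], hn⟩, (hO _).1 (List.getElem_mem hj), rfl⟩
    · rintro (⟨f, hf, rfl⟩ | ⟨u, hu, rfl⟩)
      · obtain ⟨a, ha, rfl⟩ := mem_cfgOf_edges.1 hf
        have := a.2
        refine ⟨⟨a, by omega⟩, ?_, ?_⟩
        · rw [h.done a a.2, ha]
        · rw [h.extEdges_old h0 h1 a _ rfl]
          rfl
      · obtain ⟨j, hj, hju⟩ := List.mem_iff_getElem.1 ((hO u).2 hu)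
        refine ⟨⟨m + j, by omega⟩, h.new_done j hj, ?_⟩
        rw [h.extEdges_new hj (by rw [hju]; exact u.2) _ rfl]
        simp only [hju]
  · simp [h8]

/-- Added edges have `none` as an end and yield no arc between old vertices; discarding the new
vertex therefore takes no action. -/
theorem OddJoined.outputArcs_iff (h : OddJoined n m O s t) (h0 : s.arr 0 = tails es)
    (h1 : s.arr 1 = heads es) (hOn : ∀ x ∈ O, x < n) {t' : Store}
    (hout : ∀ i : Fin m, s.arr 8 i ≠ 0 → t'.arr 3 i = s.arr 3 i) (a : Fin n × Fin n) :
    a ∈ outputArcs es t' ↔ a ∈ (cfgOf es s).arcs ∨ (some a.1, some a.2) ∈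
      (Finset.univ.filter fun i : Fin (m + O.length) => t.arr 8 i = 0).image
        (orient (extEdges n _ t) (t'.arr 3)) := by
  have hor : ∀ (i : Fin m) (j : Fin (m + O.length)), (j : ℕ) = i →
      orient (extEdges n _ t) (t'.arr 3) j =
        (some (orient es (t'.arr 3) i).1, some (orient es (t'.arr 3) i).2) := by
    intro i j hj
    unfold orient
    rw [h.extEdges_old h0 h1 i j hj, hj]
    split <;> rfl
  rw [outputArcs_eq]
  simp only [cfgOf, Finset.mem_image, Finset.mem_filter, Finset.mem_univ, true_and]
  constructor
  · rintro ⟨i, rfl⟩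
    by_cases hi : s.arr 8 i = 0
    · have := i.2
      refine Or.inr ⟨⟨i, by omega⟩, ?_, hor i _ rfl⟩
      rw [h.done i i.2, hi]
    · refine Or.inl ⟨i, hi, ?_⟩
      unfold orient
      rw [hout i hi]
  · rintro (⟨i, hi, rfl⟩ | ⟨j, hj, hja⟩)
    · refine ⟨i, ?_⟩
      unfold orient
      rw [hout i hi]
    · rcases fin_add_cases j with ⟨i, hi⟩ | ⟨k, hk, hij⟩
      · refine ⟨i, ?_⟩
        rw [hor i j hi, Prod.mk.injEq, Option.some.injEq, Option.some.injEq] at hja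
        exact Prod.ext hja.1 hja.2
      · exfalso
        have := orient_edge (extEdges n _ t) (t'.arr 3) j
        rw [hja, h.extEdges_new hk (hOn _ (List.getElem_mem hk)) j hij] at this
        simp [Sym2.eq_iff] at this

end Extended

/-- Finishing by Euler tours. -/
def eulerCmd : Cmd :=
  .call parityCmd ⨾
  .call joinCmd ⨾
  .set 14 (.var 0 ∔ .const 1) ⨾
  .put 7 (.var 0) (.const 0) ⨾
  .call walkCmd

variable {n m : ℕ} {es : Fin m → Fin n × Fin n}

/-- The walk on the extended graph serves only to halve the degrees. They are even, so the
orientation is balanced, and `eulerFinish` turns it into Euler tours without any tour being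
computed. -/
theorem euler_spec {M k K : ℕ} {wN : ℕ → ℕ} {S : Finset ℕ} {s : Store}
    (hinj : Function.Injective fun i => s((es i).1, (es i).2)) (hne : ∀ i, (es i).1 ≠ (es i).2)
    (hs : PeelSt n m (tails es) (heads es) wN S s) (h9 : s.arr 9 = fun _ => 0)
    (h12 : s.arr 12 = fun _ => 0) (h13 : s.arr 13 = fun _ => 0) (hM : n + 1 ≤ M)
    (hk : 39 * m + 61 * n + 27 + K ≤ k) :
    Tri M eulerCmd s k fun k' s' => K ≤ k' ∧
      (∀ i : Fin m, s.arr 8 i ≠ 0 → s'.arr 3 i = s.arr 3 i) ∧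
      Finish .euler (cfgOf es s) (outputArcs es s') ∧
      ∀ v, indeg (outputArcs es s') v ≤
        indeg (cfgOf es s).arcs v + (deg (cfgOf es s) v + 1) / 2 := by
  have hgood := hs.good hne
  have htne : ∀ i < m, tails es i ≠ heads es i := by
    intro i hi
    have := hne ⟨i, hi⟩
    rw [Ne, Fin.ext_iff, ← tails_fin, ← heads_fin] at this
    exact this
  apply Tri.of_wp
  simp only [eulerCmd, wp]
  refine (parityCmd_spec (m := m) (K := 32 * m + 61 * n + 25 + K) hs.m_eq
    (by rw [hs.eu_eq, hs.ev_eq]; exact htne) h9 (by omega)).framed ?_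
  rintro k₁ s₁ ⟨hk₁, hpar⟩ ⟨fr, fa⟩
  clear hk
  rw [hs.eu_eq, hs.ev_eq] at hpar
  have a0 : s₁.arr 0 = tails es := by rw [fa 0 (by decide), hs.eu_eq]
  have a1 : s₁.arr 1 = heads es := by rw [fa 1 (by decide), hs.ev_eq]
  refine (joinCmd_spec (n := n) (m := m) (K := 32 * m + 50 * n + 22 + K) ?_ ?_ ?_ ?_
    (by omega)).framed ?_
  · rw [fr 0 (by decide), hs.n_eq]
  · rw [fr 1 (by decide), hs.m_eq]
  · rw [fr 11 (by decide), hs.st_eq]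
  · rw [a0, a1, fa 4 (by decide), fa 5 (by decide)]
    exact hs.rows
  rintro k₂ t ⟨hk₂, hJ⟩ ⟨gr, ga⟩
  clear hk₁ k₁
  set O := (List.range n).filter fun v => s₁.arr 9 v = 1 with hOdef
  have hOlen : O.length ≤ n := (List.length_filter_le _ _).trans (by simp)
  have hOn : ∀ x ∈ O, x < n := fun x hx => by
    simp only [hOdef, List.mem_filter, List.mem_range] at hx
    exact hx.1
  have hnd : O.Nodup := List.Nodup.filter _ List.nodup_range
  have hcfg : cfgOf es s₁ = cfgOf es s :=
    cfgOf_congr (fa 3 (by decide)) (fa 7 (by decide)) (fa 8 (by decide))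
  have hO : ∀ v : Fin n, (v : ℕ) ∈ O ↔
      v ∈ (cfgOf es s₁).verts ∧ Odd (deg (cfgOf es s₁) v) := by
    intro v
    rw [hcfg]
    have h1 : s₁.arr 9 v = deg (cfgOf es s) v % 2 := by
      rw [hpar, deg_eq_wdeg, wdeg_cfgOf (wN := fun _ => 1) hinj (fun _ => rfl)]
    simp only [hOdef, List.mem_filter, List.mem_range, v.2, true_and, h1, decide_eq_true_eq]
    rw [← Nat.odd_iff]
    refine ⟨fun h => ⟨?_, h⟩, fun h => h.2⟩
    have hpos : 0 < deg (cfgOf es s) v := h.pos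
    obtain ⟨e, he⟩ := Finset.card_pos.1 hpos
    rw [Finset.mem_filter] at he
    exact hgood.ends e he.1 v he.2
  obtain ⟨k₂, rfl⟩ := Nat.exists_eq_add_of_le' (show 2 ≤ k₂ by omega)
  have t0 : t.reg 0 = n := by
    rw [gr 0 (by decide), fr 0 (by decide), hs.n_eq]
  have t11 : t.reg 11 = n + m + 1 := by
    rw [gr 11 (by decide), fr 11 (by decide), hs.st_eq]
  have t7 : t.arr 7 = s.arr 7 := by
    rw [ga 7 (by decide), fa 7 (by decide)]
  have t3 : t.arr 3 = s.arr 3 := by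
    rw [ga 3 (by decide), fa 3 (by decide)]
  have t12 : t.arr 12 = fun _ => 0 := by
    rw [ga 12 (by decide), fa 12 (by decide), h12]
  have t13 : t.arr 13 = fun _ => 0 := by
    rw [ga 13 (by decide), fa 13 (by decide), h13]
  have s8 : s₁.arr 8 = s.arr 8 := fa 8 (by decide)
  have s7 : s₁.arr 7 = s.arr 7 := fa 7 (by decide)
  simp [Op.eval, t0]
  have hes0 := fun i => (hJ.extEdges_enc a0 a1 hOn i).1
  have hes1 := fun i => (hJ.extEdges_enc a0 a1 hOn i).2
  have hinj' := hJ.extEdges_injective a0 a1 hinj hOn hnd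
  have hne' := hJ.extEdges_loopless a0 a1 hne hOn
  have hw : WalkGraph encOption (n + 1) (extEdges n (m + O.length) t)
      (incList (t.arr 0) (t.arr 1) (m + O.length)) (t.arr 8) :=
    walkGraph_incList encOption_injective encOption_lt
      (fun x hx => ⟨decOption n x, encOption_decOption (by omega)⟩) hinj' hne' hes0 hes1 _
  have hst : WalkSt encOption (n + 1) (n + m + 1) (extEdges n (m + O.length) t)
      (incList (t.arr 0) (t.arr 1) (m + O.length)) (t.arr 8) (t.arr 3) [] []
      ((t.setReg 14 (n + 1)).setArr 7 n 0) := by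
    refine ⟨by simp, by simp [t11], ?_, ?_, ?_, trivial, by simp, .nil, ?_, by simp, ?_,
      ?_, ?_, fun i hi => by simpa using hi, by simp, fun i _ => by simp⟩
    · intro i
      simpa using hes0 i
    · intro i
      simpa using hes1 i
    · simpa using hJ.rows
    · simp [t12]
    · rintro i (hi | hi)
      · have hnone : Function.update (s.arr 7) n 0 (encOption (n := n) none) = 0 := by
          simp [encOption]
        have hsome : ∀ v : Fin n, v ∈ (cfgOf es s).verts →
            Function.update (s.arr 7) n 0 (encOption (some v)) = 0 := by
          intro v hv
          have := v.2
          have hv' : s.arr 7 v = 0 := by simpa [cfgOf] using hv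
          simp only [encOption, Option.elim]
          rw [Function.update_of_ne (by omega), hv']
        simp only [setReg_arr, setArr_arr, if_pos, t7]
        have hi' : t.arr 8 i = 0 := by simpa using hi
        rcases fin_add_cases i with ⟨a, ha⟩ | ⟨j, hj, hij⟩
        · rw [hJ.extEdges_old a0 a1 a i ha]
          have he : s((es a).1, (es a).2) ∈ (cfgOf es s).edges := by
            refine mem_cfgOf_edges.2 ⟨a, ?_, rfl⟩
            rw [← s8, ← hJ.done a a.2, ← ha, hi']
          exact ⟨hsome _ (hgood.ends _ he _ (by simp)), hsome _ (hgood.ends _ he _ (by simp))⟩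
        · rw [hJ.extEdges_new hj (hOn _ (List.getElem_mem hj)) i hij]
          refine ⟨hsome _ ?_, hnone⟩
          rw [← hcfg]
          exact ((hO ⟨O[j], _⟩).1 (List.getElem_mem hj)).1
      · simp at hi
    · simp [t13]
    · simp [t13]
  have hsum : ∑ v : Option (Fin n), (incList (t.arr 0) (t.arr 1) (m + O.length) (encOption v)).length
      ≤ 2 * (m + O.length) := by
    refine (sum_enc_le encOption_injective encOption_lt
      fun v => (incList (t.arr 0) (t.arr 1) (m + O.length) v).length).trans
      (sum_length_incList fun i hi => ?_)
    rw [hes0 ⟨i, hi⟩, hes1 ⟨i, hi⟩]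
    exact fun h => hne' ⟨i, hi⟩ (encOption_injective h)
  refine (walkCmd_spec (A₀ := ∅) (K := K) hw hM hst (by omega)).mono ?_
  rintro k' s' ⟨hk', d, hr, hv, he, ha, ho⟩
  rw [hJ.walkCfg_eq a0 a1 hO hOn (by
      intro x hx
      have : x ≠ n := by omega
      simp [Function.update_of_ne this, t7, s7]) (by simp) (by simp), hcfg] at hr
  rw [Finset.empty_union] at ha
  have hout : ∀ i : Fin m, s.arr 8 i ≠ 0 → s'.arr 3 i = s.arr 3 i := by
    intro i hi
    have := i.2
    rw [ho ⟨i, by omega⟩, t3]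
    simpa only [hJ.done i i.2, s8] using hi
  have hD : ∀ a : Fin n × Fin n, a ∈ outputArcs es s' ↔
      a ∈ (cfgOf es s).arcs ∨ (some a.1, some a.2) ∈ d.arcs := by
    intro a
    rw [← hcfg, ha]
    refine hJ.outputArcs_iff a0 a1 hOn (fun i hi => ?_) a
    rw [s8] at hi
    rw [hout i hi, fa 3 (by decide)]
  -- No arc is present at the start in `evenConfig`, so the half bound for cycle and forest steps
  -- has no offset.
  have hdeg : ∀ x, indeg d.arcs x ≤ (deg (evenConfig (cfgOf es s)) x + 1) / 2 := by
    intro x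
    have := indeg_le_of_finishSteps hr x
    simpa [evenConfig, indeg] using this
  refine ⟨hk', hout, ?_, indeg_le_of_even hgood hdeg hD⟩
  refine eulerFinish hgood ?_ hdeg hD
  rw [ha]
  refine isOrientation_image hinj' (fun e => ?_) _
  rw [← mem_evenConfig_edges hgood, ← hcfg, ← hJ.walkCfg_eq a0 a1 hO hOn
    (t' := (t.setReg 14 (n + 1)).setArr 7 n 0) (by
      intro x hx
      have : x ≠ n := by omega
      simp [Function.update_of_ne this, t7, s7]) (by simp) (by simp)]
  simp [walkCfg]

/-! ## The whole algorithm -/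

/-- The part after the peeling phase. -/
def finishCmd : Mode → Cmd
  | .cycles => .set 14 (.var 0) ⨾ .call walkCmd
  | .euler => eulerCmd

/-- The algorithm, with a priority queue given by `init`, `ext` and `dec`. -/
def algorithmCmd (μ : Mode) (init ext dec : Cmd) : Cmd :=
  .call buildCmd ⨾ .call init ⨾ .call (peelCmd ext dec) ⨾ .call (finishCmd μ)

section

variable {n m : ℕ} {es : Fin m → Fin n × Fin n}

theorem finishCmd_spec (μ : Mode) {M k K : ℕ} {wN : ℕ → ℕ} {S : Finset ℕ} {s : Store}
    (hinj : Function.Injective fun i => s((es i).1, (es i).2)) (hne : ∀ i, (es i).1 ≠ (es i).2)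
    (hs : PeelSt n m (tails es) (heads es) wN S s) (h9 : s.arr 9 = fun _ => 0)
    (h12 : s.arr 12 = fun _ => 0) (h13 : s.arr 13 = fun _ => 0) (hM : n + 1 ≤ M)
    (hk : 39 * m + 61 * n + 27 + K ≤ k) :
    Tri M (finishCmd μ) s k fun k' s' => K ≤ k' ∧
      (∀ i : Fin m, s.arr 8 i ≠ 0 → s'.arr 3 i = s.arr 3 i) ∧
      Finish μ (cfgOf es s) (outputArcs es s') ∧
      ∀ v, indeg (outputArcs es s') v ≤
        indeg (cfgOf es s).arcs v + (deg (cfgOf es s) v + 1) / 2 := by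
  cases μ with
  | cycles => exact cycles_spec hinj hne hs h12 h13 (by omega) (by omega)
  | euler => exact euler_spec hinj hne hs h9 h12 h13 hM hk

theorem IsEdgeListing.ne {G : SimpleGraph (Fin n)} (h : IsEdgeListing G es) (i : Fin m) :
    (es i).1 ≠ (es i).2 := by
  have : s((es i).1, (es i).2) ∈ G.edgeSet := h.2 ▸ Set.mem_range_self i
  exact G.ne_of_adj (G.mem_edgeSet.1 this)

theorem IsEdgeListing.isOrientation {G : SimpleGraph (Fin n)} (h : IsEdgeListing G es)
    (s : Store) : IsOrientation G (outputArcs es s) := by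
  rw [outputArcs_eq]
  refine isOrientation_image h.1 (fun e => ?_) _
  rw [← h.2]
  simp

/-- The result `D` of a run of the algorithm that left the repeat-until loop in `c`. -/
structure Outcome (μ : Mode) (G : SimpleGraph (Fin n)) [DecidableRel G.Adj]
    (w : Sym2 (Fin n) → ℕ) (c : Config (Fin n)) (D : Finset (Fin n × Fin n)) : Prop where
  loop : RepeatLoop w (density w ⟨Finset.univ, G.edgeFinset, ∅⟩) ⟨Finset.univ, G.edgeFinset, ∅⟩ c
  early : c.verts = ∅ → D = c.arcs
  finish : Finish μ c D
  indeg_le : ∀ v, indeg D v ≤ indeg c.arcs v + (deg c v + 1) / 2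

theorem Outcome.mayReturn {μ : Mode} {G : SimpleGraph (Fin n)} [DecidableRel G.Adj]
    {w : Sym2 (Fin n) → ℕ} {c : Config (Fin n)} {D : Finset (Fin n × Fin n)}
    (h : Outcome μ G w c D) : MayReturn μ G w D := by
  refine ⟨c, h.loop, ?_⟩
  by_cases hc : c.verts = ∅
  · exact Or.inl ⟨hc, h.early hc⟩
  · exact Or.inr ⟨hc, h.finish⟩

/-- A vertex peeled off has no edge left and keeps its at most `2p - 1` arcs. A vertex of the
uniform graph had no arc before and has degree at most `2p`, so it receives at most `p`, which is at
most `2p - 1` as `p` is positive. -/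
theorem Outcome.indeg_le_pseudoarboricity {μ : Mode} {G : SimpleGraph (Fin n)} [DecidableRel G.Adj]
    {c : Config (Fin n)} {D : Finset (Fin n × Fin n)} (h : Outcome μ G (fun _ => 1) c D)
    (hn : 0 < n) (hp : 0 < pseudoarboricity G) (v : Fin n) :
    indeg D v ≤ 2 * pseudoarboricity G - 1 := by
  have h0 : PeelInv G (⟨Finset.univ, G.edgeFinset, ∅⟩ : Config (Fin n)) := by
    refine ⟨⟨by simp, ?_⟩, by simp, by simp [indeg], by simp⟩
    intro e he
    exact G.not_isDiag_of_mem_edgeSet (SimpleGraph.mem_edgeFinset.1 he)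
  have hne : (Finset.univ : Finset (Fin n)) ≠ ∅ :=
    Finset.Nonempty.ne_empty ⟨⟨0, hn⟩, Finset.mem_univ _⟩
  obtain ⟨hinv, hfin⟩ := h0.repeatLoop (h0.ceil_le hne) h.loop
  have hle := h.indeg_le v
  by_cases hv : v ∈ c.verts
  · have hu := (hfin.resolve_left (Finset.ne_empty_of_mem hv)) v hv
    have := hinv.ceil_le (Finset.ne_empty_of_mem hv)
    rw [hinv.alive v hv, deg_eq_wdeg] at hle
    omega
  · have hd : deg c v = 0 := by
      unfold deg
      rw [Finset.card_eq_zero, Finset.filter_eq_empty_iff]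
      exact fun e he hve => hv (hinv.good.ends e he v hve)
    have := hinv.dead v hv
    rw [hd] at hle
    omega

theorem algorithmCmd_spec (μ : Mode) {G : SimpleGraph (Fin n)} [DecidableRel G.Adj]
    (hG : IsEdgeListing G es) (hn : 0 < n) {M W a₀ a₁ a₂ Φ : ℕ} {w : Sym2 (Fin n) → ℕ} {wN : ℕ → ℕ}
    {ok : ℕ → Prop} {init ext dec : Cmd} {Inv : Finset ℕ → ℕ → Store → Prop}
    (pq : PQSpec M a₁ a₂ ok ext dec Inv)
    (hinit : ∀ {s k K}, s.reg 0 = n → (∀ A, 20 ≤ A → s.arr A = fun _ => 0) →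
      (∀ v, s.arr 6 v ≤ m * W) → a₀ + K ≤ k →
      Tri M init s k fun k' s' => K ≤ k' ∧ Inv (Finset.range n) Φ s')
    (hir : ∀ r ∈ init.regs, 20 ≤ r) (hia : ∀ A ∈ init.arrs, 20 ≤ A)
    (hw : ∀ i : Fin m, wN i = w s((es i).1, (es i).2)) (hW : ∀ i < m, wN i ≤ W)
    (hok : ∀ i < m, ok (wN i)) (hM : 2 * (m * W) + n + m + 1 ≤ M) {s : Store} {k : ℕ}
    (h0 : s.reg 0 = n) (h1 : s.reg 1 = m) (e0 : s.arr 0 = tails es) (e1 : s.arr 1 = heads es)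
    (e2 : s.arr 2 = wN) (hz : ∀ A, 3 ≤ A → s.arr A = fun _ => 0)
    (hk : 50 * m + 61 * n + 39 + a₀ + Φ + 2 * m * (a₂ + 10) + n * (a₁ + 12) ≤ k) :
    Tri M (algorithmCmd μ init ext dec) s k fun _ s' => ∃ c, Outcome μ G w c (outputArcs es s') := by
  have hne := hG.ne
  have htne : ∀ i < m, tails es i ≠ heads es i := by
    intro i hi
    have := hne ⟨i, hi⟩
    rw [Ne, Fin.ext_iff, ← tails_fin, ← heads_fin] at this
    exact this
  have hsum : ∑ v ∈ Finset.range n,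
      ((incList (tails es) (heads es) m v).length * (a₂ + 10) + (a₁ + 12)) ≤
      2 * m * (a₂ + 10) + n * (a₁ + 12) := by
    rw [Finset.sum_add_distrib, ← Finset.sum_mul, Finset.sum_const, Finset.card_range, smul_eq_mul]
    exact Nat.add_le_add_right (Nat.mul_le_mul_right _ (sum_length_incList htne)) _
  set T := 2 * m * (a₂ + 10) + n * (a₁ + 12) with hT
  apply Tri.of_wp
  simp only [algorithmCmd, wp]
  refine (buildCmd_spec (n := n) (m := m) (W := W)
    (K := 39 * m + 61 * n + 35 + a₀ + Φ + T) htne hW (by omega) (by omega)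
    h0 h1 e0 e1 e2 (hz 4 (by omega)) (hz 6 (by omega)) (by omega)).framed ?_
  rintro k₁ s₁ ⟨hk₁, r11, hrows, hkey, htot⟩ ⟨fr, fa⟩
  have hfa : ∀ A, 7 ≤ A → s₁.arr A = fun _ => 0 := by
    intro A hA
    rw [fa A, hz A (by omega)]
    simp [buildCmd]
    omega
  refine (hinit (K := 39 * m + 61 * n + 35 + Φ + T) ?_ (fun A hA => hfa A (by omega)) ?_
    (by omega)).framed ?_
  · rw [fr 0 (by decide), h0]
  · intro v
    rw [hkey]
    exact wsum_le _ _ _ hW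
  rintro k₂ s₂ ⟨hk₂, hI⟩ ⟨gr, ga⟩
  have hgr : ∀ r < 20, s₂.reg r = s₁.reg r := fun r hr =>
    gr r fun h => by have := hir r h; omega
  have hga : ∀ A < 20, s₂.arr A = s₁.arr A := fun A hA =>
    ga A fun h => by have := hia A h; omega
  have h7 : s₂.arr 7 = fun _ => 0 := by rw [hga 7 (by omega), hfa 7 (by omega)]
  have h8 : s₂.arr 8 = fun _ => 0 := by rw [hga 8 (by omega), hfa 8 (by omega)]
  have hst : PeelSt n m (tails es) (heads es) wN (Finset.range n) (s₂.setReg 7 n) := by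
    refine ⟨?_, ?_, ?_, ?_, ?_, ?_, ?_, by simp, ?_, ?_, ?_, ?_, by simp⟩
    · simp [hgr 0 (by omega), fr 0 (by decide), h0]
    · simp [hgr 1 (by omega), fr 1 (by decide), h1]
    · simp [hgr 11 (by omega), r11]
    · simp [hga 0 (by omega), fa 0 (by decide), e0]
    · simp [hga 1 (by omega), fa 1 (by decide), e1]
    · simp [hga 2 (by omega), fa 2 (by decide), e2]
    · simpa [hga 4 (by omega), hga 5 (by omega)] using hrows
    · intro v hv
      simp [h7, hv]
    · intro i hi _
      have h1 := tails_fin es ⟨i, hi⟩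
      have h2 := heads_fin es ⟨i, hi⟩
      simp only at h1 h2
      rw [h1, h2]
      simp
    · intro u _
      rw [setReg_arr, hga 6 (by omega), hkey]
      exact wsum_congr _ _ fun j _ => by simp [h8]
    · rw [setReg_reg, if_neg (by omega), hgr 6 (by omega), htot]
      exact wsum_congr _ _ fun j _ => by simp [h8]
  refine (peelCmd_spec (K := 39 * m + 61 * n + 27) pq hG.1 hne hw hW hok (by omega) hn hst hI
    (by omega)).framed ?_
  rintro k₃ s₃ ⟨hk₃, ⟨S, hS⟩, hloop⟩ ⟨qr, qa⟩
  have hqa : ∀ A, 9 ≤ A → A < 20 → s₃.arr A = fun _ => 0 := by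
    intro A hA hA'
    rw [qa A, hga A hA', hfa A (by omega)]
    have h1 : A ∉ ext.arrs := fun h => by have := pq.ext_arrs A h; omega
    have h2 : A ∉ dec.arrs := fun h => by have := pq.dec_arrs A h; omega
    simp [peelCmd, absorbCmd, h1, h2]
    omega
  refine (finishCmd_spec μ (K := 0) hG.1 hne hS (hqa 9 (by omega) (by omega))
    (hqa 12 (by omega) (by omega)) (hqa 13 (by omega) (by omega)) (by omega) (by omega)).mono ?_
  rintro k₄ s₄ ⟨-, hout, hfin, hdeg⟩
  have hcfg : cfgOf es s₂ = ⟨Finset.univ, G.edgeFinset, ∅⟩ := by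
    rw [cfgOf, Config.mk.injEq]
    refine ⟨by simp [h7], ?_, by simp [h8]⟩
    ext e
    rw [SimpleGraph.mem_edgeFinset, ← hG.2]
    simp [h8]
  rw [hcfg] at hloop
  refine ⟨cfgOf es s₃, hloop, ?_, hfin, hdeg⟩
  -- With no vertex left, all edges are oriented already. The finishing program runs nevertheless,
  -- but it alters none of them, so the early return is respected.
  intro hv
  have hdone : ∀ i : Fin m, s₃.arr 8 i ≠ 0 := by
    intro i hi
    have h1 := (hS.good hne).ends _ (mem_cfgOf_edges.2 ⟨i, hi, rfl⟩) (es i).1 (by simp)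
    rw [hv] at h1
    simp at h1
  rw [outputArcs_eq, cfgOf]
  simp only [ne_eq, hdone, not_false_eq_true, Finset.filter_true]
  refine Finset.image_congr fun i _ => ?_
  unfold orient
  rw [hout i (hdone i)]

end

/-! ### Time bounds and word sizes of the two programs -/

/-- All weights become one. -/
def onesCmd : Cmd :=
  .set 2 (.const 0) ⨾
  .while (.lt (.var 2) (.var 1))
    (.put 2 (.var 2) (.const 1) ⨾
     .set 2 (.var 2 ∔ .const 1))

theorem onesCmd_spec {M m k K : ℕ} {s : Store} (h1 : s.reg 1 = m) (hk : 3 * m + 2 + K ≤ k) :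
    Tri M onesCmd s k fun k' s' => K ≤ k' ∧ ∀ i < m, s'.arr 2 i = 1 := by
  apply Tri.of_wp
  obtain ⟨k, rfl⟩ := Nat.exists_eq_add_of_le' (show 1 ≤ k by omega)
  simp only [onesCmd, wp]
  simp
  refine Tri.while (fun k' s' => s'.reg 1 = m ∧ s'.reg 2 ≤ m ∧ 3 * (m - s'.reg 2) + 1 + K ≤ k' ∧
    ∀ i < s'.reg 2, s'.arr 2 i = 1) ?_ ?_ ?_
  · clear hk k
    rintro k s' ⟨g1, g2, hk, h⟩ hlt
    rw [ne_eq, eval_lt_eq_zero, not_not] at hlt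
    simp only [Expr.eval, g1] at hlt
    obtain ⟨k, rfl⟩ := Nat.exists_eq_add_of_le' (show 3 ≤ k by omega)
    refine ⟨by omega, Tri.of_wp_forall fun R hR => ?_⟩
    simp [wp, Op.eval]
    refine hR _ _ ⟨?_, ?_, ?_, ?_⟩
    · simpa using g1
    · simp; omega
    · simp; omega
    · intro i hi
      simp at hi ⊢
      by_cases hir : i = s'.reg 2
      · subst hir; simp
      · rw [Function.update_of_ne hir]
        exact h i (by omega)
  · clear hk k
    rintro k s' ⟨g1, g2, hk, h⟩ hlt
    rw [eval_lt_eq_zero] at hlt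
    simp only [Expr.eval, g1] at hlt
    exact ⟨by omega, by omega, fun i hi => h i (by omega)⟩
  · exact ⟨by simpa using h1, by simp, by simp; omega, by simp⟩

/-- A constant factor is at most a power of `Y ≥ 2`, so it can be moved into the exponent. This
yields a fixed power of the input size as bound for machine words. -/
theorem pow_lt_of_le_mul {Y Z a κ : ℕ} (hY : 2 ≤ Y) (h : Z ≤ a * Y) :
    Z ^ κ < Y ^ ((a + 1) * κ + 1) := by
  have h1 : a ≤ Y ^ a := (Nat.lt_pow_self (by omega)).le
  have h2 : Z ≤ Y ^ (a + 1) := h.trans (by rw [pow_succ]; exact Nat.mul_le_mul_right _ h1)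
  calc Z ^ κ ≤ (Y ^ (a + 1)) ^ κ := Nat.pow_le_pow_left h2 κ
    _ = Y ^ ((a + 1) * κ) := by rw [← pow_mul]
    _ < Y ^ ((a + 1) * κ + 1) := Nat.pow_lt_pow_right (by omega) (by omega)

theorem graphInput_reg_le {n m : ℕ} (es : Fin m → Fin n × Fin n) (r : ℕ) :
    (graphInput es).reg r ≤ n + m := by
  unfold graphInput
  simp only
  split <;> omega

theorem arrayOf_le {m X : ℕ} {f : Fin m → ℕ} (h : ∀ i, f i ≤ X) (i : ℕ) : arrayOf f i ≤ X := by
  unfold arrayOf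
  split
  · exact h _
  · omega

theorem graphInput_arr_le {n m : ℕ} (es : Fin m → Fin n × Fin n) (A i : ℕ) :
    (graphInput es).arr A i ≤ n := by
  unfold graphInput
  simp only
  split
  · exact arrayOf_le (fun i => (es i).1.2.le) i
  · exact arrayOf_le (fun i => (es i).2.2.le) i
  · exact Nat.zero_le _

theorem graphInput_arr_of_le {n m : ℕ} (es : Fin m → Fin n × Fin n) {A : ℕ} (hA : 2 ≤ A) :
    (graphInput es).arr A = fun _ => 0 := by
  unfold graphInput
  simp only
  split
  · omega
  · omega
  · rfl

theorem outputArcs_congr {n m : ℕ} (es : Fin m → Fin n × Fin n) {s s' : Store}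
    (h : s.arr = s'.arr) : outputArcs es s = outputArcs es s' := by
  unfold outputArcs
  rw [h]

/-- With unit weights all keys are at most `m`, and `n ≤ m` absorbs the terms linear in `n`. The
exponent comes from initial numbers up to `4(n + m)` and at most `250 m` steps, together at most
`254 (n + m)`. -/
theorem unweighted_linear_time (μ : Mode) : ∃ (P : Prog) (c C : ℕ),
    ∀ (n m : ℕ) (G : SimpleGraph (Fin n)) [DecidableRel G.Adj] (es : Fin m → Fin n × Fin n),
      2 ≤ n → n ≤ m → IsEdgeListing G es → ∃ (t : ℕ) (σ : Store),
        Exec ((n + m) ^ c) P (graphInput es) t σ ∧ t ≤ C * m ∧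
        ∃ c, Outcome μ G (fun _ => 1) c (outputArcs es σ) := by
  obtain ⟨P, κ, hP⟩ := exists_compiled
    (.call onesCmd ⨾ .call (algorithmCmd μ bucketInit bucketExt bucketDec))
  refine ⟨P, (254 + κ + 1) * κ + 1, κ * 250, fun n m G _ es hn hnm hG => ?_⟩
  have htri : Tri (3 * m + n + 1)
      (.call onesCmd ⨾ .call (algorithmCmd μ bucketInit bucketExt bucketDec)) (graphInput es)
      (250 * m) fun _ s' => ∃ c, Outcome μ G (fun _ => 1) c (outputArcs es s') := by
    apply Tri.of_wp
    simp only [wp]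
    refine (onesCmd_spec (m := m) (K := 109 * m + 87 * n + 43) rfl (by omega)).framed ?_
    rintro k s ⟨hk, hones⟩ ⟨fr, fa⟩
    refine algorithmCmd_spec μ hG (by omega) (W := 1) (a₀ := 4 * n + 4) (Φ := 6 * n + 6 * m)
      (wN := s.arr 2) (bucket_spec _ n m) ?_ (by decide) (by decide) ?_ ?_ hones (by omega)
      ?_ ?_ ?_ ?_ rfl ?_ (by omega)
    · intro s k K h0 hz h6 hk
      refine bucketInit_spec h0 (hz 20 (by omega)) (fun v _ => ?_) (by omega)
      have := h6 v
      omega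
    · intro i
      exact hones i i.2
    · intro i hi
      exact (hones i hi).le
    · rw [fr 0 (by decide)]; rfl
    · rw [fr 1 (by decide)]; rfl
    · rw [fa 0 (by decide)]; rfl
    · rw [fa 1 (by decide)]; rfl
    · intro A hA
      rw [fa A, graphInput_arr_of_le es (by omega)]
      simp [onesCmd]
      omega
  obtain ⟨t, s', k', hb, ht, c, hc⟩ := htri
  obtain ⟨t', σ', he, ht', ha⟩ := hP (3 * m + n + 1) ((n + m) ^ ((254 + κ + 1) * κ + 1))
    (4 * (n + m)) t _ s' hb (by omega) (by omega)
    ⟨fun r => (graphInput_reg_le es r).trans (by omega),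
      fun A i => (graphInput_arr_le es A i).trans (by omega)⟩
    (pow_lt_of_le_mul (by omega) (by nlinarith))
  refine ⟨t', σ', he, ht'.trans ?_, c, ?_⟩
  · rw [mul_assoc]
    exact Nat.mul_le_mul_left _ (by omega)
  · rw [outputArcs_congr es ha]
    exact hc

/-- As `n ≥ 2`, the logarithm is at least one and the linear terms are absorbed by `n log n`. Total
weights can reach `m W`, which is quadratic in `n + m + W`; hence the factor 2 in the exponent. -/
theorem weighted_time (μ : Mode) : ∃ (P : Prog) (c C : ℕ),
    ∀ (n m W : ℕ) (G : SimpleGraph (Fin n)) [DecidableRel G.Adj] (es : Fin m → Fin n × Fin n)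
      (w : Sym2 (Fin n) → ℕ), 2 ≤ n → n ≤ m → IsEdgeListing G es → (∀ e ∈ G.edgeSet, w e ≤ W) →
      ∃ (t : ℕ) (σ : Store), Exec ((n + m + W) ^ c) P (weightedInput es w) t σ ∧
        t ≤ C * (m + n * Nat.log 2 n) ∧ ∃ c, Outcome μ G w c (outputArcs es σ) := by
  obtain ⟨P, κ, hP⟩ := exists_compiled (algorithmCmd μ fibInit fibExt fibDec)
  refine ⟨P, 2 * ((1404 + κ + 1) * κ + 1), κ * 700, fun n m W G _ es w hn hnm hG hw => ?_⟩
  set Y := n + m + W with hY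
  have hwi : ∀ i : Fin m, w s((es i).1, (es i).2) ≤ W := fun i =>
    hw _ (hG.2 ▸ Set.mem_range_self i)
  have hlog : 1 ≤ Nat.log 2 n := Nat.log_pos (by omega) hn
  have hnl : n ≤ n * Nat.log 2 n := Nat.le_mul_of_pos_right n hlog
  have htri : Tri (2 * (m * W) + n + m + 1) (algorithmCmd μ fibInit fibExt fibDec)
      (weightedInput es w) (700 * (m + n * Nat.log 2 n)) fun _ s' =>
      ∃ c, Outcome μ G w c (outputArcs es s') := by
    refine algorithmCmd_spec μ hG (by omega) (W := W) (a₀ := 4 * n + 2) (Φ := 32 * n)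
      (fib_spec _ n) ?_ (by decide) (by decide) (wN := arrayOf fun i => w s((es i).1, (es i).2))
      (fun i => arrayOf_fin _ i) (fun i _ => arrayOf_le hwi i) (fun _ _ => trivial) le_rfl
      rfl rfl ?_ ?_ ?_ ?_ ?_
    · intro s k K h0 hz h6 hk
      exact fibInit_spec h0 (by omega) hz (by omega)
    · rfl
    · rfl
    · simp [weightedInput]
    · intro A hA
      simp only [weightedInput]
      rw [Function.update_of_ne (by omega), graphInput_arr_of_le es (by omega)]
    · have h1 : n * (254 * (Nat.log 2 n + 1) + 12) = 254 * (n * Nat.log 2 n) + 266 * n := by ring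
      rw [h1]
      omega
  obtain ⟨t, s', k', hb, ht, c, hc⟩ := htri
  have hYY : Y ≤ Y ^ 2 := Nat.le_self_pow (by omega) Y
  have hmW : 2 * (m * W) ≤ Y ^ 2 := by rw [hY]; nlinarith
  have hnY : n * Nat.log 2 n ≤ Y ^ 2 := by
    rw [sq]
    exact Nat.mul_le_mul (by omega) ((Nat.log_le_self 2 n).trans (by omega))
  obtain ⟨t', σ', he, ht', ha⟩ := hP (2 * (m * W) + n + m + 1)
    (Y ^ (2 * ((1404 + κ + 1) * κ + 1))) (4 * Y ^ 2) t _ s' hb (by omega) (by omega)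
    ⟨fun r => (graphInput_reg_le es r).trans (by omega), fun A i => by
      simp only [weightedInput]
      by_cases hA : A = 2
      · subst hA
        rw [Function.update_self]
        exact (arrayOf_le hwi i).trans (by omega)
      · rw [Function.update_of_ne hA]
        exact (graphInput_arr_le es A i).trans (by omega)⟩
    (by
      rw [pow_mul]
      refine pow_lt_of_le_mul (by omega) ?_
      have : κ ≤ κ * Y ^ 2 := Nat.le_mul_of_pos_right κ (by omega)
      rw [Nat.add_mul]
      omega)
  refine ⟨t', σ', he, ht'.trans ?_, c, ?_⟩
  · rw [mul_assoc]
    exact Nat.mul_le_mul_left _ (by omega)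
  · rw [outputArcs_congr es ha]
    exact hc

theorem mainTheorem9 (μ : Asahiro.Mode) :
    -- unweighted graphs: linear time
    (∃ (P : RAM.Prog) (c C : ℕ),
      ∀ (n m : ℕ) (G : SimpleGraph (Fin n)) [DecidableRel G.Adj] (es : Fin m → Fin n × Fin n),
        2 ≤ n → n ≤ m → IsEdgeListing G es →
        ∃ (t : ℕ) (σ : RAM.Store),
          RAM.Exec ((n + m) ^ c) P (graphInput es) t σ ∧
          t ≤ C * m ∧
          Asahiro.MayReturn μ G (fun _ => 1) (outputArcs es σ) ∧
          IsOrientation G (outputArcs es σ) ∧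
          ∀ v, (indeg (outputArcs es σ) v : ℚ) ≤
            (2 - 1 / (pseudoarboricity G : ℚ)) * (pseudoarboricity G : ℚ)) ∧
    -- edge-weighted graphs, with weights at most `W`
    (∃ (P : RAM.Prog) (c C : ℕ),
      ∀ (n m W : ℕ) (G : SimpleGraph (Fin n)) [DecidableRel G.Adj] (es : Fin m → Fin n × Fin n)
        (w : Sym2 (Fin n) → ℕ),
        2 ≤ n → n ≤ m → IsEdgeListing G es → (∀ e ∈ G.edgeSet, w e ≤ W) →
        ∃ (t : ℕ) (σ : RAM.Store),
          RAM.Exec ((n + m + W) ^ c) P (weightedInput es w) t σ ∧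
          t ≤ C * (m + n * Nat.log 2 n) ∧
          Asahiro.MayReturn μ G w (outputArcs es σ) ∧
          IsOrientation G (outputArcs es σ)) := by
  constructor
  · obtain ⟨P, c, C, h⟩ := unweighted_linear_time μ
    refine ⟨P, c, C, fun n m G _ es hn hnm hG => ?_⟩
    obtain ⟨t, σ, he, ht, d, hd⟩ := h n m G es hn hnm hG
    refine ⟨t, σ, he, ht, hd.mayReturn, hG.isOrientation σ, fun v => ?_⟩
    -- There is an edge because `2 ≤ n ≤ m`. For `p = 0` the formula `(2 - 1/p) p` would not equal
    -- `2p - 1`.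
    have hp : 0 < pseudoarboricity G := by
      have : s((es ⟨0, by omega⟩).1, (es ⟨0, by omega⟩).2) ∈ G.edgeSet :=
        hG.2 ▸ Set.mem_range_self (⟨0, by omega⟩ : Fin m)
      exact pseudoarboricity_pos (G.mem_edgeSet.1 this)
    have hv := hd.indeg_le_pseudoarboricity (by omega) hp v
    have hp' : (pseudoarboricity G : ℚ) ≠ 0 := by positivity
    rw [sub_mul, one_div, inv_mul_cancel₀ hp', le_sub_iff_add_le]
    exact_mod_cast (show indeg (outputArcs es σ) v + 1 ≤ 2 * pseudoarboricity G by omega)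
  · obtain ⟨P, c, C, h⟩ := weighted_time μ
    refine ⟨P, c, C, fun n m W G _ es w hn hnm hG hw => ?_⟩
    obtain ⟨t, σ, he, ht, d, hd⟩ := h n m W G es w hn hnm hG hw
    exact ⟨t, σ, he, ht, hd.mayReturn, hG.isOrientation σ⟩
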